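/- Let $\Bbbk$ be a field and let $\Lambda$ be a finite-dimensional $\Bbbk$-algebra of finite global dimension. Let $D^b(\Lambda)$ be the bounded derived category of finitely generated left $\Lambda$-modules, a $\Bbbk$-linear category with suspension $\Sigma=[1]$, and let $N,m\in\mathbb Z$. A $\Bbbk$-linear $\Sigma$-equivariant endofunctor of $D^b(\Lambda)$ is a pair $(\Phi,\varphi)$ consisting of a $\Bbbk$-linear functor $\Phi:D^b(\Lambda)\to D^b(\Lambda)$ and a natural isomorphism $\varphi:\Phi\Sigma\xrightarrow{\sim}\Sigma\Phi$. Such pairs are composed by $(\Psi,\psi)(\Phi,\varphi)=(\Psi\Phi,\ \psi\Phi\circ\Psi\varphi)$, and an isomorphism $(\Phi,\varphi)\cong(\Phi',\varphi')$ is a natural isomorphism $\alpha:\Phi\to\Phi'$ with $\varphi'\circ\alpha\Sigma=\Sigma\alpha\circ\varphi$. A Serre structure on $D^b(\Lambda)$ is a pair $(\mathbb S,\kappa)$ of a $\Bbbk$-linear autoequivalence $\mathbb S$ and isomorphisms $\kappa_{X,Y}:\operatorname{Hom}(X,Y)\xrightarrow{\sim}\operatorname{Hom}(Y,\mathbb SX)^*$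 natural in $X$ and $Y$. Its canonical commutation isomorphism with $\Sigma$ is the unique natural isomorphism $\zeta:\mathbb S\Sigma\to\Sigma\mathbb S$ such that $\kappa_{\Sigma Y,\Sigma X}(\Sigma f)(\zeta_Y^{-1}\circ\Sigma g)=\kappa_{Y,X}(f)(g)$ for all $f:Y\to X$ and $g:X\to\mathbb SY$. The category $D^b(\Lambda)$ is called $N/m$-fractional Calabi-Yau (where $N/m$ stands for a pair of integers) if it has a Serre structure $(\mathbb S,\kappa)$ such that, with $s=-\zeta$, there is an isomorphism $$(\mathbb S,s)^m\;\cong\;(\Sigma,-\mathrm{id}_{\Sigma^2})^N$$ of equivariant endofunctors. Then $D^b(\Lambda)$ is $N/m$-fractional Calabi-Yau if and only if there is an isomorphism $$(\Lambda^*)^{\otimes^{\mathbf L}_\Lambda m}\;\cong\;\Lambda[N]$$ in the bounded derived category $D^b(\Lambda\text{-}\Lambda)$ of $\Lambda$-$\Lambda$-bimodules (with $\Bbbk$ acting centrally), where $\Lambda^*=\operatorname{Hom}_\Bbbk(\Lambda,\Bbbk)$ and $\Lambda[N]$ is the regular bimodule placed in degree $-N$. On both sides zeroth powers are the respective units, and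 negative powers are powers of a quasi-inverse. -/

import Mathlib

open CategoryTheory Limits TensorProduct MulOpposite

universe v u

/-! ## Integral powers up to isomorphism -/

/-- The iterated product `x * (x * (⋯ * (x * one)))` with `n` factors `x`. -/
def iteratedPow {α : Type*} (mul : α → α → α) (one x : α) : ℕ → α
  | 0 => one
  | n + 1 => mul x (iteratedPow mul one x n)

/-- `z` is an `n`-th power of `x` (`n : ℤ`) for a product `mul` with unit `one`, where objects are
compared through the relation `iso` ("there is an isomorphism").  For negative `n` this means that
`x` has a quasi-inverse `y` and `z` is the `|n|`-th power of `y`. -/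
def IsPow {α : Type*} (mul : α → α → α) (one : α) (iso : α → α → Prop) (x : α) : ℤ → α → Prop
  | Int.ofNat n, z => iso (iteratedPow mul one x n) z
  | Int.negSucc n, z => ∃ y : α, iso (mul x y) one ∧ iso (mul y x) one ∧
      iso (iteratedPow mul one y (n + 1)) z

/-! ## Equivariant endofunctors and Serre structures -/

section Equivariant

variable (k : Type u) [Field k] {C : Type*} [Category* C] [Preadditive C] [Linear k C]

/-- A `k`-linear equivariant endofunctor of `(C, F)`: a `k`-linear functor `Φ` together with a
natural isomorphism `φ : Φ F ≅ F Φ` (recall that `F ⋙ Φ` is "first `F`, then `Φ`").  For the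
`ℤ`-action generated by an automorphism `F`, the isomorphism `φ` determines the commutation
isomorphisms with all powers of `F`. -/
structure EquivariantEndofunctor (F : C ⥤ C) where
  /-- the underlying functor -/
  functor : C ⥤ C
  additive : functor.Additive
  linear : functor.Linear k
  /-- the commutation isomorphism -/
  comm : F ⋙ functor ≅ functor ⋙ F

namespace EquivariantEndofunctor

variable {k} {F : C ⥤ C}

variable (k F) in
/-- The identity equivariant endofunctor. -/
def one : EquivariantEndofunctor k F where
  functor := 𝟭 C
  additive := inferInstance
  linear := inferInstance
  comm := F.rightUnitor ≪≫ F.leftUnitor.symm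

/-- The composite `(Ψ, ψ)(Φ, φ) = (ΨΦ, ψΦ ∘ Ψφ)`. -/
def mul (E₂ E₁ : EquivariantEndofunctor k F) : EquivariantEndofunctor k F where
  functor := E₁.functor ⋙ E₂.functor
  additive := by
    have := E₁.additive
    have := E₂.additive
    infer_instance
  linear := by
    have := E₁.additive
    have := E₂.additive
    have := E₁.linear
    have := E₂.linear
    infer_instance
  comm := NatIso.ofComponents
    (fun X => E₂.functor.mapIso (E₁.comm.app X) ≪≫ E₂.comm.app (E₁.functor.obj X))
    (fun {X Y} f => by
      have h₁ := E₁.comm.hom.naturality f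
      have h₂ := E₂.comm.hom.naturality (E₁.functor.map f)
      dsimp at h₁ h₂ ⊢
      rw [Category.assoc, ← h₂, ← Category.assoc, ← Category.assoc, ← Functor.map_comp,
        ← Functor.map_comp, h₁])

/-- There is an isomorphism of equivariant functors: a natural isomorphism of the underlying
functors which is compatible with the commutation isomorphisms. -/
def Isomorphic (E E' : EquivariantEndofunctor k F) : Prop :=
  ∃ α : E.functor ≅ E'.functor, ∀ X : C,
    E.comm.hom.app X ≫ F.map (α.hom.app X) = α.hom.app (F.obj X) ≫ E'.comm.hom.app X

variable (k F) in
/-- The equivariant endofunctor `(F, -id_{F²})`. -/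
def negSelf [F.Additive] [F.Linear k] : EquivariantEndofunctor k F where
  functor := F
  additive := inferInstance
  linear := inferInstance
  comm := -(Iso.refl (F ⋙ F))

/-- `G` is isomorphic to `E ^ n`, `n : ℤ`, as an equivariant endofunctor. -/
def IsPower (E : EquivariantEndofunctor k F) (n : ℤ) (G : EquivariantEndofunctor k F) : Prop :=
  IsPow mul (one k F) Isomorphic E n G

end EquivariantEndofunctor

variable (C) in
/-- A Serre structure `(S, κ)` on a `k`-linear category: a `k`-linear autoequivalence `S` with
isomorphisms `κ : Hom(X, Y) ≅ Hom(Y, S X)*` natural in both variables. -/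
structure SerreStructure where
  /-- the Serre functor -/
  S : C ⥤ C
  isEquivalence : S.IsEquivalence
  additive : S.Additive
  linear : S.Linear k
  /-- Serre duality -/
  κ (X Y : C) : (X ⟶ Y) ≃ₗ[k] Module.Dual k (Y ⟶ S.obj X)
  κ_comp_left {X Y Z : C} (f : X ⟶ Y) (h : Y ⟶ Z) (u : Z ⟶ S.obj X) :
    κ X Z (f ≫ h) u = κ X Y f (h ≫ u)
  κ_comp_right {W X Y : C} (f : W ⟶ X) (g : X ⟶ Y) (u : Y ⟶ S.obj W) :
    κ W Y (f ≫ g) u = κ X Y g (u ≫ S.map f)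

namespace SerreStructure

variable {k}

/-- `ζ : S F ≅ F S` is the canonical commutation isomorphism of the Serre functor `S` with an
autoequivalence `F`.  Writing `F⁻` for a quasi-inverse of `F`, it is the isomorphism for which the
composite
`Hom(Z, S F Y)* ≅ Hom(F Y, Z) ≅ Hom(Y, F⁻ Z) ≅ Hom(F⁻ Z, S Y)* ≅ Hom(Z, F S Y)*`
(given by `κ⁻¹`, the adjunction, `κ` and the adjunction) is dual to composition with `ζ_Y⁻¹`.
It is enough to say this for `Z = F X`, where it becomes the equation below;
as `κ` is a perfect pairing, the equation determines `ζ`. -/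
def IsCanonicalCommutation (σ : SerreStructure k C) (F : C ⥤ C)
    (ζ : F ⋙ σ.S ≅ σ.S ⋙ F) : Prop :=
  ∀ ⦃X Y : C⦄ (f : Y ⟶ X) (g : X ⟶ σ.S.obj Y),
    σ.κ (F.obj Y) (F.obj X) (F.map f) (F.map g ≫ ζ.inv.app Y) = σ.κ Y X f g

end SerreStructure

/-- A `sgn`-equivariant Serre structure `(S, s, κ)` on `(C, F)`: a Serre structure with the
commutation isomorphism `s = -ζ`, where `ζ : S F ≅ F S` is the canonical one. -/
structure SgnEquivariantSerreStructure (F : C ⥤ C) extends SerreStructure k C where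
  /-- the canonical commutation isomorphism -/
  ζ : F ⋙ S ≅ S ⋙ F
  isCanonical : toSerreStructure.IsCanonicalCommutation F ζ

/-- The equivariant functor `(S, s)`, `s = -ζ`. -/
def SgnEquivariantSerreStructure.toEquivariantEndofunctor {k : Type u} [Field k] {C : Type*}
    [Category* C] [Preadditive C] [Linear k C] {F : C ⥤ C}
    (σ : SgnEquivariantSerreStructure k F) : EquivariantEndofunctor k F where
  functor := σ.S
  additive := σ.additive
  linear := σ.linear
  comm := -σ.ζ

variable (C) in
/-- The `k`-linear category `C` with suspension `Σ = ⟦1⟧` is fractional Calabi-Yau of dimension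
`N / m` (a pair of integers): it has a `sgn`-equivariant Serre structure `(S, s, κ)` and there is
an isomorphism `(S, s) ^ m ≅ (Σ, -id_{Σ²}) ^ N` of equivariant endofunctors. -/
def IsFractionalCalabiYau [HasShift C ℤ] [(shiftFunctor C (1 : ℤ)).Additive]
    [(shiftFunctor C (1 : ℤ)).Linear k] (N m : ℤ) : Prop :=
  ∃ σ : SgnEquivariantSerreStructure k (shiftFunctor C (1 : ℤ)),
    ∃ G : EquivariantEndofunctor k (shiftFunctor C (1 : ℤ)),
      σ.toEquivariantEndofunctor.IsPower m G ∧
      (EquivariantEndofunctor.negSelf k (shiftFunctor C (1 : ℤ))).IsPower N G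

end Equivariant

/-! ## Derived categories of modules -/

section Derived

noncomputable instance ModuleCat.hasDerivedCategory (R : Type u) [Ring R] :
    HasDerivedCategory.{u + 1} (ModuleCat.{u} R) :=
  HasDerivedCategory.standard _

/-- The objects of the derived category of (left) `R`-modules which have bounded cohomology
consisting of finitely generated modules. -/
def finiteBounded (R : Type u) [Ring R] : ObjectProperty (DerivedCategory (ModuleCat.{u} R)) :=
  fun X => DerivedCategory.TStructure.t.bounded X ∧
    ∀ n : ℤ, Module.Finite R ((DerivedCategory.homologyFunctor (ModuleCat.{u} R) n).obj X)

instance (R : Type u) [Ring R] : (finiteBounded R).IsStableUnderShift ℤ where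
  isStableUnderShiftBy a :=
    { le_shift := fun X hX => ⟨ObjectProperty.le_shift _ a X hX.1, fun n => by
        have e := ((DerivedCategory.homologyFunctor (ModuleCat.{u} R) 0).shiftIso
          a n (a + n) rfl).app X
        have : Module.Finite R
            (((DerivedCategory.homologyFunctor (ModuleCat.{u} R) 0).shift (a + n)).obj X) :=
          hX.2 (a + n)
        exact Module.Finite.equiv e.toLinearEquiv.symm⟩ }

/-- `D^b(R)` for a noetherian ring `R`: the bounded derived category of finitely generated left
`R`-modules, as a full triangulated subcategory of the derived category of all left `R`-modules. -/
abbrev BoundedDerivedCategory (R : Type u) [Ring R] := (finiteBounded R).FullSubcategory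

/-- The global dimension of `R` is finite. -/
def HasFiniteGlobalDimension (R : Type u) [Ring R] : Prop :=
  ∃ d : ℕ, ∀ M : ModuleCat.{u} R, HasProjectiveDimensionLE M d

variable (k : Type u) [Field k] (R : Type u) [Ring R] [Algebra k R]

instance (n : ℤ) : (shiftFunctor (BoundedDerivedCategory R) n).Linear k := by
  have : ((shiftFunctor (BoundedDerivedCategory R) n) ⋙ (finiteBounded R).ι).Linear k :=
    Functor.linear_of_iso _ ((finiteBounded R).ι.commShiftIso n).symm
  refine ⟨fun {X Y} f r => (finiteBounded R).ι.map_injective ?_⟩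
  exact (Functor.map_smul ((shiftFunctor (BoundedDerivedCategory R) n) ⋙
    (finiteBounded R).ι) r f)

end Derived

/-! ## Bimodules and their tensor product -/

section Bimodules

variable (k : Type u) [Field k] (Λ : Type u) [Ring Λ] [Algebra k Λ]

/-- The category of `Λ`-`Λ`-bimodules on which `k` acts centrally, that is, of left modules over
the enveloping algebra `Λ ⊗[k] Λᵐᵒᵖ`: the left action of `a` is that of `a ⊗ₜ 1` and the right
action of `a` is that of `1 ⊗ₜ op a`. -/
abbrev BimoduleCat := ModuleCat.{u} (Λ ⊗[k] Λᵐᵒᵖ)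

attribute [local instance] TensorProduct.Algebra.module in
/-- The regular bimodule `Λ`, with `a • x • b = a * x * b`. -/
def regularBimod : BimoduleCat k Λ :=
  ModuleCat.of (Λ ⊗[k] Λᵐᵒᵖ) Λ

/-- The action of the enveloping algebra on `Λ* = Hom_k(Λ, k)`: `(a φ b) x = φ (b x a)`. -/
def dualAction : Λ ⊗[k] Λᵐᵒᵖ →ₐ[k] Module.End k (Module.Dual k Λ) :=
  Algebra.TensorProduct.lift
    (AlgHom.ofLinearMap
      (Module.Dual.transpose (R := k) (M := Λ) (M' := Λ) ∘ₗ (LinearMap.mul k Λ).flip)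
      (by ext; simp [Module.Dual.transpose])
      (by intro a b; ext; simp [Module.Dual.transpose, mul_assoc]))
    (AlgHom.ofLinearMap
      (Module.Dual.transpose (R := k) (M := Λ) (M' := Λ) ∘ₗ LinearMap.mul k Λ ∘ₗ
        (opLinearEquiv k).symm.toLinearMap)
      (by ext; simp [Module.Dual.transpose])
      (by intro a b; ext; simp [Module.Dual.transpose, mul_assoc]))
    (by intro a b; ext; simp [Module.Dual.transpose, mul_assoc])

lemma dualAction_apply (a b : Λ) (φ : Module.Dual k Λ) (x : Λ) :
    dualAction k Λ (a ⊗ₜ op b) φ x = φ (b * x * a) := by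
  simp [dualAction, Module.Dual.transpose, mul_assoc]

/-- The dual bimodule `Λ* = Hom_k(Λ, k)`. -/
def dualBimod : BimoduleCat k Λ :=
  letI : Module (Λ ⊗[k] Λᵐᵒᵖ) (Module.Dual k Λ) :=
    Module.compHom _ (dualAction k Λ).toRingHom
  ModuleCat.of (Λ ⊗[k] Λᵐᵒᵖ) (Module.Dual k Λ)

section Tensor

variable {k Λ}
variable (M N : Type u) [AddCommGroup M] [AddCommGroup N] [Module k M] [Module k N]
  [Module (Λ ⊗[k] Λᵐᵒᵖ) M] [Module (Λ ⊗[k] Λᵐᵒᵖ) N] [IsScalarTower k (Λ ⊗[k] Λᵐᵒᵖ) M]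
  [IsScalarTower k (Λ ⊗[k] Λᵐᵒᵖ) N]

variable (k Λ) in
/-- The outer action of the enveloping algebra on `M ⊗[k] N` for bimodules `M`, `N`:
`a • (m ⊗ₜ n) • b = (a • m) ⊗ₜ (n • b)`. -/
noncomputable def outerAction : Λ ⊗[k] Λᵐᵒᵖ →ₐ[k] Module.End k (M ⊗[k] N) :=
  (Module.endTensorEndAlgHom (R := k) (A := k) (M := M) (N := N)).comp
    (Algebra.TensorProduct.map
      ((Algebra.lsmul k k M).comp
        (Algebra.TensorProduct.includeLeft : Λ →ₐ[k] Λ ⊗[k] Λᵐᵒᵖ))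
      ((Algebra.lsmul k k N).comp
        (Algebra.TensorProduct.includeRight : Λᵐᵒᵖ →ₐ[k] Λ ⊗[k] Λᵐᵒᵖ)))

lemma outerAction_tmul (a : Λ) (b : Λᵐᵒᵖ) (m : M) (n : N) :
    outerAction k Λ M N (a ⊗ₜ b) (m ⊗ₜ n) =
      ((a ⊗ₜ 1 : Λ ⊗[k] Λᵐᵒᵖ) • m) ⊗ₜ ((1 ⊗ₜ b : Λ ⊗[k] Λᵐᵒᵖ) • n) := by
  rfl

variable (k) in
/-- The tensor product `M ⊗[k] N` over the ground field, to be equipped with the outer bimodule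
structure. -/
def OuterTensor (M N : Type u) [AddCommGroup M] [AddCommGroup N] [Module k M] [Module k N] :
    Type u :=
  M ⊗[k] N

noncomputable instance : AddCommGroup (OuterTensor k M N) :=
  inferInstanceAs (AddCommGroup (M ⊗[k] N))

noncomputable instance : Module (Λ ⊗[k] Λᵐᵒᵖ) (OuterTensor k M N) :=
  letI : Module (Λ ⊗[k] Λᵐᵒᵖ) (M ⊗[k] N) := Module.compHom _ (outerAction k Λ M N).toRingHom
  inferInstanceAs (Module (Λ ⊗[k] Λᵐᵒᵖ) (M ⊗[k] N))

variable {M N} in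
/-- The pure tensor `m ⊗ n` in `M ⊗[k] N`. -/
noncomputable def OuterTensor.tmul (m : M) (n : N) : OuterTensor k M N := m ⊗ₜ[k] n

variable (k Λ) in
/-- The sub-bimodule of `M ⊗[k] N` generated by the elements `(m • a) ⊗ n - m ⊗ (a • n)`. -/
noncomputable def balancedRelations : Submodule (Λ ⊗[k] Λᵐᵒᵖ) (OuterTensor k M N) :=
  Submodule.span _ {t | ∃ (m : M) (a : Λ) (n : N),
    t = OuterTensor.tmul ((1 ⊗ₜ op a : Λ ⊗[k] Λᵐᵒᵖ) • m) n -
      OuterTensor.tmul m ((a ⊗ₜ 1 : Λ ⊗[k] Λᵐᵒᵖ) • n)}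

variable {M N} {M' N' : Type u} [AddCommGroup M'] [AddCommGroup N'] [Module k M'] [Module k N']
  [Module (Λ ⊗[k] Λᵐᵒᵖ) M'] [Module (Λ ⊗[k] Λᵐᵒᵖ) N'] [IsScalarTower k (Λ ⊗[k] Λᵐᵒᵖ) M']
  [IsScalarTower k (Λ ⊗[k] Λᵐᵒᵖ) N']

lemma outerAction_map (f : M →ₗ[Λ ⊗[k] Λᵐᵒᵖ] M') (g : N →ₗ[Λ ⊗[k] Λᵐᵒᵖ] N')
    (e : Λ ⊗[k] Λᵐᵒᵖ) (t : M ⊗[k] N) :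
    TensorProduct.map (f.restrictScalars k) (g.restrictScalars k) (outerAction k Λ M N e t) =
      outerAction k Λ M' N' e
        (TensorProduct.map (f.restrictScalars k) (g.restrictScalars k) t) := by
  induction e with
  | zero => simp
  | add e₁ e₂ h₁ h₂ => simp only [map_add, LinearMap.add_apply, h₁, h₂]
  | tmul a b =>
    induction t with
    | zero => simp
    | add t₁ t₂ h₁ h₂ => simp only [map_add, h₁, h₂]
    | tmul m n => simp [outerAction_tmul]

/-- The bimodule map `f ⊗ g` on `M ⊗[k] N`. -/
noncomputable def OuterTensor.map (f : M →ₗ[Λ ⊗[k] Λᵐᵒᵖ] M') (g : N →ₗ[Λ ⊗[k] Λᵐᵒᵖ] N') :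
    OuterTensor k M N →ₗ[Λ ⊗[k] Λᵐᵒᵖ] OuterTensor k M' N' where
  toFun := TensorProduct.map (f.restrictScalars k) (g.restrictScalars k)
  map_add' := map_add (TensorProduct.map (f.restrictScalars k) (g.restrictScalars k))
  map_smul' e t := by
    exact outerAction_map f g e t

lemma OuterTensor.map_tmul (f : M →ₗ[Λ ⊗[k] Λᵐᵒᵖ] M') (g : N →ₗ[Λ ⊗[k] Λᵐᵒᵖ] N')
    (m : M) (n : N) :
    OuterTensor.map f g (OuterTensor.tmul m n : OuterTensor k M N) =
      OuterTensor.tmul (f m) (g n) := rfl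

lemma balancedRelations_le (f : M →ₗ[Λ ⊗[k] Λᵐᵒᵖ] M') (g : N →ₗ[Λ ⊗[k] Λᵐᵒᵖ] N') :
    balancedRelations k Λ M N ≤
      (balancedRelations k Λ M' N').comap (OuterTensor.map f g) := by
  refine Submodule.span_le.2 ?_
  rintro _ ⟨m, a, n, rfl⟩
  refine Submodule.subset_span ⟨f m, a, g n, ?_⟩
  rw [map_sub, OuterTensor.map_tmul, OuterTensor.map_tmul, map_smul, map_smul]

end Tensor

open scoped ModuleCat

variable {k Λ} in
/-- The tensor product `M ⊗_Λ N` of bimodules: the quotient of `M ⊗[k] N` by the relations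
`(m • a) ⊗ n = m ⊗ (a • n)`, with the outer bimodule structure. -/
noncomputable def tensorBimod (M N : BimoduleCat k Λ) : BimoduleCat k Λ :=
  ModuleCat.of (Λ ⊗[k] Λᵐᵒᵖ) (OuterTensor k M N ⧸ balancedRelations k Λ M N)

variable {k Λ} in
/-- The bimodule map `f ⊗_Λ g`. -/
noncomputable def tensorBimodMap {M N M' N' : BimoduleCat k Λ} (f : M ⟶ M') (g : N ⟶ N') :
    tensorBimod M N ⟶ tensorBimod M' N' :=
  ModuleCat.ofHom (Submodule.mapQ _ _ (OuterTensor.map f.hom g.hom)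
    (balancedRelations_le f.hom g.hom))

variable {k Λ} in
/-- Bimodule maps out of `M ⊗_Λ N` agree if they agree on pure tensors. -/
lemma tensorBimod_hom_ext {M N X : BimoduleCat k Λ} {f g : tensorBimod M N ⟶ X}
    (h : ∀ (m : M) (n : N), f.hom (Submodule.Quotient.mk (OuterTensor.tmul m n)) =
      g.hom (Submodule.Quotient.mk (OuterTensor.tmul m n))) : f = g := by
  ext x
  obtain ⟨t, rfl⟩ := Submodule.Quotient.mk_surjective _ x
  change M ⊗[k] N at t
  induction t with
  | zero => exact (map_zero f.hom).trans (map_zero g.hom).symm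
  | add x y hx hy =>
    exact (map_add f.hom _ _).trans ((congrArg₂ (· + ·) hx hy).trans (map_add g.hom _ _).symm)
  | tmul m n => exact h m n

/-- The bifunctor `(M, N) ↦ M ⊗_Λ N` on bimodules. -/
noncomputable def tensorBifunctor : BimoduleCat k Λ ⥤ BimoduleCat k Λ ⥤ BimoduleCat k Λ where
  obj M :=
    { obj := fun N => tensorBimod M N
      map := fun g => tensorBimodMap (𝟙 M) g
      map_id := fun N => tensorBimod_hom_ext fun m n => rfl
      map_comp := fun f g => tensorBimod_hom_ext fun m n => rfl }
  map f :=
    { app := fun N => tensorBimodMap f (𝟙 N)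
      naturality := fun N N' g => tensorBimod_hom_ext fun m n => rfl }
  map_id M := by
    ext N : 2
    exact tensorBimod_hom_ext fun m n => rfl
  map_comp f g := by
    ext N : 2
    exact tensorBimod_hom_ext fun m n => rfl

instance : (tensorBifunctor k Λ).Additive where
  map_add {M M' f g} := by
    ext N : 2
    refine tensorBimod_hom_ext fun m n => ?_
    exact congrArg Submodule.Quotient.mk (TensorProduct.add_tmul (R := k) (f.hom m) (g.hom m) n)

instance (M : BimoduleCat k Λ) : ((tensorBifunctor k Λ).obj M).Additive where
  map_add {N N' f g} := by
    refine tensorBimod_hom_ext fun m n => ?_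
    exact congrArg Submodule.Quotient.mk (TensorProduct.tmul_add (R := k) m (f.hom n) (g.hom n))

variable {k Λ} in
/-- The tensor product `X ⊗_Λ Y` of complexes of bimodules: in degree `n` it is the direct sum of
the `X^i ⊗_Λ Y^j` with `i + j = n`, and the differential is `d ⊗ 1 + (-1)^i (1 ⊗ d)` on this
summand. -/
noncomputable def tensorComplex (X Y : CochainComplex (BimoduleCat k Λ) ℤ) :
    CochainComplex (BimoduleCat k Λ) ℤ :=
  HomologicalComplex.mapBifunctor X Y (tensorBifunctor k Λ) (ComplexShape.up ℤ)

/-- The bimodule `Λ` as a complex concentrated in degree `0`. -/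
noncomputable def regularComplex : CochainComplex (BimoduleCat k Λ) ℤ :=
  (CochainComplex.singleFunctor (BimoduleCat k Λ) 0).obj (regularBimod k Λ)

/-- The bimodule `Λ*` as a complex concentrated in degree `0`. -/
noncomputable def dualComplex : CochainComplex (BimoduleCat k Λ) ℤ :=
  (CochainComplex.singleFunctor (BimoduleCat k Λ) 0).obj (dualBimod k Λ)

/-- A resolution of the bimodule `Λ` by projective bimodules. -/
noncomputable def diagonalResolution : CochainComplex (BimoduleCat k Λ) ℤ :=
  (projectiveResolution (regularBimod k Λ)).cochainComplex

variable {k Λ} in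
/-- The derived tensor product `X ⊗^L_Λ Y` of complexes of bimodules, represented by the complex
`X ⊗_Λ (B ⊗_Λ Y)` where `B` is a resolution of `Λ` by projective bimodules: `B ⊗_Λ Y ⟶ Y` is a
resolution of `Y` by a complex of bimodules which is homotopically flat as a complex of left
modules. -/
noncomputable def derivedTensor (X Y : CochainComplex (BimoduleCat k Λ) ℤ) :
    CochainComplex (BimoduleCat k Λ) ℤ :=
  tensorComplex X (tensorComplex (diagonalResolution k Λ) Y)

variable {k Λ} in
/-- The complexes of bimodules `X` and `Y` are isomorphic in the derived category of
`Λ`-`Λ`-bimodules (which contains `D^b(Λ-Λ)` as a full subcategory). -/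
def DerivedIsomorphic (X Y : CochainComplex (BimoduleCat k Λ) ℤ) : Prop :=
  Nonempty (DerivedCategory.Q.obj X ≅ DerivedCategory.Q.obj Y)

variable {k Λ} in
/-- In the derived category of bimodules there is an isomorphism between the `m`-th derived tensor
power of `X` over `Λ` (`m : ℤ`, the power with exponent `0` is `Λ`) and `Z`. -/
def IsDerivedTensorPower (X : CochainComplex (BimoduleCat k Λ) ℤ) (m : ℤ)
    (Z : CochainComplex (BimoduleCat k Λ) ℤ) : Prop :=
  IsPow derivedTensor (regularComplex k Λ) DerivedIsomorphic X m Z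

end Bimodules

/-! A complex of bimodules `X` acts on the derived category of modules by `X ⊗^L_Λ -`, together with
the commutation isomorphism of this functor with `Σ`. The action is multiplicative
(`toClass_derivedTensor`), the regular bimodule acts as the identity on the bounded derived category
(`restricts_regularComplex`), and `Λ[N]` acts as `(Σ, -id) ^ N` (`restricts_regularComplex_shift`,
`isPower_negSelf_iff`), because moving a suspension past `Λ[N]` costs the Koszul sign `(-1) ^ N`.
The theorem therefore reduces to two facts: the action of `Λ*` is the equivariant Serre functor, and
the action detects whether a complex of bimodules is `Λ[N]`.

The Serre functor. A morphism `Q ⟶ Λ* ⊗_Λ Q`, with `Q` finitely generated projective, has a trace in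
`k`, and this trace is cyclic. Alternating sums over bounded complexes of such modules are homotopy
invariant (`supertrace_eq_zero`), so there is a trace for morphisms `X ⟶ Λ* ⊗^L_Λ X`, hence a
pairing of `Hom(X, Y)` with `Hom(Y, Λ* ⊗^L_Λ X)`. For `X = Y = Λ` it is the evaluation pairing of
`Λ` with `Λ*`, which is perfect because `Λ` is finite-dimensional. Finite global dimension means
that `Λ` generates the bounded derived category under cones, shifts and retracts, so the five lemma
makes all pairings perfect (`isPerfectPair`). Perfectness and cyclicity also force `Λ* ⊗^L_Λ -` to
be fully faithful; it is essentially surjective because finitely generated injective modules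
generate as well and are direct summands of powers of `Λ*`. The supertrace changes sign under a
shift (`supertrace_shift`). Consequently the canonical isomorphism `ζ` of the Serre functor is minus
the commutation isomorphism of the tensor functor, and `s = -ζ` is the latter
(`exists_serreStructure_restricts`).

Detection. Suppose that `Z ⊗^L_Λ -` restricts to a functor isomorphic to `Σ ^ M`. The value at `Λ`
shows that `Z`, as a complex of left modules, is `Λ[M]`, so that `Z` is a shifted bimodule `B[M]`;
naturality with respect to the endomorphisms of `Λ`, which are the right multiplications, identifies
the right action on `B` (`derivedIsomorphic_shift_of_restricts`). Commutation isomorphisms play no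
role in this step.

The implication from bimodules to functors applies the action to the given isomorphism. In the other
direction the given Serre functor may be replaced by `Λ* ⊗^L_Λ -`, as Serre functors are unique up
to isomorphism (`serreFunctorIso`), and detection applies. For a negative exponent `-(n + 1)` an
inverse of `Λ*` among the complexes of bimodules is needed: if `H` is inverse to `S` and `H ^ (n +
1) ≅ Σ ^ N`, then `H ≅ S ^ n Σ ^ N`, which is again given by a complex of bimodules. -/

/-! ## The tensor product of a bimodule and a left module -/

section ModuleTensor

open scoped ModuleCat

variable {k : Type u} [Field k] {Λ : Type u} [Ring Λ] [Algebra k Λ]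

/-- The underlying left module of a bimodule. -/
noncomputable instance bimodLeftModule (X : BimoduleCat k Λ) : Module Λ X :=
  Module.compHom X (Algebra.TensorProduct.includeLeft : Λ →ₐ[k] Λ ⊗[k] Λᵐᵒᵖ).toRingHom

lemma bimod_left_smul (X : BimoduleCat k Λ) (a : Λ) (x : X) :
    a • x = (a ⊗ₜ 1 : Λ ⊗[k] Λᵐᵒᵖ) • x := rfl

instance (X : BimoduleCat k Λ) : IsScalarTower k Λ X where
  smul_assoc r a x := by
    rw [bimod_left_smul, bimod_left_smul, ← TensorProduct.smul_tmul', smul_assoc]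

/-- The map of left modules underlying a bimodule map. -/
noncomputable def leftLinear {X Y : BimoduleCat k Λ} (f : X ⟶ Y) : X →ₗ[Λ] Y where
  toFun x := f.hom x
  map_add' := f.hom.map_add
  map_smul' a := f.hom.map_smul (a ⊗ₜ 1)

@[simp]
lemma leftLinear_apply {X Y : BimoduleCat k Λ} (f : X ⟶ Y) (x : X) :
    leftLinear f x = f.hom x := rfl

/-- The right multiplication by `a` on a bimodule. -/
noncomputable def rightMul (X : BimoduleCat k Λ) (a : Λ) : X →ₗ[Λ] X where
  toFun x := (1 ⊗ₜ op a : Λ ⊗[k] Λᵐᵒᵖ) • x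
  map_add' x y := smul_add _ x y
  map_smul' b x := by
    simp only [bimod_left_smul, ← mul_smul, RingHom.id_apply]
    simp

lemma rightMul_apply (X : BimoduleCat k Λ) (a : Λ) (x : X) :
    rightMul X a x = (1 ⊗ₜ op a : Λ ⊗[k] Λᵐᵒᵖ) • x := rfl

lemma rightMul_one (X : BimoduleCat k Λ) : rightMul X 1 = LinearMap.id := by
  ext x
  exact one_smul (Λ ⊗[k] Λᵐᵒᵖ) x

lemma rightMul_mul (X : BimoduleCat k Λ) (a b : Λ) :
    rightMul X (a * b) = rightMul X b ∘ₗ rightMul X a := by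
  ext x
  simp only [rightMul_apply, LinearMap.comp_apply, ← mul_smul]
  simp

lemma rightMul_add (X : BimoduleCat k Λ) (a b : Λ) :
    rightMul X (a + b) = rightMul X a + rightMul X b := by
  ext x
  simp only [rightMul_apply, LinearMap.add_apply, MulOpposite.op_add, TensorProduct.tmul_add,
    add_smul]

lemma bimod_smul_tmul (X : BimoduleCat k Λ) (a b : Λ) (x : X) :
    (a ⊗ₜ op b : Λ ⊗[k] Λᵐᵒᵖ) • x = a • rightMul X b x := by
  simp only [bimod_left_smul, rightMul_apply, ← mul_smul]
  simp

/-- A bimodule morphism is a morphism of left modules which commutes with the right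
multiplications. -/
noncomputable def bimodHomMk {X Y : BimoduleCat k Λ} (f : X →ₗ[Λ] Y)
    (hf : ∀ a x, f (rightMul X a x) = rightMul Y a (f x)) : X ⟶ Y :=
  ModuleCat.ofHom
    { toFun := f
      map_add' := f.map_add
      map_smul' := fun e x => by
        have ht (a : Λ) (b : Λᵐᵒᵖ) : f ((a ⊗ₜ b : Λ ⊗[k] Λᵐᵒᵖ) • x) =
            (a ⊗ₜ b : Λ ⊗[k] Λᵐᵒᵖ) • f x := by
          obtain ⟨b, rfl⟩ := op_surjective b
          simp [bimod_smul_tmul, hf]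
        dsimp
        induction e with
        | zero => simpa only [TensorProduct.zero_tmul] using ht 0 0
        | add e₁ e₂ h₁ h₂ => simp [add_smul, h₁, h₂]
        | tmul a b => exact ht a b }

lemma bimodHom_rightMul {X Y : BimoduleCat k Λ} (f : X ⟶ Y) (a : Λ) (x : X) :
    f.hom (rightMul X a x) = rightMul Y a (f.hom x) :=
  f.hom.map_smul _ _

variable (k Λ) in
/-- The functor sending a bimodule to the underlying left module. -/
noncomputable def leftModule : BimoduleCat k Λ ⥤ ModuleCat.{u} Λ where
  obj X := ModuleCat.of Λ X
  map f := ModuleCat.ofHom (leftLinear f)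

instance : (leftModule k Λ).Additive where

variable (k Λ) in
/-- The functor `leftModule` does not change the underlying abelian group. -/
noncomputable def leftModuleForgetIso : leftModule k Λ ⋙ forget₂ (ModuleCat.{u} Λ) AddCommGrpCat ≅
    forget₂ (BimoduleCat k Λ) AddCommGrpCat :=
  Iso.refl _

/-- Exactness can be tested on abelian groups: the forgetful functor from `Λ`-modules reflects
finite limits, and its composite with `leftModule` is the forgetful functor from bimodules. -/
instance : PreservesFiniteLimits (leftModule k Λ) := by
  have : PreservesFiniteLimits (leftModule k Λ ⋙ forget₂ (ModuleCat.{u} Λ) AddCommGrpCat) :=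
    preservesFiniteLimits_of_natIso (leftModuleForgetIso k Λ).symm
  exact ⟨fun J _ _ => preservesLimitsOfShape_of_reflects_of_preserves _
    (forget₂ (ModuleCat.{u} Λ) AddCommGrpCat)⟩

instance : PreservesFiniteColimits (leftModule k Λ) := by
  have : PreservesFiniteColimits (leftModule k Λ ⋙ forget₂ (ModuleCat.{u} Λ) AddCommGrpCat) :=
    preservesFiniteColimits_of_natIso (leftModuleForgetIso k Λ).symm
  exact ⟨fun J _ _ => preservesColimitsOfShape_of_reflects_of_preserves _
    (forget₂ (ModuleCat.{u} Λ) AddCommGrpCat)⟩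

variable (k Λ) in
/-- The right multiplication by `a` as an endomorphism of the functor `leftModule`. -/
noncomputable def rightMulNat (a : Λ) : leftModule k Λ ⟶ leftModule k Λ where
  app X := ModuleCat.ofHom (rightMul X a)
  naturality X Y f := by
    ext x
    exact (bimodHom_rightMul f a x).symm

/-- The relations `x a ⊗ m = x ⊗ a m` defining `X ⊗_Λ M`. -/
noncomputable def tensorModRelations (X : BimoduleCat k Λ) (M : ModuleCat.{u} Λ) :
    Submodule Λ (X ⊗[k] M) :=
  Submodule.span Λ {t | ∃ (x : X) (a : Λ) (m : M),
    t = rightMul X a x ⊗ₜ[k] m - x ⊗ₜ[k] (a • m)}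

/-- The left module `X ⊗_Λ M` for a bimodule `X` and a left module `M`. -/
noncomputable def tensorMod (X : BimoduleCat k Λ) (M : ModuleCat.{u} Λ) : ModuleCat.{u} Λ :=
  ModuleCat.of Λ ((X ⊗[k] M) ⧸ tensorModRelations X M)

namespace tensorMod

variable {X X' X'' : BimoduleCat k Λ} {M M' M'' W : ModuleCat.{u} Λ}

variable (X M) in
/-- The projection `X ⊗[k] M → X ⊗_Λ M`. -/
noncomputable def proj : X ⊗[k] M →ₗ[Λ] tensorMod X M :=
  Submodule.mkQ _

/-- The pure tensor `x ⊗ m`. -/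
noncomputable def tmul (x : X) (m : M) : tensorMod X M :=
  proj X M (x ⊗ₜ[k] m)

lemma proj_surjective : Function.Surjective (proj X M) := Submodule.mkQ_surjective _

lemma tmul_add (x : X) (m m' : M) :
    tmul x (m + m') = tmul x m + tmul x m' := by
  simp only [tmul, TensorProduct.tmul_add, map_add]

lemma add_tmul (x x' : X) (m : M) :
    tmul (x + x') m = tmul x m + tmul x' m := by
  simp only [tmul, TensorProduct.add_tmul, map_add]

lemma smul_tmul (a : Λ) (x : X) (m : M) :
    tmul (a • x) m = a • tmul x m := by
  simp only [tmul, ← map_smul, TensorProduct.smul_tmul']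

lemma smul_tmul_base (r : k) (x : X) (m : M) :
    tmul (r • x) m = r • tmul x m := by
  have h : r • x = (algebraMap k Λ r) • x := (algebraMap_smul Λ r x).symm
  rw [h, smul_tmul, algebraMap_smul]

lemma tmul_smul_base (r : k) (x : X) (m : M) :
    tmul x (r • m) = r • tmul x m := by
  rw [← smul_tmul_base]
  simp only [tmul, TensorProduct.smul_tmul]

lemma tmul_smul (a : Λ) (x : X) (m : M) :
    tmul x (a • m) = tmul (rightMul X a x) m := by
  refine ((Submodule.Quotient.eq _).2 ?_).symm
  exact Submodule.subset_span ⟨x, a, m, rfl⟩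

lemma induction_on {p : tensorMod X M → Prop} (t : tensorMod X M) (h0 : p 0)
    (ht : ∀ (x : X) (m : M), p (tmul x m))
    (ha : ∀ s t, p s → p t → p (s + t)) : p t := by
  obtain ⟨t, rfl⟩ := proj_surjective t
  induction t with
  | zero => rwa [map_zero]
  | add x y hx hy => rw [map_add]; exact ha _ _ hx hy
  | tmul x m => exact ht x m

/-- The universal property of `X ⊗_Λ M`. -/
noncomputable def lift (f : X →ₗ[Λ] M →ₗ[k] W)
    (hf : ∀ x a m, f (rightMul X a x) m = f x (a • m)) : tensorMod X M ⟶ W :=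
  ModuleCat.ofHom (Submodule.liftQ _ (TensorProduct.AlgebraTensorModule.lift f) (by
    refine Submodule.span_le.2 ?_
    rintro _ ⟨x, a, m, rfl⟩
    simp [hf]))

lemma lift_tmul (f : X →ₗ[Λ] M →ₗ[k] W)
    (hf : ∀ x a m, f (rightMul X a x) m = f x (a • m)) (x : X) (m : M) :
    (lift f hf).hom (tmul x m) = f x m := by
  exact (Submodule.liftQ_apply _ _ _).trans (TensorProduct.AlgebraTensorModule.lift_tmul f x m)

lemma hom_ext {f g : tensorMod X M ⟶ W}
    (h : ∀ (x : X) (m : M), f.hom (tmul x m) = g.hom (tmul x m)) :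
    f = g := by
  ext t
  induction t using induction_on with
  | h0 => simp
  | ht x m => exact h x m
  | ha s t hs ht => rw [map_add, map_add, hs, ht]

variable (X M) in
/-- The bilinear map `(x, m) ↦ x ⊗ m`. -/
noncomputable def mk : X →ₗ[Λ] M →ₗ[k] tensorMod X M where
  toFun x :=
    { toFun := fun m => tmul x m
      map_add' := tmul_add x
      map_smul' := fun r m => tmul_smul_base r x m }
  map_add' x y := LinearMap.ext fun m => add_tmul x y m
  map_smul' a x := LinearMap.ext fun m => smul_tmul a x m

lemma mk_apply (x : X) (m : M) : mk X M x m = tmul x m := rfl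

/-- The linear map `f ⊗_Λ g`. -/
noncomputable def map (f : X ⟶ X') (g : M ⟶ M') : tensorMod X M ⟶ tensorMod X' M' :=
  lift
    { toFun := fun x => mk X' M' (f.hom x) ∘ₗ (g.hom.restrictScalars k)
      map_add' := fun x y => by ext m; simp
      map_smul' := fun a x => by
        ext m
        simp [← leftLinear_apply] }
    (fun x a m => by
      simp [bimodHom_rightMul, mk_apply, tmul_smul])

lemma map_tmul (f : X ⟶ X') (g : M ⟶ M') (x : X) (m : M) :
    (map f g).hom (tmul x m) = tmul (f.hom x) (g.hom m) :=
  lift_tmul _ _ _ _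

variable (X M) in
lemma map_id : map (𝟙 X) (𝟙 M) = 𝟙 (tensorMod X M) :=
  hom_ext fun _ _ => map_tmul _ _ _ _

lemma map_add_left (f f' : X ⟶ X') (g : M ⟶ M') : map (f + f') g = map f g + map f' g :=
  hom_ext fun x m => by
    rw [map_tmul, ModuleCat.hom_add, LinearMap.add_apply, add_tmul, ModuleCat.hom_add,
      LinearMap.add_apply, map_tmul, map_tmul]

lemma map_add_right (f : X ⟶ X') (g g' : M ⟶ M') : map f (g + g') = map f g + map f g' :=
  hom_ext fun x m => by
    rw [map_tmul, ModuleCat.hom_add, LinearMap.add_apply, tmul_add, ModuleCat.hom_add,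
      LinearMap.add_apply, map_tmul, map_tmul]

lemma map_smul_right (f : X ⟶ X') (r : k) (g : M ⟶ M') : map f (r • g) = r • map f g :=
  hom_ext fun x m => by
    rw [map_tmul]
    exact (tmul_smul_base _ _ _).trans (congrArg (r • ·) (map_tmul f g x m)).symm

lemma map_comp (f : X ⟶ X') (g : M ⟶ M') (f' : X' ⟶ X'') (g' : M' ⟶ M'') :
    map f g ≫ map f' g' = map (f ≫ f') (g ≫ g') :=
  hom_ext fun x m => by
    rw [map_tmul, ModuleCat.hom_comp, LinearMap.comp_apply, map_tmul, map_tmul]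
    rfl

end tensorMod

open tensorMod hiding map_tmul map

variable (k Λ) in
/-- The bifunctor `(X, M) ↦ X ⊗_Λ M` on bimodules and left modules. -/
noncomputable def tensorModBifunctor : BimoduleCat k Λ ⥤ ModuleCat.{u} Λ ⥤ ModuleCat.{u} Λ where
  obj X :=
    { obj := fun M => tensorMod X M
      map := fun g => tensorMod.map (𝟙 X) g
      map_id := fun M => tensorMod.map_id X M
      map_comp := fun f g => by rw [tensorMod.map_comp, Category.comp_id] }
  map f :=
    { app := fun M => tensorMod.map f (𝟙 M)
      naturality := fun M M' g => by
        dsimp only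
        rw [tensorMod.map_comp, tensorMod.map_comp, Category.comp_id, Category.comp_id,
          Category.id_comp, Category.id_comp] }
  map_id X := by
    ext M : 2
    exact tensorMod.map_id X M
  map_comp f g := by
    ext M : 2
    dsimp only [NatTrans.comp_app]
    rw [tensorMod.map_comp, Category.comp_id]

lemma tensorModBifunctor_map_tmul {X X' : BimoduleCat k Λ} (f : X ⟶ X') (M : ModuleCat.{u} Λ)
    (x : X) (m : M) :
    (((tensorModBifunctor k Λ).map f).app M).hom (tmul x m) = tmul (f.hom x) m :=
  tensorMod.map_tmul _ _ _ _

lemma tensorModBifunctor_obj_map_tmul (X : BimoduleCat k Λ) {M M' : ModuleCat.{u} Λ} (g : M ⟶ M')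
    (x : X) (m : M) :
    (((tensorModBifunctor k Λ).obj X).map g).hom (tmul x m) = tmul x (g.hom m) :=
  tensorMod.map_tmul _ _ _ _

instance : (tensorModBifunctor k Λ).Additive where
  map_add {X X' f g} := by
    ext M : 2
    exact tensorMod.map_add_left f g (𝟙 M)

instance (X : BimoduleCat k Λ) : ((tensorModBifunctor k Λ).obj X).Additive where
  map_add {_ _ f g} := tensorMod.map_add_right (𝟙 X) f g

instance (X : BimoduleCat k Λ) : ((tensorModBifunctor k Λ).obj X).Linear k where
  map_smul f r := tensorMod.map_smul_right (𝟙 X) r f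

end ModuleTensor

/-! ## Adjunctions, associativity and units for the tensor product -/

section ModuleTensorAdjunctions

open scoped ModuleCat

variable {k : Type u} [Field k] {Λ : Type u} [Ring Λ] [Algebra k Λ]

lemma rightMul_zero (X : BimoduleCat k Λ) : rightMul X 0 = 0 := by
  have h := rightMul_add X 0 0
  rwa [add_zero, left_eq_add] at h

/-- Centrality of `k` is built into the enveloping algebra: a scalar can be moved across `⊗[k]`. -/
lemma rightMul_algebraMap (X : BimoduleCat k Λ) (r : k) (x : X) :
    rightMul X (algebraMap k Λ r) x = algebraMap k Λ r • x := by
  rw [rightMul_apply, bimod_left_smul, Algebra.algebraMap_eq_smul_one,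
    MulOpposite.op_smul, MulOpposite.op_one, TensorProduct.tmul_smul, TensorProduct.smul_tmul']

/-- The left module structure of `Hom_Λ(X, W)` for a bimodule `X` and a left module `W`. -/
@[reducible]
noncomputable def homModModule (X : BimoduleCat k Λ) (W : ModuleCat.{u} Λ) :
    Module Λ (X →ₗ[Λ] W) where
  smul a g := g ∘ₗ rightMul X a
  one_smul g := by
    change g ∘ₗ rightMul X 1 = g
    rw [rightMul_one, LinearMap.comp_id]
  mul_smul a b g := by
    change g ∘ₗ rightMul X (a * b) = (g ∘ₗ rightMul X b) ∘ₗ rightMul X a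
    rw [rightMul_mul, LinearMap.comp_assoc]
  smul_zero a := LinearMap.zero_comp _
  smul_add a f g := LinearMap.add_comp _ _ _
  add_smul a b g := by
    change g ∘ₗ rightMul X (a + b) = g ∘ₗ rightMul X a + g ∘ₗ rightMul X b
    rw [rightMul_add, LinearMap.comp_add]
  zero_smul g := by
    change g ∘ₗ rightMul X 0 = 0
    rw [rightMul_zero, LinearMap.comp_zero]

/-- The left module `Hom_Λ(X, W)` for a bimodule `X` and a left module `W`. -/
noncomputable def homMod (X : BimoduleCat k Λ) (W : ModuleCat.{u} Λ) : ModuleCat.{u} Λ :=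
  letI := homModModule X W
  ModuleCat.of Λ (X →ₗ[Λ] W)

/-- The linear maps corresponding to the elements of `homMod X W`. -/
noncomputable def homModEval (X : BimoduleCat k Λ) (W : ModuleCat.{u} Λ) :
    homMod X W ≃+ (X →ₗ[Λ] W) := AddEquiv.refl _

lemma homModEval_smul {X : BimoduleCat k Λ} {W : ModuleCat.{u} Λ} (a : Λ) (g : homMod X W) (x : X) :
    homModEval X W (a • g) x = homModEval X W g (rightMul X a x) := rfl

lemma homMod_ext {X : BimoduleCat k Λ} {W : ModuleCat.{u} Λ} {g h : homMod X W}
    (w : ∀ x, homModEval X W g x = homModEval X W h x) : g = h :=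
  LinearMap.ext w

/-- The action of the enveloping algebra on `Hom_k(M, W)` for left modules `M` and `W`. -/
noncomputable def homBimodAction (M W : ModuleCat.{u} Λ) :
    Λ ⊗[k] Λᵐᵒᵖ →ₐ[k] Module.End k (M →ₗ[k] W) :=
  Algebra.TensorProduct.lift
    (AlgHom.ofLinearMap
      (LinearMap.llcomp k M W W ∘ₗ (Algebra.lsmul k k W).toLinearMap)
      (by ext; simp)
      (by intro a b; ext; simp))
    (AlgHom.ofLinearMap
      ((LinearMap.llcomp k M M W).flip ∘ₗ (Algebra.lsmul k k M).toLinearMap ∘ₗ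
        (opLinearEquiv k).symm.toLinearMap)
      (by ext; simp)
      (by intro a b; ext; simp))
    (by intro a b; ext; simp)

lemma homBimodAction_apply (M W : ModuleCat.{u} Λ) (a b : Λ) (f : M →ₗ[k] W) (m : M) :
    homBimodAction (k := k) M W (a ⊗ₜ op b) f m = a • f (b • m) :=
  LinearMap.congr_fun (LinearMap.congr_fun
    (Algebra.TensorProduct.lift_tmul _ _ _ a (op b)) f) m

variable (k) in
/-- The bimodule `Hom_k(M, W)` for left modules `M` and `W`. -/
noncomputable def homBimod (M W : ModuleCat.{u} Λ) : BimoduleCat k Λ :=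
  letI : Module (Λ ⊗[k] Λᵐᵒᵖ) (M →ₗ[k] W) :=
    Module.compHom _ (homBimodAction (k := k) M W).toRingHom
  ModuleCat.of (Λ ⊗[k] Λᵐᵒᵖ) (M →ₗ[k] W)

variable (k) in
/-- The `k`-linear maps corresponding to the elements of `homBimod k M W`. -/
noncomputable def homBimodEval (M W : ModuleCat.{u} Λ) : homBimod k M W ≃+ (M →ₗ[k] W) :=
  AddEquiv.refl _

lemma homBimod_ext {M W : ModuleCat.{u} Λ} {g h : homBimod k M W}
    (w : ∀ x, homBimodEval k M W g x = homBimodEval k M W h x) : g = h :=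
  (homBimodEval k M W).injective (LinearMap.ext w)

lemma homBimodEval_smul {M W : ModuleCat.{u} Λ} (a : Λ) (f : homBimod k M W) (m : M) :
    homBimodEval k M W (a • f) m = a • homBimodEval k M W f m :=
  (homBimodAction_apply M W a 1 (homBimodEval k M W f) m).trans (by rw [one_smul])

lemma homBimodEval_rightMul {M W : ModuleCat.{u} Λ} (a : Λ) (f : homBimod k M W) (m : M) :
    homBimodEval k M W (rightMul _ a f) m = homBimodEval k M W f (a • m) :=
  (homBimodAction_apply M W 1 a (homBimodEval k M W f) m).trans (by rw [one_smul])

/-- The morphism `M ⟶ Hom_Λ(X, W)` corresponding to `X ⊗_Λ M ⟶ W`. -/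
noncomputable def tensorModCurry {X : BimoduleCat k Λ} {M W : ModuleCat.{u} Λ}
    (f : tensorMod X M ⟶ W) : M ⟶ homMod X W := ModuleCat.ofHom (Y := homMod X W) (
  { toFun := fun m => (homModEval X W).symm
      { toFun := fun x => f.hom (tensorMod.tmul x m)
        map_add' := fun x y => by rw [tensorMod.add_tmul, map_add]
        map_smul' := fun a x => by rw [tensorMod.smul_tmul, map_smul]; rfl }
    map_add' := fun m m' => homMod_ext fun x => by
      change f.hom (tensorMod.tmul x (m + m')) =
        f.hom (tensorMod.tmul x m) + f.hom (tensorMod.tmul x m')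
      rw [tensorMod.tmul_add, map_add]
    map_smul' := fun a m => homMod_ext fun x =>
      congrArg f.hom (tensorMod.tmul_smul a x m) } : M →ₗ[Λ] homMod X W)

lemma tensorModCurry_apply {X : BimoduleCat k Λ} {M W : ModuleCat.{u} Λ}
    (f : tensorMod X M ⟶ W) (m : M) (x : X) :
    homModEval X W ((tensorModCurry f).hom m) x = f.hom (tensorMod.tmul x m) := rfl

/-- The morphism `X ⊗_Λ M ⟶ W` corresponding to `M ⟶ Hom_Λ(X, W)`. -/
noncomputable def tensorModUncurry {X : BimoduleCat k Λ} {M W : ModuleCat.{u} Λ}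
    (g : M ⟶ homMod X W) : tensorMod X M ⟶ W :=
  tensorMod.lift
    { toFun := fun x =>
        { toFun := fun m => homModEval X W (g.hom m) x
          map_add' := fun m m' => by
            rw [map_add, map_add, LinearMap.add_apply]
          map_smul' := fun r m => by
            rw [← algebraMap_smul Λ r m, map_smul, homModEval_smul, rightMul_algebraMap, map_smul,
              algebraMap_smul, RingHom.id_apply] }
      map_add' := fun x y => LinearMap.ext fun m => (homModEval X W (g.hom m)).map_add x y
      map_smul' := fun a x => LinearMap.ext fun m => (homModEval X W (g.hom m)).map_smul a x }
    (fun x a m => (congrArg (fun z => homModEval X W z x) (g.hom.map_smul a m)).symm)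

lemma tensorModUncurry_tmul {X : BimoduleCat k Λ} {M W : ModuleCat.{u} Λ}
    (g : M ⟶ homMod X W) (m : M) (x : X) :
    (tensorModUncurry g).hom (tensorMod.tmul x m) = homModEval X W (g.hom m) x :=
  tensorMod.lift_tmul _ (fun x a m =>
    (congrArg (fun z => homModEval X W z x) (g.hom.map_smul a m)).symm) _ _

/-- Morphisms `X ⊗_Λ M ⟶ W` are the same as morphisms `M ⟶ Hom_Λ(X, W)`. -/
noncomputable def tensorModHomEquiv (X : BimoduleCat k Λ) (M W : ModuleCat.{u} Λ) :
    (tensorMod X M ⟶ W) ≃ (M ⟶ homMod X W) where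
  toFun := tensorModCurry
  invFun := tensorModUncurry
  left_inv f := tensorMod.hom_ext fun x m => tensorModUncurry_tmul _ _ _
  right_inv g := by
    ext m
    exact homMod_ext fun x => tensorModUncurry_tmul _ _ _

/-- The morphism `X ⟶ Hom_k(M, W)` corresponding to `X ⊗_Λ M ⟶ W`. -/
noncomputable def tensorModCurry' {X : BimoduleCat k Λ} {M W : ModuleCat.{u} Λ}
    (f : tensorMod X M ⟶ W) : X ⟶ homBimod k M W := bimodHomMk
  { toFun := fun x => (homBimodEval k M W).symm
      (f.hom.restrictScalars k ∘ₗ tensorMod.mk X M x)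
    map_add' := fun x y => homBimod_ext fun m => by
      change f.hom (tensorMod.tmul (x + y) m) =
        f.hom (tensorMod.tmul x m) + f.hom (tensorMod.tmul y m)
      rw [tensorMod.add_tmul, map_add]
    map_smul' := fun a x => homBimod_ext fun m =>
      ((congrArg f.hom (tensorMod.smul_tmul a x m)).trans (f.hom.map_smul a _)).trans
        (homBimodEval_smul a ((homBimodEval k M W).symm
          (f.hom.restrictScalars k ∘ₗ tensorMod.mk X M x)) m).symm }
  (fun a x => homBimod_ext fun m =>
    (congrArg f.hom (tensorMod.tmul_smul a x m)).symm.trans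
      (homBimodEval_rightMul a ((homBimodEval k M W).symm
          (f.hom.restrictScalars k ∘ₗ tensorMod.mk X M x)) m).symm)

/-- The morphism `X ⊗_Λ M ⟶ W` corresponding to `X ⟶ Hom_k(M, W)`. -/
noncomputable def tensorModUncurry' {X : BimoduleCat k Λ} {M W : ModuleCat.{u} Λ}
    (g : X ⟶ homBimod k M W) : tensorMod X M ⟶ W :=
  tensorMod.lift
    { toFun := fun x => homBimodEval k M W (g.hom x)
      map_add' := fun x y => by rw [map_add, map_add]
      map_smul' := fun a x => LinearMap.ext fun m => by
        rw [← leftLinear_apply, map_smul]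
        exact homBimodEval_smul a _ m }
    (fun x a m => (congrArg (fun z => homBimodEval k M W z m) (bimodHom_rightMul g a x)).trans
      (homBimodEval_rightMul a _ m))

lemma tensorModUncurry'_tmul {X : BimoduleCat k Λ} {M W : ModuleCat.{u} Λ}
    (g : X ⟶ homBimod k M W) (m : M) (x : X) :
    (tensorModUncurry' g).hom (tensorMod.tmul x m) = homBimodEval k M W (g.hom x) m :=
  tensorMod.lift_tmul _ (fun x a m =>
    (congrArg (fun z => homBimodEval k M W z m) (bimodHom_rightMul g a x)).trans
      (homBimodEval_rightMul a _ m)) _ _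

/-- Morphisms `X ⊗_Λ M ⟶ W` are the same as bimodule morphisms `X ⟶ Hom_k(M, W)`. -/
noncomputable def tensorModHomEquiv' (X : BimoduleCat k Λ) (M W : ModuleCat.{u} Λ) :
    (tensorMod X M ⟶ W) ≃ (X ⟶ homBimod k M W) where
  toFun := tensorModCurry'
  invFun := tensorModUncurry'
  left_inv f := tensorMod.hom_ext fun x m => tensorModUncurry'_tmul _ _ _
  right_inv g := by
    ext x
    exact homBimod_ext fun m => tensorModUncurry'_tmul _ _ _

/-- Left adjoints preserve coproducts. Associativity of tensor products of complexes needs this in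
each variable separately, since the terms of these complexes are infinite direct sums. -/
instance (X : BimoduleCat k Λ) : ((tensorModBifunctor k Λ).obj X).IsLeftAdjoint :=
  ⟨_, ⟨Adjunction.adjunctionOfEquivRight (F := (tensorModBifunctor k Λ).obj X)
    (G_obj := homMod X)
    (fun M W => tensorModHomEquiv X M W) (fun M' M W f g => by
      refine ModuleCat.hom_ext (LinearMap.ext fun m => homMod_ext fun x => ?_)
      refine (tensorModCurry_apply (((tensorModBifunctor k Λ).obj X).map f ≫ g) m x).trans ?_
      exact congrArg g.hom (tensorMod.map_tmul (𝟙 X) f x m))⟩⟩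

lemma tensorModHomEquiv'_naturality (M : ModuleCat.{u} Λ) (X' X : BimoduleCat k Λ)
    (W : ModuleCat.{u} Λ) (f : X' ⟶ X) (g : tensorMod X M ⟶ W) :
    tensorModHomEquiv' X' M W (((tensorModBifunctor k Λ).flip.obj M).map f ≫ g) =
      f ≫ tensorModHomEquiv' X M W g := by
  ext x
  exact homBimod_ext fun m => congrArg g.hom (tensorMod.map_tmul f (𝟙 M) x m)

variable (k) in
/-- The functor `Hom_k(M, -)` from left modules to bimodules. -/
noncomputable def homBimodFunctor (M : ModuleCat.{u} Λ) : ModuleCat.{u} Λ ⥤ BimoduleCat k Λ :=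
  Adjunction.rightAdjointOfEquiv (F := (tensorModBifunctor k Λ).flip.obj M)
    (G_obj := homBimod k M)
    (fun X W => tensorModHomEquiv' X M W) (tensorModHomEquiv'_naturality M)

variable (k) in
/-- The adjunction between `- ⊗_Λ M` and `Hom_k(M, -)`. -/
noncomputable def tensorModFlipAdj (M : ModuleCat.{u} Λ) :
    (tensorModBifunctor k Λ).flip.obj M ⊣ homBimodFunctor k M :=
  Adjunction.adjunctionOfEquivRight (F := (tensorModBifunctor k Λ).flip.obj M)
    (G_obj := homBimod k M) (fun X W => tensorModHomEquiv' X M W) (tensorModHomEquiv'_naturality M)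

instance (M : ModuleCat.{u} Λ) : ((tensorModBifunctor k Λ).flip.obj M).IsLeftAdjoint :=
  ⟨_, ⟨tensorModFlipAdj k M⟩⟩

lemma homBimodFunctor_map_apply (M : ModuleCat.{u} Λ) {W W' : ModuleCat.{u} Λ} (g : W ⟶ W')
    (f : homBimod k M W) (m : M) :
    homBimodEval k M W' (((homBimodFunctor k M).map g).hom f) m = g.hom (homBimodEval k M W f m) :=
      by
  exact congrArg g.hom (tensorModUncurry'_tmul (𝟙 (homBimod k M W)) m f)

/-- If `X` is a projective bimodule, then `X ⊗_Λ M` is projective. -/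
instance (X : BimoduleCat k Λ) [Projective X] (M : ModuleCat.{u} Λ) :
    Projective (((tensorModBifunctor k Λ).obj X).obj M) := by
  have : (homBimodFunctor k M).PreservesEpimorphisms := by
    refine ⟨fun {W W'} g hg => ?_⟩
    rw [ModuleCat.epi_iff_surjective] at hg ⊢
    intro f
    -- Only a `k`-linear lift is required, and every module over the field `k` is projective.
    obtain ⟨h, hh⟩ := Module.projective_lifting_property (g.hom.restrictScalars k)
      (homBimodEval k M W' f) hg
    exact ⟨(homBimodEval k M W).symm h, homBimod_ext fun m =>
      (homBimodFunctor_map_apply M g _ m).trans (LinearMap.congr_fun hh m)⟩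
  exact (tensorModFlipAdj k M).map_projective X inferInstance

section Associator

/-- The pure tensor `x ⊗ y` of elements of bimodules. -/
noncomputable def bimodTmul {X Y : BimoduleCat k Λ} (x : X) (y : Y) : tensorBimod X Y :=
  Submodule.Quotient.mk (OuterTensor.tmul x y)

lemma smul_bimodTmul {X Y : BimoduleCat k Λ} (a : Λ) (x : X) (y : Y) :
    bimodTmul (a • x) y = a • bimodTmul x y := by
  refine Eq.symm ?_
  change Submodule.Quotient.mk ((a ⊗ₜ[k] (1 : Λᵐᵒᵖ)) • OuterTensor.tmul x y) = _
  refine congrArg Submodule.Quotient.mk ?_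
  refine (outerAction_tmul (k := k) X Y a 1 x y).trans ?_
  rw [← Algebra.TensorProduct.one_def, one_smul]
  rfl

lemma rightMul_bimodTmul {X Y : BimoduleCat k Λ} (a : Λ) (x : X) (y : Y) :
    rightMul _ a (bimodTmul x y) = bimodTmul x (rightMul Y a y) := by
  change Submodule.Quotient.mk (((1 : Λ) ⊗ₜ[k] op a) • OuterTensor.tmul x y) = _
  refine congrArg Submodule.Quotient.mk ?_
  refine (outerAction_tmul (k := k) X Y 1 (op a) x y).trans ?_
  rw [← Algebra.TensorProduct.one_def, one_smul]
  rfl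

lemma bimodTmul_balanced {X Y : BimoduleCat k Λ} (a : Λ) (x : X) (y : Y) :
    bimodTmul (rightMul X a x) y = bimodTmul x (a • y) :=
  (Submodule.Quotient.eq _).2 (Submodule.subset_span ⟨x, a, y, rfl⟩)

lemma bimodTmul_add {X Y : BimoduleCat k Λ} (x : X) (y y' : Y) :
    bimodTmul x (y + y') = bimodTmul x y + bimodTmul x y' :=
  congrArg Submodule.Quotient.mk (TensorProduct.tmul_add (R := k) x y y')

lemma add_bimodTmul {X Y : BimoduleCat k Λ} (x x' : X) (y : Y) :
    bimodTmul (x + x') y = bimodTmul x y + bimodTmul x' y :=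
  congrArg Submodule.Quotient.mk (TensorProduct.add_tmul (R := k) x x' y)

lemma tensorBimod_induction {X Y : BimoduleCat k Λ} {p : tensorBimod X Y → Prop}
    (t : tensorBimod X Y) (h0 : p 0) (ht : ∀ (x : X) (y : Y), p (bimodTmul x y))
    (ha : ∀ s t, p s → p t → p (s + t)) : p t := by
  obtain ⟨t, rfl⟩ := Submodule.Quotient.mk_surjective _ t
  change X ⊗[k] Y at t
  induction t with
  | zero => exact h0
  | add x y hx hy => exact ha _ _ hx hy
  | tmul x m => exact ht x m

lemma rightMul_base (X : BimoduleCat k Λ) (r : k) (x : X) :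
    rightMul X (algebraMap k Λ r) x = r • x := by
  rw [rightMul_algebraMap, algebraMap_smul]

/-- The bimodule map on `X ⊗[k] Y` (with the outer bimodule structure) given by a bilinear map. -/
noncomputable def outerLift {X Y Z : BimoduleCat k Λ} (f : X →+ Y →+ Z)
    (hb : ∀ (r : k) (x : X) (y : Y), f (r • x) y = f x (r • y))
    (hs : ∀ (a : Λ) (x : X) (y : Y), f (a • x) y = a • f x y)
    (hr : ∀ (x : X) (a : Λ) (y : Y), f x (rightMul Y a y) = rightMul Z a (f x y)) :
    OuterTensor k X Y →ₗ[Λ ⊗[k] Λᵐᵒᵖ] Z where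
  toFun := TensorProduct.liftAddHom (R := k) f hb
  map_add' s t := map_add _ s t
  map_smul' e t := by
    have ht (a : Λ) (b : Λᵐᵒᵖ) (x : X) (y : Y) :
        TensorProduct.liftAddHom (R := k) f hb
          (outerAction k Λ X Y (a ⊗ₜ[k] b) (x ⊗ₜ[k] y)) = (a ⊗ₜ[k] b) • f x y := by
      obtain ⟨b, rfl⟩ := op_surjective b
      rw [outerAction_tmul, TensorProduct.liftAddHom_tmul]
      exact (hs a x _).trans ((congrArg (a • ·) (hr x b y)).trans
        (bimod_smul_tmul Z a b (f x y)).symm)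
    change X ⊗[k] Y at t
    change TensorProduct.liftAddHom (R := k) f _ (outerAction k Λ X Y e t) = e •
      TensorProduct.liftAddHom (R := k) f _ t
    induction e with
    | zero =>
      rw [map_zero, LinearMap.zero_apply, map_zero]
      exact (zero_smul (Λ ⊗[k] Λᵐᵒᵖ) (_ : Z)).symm
    | add e₁ e₂ h₁ h₂ => rw [map_add, LinearMap.add_apply, map_add, add_smul, h₁, h₂]
    | tmul a b =>
      induction t with
      | zero => rw [map_zero, map_zero, smul_zero]
      | add t₁ t₂ h₁ h₂ => rw [map_add, map_add, map_add, smul_add, h₁, h₂]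
      | tmul x y => exact ht a b x y

/-- The universal property of `X ⊗_Λ Y`. -/
noncomputable def tensorBimodLift {X Y Z : BimoduleCat k Λ} (f : X →+ Y →+ Z)
    (hs : ∀ (a : Λ) (x : X) (y : Y), f (a • x) y = a • f x y)
    (hf : ∀ (x : X) (a : Λ) (y : Y), f (rightMul X a x) y = f x (a • y))
    (hr : ∀ (x : X) (a : Λ) (y : Y), f x (rightMul Y a y) = rightMul Z a (f x y)) :
    tensorBimod X Y ⟶ Z :=
  ModuleCat.ofHom (Submodule.liftQ (balancedRelations k Λ X Y)
    -- Balancedness over `k` is a special case of balancedness over `Λ`, because right and left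
    -- multiplication by a scalar agree.
    (outerLift f (fun r x y => by rw [← rightMul_base, hf, algebraMap_smul]) hs hr) (by
    refine Submodule.span_le.2 ?_
    rintro _ ⟨x, a, y, rfl⟩
    refine (LinearMap.map_sub _ _ _).trans (sub_eq_zero.2 ?_)
    exact hf x a y))

/-- The morphism `(X ⊗ Y) ⊗ M ⟶ X ⊗ (Y ⊗ M)`. -/
noncomputable def tensorModAssocHom (X Y : BimoduleCat k Λ) (M : ModuleCat.{u} Λ) :
    tensorMod (tensorBimod X Y) M ⟶ tensorMod X (tensorMod Y M) :=
  tensorModUncurry' (tensorBimodLift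
    (AddMonoidHom.mk' (fun x => AddMonoidHom.mk' (fun y => (homBimodEval k M _).symm
        ((tensorMod.mk X (tensorMod Y M) x) ∘ₗ (tensorMod.mk Y M y)))
        (fun y y' => homBimod_ext fun m =>
          (congrArg (tensorMod.tmul x) (tensorMod.add_tmul y y' m)).trans
            (tensorMod.tmul_add _ _ _)))
      (fun x x' => AddMonoidHom.ext fun _ => homBimod_ext fun _ => tensorMod.add_tmul x x' _))
    (fun a x y => homBimod_ext fun m => (tensorMod.smul_tmul a x _).trans
      (homBimodEval_smul a ((homBimodEval k M _).symm
        ((tensorMod.mk X (tensorMod Y M) x) ∘ₗ (tensorMod.mk Y M y))) m).symm)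
    (fun x a y => homBimod_ext fun m => (tensorMod.tmul_smul a x (tensorMod.tmul y m)).symm.trans
      (congrArg (tensorMod.tmul x) (tensorMod.smul_tmul a y m).symm))
    (fun x a y => homBimod_ext fun m =>
      (congrArg (tensorMod.tmul x) (tensorMod.tmul_smul a y m).symm).trans
      (homBimodEval_rightMul a ((homBimodEval k M _).symm
        ((tensorMod.mk X (tensorMod Y M) x) ∘ₗ (tensorMod.mk Y M y))) m).symm))

lemma tensorModAssocHom_tmul {X Y : BimoduleCat k Λ} {M : ModuleCat.{u} Λ} (x : X) (y : Y) (m : M) :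
    (tensorModAssocHom X Y M).hom (tensorMod.tmul (bimodTmul x y) m) =
      tensorMod.tmul x (tensorMod.tmul y m) :=
  tensorModUncurry'_tmul _ _ _

/-- The morphism `X ⊗ (Y ⊗ M) ⟶ (X ⊗ Y) ⊗ M`. -/
noncomputable def tensorModAssocInv (X Y : BimoduleCat k Λ) (M : ModuleCat.{u} Λ) :
    tensorMod X (tensorMod Y M) ⟶ tensorMod (tensorBimod X Y) M :=
  tensorModUncurry (tensorModUncurry (ModuleCat.ofHom
    (Y := homMod Y (homMod X (tensorMod (tensorBimod X Y) M))) (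
    { toFun := fun m => (homModEval _ _).symm
        { toFun := fun y => (homModEval _ _).symm
            { toFun := fun x => tensorMod.tmul (bimodTmul x y) m
              map_add' := fun x x' => by rw [add_bimodTmul, tensorMod.add_tmul]
              map_smul' := fun a x => by
                rw [smul_bimodTmul, tensorMod.smul_tmul, RingHom.id_apply] }
          map_add' := fun y y' => homMod_ext fun x =>
            (congrArg (fun z => tensorMod.tmul z m) (bimodTmul_add x y y')).trans
              (tensorMod.add_tmul _ _ _)
          map_smul' := fun a y => homMod_ext fun x =>
            congrArg (fun z => tensorMod.tmul z m) (bimodTmul_balanced a x y).symm }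
      map_add' := fun m m' => homMod_ext fun y => homMod_ext fun x => tensorMod.tmul_add _ _ _
      map_smul' := fun a m => homMod_ext fun y => homMod_ext fun x =>
        (tensorMod.tmul_smul a _ m).trans
          (congrArg (fun z => tensorMod.tmul z m) (rightMul_bimodTmul a x y)) } :
      M →ₗ[Λ] homMod Y (homMod X (tensorMod (tensorBimod X Y) M)))))

lemma tensorModAssocInv_tmul {X Y : BimoduleCat k Λ} {M : ModuleCat.{u} Λ} (x : X) (y : Y) (m : M) :
    (tensorModAssocInv X Y M).hom (tensorMod.tmul x (tensorMod.tmul y m)) =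
      tensorMod.tmul (bimodTmul x y) m := by
  refine (tensorModUncurry_tmul _ _ _).trans ?_
  refine (congrArg (fun z => homModEval X _ z x) (tensorModUncurry_tmul _ _ _)).trans ?_
  rfl

lemma tensorMod_tensorBimod_hom_ext {X Y : BimoduleCat k Λ} {M W : ModuleCat.{u} Λ}
    {f g : tensorMod (tensorBimod X Y) M ⟶ W}
    (h : ∀ (x : X) (y : Y) (m : M), f.hom (tensorMod.tmul (bimodTmul x y) m) =
      g.hom (tensorMod.tmul (bimodTmul x y) m)) : f = g :=
  tensorMod.hom_ext fun t m => by
    induction t using tensorBimod_induction with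
    | h0 =>
      have h0 : tensorMod.tmul (0 : tensorBimod X Y) m = 0 :=
        LinearMap.congr_fun (map_zero (tensorMod.mk (tensorBimod X Y) M)) m
      rw [h0, map_zero, map_zero]
    | ht x y => exact h x y m
    | ha s t hs ht => rw [tensorMod.add_tmul, map_add, map_add, hs, ht]

lemma tensorMod_tensorMod_hom_ext {X Y : BimoduleCat k Λ} {M W : ModuleCat.{u} Λ}
    {f g : tensorMod X (tensorMod Y M) ⟶ W}
    (h : ∀ (x : X) (y : Y) (m : M), f.hom (tensorMod.tmul x (tensorMod.tmul y m)) =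
      g.hom (tensorMod.tmul x (tensorMod.tmul y m))) : f = g :=
  tensorMod.hom_ext fun x t => by
    induction t using tensorMod.induction_on with
    | h0 =>
      have h0 : tensorMod.tmul x (0 : tensorMod Y M) = 0 :=
        map_zero (tensorMod.mk X (tensorMod Y M) x)
      rw [h0, map_zero, map_zero]
    | ht y m => exact h x y m
    | ha s t hs ht => rw [tensorMod.tmul_add, map_add, map_add, hs, ht]

/-- The isomorphism `(X ⊗ Y) ⊗ M ≅ X ⊗ (Y ⊗ M)`. -/
noncomputable def tensorModAssoc (X Y : BimoduleCat k Λ) (M : ModuleCat.{u} Λ) :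
    tensorMod (tensorBimod X Y) M ≅ tensorMod X (tensorMod Y M) where
  hom := tensorModAssocHom X Y M
  inv := tensorModAssocInv X Y M
  hom_inv_id := tensorMod_tensorBimod_hom_ext fun x y m =>
    (congrArg (tensorModAssocInv X Y M).hom (tensorModAssocHom_tmul x y m)).trans
      (tensorModAssocInv_tmul x y m)
  inv_hom_id := tensorMod_tensorMod_hom_ext fun x y m =>
    (congrArg (tensorModAssocHom X Y M).hom (tensorModAssocInv_tmul x y m)).trans
      (tensorModAssocHom_tmul x y m)

variable (k Λ) in
/-- The associator for the tensor product of two bimodules and a left module. -/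
noncomputable def tensorModAssociator :
    bifunctorComp₁₂ (tensorBifunctor k Λ) (tensorModBifunctor k Λ) ≅
      bifunctorComp₂₃ (tensorModBifunctor k Λ) (tensorModBifunctor k Λ) :=
  NatIso.ofComponents (fun X => NatIso.ofComponents (fun Y => NatIso.ofComponents
    (fun M => tensorModAssoc X Y M)
    (fun {M M'} f => tensorMod_tensorBimod_hom_ext fun x y m => rfl))
    (fun {Y Y'} f => by
      ext M : 2
      exact tensorMod_tensorBimod_hom_ext fun x y m => rfl))
    (fun {X X'} f => by
      ext Y : 2
      ext M : 2
      exact tensorMod_tensorBimod_hom_ext fun x y m => rfl)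

end Associator

section Units

variable (k Λ) in
/-- The elements of the regular bimodule. -/
def regularBimodEquiv : regularBimod k Λ ≃+ Λ := AddEquiv.refl _

lemma regularBimodEquiv_smul (a : Λ) (x : regularBimod k Λ) :
    regularBimodEquiv k Λ (a • x) = a * regularBimodEquiv k Λ x := by
  let := TensorProduct.Algebra.module (R := k) (A := Λ) (B := Λᵐᵒᵖ) (M := Λ)
  refine (TensorProduct.Algebra.smul_def (R := k) a (1 : Λᵐᵒᵖ)
    (regularBimodEquiv k Λ x)).trans ?_
  rw [one_smul, smul_eq_mul]

lemma regularBimodEquiv_rightMul (a : Λ) (x : regularBimod k Λ) :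
    regularBimodEquiv k Λ (rightMul _ a x) = regularBimodEquiv k Λ x * a := by
  let := TensorProduct.Algebra.module (R := k) (A := Λ) (B := Λᵐᵒᵖ) (M := Λ)
  refine (TensorProduct.Algebra.smul_def (R := k) (1 : Λ) (op a)
    (regularBimodEquiv k Λ x)).trans ?_
  rw [one_smul, op_smul_eq_mul]

lemma regularBimodEquiv_base (r : k) (x : regularBimod k Λ) :
    regularBimodEquiv k Λ (r • x) = r • regularBimodEquiv k Λ x := by
  rw [← algebraMap_smul Λ r x, regularBimodEquiv_smul, Algebra.smul_def]

/-- The multiplication `Λ ⊗_Λ M ⟶ M`. -/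
noncomputable def tensorModLeftUnitHom (M : ModuleCat.{u} Λ) :
    tensorMod (regularBimod k Λ) M ⟶ M :=
  tensorMod.lift
    { toFun := fun x => (Algebra.lsmul k k M) (regularBimodEquiv k Λ x)
      map_add' := fun x y => by rw [map_add, map_add]
      map_smul' := fun a x => by
        ext m
        simp [regularBimodEquiv_smul] }
    (fun x a m => by simp [regularBimodEquiv_rightMul])

lemma tensorModLeftUnitHom_tmul {M : ModuleCat.{u} Λ} (x : regularBimod k Λ) (m : M) :
    (tensorModLeftUnitHom M).hom (tensorMod.tmul x m) = regularBimodEquiv k Λ x • m := rfl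

/-- The isomorphism `Λ ⊗_Λ M ≅ M`. -/
noncomputable def tensorModLeftUnit (M : ModuleCat.{u} Λ) : tensorMod (regularBimod k Λ) M ≅ M where
  hom := tensorModLeftUnitHom M
  inv := ModuleCat.ofHom (Y := tensorMod (regularBimod k Λ) M)
    { toFun := fun m => tensorMod.tmul ((regularBimodEquiv k Λ).symm 1) m
      map_add' := fun m m' => tensorMod.tmul_add _ _ _
      map_smul' := fun a m => by
        refine (tensorMod.tmul_smul _ _ _).trans (Eq.trans ?_ (tensorMod.smul_tmul _ _ _))
        refine congrArg (fun z => tensorMod.tmul z m) ?_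
        apply (regularBimodEquiv k Λ).injective
        simp [regularBimodEquiv_smul, regularBimodEquiv_rightMul] }
  hom_inv_id := tensorMod.hom_ext fun x m => by
    refine (congrArg (tensorMod.tmul ((regularBimodEquiv k Λ).symm 1))
      (tensorModLeftUnitHom_tmul x m)).trans ?_
    refine (tensorMod.tmul_smul (regularBimodEquiv k Λ x) _ _).trans
      (congrArg (fun z => tensorMod.tmul z m) ?_)
    apply (regularBimodEquiv k Λ).injective
    simp [regularBimodEquiv_rightMul]
  inv_hom_id := by
    refine ModuleCat.hom_ext (LinearMap.ext fun m => ?_)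
    refine (tensorModLeftUnitHom_tmul ((regularBimodEquiv k Λ).symm 1) m).trans ?_
    exact (congrArg (· • m) (AddEquiv.apply_symm_apply (regularBimodEquiv k Λ) 1)).trans
      (one_smul Λ m)

variable (k Λ) in
/-- The functor `Λ ⊗_Λ -` is the identity. -/
noncomputable def tensorModLeftUnitor :
    (tensorModBifunctor k Λ).obj (regularBimod k Λ) ≅ 𝟭 (ModuleCat.{u} Λ) :=
  NatIso.ofComponents (fun M => tensorModLeftUnit M) (fun f =>
    tensorMod.hom_ext fun x m => (f.hom.map_smul (regularBimodEquiv k Λ x) m).symm)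

variable (Λ) in
/-- The right multiplication by `a` on the left module `Λ`. -/
noncomputable def regularRightMul (a : Λ) : ModuleCat.of Λ Λ ⟶ ModuleCat.of Λ Λ :=
  ModuleCat.ofHom (LinearMap.toSpanSingleton Λ Λ a)

/-- The multiplication `X ⊗_Λ Λ ⟶ X`. -/
noncomputable def tensorModRightUnitHom (X : BimoduleCat k Λ) :
    tensorMod X (ModuleCat.of Λ Λ) ⟶ (leftModule k Λ).obj X :=
  tensorModUncurry (W := (leftModule k Λ).obj X) (ModuleCat.ofHom
    (Y := homMod X ((leftModule k Λ).obj X))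
    { toFun := fun a : Λ => (homModEval X ((leftModule k Λ).obj X)).symm (rightMul X a)
      map_add' := rightMul_add X
      map_smul' := fun a b => rightMul_mul X a b })

lemma tensorModRightUnitHom_tmul (X : BimoduleCat k Λ) (x : X) (a : Λ) :
    (tensorModRightUnitHom X).hom (tensorMod.tmul (M := ModuleCat.of Λ Λ) x a) =
      rightMul X a x :=
  tensorModUncurry_tmul _ _ _

/-- The isomorphism `X ⊗_Λ Λ ≅ X`. -/
noncomputable def tensorModRightUnit (X : BimoduleCat k Λ) :
    tensorMod X (ModuleCat.of Λ Λ) ≅ (leftModule k Λ).obj X where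
  hom := tensorModRightUnitHom X
  inv := ModuleCat.ofHom (X := (leftModule k Λ).obj X) (Y := tensorMod X (ModuleCat.of Λ Λ))
    { toFun := fun x : X => tensorMod.tmul x (1 : Λ)
      map_add' := fun x y => tensorMod.add_tmul (M := ModuleCat.of Λ Λ) x y (1 : Λ)
      map_smul' := fun a x => tensorMod.smul_tmul (M := ModuleCat.of Λ Λ) a x (1 : Λ) }
  hom_inv_id := tensorMod.hom_ext fun x a => by
    refine (congrArg (fun z : X => tensorMod.tmul (M := ModuleCat.of Λ Λ) z (1 : Λ))
      (tensorModRightUnitHom_tmul X x a)).trans ?_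
    refine (tensorMod.tmul_smul (M := ModuleCat.of Λ Λ) (a : Λ) x (1 : Λ)).symm.trans ?_
    exact congrArg (tensorMod.tmul (M := ModuleCat.of Λ Λ) x) (mul_one (a : Λ))
  inv_hom_id := by
    refine ModuleCat.hom_ext (LinearMap.ext fun x : X => ?_)
    refine (tensorModRightUnitHom_tmul X x 1).trans ?_
    exact LinearMap.congr_fun (rightMul_one X) x

variable (k Λ) in
/-- The functor `- ⊗_Λ Λ` is the forgetful functor to left modules. -/
noncomputable def tensorModRightUnitor :
    (tensorModBifunctor k Λ).flip.obj (ModuleCat.of Λ Λ) ≅ leftModule k Λ :=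
  NatIso.ofComponents (fun X => tensorModRightUnit X) (fun {X Y} f =>
    tensorMod.hom_ext fun x a => (tensorModRightUnitHom_tmul Y (f.hom x) a).trans
      ((bimodHom_rightMul f a x).symm.trans
        (congrArg f.hom (tensorModRightUnitHom_tmul X x a).symm)))

/-- The right action on a bimodule is recovered from the functor `X ⊗_Λ -` by evaluating it at the
endomorphisms of `Λ`. This is what later identifies a bimodule from its tensor functor. -/
lemma tensorModRightUnit_naturality (X : BimoduleCat k Λ) (a : Λ) :
    ((tensorModBifunctor k Λ).obj X).map (regularRightMul Λ a) ≫ (tensorModRightUnit X).hom =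
      (tensorModRightUnit X).hom ≫ (rightMulNat k Λ a).app X :=
  tensorMod.hom_ext fun x b => (tensorModRightUnitHom_tmul X x (b * a : Λ)).trans
    ((LinearMap.congr_fun (rightMul_mul X b a) x).trans
        (congrArg (rightMul X a) (tensorModRightUnitHom_tmul X x b).symm))

end Units

end ModuleTensorAdjunctions

/-! ## Tensor products with contractible complexes -/

section Contraction

/-- An endomorphism of a direct sum which is unitriangular (for a decomposition indexed by the
integers which is bounded above) is an isomorphism. -/
lemma isIso_of_unitriangular {D : Type*} [Category* D] [Preadditive D] {T : D} (C : ℤ → D)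
    (ι : ∀ i, C i ⟶ T) (hdesc : ∀ {W : D} (f : ∀ i, C i ⟶ W), ∃ g : T ⟶ W, ∀ i, ι i ≫ g = f i)
    (hext : ∀ {W : D} (f g : T ⟶ W), (∀ i, ι i ≫ f = ι i ≫ g) → f = g)
    (b : ℤ) (hb : ∀ i, b < i → IsZero (C i)) (u : T ⟶ T) (N : ∀ i, C i ⟶ C (i + 1))
    (hu : ∀ i, ι i ≫ u = ι i + N i ≫ ι (i + 1)) : IsIso u := by
  -- Partial sums of the geometric series for `(1 + N)⁻¹`, restricted to the summand `C i`. As `N`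
  -- raises the index and `C i = 0` for `i > b`, they are constant in `r` as soon as `b < i + r`.
  let w : ℕ → ∀ i, C i ⟶ T := fun r => r.rec ι (fun _ v i => ι i - N i ≫ v (i + 1))
  have w_succ (r : ℕ) (i : ℤ) : w (r + 1) i = ι i - N i ≫ w r (i + 1) := rfl
  have stable (r : ℕ) : ∀ i, b < i + r → w (r + 1) i = w r i := by
    induction r with
    | zero => exact fun i hi => (hb i (by simpa using hi)).eq_of_src _ _
    | succ r hr =>
      intro i hi
      rw [w_succ (r + 1) i, hr (i + 1) (by push_cast at hi; lia), ← w_succ r i]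
  have stable' (r : ℕ) (i : ℤ) (hi : b < i + r) (s : ℕ) : w (r + s) i = w r i := by
    induction s with
    | zero => rfl
    | succ s hs => rw [← add_assoc, stable _ _ (by push_cast; lia), hs]
  obtain ⟨v, hv⟩ : ∃ v : ∀ i, C i ⟶ T, ∀ i, v i = ι i - N i ≫ v (i + 1) := by
    -- From `i` it takes `b + 1 - i` steps to leave the range of nonzero summands, so this partial
    -- sum is the stable value.
    refine ⟨fun i => w (b + 1 - i).toNat i, fun i => ?_⟩
    have h₁ := stable' (b + 1 - i).toNat i (by lia) 1
    have h₂ := stable' (b + 1 - (i + 1)).toNat (i + 1) (by lia)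
      ((b + 1 - i).toNat - (b + 1 - (i + 1)).toNat)
    dsimp only
    rw [← h₁, w_succ, ← h₂]
    congr 3
    lia
  obtain ⟨g, hg⟩ := hdesc v
  refine ⟨g, hext _ _ fun i => ?_, hext _ _ fun i => ?_⟩
  · rw [← Category.assoc, hu, Preadditive.add_comp, Category.assoc, hg, hg, hv i, Category.comp_id,
      sub_add_cancel]
  · have key (r : ℕ) : ∀ i, b < i + r → v i ≫ u = ι i := by
      induction r with
      | zero => exact fun i hi => (hb i (by simpa using hi)).eq_of_src _ _
      | succ r hr =>
        intro i hi
        rw [hv i, Preadditive.sub_comp, Category.assoc, hr (i + 1) (by push_cast at hi; lia), hu,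
          add_sub_cancel_right]
    rw [← Category.assoc, hg, Category.comp_id, key (b + 1 - i).toNat i (by lia)]

variable {C₁ C₂ D : Type*} [Category* C₁] [Category* C₂] [Category* D]
  [Preadditive C₁] [Preadditive C₂] [Preadditive D]
  (K₁ : CochainComplex C₁ ℤ) (K₂ : CochainComplex C₂ ℤ) (F : C₁ ⥤ C₂ ⥤ D) [F.Additive]
  [∀ X, (F.obj X).Additive] [CochainComplex.HasMapBifunctor K₁ K₂ F]

lemma ιMapBifunctor_d (p q n : ℤ) (h : p + q = n) (p' q' n' : ℤ) (hp : p + 1 = p')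
    (hq : q + 1 = q') (hn : n + 1 = n') :
    CochainComplex.ιMapBifunctor K₁ K₂ F p q n h ≫ (CochainComplex.mapBifunctor K₁ K₂ F).d n n' =
      (F.map (K₁.d p p')).app (K₂.X q) ≫
          CochainComplex.ιMapBifunctor K₁ K₂ F p' q n' (by lia) +
        p.negOnePow • ((F.obj (K₁.X p)).map (K₂.d q q') ≫
          CochainComplex.ιMapBifunctor K₁ K₂ F p q' n' (by lia)) := by
  subst hp hq hn
  rw [HomologicalComplex.mapBifunctor.d_eq, Preadditive.comp_add,
    HomologicalComplex.mapBifunctor.ι_D₁, HomologicalComplex.mapBifunctor.ι_D₂,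
    HomologicalComplex.mapBifunctor.d₁_eq K₁ K₂ F (.up ℤ) (i₁ := p) (i₁' := p + 1) rfl q (n + 1)
      (show p + 1 + q = n + 1 by lia),
    HomologicalComplex.mapBifunctor.d₂_eq K₁ K₂ F (.up ℤ) p (i₂ := q) (i₂' := q + 1) rfl (n + 1)
      (show p + (q + 1) = n + 1 by lia)]
  simp

section GradedMap

variable {K₂} {L₂ L₂' : CochainComplex C₂ ℤ} [CochainComplex.HasMapBifunctor K₁ L₂ F]
  [CochainComplex.HasMapBifunctor K₁ L₂' F]

/-- The morphism in degree `n` between the tensor products with `K₁` which is induced by a family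
of morphisms `K₂.X q ⟶ L₂.X q`, not necessarily compatible with the differentials. -/
noncomputable def mapBifunctorGradedMap (φ : ∀ q, K₂.X q ⟶ L₂.X q) (n : ℤ) :
    (CochainComplex.mapBifunctor K₁ K₂ F).X n ⟶ (CochainComplex.mapBifunctor K₁ L₂ F).X n :=
  HomologicalComplex.mapBifunctorDesc (fun p q h =>
    (F.obj (K₁.X p)).map (φ q) ≫ CochainComplex.ιMapBifunctor K₁ L₂ F p q n h)

@[simp]
lemma ι_mapBifunctorGradedMap (φ : ∀ q, K₂.X q ⟶ L₂.X q) (p q n : ℤ) (h : p + q = n) :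
    CochainComplex.ιMapBifunctor K₁ K₂ F p q n h ≫ mapBifunctorGradedMap K₁ F φ n =
      (F.obj (K₁.X p)).map (φ q) ≫ CochainComplex.ιMapBifunctor K₁ L₂ F p q n h :=
  HomologicalComplex.ι_mapBifunctorDesc _ _ _ _

lemma mapBifunctorGradedMap_comp (φ : ∀ q, K₂.X q ⟶ L₂.X q) (ψ : ∀ q, L₂.X q ⟶ L₂'.X q) (n : ℤ) :
    mapBifunctorGradedMap K₁ F φ n ≫ mapBifunctorGradedMap K₁ F ψ n =
      mapBifunctorGradedMap K₁ F (fun q => φ q ≫ ψ q) n :=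
  HomologicalComplex.mapBifunctor.hom_ext fun p q h => by
    rw [← Category.assoc, ι_mapBifunctorGradedMap, Category.assoc, ι_mapBifunctorGradedMap,
      ι_mapBifunctorGradedMap, Functor.map_comp, Category.assoc]

lemma mapBifunctorGradedMap_id (n : ℤ) :
    mapBifunctorGradedMap K₁ F (fun q => 𝟙 (K₂.X q)) n = 𝟙 _ :=
  HomologicalComplex.mapBifunctor.hom_ext fun p q h => by
    rw [ι_mapBifunctorGradedMap, CategoryTheory.Functor.map_id, Category.id_comp, Category.comp_id]

lemma mapBifunctorGradedMap_add (φ ψ : ∀ q, K₂.X q ⟶ L₂.X q) (n : ℤ) :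
    mapBifunctorGradedMap K₁ F (fun q => φ q + ψ q) n =
      mapBifunctorGradedMap K₁ F φ n + mapBifunctorGradedMap K₁ F ψ n :=
  HomologicalComplex.mapBifunctor.hom_ext fun p q h => by
    rw [Preadditive.comp_add, ι_mapBifunctorGradedMap, ι_mapBifunctorGradedMap,
      ι_mapBifunctorGradedMap, Functor.map_add, Preadditive.add_comp]

lemma mapBifunctorMap_f_eq_gradedMap (φ : K₂ ⟶ L₂) (n : ℤ) :
    (HomologicalComplex.mapBifunctorMap (𝟙 K₁) φ F (.up ℤ)).f n =
      mapBifunctorGradedMap K₁ F φ.f n :=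
  HomologicalComplex.mapBifunctor.hom_ext fun p q h => by
    rw [HomologicalComplex.ι_mapBifunctorMap, HomologicalComplex.id_f,
      CategoryTheory.Functor.map_id]
    exact (Category.id_comp _).trans (ι_mapBifunctorGradedMap _ _ _ _ _ _ _).symm

end GradedMap

/-- The rows `K₁.X i ⊗ K₂` are contractible, but their contractions need not be compatible with the
differential of `K₁`. Assembled with the sign `(-1) ^ p` they give a degree `-1` map `s` for which
`ds + sd` is the identity plus a term raising `p` by one. Since `K₁` is bounded above, this
unitriangular map is invertible, and an isomorphism homotopic to zero forces contractibility. -/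
lemma nonempty_homotopy_mapBifunctor (b : ℤ) (hb : ∀ i, b < i → IsZero (K₁.X i))
    (hs : ∀ i, Homotopy (𝟙 (((F.obj (K₁.X i)).mapHomologicalComplex (.up ℤ)).obj K₂)) 0) :
    Nonempty (Homotopy (𝟙 (CochainComplex.mapBifunctor K₁ K₂ F)) 0) := by
  let T := CochainComplex.mapBifunctor K₁ K₂ F
  let σ (i j j' : ℤ) : (F.obj (K₁.X i)).obj (K₂.X j) ⟶ (F.obj (K₁.X i)).obj (K₂.X j') :=
    (hs i).hom j j'
  have hσ (i j₀ j j₁ : ℤ) (h₀ : j₀ + 1 = j) (h₁ : j + 1 = j₁) :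
      (F.obj (K₁.X i)).map (K₂.d j j₁) ≫ σ i j₁ j + σ i j j₀ ≫ (F.obj (K₁.X i)).map (K₂.d j₀ j) =
        𝟙 _ := by
    have h := (hs i).comm j
    rw [dNext_eq _ (show (ComplexShape.up ℤ).Rel j j₁ from h₁),
      prevD_eq _ (show (ComplexShape.up ℤ).Rel j₀ j from h₀)] at h
    simp only [HomologicalComplex.id_f, HomologicalComplex.zero_f, add_zero] at h
    exact h.symm
  let s (n n' : ℤ) (hn : n' + 1 = n) : T.X n ⟶ T.X n' :=
    HomologicalComplex.mapBifunctorDesc (fun p q h => p.negOnePow • (σ p q (q - 1) ≫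
      CochainComplex.ιMapBifunctor K₁ K₂ F p (q - 1) n' (by
        change p + q = n at h
        lia)))
  have hι (n n' : ℤ) (hn : n' + 1 = n) (p q q' : ℤ) (h : p + q = n) (hq : q' + 1 = q) :
      CochainComplex.ιMapBifunctor K₁ K₂ F p q n h ≫ s n n' hn =
        p.negOnePow • (σ p q q' ≫ CochainComplex.ιMapBifunctor K₁ K₂ F p q' n' (by lia)) := by
    obtain rfl : q' = q - 1 := by lia
    exact HomologicalComplex.ι_mapBifunctorDesc _ _ _ _
  let u : T ⟶ T := Homotopy.nullHomotopicMap' (fun n n' (hn : n' + 1 = n) => s n n' hn)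
  have hu (n : ℤ) : IsIso (u.f n) := by
    have huf : u.f n = T.d n (n + 1) ≫ s (n + 1) n rfl + s n (n - 1) (by lia) ≫ T.d (n - 1) n :=
      Homotopy.nullHomotopicMap'_f (show (n - 1) + 1 = n by lia) (show n + 1 = n + 1 from rfl) _
    refine isIso_of_unitriangular (fun p => (F.obj (K₁.X p)).obj (K₂.X (n - p)))
      (fun p => CochainComplex.ιMapBifunctor K₁ K₂ F p (n - p) n (by lia))
      (fun {W} f => ⟨HomologicalComplex.mapBifunctorDesc (fun p q h =>
        (F.obj (K₁.X p)).map (eqToHom (by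
          change p + q = n at h
          congr 1
          lia)) ≫ f p), fun i => ?_⟩)
      (fun f g hfg => HomologicalComplex.mapBifunctor.hom_ext fun p q h => ?_) b
      (fun p hp => by
        rw [IsZero.iff_id_eq_zero, ← NatTrans.id_app, ← CategoryTheory.Functor.map_id,
          (IsZero.iff_id_eq_zero _).1 (hb p hp), Functor.map_zero, zero_app]) _
      (fun p => (p + 1).negOnePow • ((F.map (K₁.d p (p + 1))).app (K₂.X (n - p)) ≫
          σ (p + 1) (n - p) (n - (p + 1))) +
        p.negOnePow • (σ p (n - p) (n - (p + 1)) ≫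
          (F.map (K₁.d p (p + 1))).app (K₂.X (n - (p + 1))))) (fun p => ?_)
    · refine (HomologicalComplex.ι_mapBifunctorDesc _ _ _ _).trans ?_
      simp
    · change p + q = n at h
      obtain rfl : q = n - p := by lia
      exact hfg p
    · rw [huf, Preadditive.comp_add, ← Category.assoc, ← Category.assoc,
        ιMapBifunctor_d K₁ K₂ F p (n - p) n _ (p + 1) (n - p + 1) (n + 1) rfl rfl rfl,
        hι n (n - 1) (by lia) p (n - p) (n - (p + 1)) (by lia) (by lia),
        Preadditive.add_comp, Linear.units_smul_comp, Linear.units_smul_comp, Category.assoc,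
        Category.assoc, Category.assoc,
        hι (n + 1) n rfl (p + 1) (n - p) (n - (p + 1)) (by lia) (by lia),
        hι (n + 1) n rfl p (n - p + 1) (n - p) (by lia) (by lia),
        ιMapBifunctor_d K₁ K₂ F p (n - (p + 1)) (n - 1) (by lia) (p + 1) (n - p) n rfl
          (by lia) (by lia)]
      -- The terms which stay in column `p` combine, with sign `(-1) ^ (p + p) = 1`, to the
      -- contraction identity of the row; the remaining ones land in column `p + 1`.
      have h := hσ p (n - (p + 1)) (n - p) (n - p + 1) (by lia) rfl
      simp only [Linear.comp_units_smul, Preadditive.comp_add, smul_add, smul_smul,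
        ← Int.negOnePow_add, Int.negOnePow_even _ (Even.add_self _), one_smul,
        Preadditive.add_comp, Linear.units_smul_comp, Category.assoc]
      have h' := congrArg (· ≫ CochainComplex.ιMapBifunctor K₁ K₂ F p (n - p) n (by lia)) h
      simp only [Preadditive.add_comp, Category.assoc, Category.id_comp] at h'
      refine Eq.trans ?_ (congrArg (· + _) h')
      abel
  have : ∀ n, IsIso (u.f n) := hu
  have : IsIso u := HomologicalComplex.Hom.isIso_of_components u
  refine ⟨Homotopy.trans (Homotopy.ofEq (IsIso.inv_hom_id u).symm) ?_⟩
  exact ((Homotopy.nullHomotopy' _).compLeft (inv u)).trans (Homotopy.ofEq comp_zero)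

end Contraction

/-! ## Quasi-isomorphisms and degreewise split sequences -/

section SplitExact

variable {C D : Type*} [Category* C] [Category* D] [Abelian C] [Abelian D]

lemma quasiIso_f_of_acyclic {S : ShortComplex (CochainComplex C ℤ)} (hS : S.ShortExact)
    (h : S.X₃.Acyclic) : QuasiIso S.f := by
  have hz (i : ℤ) : IsZero (S.X₃.homology i) := (h i).isZero_homology
  rw [quasiIso_iff]
  intro i
  rw [quasiIsoAt_iff_isIso_homologyMap]
  have : Epi (HomologicalComplex.homologyMap S.f i) :=
    (hS.homology_exact₂ i).epi_f ((hz i).eq_of_tgt _ _)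
  have : Mono (HomologicalComplex.homologyMap S.f i) :=
    (hS.homology_exact₁ (i - 1) i (show i - 1 + 1 = i by lia)).mono_g ((hz _).eq_of_src _ _)
  exact isIso_of_mono_of_epi _

lemma quasiIso_g_of_acyclic {S : ShortComplex (CochainComplex C ℤ)} (hS : S.ShortExact)
    (h : S.X₁.Acyclic) : QuasiIso S.g := by
  have hz (i : ℤ) : IsZero (S.X₁.homology i) := (h i).isZero_homology
  rw [quasiIso_iff]
  intro i
  rw [quasiIsoAt_iff_isIso_homologyMap]
  have : Mono (HomologicalComplex.homologyMap S.g i) :=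
    (hS.homology_exact₂ i).mono_g ((hz i).eq_of_src _ _)
  have : Epi (HomologicalComplex.homologyMap S.g i) :=
    (hS.homology_exact₃ i (i + 1) rfl).epi_f ((hz _).eq_of_tgt _ _)
  exact isIso_of_mono_of_epi _

lemma acyclic_of_homotopy {K : CochainComplex C ℤ} (h : Homotopy (𝟙 K) 0) : K.Acyclic := fun i => by
  rw [HomologicalComplex.exactAt_iff_isZero_homology, IsZero.iff_id_eq_zero,
    ← HomologicalComplex.homologyMap_id, h.homologyMap_eq i, HomologicalComplex.homologyMap_zero]

/-- A short complex of complexes which is split in each degree. -/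
def IsDegreewiseSplit (S : ShortComplex (CochainComplex C ℤ)) : Prop :=
  ∀ n, ∃ (r : S.X₂.X n ⟶ S.X₁.X n) (s : S.X₃.X n ⟶ S.X₂.X n),
    S.f.f n ≫ r = 𝟙 _ ∧ s ≫ S.g.f n = 𝟙 _ ∧ r ≫ S.f.f n + S.g.f n ≫ s = 𝟙 _

lemma IsDegreewiseSplit.shortExact {S : ShortComplex (CochainComplex C ℤ)}
    (h : IsDegreewiseSplit S) : S.ShortExact :=
  HomologicalComplex.shortExact_of_degreewise_shortExact S fun n => by
    obtain ⟨r, s, h₁, h₂, h₃⟩ := h n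
    exact ShortComplex.Splitting.shortExact
      { r := r, s := s, f_r := h₁, s_g := h₂, id := h₃ }

lemma isDegreewiseSplit_of_shortExact {S : ShortComplex (CochainComplex C ℤ)} (hS : S.ShortExact)
    (r : ∀ n, S.X₂.X n ⟶ S.X₁.X n) (hr : ∀ n, S.f.f n ≫ r n = 𝟙 _) :
    IsDegreewiseSplit S := fun n => by
  have hn := (HomologicalComplex.shortExact_iff_degreewise_shortExact _).1 hS n
  let σ := ShortComplex.Splitting.ofExactOfRetraction _ hn.exact (r n) (hr n) hn.epi_g
  exact ⟨σ.r, σ.s, σ.f_r, σ.s_g, σ.id⟩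

lemma isDegreewiseSplit_cokernel {K L : CochainComplex C ℤ} (f : K ⟶ L)
    (r : ∀ n, L.X n ⟶ K.X n) (hr : ∀ n, f.f n ≫ r n = 𝟙 _) :
    IsDegreewiseSplit (ShortComplex.mk f (cokernel.π f) (cokernel.condition f)) := by
  have hf (n : ℤ) : Mono (f.f n) := mono_of_mono_fac (hr n)
  have : Mono f := HomologicalComplex.mono_of_mono_f f hf
  exact isDegreewiseSplit_of_shortExact
    { exact := ShortComplex.exact_of_g_is_cokernel _ (cokernelIsCokernel f) } r hr

/-- An additive functor between categories of complexes which maps degreewise split sequences to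
exact sequences and acyclic complexes to acyclic complexes preserves quasi-isomorphisms. -/
lemma quasiIso_map_of_acyclic (Φ : CochainComplex C ℤ ⥤ CochainComplex D ℤ) [Φ.Additive]
    (hΦ : ∀ S : ShortComplex (CochainComplex C ℤ), IsDegreewiseSplit S → (S.map Φ).ShortExact)
    (hac : ∀ K : CochainComplex C ℤ, K.Acyclic → (Φ.obj K).Acyclic)
    {K L : CochainComplex C ℤ} (f : K ⟶ L) [QuasiIso f] : QuasiIso (Φ.map f) := by
  let E := CochainComplex.mappingCone (𝟙 K)
  have hE : E.Acyclic := acyclic_of_homotopy (CochainComplex.mappingCone.homotopyToZeroOfId K)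
  -- Up to the contractible summand `E`, `f` is a degreewise split monomorphism: `f` is `g` followed
  -- by the projection. The kernel of the projection is contractible and the cokernel of `g` is
  -- acyclic, so the hypotheses on `Φ` apply to both factors.
  let g : K ⟶ L ⊞ E := biprod.lift f (CochainComplex.mappingCone.inr (𝟙 K))
  have hfst : IsDegreewiseSplit
      (ShortComplex.mk (biprod.inr : E ⟶ L ⊞ E) biprod.fst (by simp)) := fun n =>
    ⟨(biprod.snd : L ⊞ E ⟶ E).f n, (biprod.inl : L ⟶ L ⊞ E).f n,
      HomologicalComplex.biprod_inr_snd_f _ _ n, HomologicalComplex.biprod_inl_fst_f _ _ n,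
      (add_comm _ _).trans (HomologicalComplex.biprod_total_f _ _ n)⟩
  have hg := isDegreewiseSplit_cokernel g (fun n => (biprod.snd : L ⊞ E ⟶ E).f n ≫
    (CochainComplex.mappingCone.snd (𝟙 K)).v n n (add_zero n)) (fun n => by
      rw [← Category.assoc, ← HomologicalComplex.comp_f, biprod.lift_snd,
        CochainComplex.mappingCone.inr_f_snd_v])
  have : QuasiIso (biprod.fst : L ⊞ E ⟶ L) := quasiIso_g_of_acyclic hfst.shortExact hE
  have hgf : g ≫ biprod.fst = f := biprod.lift_fst _ _
  have : QuasiIso g := by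
    have : QuasiIso (g ≫ (biprod.fst : L ⊞ E ⟶ L)) := by rwa [hgf]
    exact quasiIso_of_comp_right g biprod.fst
  have h₁ : QuasiIso (Φ.map (biprod.fst : L ⊞ E ⟶ L)) :=
    quasiIso_g_of_acyclic (hΦ _ hfst) (hac _ hE)
  have h₂ : QuasiIso (Φ.map g) :=
    quasiIso_f_of_acyclic (hΦ _ hg)
      (hac _ (hg.shortExact.acyclic_X₃ this))
  rw [← hgf, Φ.map_comp]
  infer_instance

variable {C₁ C₂ : Type*} [Category* C₁] [Category* C₂] [Abelian C₁] [Abelian C₂]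

lemma isDegreewiseSplit_mapBifunctor (F : C₁ ⥤ C₂ ⥤ D) [F.Additive]
    [∀ X, (F.obj X).Additive] [∀ K₁ K₂, CochainComplex.HasMapBifunctor K₁ K₂ F]
    (K₁ : CochainComplex C₁ ℤ) (S : ShortComplex (CochainComplex C₂ ℤ))
    (hS : IsDegreewiseSplit S) [(F.map₂CochainComplex.obj K₁).PreservesZeroMorphisms] :
    IsDegreewiseSplit (S.map (F.map₂CochainComplex.obj K₁)) := fun n => by
  choose r s h₁ h₂ h₃ using hS
  refine ⟨mapBifunctorGradedMap K₁ F r n, mapBifunctorGradedMap K₁ F s n, ?_, ?_, ?_⟩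
  · refine (congrArg (· ≫ mapBifunctorGradedMap K₁ F r n)
      (mapBifunctorMap_f_eq_gradedMap K₁ F S.f n)).trans ?_
    refine (mapBifunctorGradedMap_comp K₁ F S.f.f r n).trans ?_
    exact (congrArg (fun φ => mapBifunctorGradedMap K₁ F φ n) (funext h₁)).trans
      (mapBifunctorGradedMap_id (K₂ := S.X₁) K₁ F n)
  · refine (congrArg (mapBifunctorGradedMap K₁ F s n ≫ ·)
      (mapBifunctorMap_f_eq_gradedMap K₁ F S.g n)).trans ?_
    refine (mapBifunctorGradedMap_comp K₁ F s S.g.f n).trans ?_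
    exact (congrArg (fun φ => mapBifunctorGradedMap K₁ F φ n) (funext h₂)).trans
      (mapBifunctorGradedMap_id (K₂ := S.X₃) K₁ F n)
  · refine (congrArg₂ (fun φ ψ => mapBifunctorGradedMap K₁ F r n ≫ φ +
      ψ ≫ mapBifunctorGradedMap K₁ F s n) (mapBifunctorMap_f_eq_gradedMap K₁ F S.f n)
      (mapBifunctorMap_f_eq_gradedMap K₁ F S.g n)).trans ?_
    refine (congrArg₂ (· + ·) (mapBifunctorGradedMap_comp K₁ F r S.f.f n)
      (mapBifunctorGradedMap_comp K₁ F S.g.f s n)).trans ?_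
    refine (mapBifunctorGradedMap_add K₁ F _ _ n).symm.trans ?_
    exact (congrArg (fun φ => mapBifunctorGradedMap K₁ F φ n) (funext h₃)).trans
      (mapBifunctorGradedMap_id (K₂ := S.X₂) K₁ F n)

instance (F : C₁ ⥤ C₂ ⥤ D) [F.Additive]
    [∀ X, (F.obj X).Additive] [∀ K₁ K₂, CochainComplex.HasMapBifunctor K₁ K₂ F]
    (K₁ : CochainComplex C₁ ℤ) : (F.map₂CochainComplex.obj K₁).Additive where
  map_add {K L f g} := by
    ext n : 1
    refine (mapBifunctorMap_f_eq_gradedMap K₁ F (f + g) n).trans ?_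
    refine (mapBifunctorGradedMap_add K₁ F f.f g.f n).trans ?_
    exact (congrArg₂ (· + ·) (mapBifunctorMap_f_eq_gradedMap K₁ F f n)
      (mapBifunctorMap_f_eq_gradedMap K₁ F g n)).symm

lemma mapBifunctorGradedMap_smul {k : Type*} [Semiring k] [Linear k C₂] [Linear k D]
    (F : C₁ ⥤ C₂ ⥤ D) [F.Additive]
    [∀ X, (F.obj X).Additive] [∀ X, (F.obj X).Linear k]
    [∀ K₁ K₂, CochainComplex.HasMapBifunctor K₁ K₂ F]
    (K₁ : CochainComplex C₁ ℤ) {K₂ L₂ : CochainComplex C₂ ℤ} (r : k)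
    (φ : ∀ q, K₂.X q ⟶ L₂.X q) (n : ℤ) :
    mapBifunctorGradedMap K₁ F (fun q => r • φ q) n = r • mapBifunctorGradedMap K₁ F φ n :=
  HomologicalComplex.mapBifunctor.hom_ext fun p q h => by
    rw [Linear.comp_smul, ι_mapBifunctorGradedMap, ι_mapBifunctorGradedMap,
      Functor.map_smul, Linear.smul_comp]

instance {k : Type*} [Semiring k] [Linear k C₂] [Linear k D] (F : C₁ ⥤ C₂ ⥤ D) [F.Additive]
    [∀ X, (F.obj X).Additive] [∀ X, (F.obj X).Linear k]
    [∀ K₁ K₂, CochainComplex.HasMapBifunctor K₁ K₂ F]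
    (K₁ : CochainComplex C₁ ℤ) : (F.map₂CochainComplex.obj K₁).Linear k where
  map_smul {K L} f r := by
    ext n : 1
    refine (mapBifunctorMap_f_eq_gradedMap K₁ F (r • f) n).trans ?_
    refine (mapBifunctorGradedMap_smul F K₁ r f.f n).trans ?_
    exact (congrArg (r • ·) (mapBifunctorMap_f_eq_gradedMap K₁ F f n)).symm

end SplitExact

/-! ## Contracting complexes over a field -/

section FieldContraction

variable {k : Type u} [Field k]

/-- Choose a section of `d` onto its range and extend it to all of `W`; both exist for vector
spaces. -/
lemma exists_generalized_inverse {V W : Type*} [AddCommGroup V] [Module k V] [AddCommGroup W]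
    [Module k W] (d : V →ₗ[k] W) : ∃ g : W →ₗ[k] V, ∀ x, d (g (d x)) = d x := by
  obtain ⟨s, hs⟩ := d.rangeRestrict.exists_rightInverse_of_surjective d.range_rangeRestrict
  obtain ⟨g, hg⟩ := LinearMap.exists_extend s
  refine ⟨g, fun x => ?_⟩
  have h₁ : g (d x) = s (d.rangeRestrict x) := LinearMap.congr_fun hg (d.rangeRestrict x)
  rw [h₁]
  exact congrArg Subtype.val (LinearMap.congr_fun hs (d.rangeRestrict x))

lemma nonempty_homotopy_of_acyclic (K : CochainComplex (ModuleCat.{u} k) ℤ) (hK : K.Acyclic) :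
    Nonempty (Homotopy (𝟙 K) 0) := by
  have h (n n' : ℤ) : ∃ g : K.X n' ⟶ K.X n, K.d n n' ≫ g ≫ K.d n n' = K.d n n' := by
    obtain ⟨g, hg⟩ := exists_generalized_inverse (k := k) (K.d n n').hom
    exact ⟨ModuleCat.ofHom g, ModuleCat.hom_ext (LinearMap.ext hg)⟩
  choose g hg using h
  -- With `d g d = d`, the map `1 - g d` is a projection to the cycles. By acyclicity these are
  -- boundaries, on which `d g` is the identity. Hence `d s = 1 - g d`, while `s d = g d`, and the
  -- sum is the identity.
  let s (n n' : ℤ) (_ : (ComplexShape.up ℤ).Rel n' n) : K.X n ⟶ K.X n' :=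
    (𝟙 _ - K.d n (n + 1) ≫ g n (n + 1)) ≫ g n' n
  have hs (n : ℤ) : (Homotopy.nullHomotopicMap' s).f n =
      𝟙 (K.X n) := by
    rw [Homotopy.nullHomotopicMap'_f (c := .up ℤ) (show (n - 1) + 1 = n by lia)
      (show n + 1 = n + 1 from rfl)]
    have h₁ : K.d n (n + 1) ≫ s (n + 1) n rfl = K.d n (n + 1) ≫ g n (n + 1) := by
      simp [s]
    have h₂ : (𝟙 _ - K.d n (n + 1) ≫ g n (n + 1)) ≫ g (n - 1) n ≫ K.d (n - 1) n =
        𝟙 _ - K.d n (n + 1) ≫ g n (n + 1) := by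
      have hex : (K.sc' (n - 1) n (n + 1)).Exact :=
        (K.exactAt_iff' (n - 1) n (n + 1) (by simp) (by simp)).1 (hK n)
      ext x
      have hx : K.d n (n + 1) ((𝟙 (K.X n) - K.d n (n + 1) ≫ g n (n + 1)).hom x) = 0 := by
        have := hg n (n + 1)
        rw [← sub_eq_zero] at this
        have h0 : (𝟙 (K.X n) - K.d n (n + 1) ≫ g n (n + 1)) ≫ K.d n (n + 1) = 0 := by
          rw [Preadditive.sub_comp, Category.id_comp, Category.assoc, hg, sub_self]
        exact LinearMap.congr_fun (congrArg ModuleCat.Hom.hom h0) x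
      obtain ⟨y, hy⟩ := (ShortComplex.moduleCat_exact_iff _).1 hex _ hx
      change (K.d (n - 1) n).hom y = _ at hy
      have := LinearMap.congr_fun (congrArg ModuleCat.Hom.hom (hg (n - 1) n)) y
      rw [ModuleCat.hom_comp, LinearMap.comp_apply, ← hy]
      exact this
    rw [h₁, Category.assoc, h₂, add_sub_cancel]
  refine ⟨Homotopy.trans (Homotopy.ofEq ?_) (Homotopy.nullHomotopy' s)⟩
  ext1 n
  exact (hs n).symm

end FieldContraction

/-! ## Tensor products with projective bimodules -/

section ProjectiveBimodules

open scoped ModuleCat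

variable {k : Type u} [Field k] {Λ : Type u} [Ring Λ] [Algebra k Λ]

variable (k Λ) in
/-- The functor sending a `Λ`-module to the underlying vector space over `k`. -/
noncomputable def toVect : ModuleCat.{u} Λ ⥤ ModuleCat.{u} k where
  obj M := ModuleCat.of k M
  map f := ModuleCat.ofHom (f.hom.restrictScalars k)

instance : (toVect k Λ).Additive where

variable (k Λ) in
/-- The functor `toVect` does not change the underlying abelian group. -/
noncomputable def toVectForgetIso : toVect k Λ ⋙ forget₂ (ModuleCat.{u} k) AddCommGrpCat ≅
    forget₂ (ModuleCat.{u} Λ) AddCommGrpCat :=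
  Iso.refl _

instance : PreservesFiniteLimits (toVect k Λ) := by
  have : PreservesFiniteLimits (toVect k Λ ⋙ forget₂ (ModuleCat.{u} k) AddCommGrpCat) :=
    preservesFiniteLimits_of_natIso (toVectForgetIso k Λ).symm
  exact ⟨fun J _ _ => preservesLimitsOfShape_of_reflects_of_preserves _
    (forget₂ (ModuleCat.{u} k) AddCommGrpCat)⟩

instance : PreservesFiniteColimits (toVect k Λ) := by
  have : PreservesFiniteColimits (toVect k Λ ⋙ forget₂ (ModuleCat.{u} k) AddCommGrpCat) :=
    preservesFiniteColimits_of_natIso (toVectForgetIso k Λ).symm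
  exact ⟨fun J _ _ => preservesColimitsOfShape_of_reflects_of_preserves _
    (forget₂ (ModuleCat.{u} k) AddCommGrpCat)⟩

/-- The functor `V ↦ N ⊗_k V` from vector spaces to left modules, for a bimodule `N`. -/
noncomputable def tensorVect (N : BimoduleCat k Λ) : ModuleCat.{u} k ⥤ ModuleCat.{u} Λ where
  obj V := ModuleCat.of Λ (N ⊗[k] V)
  map f := ModuleCat.ofHom (TensorProduct.AlgebraTensorModule.lTensor Λ N f.hom)
  map_id V := by
    ext : 1
    exact TensorProduct.AlgebraTensorModule.lTensor_id
  map_comp f g := by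
    ext : 1
    exact TensorProduct.AlgebraTensorModule.lTensor_comp _ _

instance (N : BimoduleCat k Λ) : (tensorVect N).Additive where
  map_add {V W f g} := by
    ext : 1
    exact LinearMap.ext fun t => LinearMap.congr_fun (LinearMap.lTensor_add N f.hom g.hom) t

/-- The pure tensor in `N ⊗_k M`. -/
noncomputable def vectTmul {N : BimoduleCat k Λ} {M : ModuleCat.{u} Λ} (x : N) (m : M) :
    (toVect k Λ ⋙ tensorVect N).obj M := x ⊗ₜ[k] m

lemma vectTmul_add {N : BimoduleCat k Λ} {M : ModuleCat.{u} Λ} (x : N) (m m' : M) :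
    vectTmul x (m + m') = vectTmul x m + vectTmul x m' := TensorProduct.tmul_add _ _ _

lemma add_vectTmul {N : BimoduleCat k Λ} {M : ModuleCat.{u} Λ} (x x' : N) (m : M) :
    vectTmul (x + x') m = vectTmul x m + vectTmul x' m := TensorProduct.add_tmul _ _ _

lemma smul_vectTmul {N : BimoduleCat k Λ} {M : ModuleCat.{u} Λ} (a : Λ) (x : N) (m : M) :
    vectTmul (a • x) m = a • vectTmul x m := rfl

lemma smul_vectTmul_base {N : BimoduleCat k Λ} {M : ModuleCat.{u} Λ} (r : k) (x : N) (m : M) :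
    vectTmul (r • x) m = vectTmul x (r • m) :=
  TensorProduct.smul_tmul (R := k) (R' := k) (M := N) (N := M) r x m

lemma vectTmul_hom_ext {N : BimoduleCat k Λ} {M W : ModuleCat.{u} Λ}
    {f g : (toVect k Λ ⋙ tensorVect N).obj M ⟶ W}
    (h : ∀ (x : N) (m : M), f.hom (vectTmul x m) = g.hom (vectTmul x m)) : f = g := by
  refine ModuleCat.hom_ext (LinearMap.ext fun t => ?_)
  change N ⊗[k] M at t
  induction t with
  | zero => exact (map_zero f.hom).trans (map_zero g.hom).symm
  | add x y hx hy =>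
    exact (map_add f.hom _ _).trans ((congrArg₂ (· + ·) hx hy).trans (map_add g.hom _ _).symm)
  | tmul x m => exact h x m

/-- The projection `N ⊗_k M ⟶ N ⊗_Λ M`. -/
noncomputable def tensorVectProj (N : BimoduleCat k Λ) :
    toVect k Λ ⋙ tensorVect N ⟶ (tensorModBifunctor k Λ).obj N where
  app M := ModuleCat.ofHom (X := (toVect k Λ ⋙ tensorVect N).obj M)
    (Y := ((tensorModBifunctor k Λ).obj N).obj M) (tensorMod.proj N M)
  naturality _ _ f := vectTmul_hom_ext fun x m => (tensorModBifunctor_obj_map_tmul N f x m).symm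

/-- A biadditive map. -/
def biAddMk {X Y Z : Type*} [AddCommGroup X] [AddCommGroup Y] [AddCommGroup Z] (f : X → Y → Z)
    (hl : ∀ x x' y, f (x + x') y = f x y + f x' y)
    (hr : ∀ x y y', f x (y + y') = f x y + f x y') : X →+ Y →+ Z :=
  AddMonoidHom.mk' (fun x => AddMonoidHom.mk' (f x) (hr x))
    (fun x x' => AddMonoidHom.ext (hl x x'))

lemma biAddMk_apply {X Y Z : Type*} [AddCommGroup X] [AddCommGroup Y] [AddCommGroup Z]
    (f : X → Y → Z) (hl : ∀ x x' y, f (x + x') y = f x y + f x' y)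
    (hr : ∀ x y y', f x (y + y') = f x y + f x y') (x : X) (y : Y) :
    biAddMk f hl hr x y = f x y := rfl

variable (k) in
/-- The bimodule `N ⊗_k Λ`. -/
noncomputable def outerRegular (N : BimoduleCat k Λ) : BimoduleCat k Λ :=
  ModuleCat.of (Λ ⊗[k] Λᵐᵒᵖ) (OuterTensor k N (regularBimod k Λ))

/-- The pure tensor in `N ⊗_k Λ`. -/
noncomputable def outerRegularTmul {N : BimoduleCat k Λ} (x : N) (a : regularBimod k Λ) :
    outerRegular k N := OuterTensor.tmul x a

lemma outerRegular_induction {N : BimoduleCat k Λ} {p : outerRegular k N → Prop}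
    (t : outerRegular k N) (h0 : p 0) (ht : ∀ x a, p (outerRegularTmul x a))
    (ha : ∀ s t, p s → p t → p (s + t)) : p t := by
  change N ⊗[k] regularBimod k Λ at t
  induction t with
  | zero => exact h0
  | add x y hx hy => exact ha _ _ hx hy
  | tmul x m => exact ht x m

/-- The multiplication `N ⊗_k Λ ⟶ N` for a bimodule `N`. -/
noncomputable def outerMul (N : BimoduleCat k Λ) : outerRegular k N ⟶ N :=
  ModuleCat.ofHom (X := outerRegular k N) (outerLift
    (biAddMk (fun (x : N) a => rightMul N (regularBimodEquiv k Λ a) x)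
      (fun x y a => map_add _ _ _)
      (fun x a b => by rw [map_add, rightMul_add, LinearMap.add_apply]))
    (fun r x a => by
      rw [biAddMk_apply, biAddMk_apply, regularBimodEquiv_base, Algebra.smul_def, rightMul_mul,
        LinearMap.comp_apply, rightMul_base])
    (fun a x b => (rightMul N _).map_smul a x)
    (fun x a b => by
      rw [biAddMk_apply, biAddMk_apply, regularBimodEquiv_rightMul, rightMul_mul,
        LinearMap.comp_apply]))

lemma outerMul_tmul (N : BimoduleCat k Λ) (x : N) (a : regularBimod k Λ) :
    (outerMul N).hom (outerRegularTmul x a) = rightMul N (regularBimodEquiv k Λ a) x := rfl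

lemma outerMul_surjective (N : BimoduleCat k Λ) : Function.Surjective (outerMul N).hom :=
  fun x => ⟨outerRegularTmul x ((regularBimodEquiv k Λ).symm 1), by
    rw [outerMul_tmul, AddEquiv.apply_symm_apply, rightMul_one, LinearMap.id_apply]⟩

/-- The map `m ↦ x ⊗ m` as an element of a bimodule. -/
noncomputable def vectMk {N : BimoduleCat k Λ} (M : ModuleCat.{u} Λ) (x : N) :
    homBimod k M ((toVect k Λ ⋙ tensorVect N).obj M) :=
  (homBimodEval k M _).symm
    { toFun := fun m => vectTmul x m
      map_add' := vectTmul_add x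
      map_smul' := fun r m => by
        rw [← smul_vectTmul_base, ← algebraMap_smul Λ r x, smul_vectTmul, algebraMap_smul,
          RingHom.id_apply] }

lemma vectMk_apply {N : BimoduleCat k Λ} {M : ModuleCat.{u} Λ} (x : N) (m : M) :
    homBimodEval k M _ (vectMk M x) m = vectTmul x m := rfl

/-- The bilinear map underlying `outerRegularTensor`. -/
noncomputable def outerRegularBilin (N : BimoduleCat k Λ) (M : ModuleCat.{u} Λ) :
    N →+ regularBimod k Λ →+ homBimod k M ((toVect k Λ ⋙ tensorVect N).obj M) :=
  biAddMk (fun (x : N) a => rightMul _ (regularBimodEquiv k Λ a) (vectMk M x))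
    (fun x y a => by
      rw [← map_add]
      exact congrArg _ (homBimod_ext fun m => add_vectTmul x y m))
    (fun x a b => by rw [map_add, rightMul_add, LinearMap.add_apply])

lemma outerRegularBilin_apply (N : BimoduleCat k Λ) (M : ModuleCat.{u} Λ) (x : N)
    (a : regularBimod k Λ) (m : M) :
    homBimodEval k M _ (outerRegularBilin N M x a) m =
      vectTmul x (regularBimodEquiv k Λ a • m) := by
  rw [outerRegularBilin, biAddMk_apply, homBimodEval_rightMul, vectMk_apply]

/-- The map `(N ⊗_k Λ) ⊗_Λ M ⟶ N ⊗_k M`. -/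
noncomputable def outerRegularTensor (N : BimoduleCat k Λ) (M : ModuleCat.{u} Λ) :
    tensorMod (outerRegular k N) M ⟶ (toVect k Λ ⋙ tensorVect N).obj M :=
  tensorModUncurry' (ModuleCat.ofHom (X := outerRegular k N) (Y := homBimod k M _)
    (outerLift (outerRegularBilin N M)
    (fun r x a => homBimod_ext fun m => by
      rw [outerRegularBilin_apply, outerRegularBilin_apply, smul_vectTmul_base,
        regularBimodEquiv_base, smul_assoc])
    (fun a x b => homBimod_ext fun m => by
      rw [outerRegularBilin_apply, homBimodEval_smul, outerRegularBilin_apply, smul_vectTmul])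
    (fun x a b => homBimod_ext fun m => by
      rw [outerRegularBilin_apply, homBimodEval_rightMul, outerRegularBilin_apply,
        regularBimodEquiv_rightMul, mul_smul])))

lemma outerRegularTensor_tmul (N : BimoduleCat k Λ) (M : ModuleCat.{u} Λ) (x : N)
    (a : regularBimod k Λ) (m : M) :
    (outerRegularTensor N M).hom (tensorMod.tmul (outerRegularTmul x a) m) =
      vectTmul x (regularBimodEquiv k Λ a • m) :=
  (tensorModUncurry'_tmul _ _ _).trans (outerRegularBilin_apply N M x a m)

lemma tensorMod_outerRegular_hom_ext {N : BimoduleCat k Λ} {M W : ModuleCat.{u} Λ}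
    {f g : tensorMod (outerRegular k N) M ⟶ W}
    (h : ∀ (x : N) (a : regularBimod k Λ) (m : M),
      f.hom (tensorMod.tmul (outerRegularTmul x a) m) =
      g.hom (tensorMod.tmul (outerRegularTmul x a) m)) : f = g :=
  tensorMod.hom_ext fun t m => by
    induction t using outerRegular_induction with
    | h0 =>
      have h0 : tensorMod.tmul (0 : outerRegular k N) m = 0 :=
        LinearMap.congr_fun (map_zero (tensorMod.mk (outerRegular k N) M)) m
      rw [h0, map_zero, map_zero]
    | ht x y => exact h x y m
    | ha s t hs ht => rw [tensorMod.add_tmul, map_add, map_add, hs, ht]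

lemma outerRegularTensor_naturality (N : BimoduleCat k Λ) {M M' : ModuleCat.{u} Λ} (f : M ⟶ M') :
    ((tensorModBifunctor k Λ).obj (outerRegular k N)).map f ≫ outerRegularTensor N M' =
      outerRegularTensor N M ≫ (toVect k Λ ⋙ tensorVect N).map f :=
  tensorMod_outerRegular_hom_ext fun x a m => by
    refine (congrArg (outerRegularTensor N M').hom
      (tensorModBifunctor_obj_map_tmul (outerRegular k N) f (outerRegularTmul x a) m)).trans ?_
    refine (outerRegularTensor_tmul N M' x a (f.hom m)).trans ?_
    refine Eq.trans ?_ (congrArg ((toVect k Λ ⋙ tensorVect N).map f).hom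
      (outerRegularTensor_tmul N M x a m).symm)
    exact congrArg (fun z : M' => vectTmul x z) (f.hom.map_smul _ m).symm

lemma outerRegularTensor_proj (N : BimoduleCat k Λ) (M : ModuleCat.{u} Λ) :
    outerRegularTensor N M ≫ (tensorVectProj N).app M =
      ((tensorModBifunctor k Λ).map (outerMul N)).app M :=
  tensorMod_outerRegular_hom_ext fun x a m => by
    refine (congrArg ((tensorVectProj N).app M).hom (outerRegularTensor_tmul N M x a m)).trans ?_
    refine Eq.trans ?_ (tensorModBifunctor_map_tmul (outerMul N) M _ m).symm
    exact (tensorMod.tmul_smul _ x m).trans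
      (congrArg (fun z => tensorMod.tmul z m) (outerMul_tmul N x a).symm)

/-- For a projective bimodule `N`, the functor `N ⊗_Λ -` is a direct summand of `N ⊗_k -`. -/
lemma exists_section_tensorVectProj (N : BimoduleCat k Λ) [Projective N] :
    ∃ σ : (tensorModBifunctor k Λ).obj N ⟶ toVect k Λ ⋙ tensorVect N,
      σ ≫ tensorVectProj N = 𝟙 _ := by
  have : Epi (outerMul N) := (ModuleCat.epi_iff_surjective _).2 (outerMul_surjective N)
  -- Projectivity splits the multiplication `N ⊗_k Λ ⟶ N` as a map of bimodules; tensoring the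
  -- splitting with `M` turns `N ⊗_k Λ ⊗_Λ M` into `N ⊗_k M`.
  let s : N ⟶ outerRegular k N := Projective.factorThru (𝟙 N) (outerMul N)
  have hs : s ≫ outerMul N = 𝟙 N := Projective.factorThru_comp _ _
  refine ⟨{ app := fun M => ((tensorModBifunctor k Λ).map s).app M ≫ outerRegularTensor N M
            naturality := fun _ _ f => ?_ }, ?_⟩
  · refine (Category.assoc _ _ _).symm.trans ?_
    refine (congrArg (· ≫ outerRegularTensor N _)
      (((tensorModBifunctor k Λ).map s).naturality f)).trans ?_
    refine (Category.assoc _ _ _).trans ?_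
    exact (congrArg (((tensorModBifunctor k Λ).map s).app _ ≫ ·)
      (outerRegularTensor_naturality N f)).trans (Category.assoc _ _ _).symm
  · ext M : 2
    refine (Category.assoc (((tensorModBifunctor k Λ).map s).app M) (outerRegularTensor N M)
      ((tensorVectProj N).app M)).trans ?_
    refine (congrArg (((tensorModBifunctor k Λ).map s).app M ≫ ·)
      (outerRegularTensor_proj N M)).trans ?_
    rw [← NatTrans.comp_app, ← Functor.map_comp, hs, CategoryTheory.Functor.map_id]

/-- The functor `N ⊗_Λ -` is a direct summand of `N ⊗_k -`, which sees only the complex of vector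
spaces underlying `M`. An acyclic complex of vector spaces is contractible, and contractions pass to
direct summands. -/
lemma nonempty_homotopy_tensorMod (N : BimoduleCat k Λ) [Projective N]
    (M : CochainComplex (ModuleCat.{u} Λ) ℤ) (hM : M.Acyclic) :
    Nonempty (Homotopy
      (𝟙 ((((tensorModBifunctor k Λ).obj N).mapHomologicalComplex (.up ℤ)).obj M)) 0) := by
  obtain ⟨σ, hσ⟩ := exists_section_tensorVectProj N
  have hV : (((toVect k Λ).mapHomologicalComplex (.up ℤ)).obj M).Acyclic := fun i =>
    (hM i).map (toVect k Λ)
  obtain ⟨h⟩ := nonempty_homotopy_of_acyclic _ hV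
  let h' := (tensorVect N).mapHomotopy h
  let σ' : _ ⟶ ((tensorVect N).mapHomologicalComplex (.up ℤ)).obj
    (((toVect k Λ).mapHomologicalComplex (.up ℤ)).obj M) :=
      (NatTrans.mapHomologicalComplex σ (.up ℤ)).app M
  let π' : ((tensorVect N).mapHomologicalComplex (.up ℤ)).obj
    (((toVect k Λ).mapHomologicalComplex (.up ℤ)).obj M) ⟶ _ :=
      (NatTrans.mapHomologicalComplex (tensorVectProj N) (.up ℤ)).app M
  have hσ' : σ' ≫ π' = 𝟙 _ := by
    ext1 n
    exact congrArg (fun τ => NatTrans.app τ (M.X n)) hσ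
  refine ⟨Homotopy.trans (Homotopy.ofEq ?_) (((h'.compRight π').compLeft σ').trans
    (Homotopy.ofEq (by
      rw [Functor.map_zero, zero_comp, comp_zero])))⟩
  rw [CategoryTheory.Functor.map_id]
  exact hσ'.symm.trans (congrArg (σ' ≫ ·) (Category.id_comp π').symm)

end ProjectiveBimodules

/-! ## Functors between derived categories -/

section DerivedLift

open Pretriangulated

variable {C D : Type*} [Category* C] [Category* D] [Abelian C] [Abelian D]

/-- A functor between categories of complexes which preserves quasi-isomorphisms. -/
class PreservesQuasiIso (Φ : CochainComplex C ℤ ⥤ CochainComplex D ℤ) : Prop where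
  quasiIso_map {K L : CochainComplex C ℤ} (f : K ⟶ L) [QuasiIso f] : QuasiIso (Φ.map f)

lemma isDegreewiseSplit_triangleRotateShortComplex {K L : CochainComplex C ℤ} (f : K ⟶ L) :
    IsDegreewiseSplit (CochainComplex.mappingCone.triangleRotateShortComplex f) := fun n =>
  let σ := CochainComplex.mappingCone.triangleRotateShortComplexSplitting f n
  ⟨σ.r, σ.s, σ.f_r, σ.s_g, σ.id⟩

lemma IsDegreewiseSplit.map_comp {E : Type*} [Category* E] [Abelian E]
    (F : CochainComplex C ℤ ⥤ CochainComplex D ℤ) (G : CochainComplex D ℤ ⥤ CochainComplex E ℤ)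
    [F.PreservesZeroMorphisms] [G.PreservesZeroMorphisms]
    (hF : ∀ S : ShortComplex (CochainComplex C ℤ), IsDegreewiseSplit S → IsDegreewiseSplit
      (S.map F))
    (hG : ∀ S : ShortComplex (CochainComplex D ℤ), IsDegreewiseSplit S → IsDegreewiseSplit
      (S.map G))
    (S : ShortComplex (CochainComplex C ℤ)) (hS : IsDegreewiseSplit S) :
    IsDegreewiseSplit (S.map (F ⋙ G)) :=
  hG (S.map F) (hF S hS)

variable [HasDerivedCategory D]

lemma isInvertedBy_quasiIso (Φ : CochainComplex C ℤ ⥤ CochainComplex D ℤ) [PreservesQuasiIso Φ] :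
    (HomologicalComplex.quasiIso C (.up ℤ)).IsInvertedBy (Φ ⋙ DerivedCategory.Q) := fun _ _ f hf =>
      by
  have : QuasiIso f := hf
  have := PreservesQuasiIso.quasiIso_map (Φ := Φ) f
  exact inferInstanceAs (IsIso (DerivedCategory.Q.map (Φ.map f)))
variable [HasDerivedCategory C]

variable (Φ Ψ Θ : CochainComplex C ℤ ⥤ CochainComplex D ℤ)
  [PreservesQuasiIso Φ] [PreservesQuasiIso Ψ] [PreservesQuasiIso Θ]

/-- The functor between derived categories induced by a functor `Φ` on complexes which preserves
quasi-isomorphisms. -/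
noncomputable def derivedLift : DerivedCategory C ⥤ DerivedCategory D :=
  Localization.lift _ (isInvertedBy_quasiIso Φ) DerivedCategory.Q

/-- `derivedLift Φ` is computed by `Φ`. -/
noncomputable def derivedLiftFac :
    DerivedCategory.Q ⋙ derivedLift Φ ≅ Φ ⋙ DerivedCategory.Q :=
  Localization.fac _ (isInvertedBy_quasiIso Φ) DerivedCategory.Q

noncomputable instance : Localization.Lifting DerivedCategory.Q
    (HomologicalComplex.quasiIso C (.up ℤ)) (Φ ⋙ DerivedCategory.Q) (derivedLift Φ) :=
  ⟨derivedLiftFac Φ⟩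

noncomputable instance [Φ.CommShift ℤ] : (derivedLift Φ).CommShift ℤ :=
  Functor.commShiftOfLocalization DerivedCategory.Q (HomologicalComplex.quasiIso C (.up ℤ)) ℤ
    (Φ ⋙ DerivedCategory.Q) (derivedLift Φ)

instance [Φ.CommShift ℤ] : NatTrans.CommShift (derivedLiftFac Φ).hom ℤ :=
  NatTrans.commShift_iso_hom_of_localization DerivedCategory.Q
    (HomologicalComplex.quasiIso C (.up ℤ)) ℤ (Φ ⋙ DerivedCategory.Q) (derivedLift Φ)

/-- Additivity descends in two steps: first along the full and essentially surjective functor to the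
homotopy category, then along the localization `Qh`. -/
instance [Φ.Additive] : (derivedLift Φ).Additive := by
  have h : (DerivedCategory.Q ⋙ derivedLift Φ).Additive :=
    Functor.additive_of_iso (derivedLiftFac Φ).symm
  have h' : (HomotopyCategory.quotient C (.up ℤ) ⋙ DerivedCategory.Qh ⋙ derivedLift Φ).Additive :=
    Functor.additive_of_iso (Functor.isoWhiskerRight (DerivedCategory.quotientCompQhIso C).symm
      (derivedLift Φ) ≪≫ Functor.associator _ _ _)
  have : (DerivedCategory.Qh ⋙ derivedLift Φ).Additive :=
    Functor.additive_of_full_essSurj_comp (HomotopyCategory.quotient C (.up ℤ)) _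
  exact (Localization.functor_additive_iff DerivedCategory.Qh
    (HomotopyCategory.subcategoryAcyclic C).trW (derivedLift Φ)).2 this

instance {k : Type*} [Ring k] [Linear k C] [Linear k D] [Φ.Linear k] :
    (derivedLift Φ).Linear k :=
  (Localization.functor_linear_iff DerivedCategory.Q (HomologicalComplex.quasiIso C (.up ℤ)) k
    (Φ ⋙ DerivedCategory.Q) (derivedLift Φ)).1 inferInstance

/-- A functor between pretriangulated categories which maps each distinguished triangle to a
distinguished triangle, for some choice of the third morphism. -/
class PreservesCones {T T' : Type*} [Category* T] [Category* T'] [Preadditive T] [Preadditive T']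
    [HasZeroObject T] [HasZeroObject T'] [HasShift T ℤ] [HasShift T' ℤ]
    [∀ n : ℤ, (shiftFunctor T n).Additive] [∀ n : ℤ, (shiftFunctor T' n).Additive]
    [Pretriangulated T] [Pretriangulated T'] (F : T ⥤ T') : Prop where
  exists_distinguished {A : Triangle T} (hA : A ∈ distTriang T) :
    ∃ h : F.obj A.obj₃ ⟶ (F.obj A.obj₁)⟦(1 : ℤ)⟧,
      Triangle.mk (F.map A.mor₁) (F.map A.mor₂) h ∈ distTriang T'

/-- Each distinguished triangle comes from a degreewise split sequence of complexes, up to the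
third morphism. -/
lemma exists_isDegreewiseSplit_of_distinguished {A : Triangle (DerivedCategory C)}
    (hA : A ∈ distTriang (DerivedCategory C)) :
    ∃ (S : ShortComplex (CochainComplex C ℤ)) (_ : IsDegreewiseSplit S)
      (e₁ : A.obj₁ ≅ DerivedCategory.Q.obj S.X₁) (e₂ : A.obj₂ ≅ DerivedCategory.Q.obj S.X₂)
      (e₃ : A.obj₃ ≅ DerivedCategory.Q.obj S.X₃),
      A.mor₁ ≫ e₂.hom = e₁.hom ≫ DerivedCategory.Q.map S.f ∧
      A.mor₂ ≫ e₃.hom = e₂.hom ≫ DerivedCategory.Q.map S.g := by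
  -- The inverse rotation of `A` is a mapping cone triangle of some `f : K ⟶ L`, so `A` itself has
  -- the objects `L`, the cone of `f` and `K[1]`. These form a degreewise split sequence.
  obtain ⟨K, L, f, ⟨e⟩⟩ := (DerivedCategory.mem_distTriang_iff _).1 (inv_rot_of_distTriang _ hA)
  let i : A.obj₃⟦(-1 : ℤ)⟧ ≅ DerivedCategory.Q.obj K := Triangle.π₁.mapIso e
  refine ⟨_, isDegreewiseSplit_triangleRotateShortComplex f, Triangle.π₂.mapIso e,
    Triangle.π₃.mapIso e, ((shiftEquiv (DerivedCategory C) (1 : ℤ)).counitIso.app A.obj₃).symm ≪≫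
      (shiftFunctor _ (1 : ℤ)).mapIso i ≪≫
      (DerivedCategory.Q.commShiftIso (1 : ℤ)).symm.app K, e.hom.comm₂, ?_⟩
  have h : (A.mor₂ ≫ (shiftEquiv (DerivedCategory C) (1 : ℤ)).counitIso.inv.app A.obj₃) ≫
      i.hom⟦(1 : ℤ)⟧' = e.hom.hom₃ ≫ DerivedCategory.Q.map
        (CochainComplex.mappingCone.triangle f).mor₃ ≫
        (DerivedCategory.Q.commShiftIso (1 : ℤ)).hom.app K := e.hom.comm₃
  have h' := congrArg (· ≫ (DerivedCategory.Q.commShiftIso (1 : ℤ)).inv.app K) h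
  refine Eq.trans ?_ (h'.trans ?_)
  · exact (congrArg (A.mor₂ ≫ ·) (Category.assoc _ _ _).symm).trans
      (((Category.assoc _ _ _).symm).trans
        (congrArg (· ≫ (DerivedCategory.Q.commShiftIso (1 : ℤ)).inv.app K)
          (Category.assoc _ _ _).symm))
  · refine (Category.assoc _ _ _).trans (congrArg (e.hom.hom₃ ≫ ·) ?_)
    refine (Category.assoc _ _ _).trans ?_
    exact (congrArg (DerivedCategory.Q.map (CochainComplex.mappingCone.triangle f).mor₃ ≫ ·)
      ((DerivedCategory.Q.commShiftIso (1 : ℤ)).hom_inv_id_app K)).trans (Category.comp_id _)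

/-- Every triangle comes from a degreewise split sequence, whose image is short exact and therefore
yields a triangle again. The connecting morphism of this triangle is taken as it comes; comparing it
with the image of the original third morphism is unnecessary for five lemma arguments. -/
lemma preservesCones_derivedLift [Φ.PreservesZeroMorphisms]
    (hΦ : ∀ S : ShortComplex (CochainComplex C ℤ), IsDegreewiseSplit S → (S.map Φ).ShortExact) :
    PreservesCones (derivedLift Φ) where
  exists_distinguished {A} hA := by
    obtain ⟨S, hS, e₁, e₂, e₃, h₁, h₂⟩ := exists_isDegreewiseSplit_of_distinguished hA
    have hT := DerivedCategory.triangleOfSES_distinguished (hΦ S hS)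
    let a₁ : (derivedLift Φ).obj A.obj₁ ≅ DerivedCategory.Q.obj (Φ.obj S.X₁) :=
      (derivedLift Φ).mapIso e₁ ≪≫ (derivedLiftFac Φ).app S.X₁
    let a₂ : (derivedLift Φ).obj A.obj₂ ≅ DerivedCategory.Q.obj (Φ.obj S.X₂) :=
      (derivedLift Φ).mapIso e₂ ≪≫ (derivedLiftFac Φ).app S.X₂
    let a₃ : (derivedLift Φ).obj A.obj₃ ≅ DerivedCategory.Q.obj (Φ.obj S.X₃) :=
      (derivedLift Φ).mapIso e₃ ≪≫ (derivedLiftFac Φ).app S.X₃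
    refine ⟨a₃.hom ≫ DerivedCategory.triangleOfSESδ (hΦ S hS) ≫ a₁.inv⟦(1 : ℤ)⟧', ?_⟩
    refine isomorphic_distinguished _ hT _ (Triangle.isoMk _ _ a₁ a₂ a₃ ?_ ?_ ?_)
    · have h := (derivedLiftFac Φ).hom.naturality S.f
      have h' := congrArg ((derivedLift Φ).map) h₁
      simp only [Functor.map_comp] at h'
      change (derivedLift Φ).map A.mor₁ ≫ (derivedLift Φ).map e₂.hom ≫ _ =
        ((derivedLift Φ).map e₁.hom ≫ _) ≫ DerivedCategory.Q.map (Φ.map S.f)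
      rw [← Category.assoc, h', Category.assoc, Category.assoc]
      exact congrArg ((derivedLift Φ).map e₁.hom ≫ ·) h
    · have h := (derivedLiftFac Φ).hom.naturality S.g
      have h' := congrArg ((derivedLift Φ).map) h₂
      simp only [Functor.map_comp] at h'
      change (derivedLift Φ).map A.mor₂ ≫ (derivedLift Φ).map e₃.hom ≫ _ =
        ((derivedLift Φ).map e₂.hom ≫ _) ≫ DerivedCategory.Q.map (Φ.map S.g)
      rw [← Category.assoc, h', Category.assoc, Category.assoc]
      exact congrArg ((derivedLift Φ).map e₂.hom ≫ ·) h
    · have h : a₁.inv⟦(1 : ℤ)⟧' ≫ a₁.hom⟦(1 : ℤ)⟧' = 𝟙 _ := by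
        rw [← Functor.map_comp, a₁.inv_hom_id, CategoryTheory.Functor.map_id]
      refine (Category.assoc _ _ _).trans (congrArg (a₃.hom ≫ ·) ?_)
      refine (Category.assoc _ _ _).trans ?_
      exact (congrArg (DerivedCategory.triangleOfSESδ (hΦ S hS) ≫ ·) h).trans (Category.comp_id _)

section Descent

variable {E : Type*} [Category* E] {G H I : DerivedCategory C ⥤ E}

/-- A natural transformation between functors on the derived category is determined by its
values on complexes. -/
noncomputable def derivedDesc (σ : DerivedCategory.Q ⋙ G ⟶ DerivedCategory.Q ⋙ H) : G ⟶ H :=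
  Localization.liftNatTrans DerivedCategory.Q (HomologicalComplex.quasiIso C (.up ℤ)) _ _ G H σ

lemma derivedDesc_app (σ : DerivedCategory.Q ⋙ G ⟶ DerivedCategory.Q ⋙ H)
    (K : CochainComplex C ℤ) :
    (derivedDesc σ).app (DerivedCategory.Q.obj K) = σ.app K :=
  (Localization.liftNatTrans_app _ _ _ _ _ _ _ _).trans ((Category.id_comp _).trans
    (Category.comp_id _))

lemma derived_natTrans_ext {τ τ' : G ⟶ H}
    (h : ∀ K : CochainComplex C ℤ,
      τ.app (DerivedCategory.Q.obj K) = τ'.app (DerivedCategory.Q.obj K)) : τ = τ' :=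
  Localization.natTrans_ext DerivedCategory.Q (HomologicalComplex.quasiIso C (.up ℤ)) h

/-- The isomorphism of functors on the derived category induced by an isomorphism of their
restrictions to complexes. -/
noncomputable def derivedDescIso (e : DerivedCategory.Q ⋙ G ≅ DerivedCategory.Q ⋙ H) : G ≅ H where
  hom := derivedDesc e.hom
  inv := derivedDesc e.inv
  hom_inv_id := derived_natTrans_ext fun K => by
    rw [NatTrans.comp_app, derivedDesc_app, derivedDesc_app, e.hom_inv_id_app]
    rfl
  inv_hom_id := derived_natTrans_ext fun K => by
    rw [NatTrans.comp_app, derivedDesc_app, derivedDesc_app, e.inv_hom_id_app]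
    rfl

instance [HasShift E ℤ] [G.CommShift ℤ] [H.CommShift ℤ]
    (σ : DerivedCategory.Q ⋙ G ⟶ DerivedCategory.Q ⋙ H) [NatTrans.CommShift σ ℤ] :
    NatTrans.CommShift (derivedDesc σ) ℤ where
  shift_comm a := derived_natTrans_ext fun K => by
    have h := NatTrans.shift_app_comm σ a K
    rw [Functor.commShiftIso_comp_hom_app, Functor.commShiftIso_comp_hom_app] at h
    have h' : G.map ((DerivedCategory.Q.commShiftIso a).hom.app K) ≫
        (derivedDesc σ).app ((DerivedCategory.Q.obj K)⟦a⟧) = σ.app (K⟦a⟧) ≫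
        H.map ((DerivedCategory.Q.commShiftIso a).hom.app K) := by
      refine ((derivedDesc σ).naturality _).trans ?_
      exact congrArg (· ≫ H.map ((DerivedCategory.Q.commShiftIso a).hom.app K))
        (derivedDesc_app σ (K⟦a⟧))
    -- Naturality is only controlled on objects `Q.obj K`, while `(Q.obj K)⟦a⟧` is merely isomorphic
    -- to one of these; precomposing with this isomorphism reduces the claim to the compatibility of
    -- `σ`.
    rw [← cancel_epi (G.map ((DerivedCategory.Q.commShiftIso a).hom.app K))]
    simp only [NatTrans.comp_app, Functor.whiskerRight_app, Functor.whiskerLeft_app,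
      derivedDesc_app]
    refine (Category.assoc _ _ _).symm.trans (h.trans ?_)
    refine (Category.assoc _ _ _).symm.trans ?_
    refine (congrArg (· ≫ (H.commShiftIso a).hom.app _) h'.symm).trans ?_
    exact Category.assoc _ _ _

end Descent

variable {Φ Ψ Θ}

/-- The natural transformation between derived functors which is induced by a natural
transformation on complexes. -/
noncomputable def derivedLiftMap (τ : Φ ⟶ Ψ) : derivedLift Φ ⟶ derivedLift Ψ :=
  derivedDesc ((derivedLiftFac Φ).hom ≫ Functor.whiskerRight τ DerivedCategory.Q ≫
    (derivedLiftFac Ψ).inv)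

lemma derivedLiftMap_app (τ : Φ ⟶ Ψ) (K : CochainComplex C ℤ) :
    (derivedLiftMap τ).app (DerivedCategory.Q.obj K) =
      (derivedLiftFac Φ).hom.app K ≫ DerivedCategory.Q.map (τ.app K) ≫
        (derivedLiftFac Ψ).inv.app K :=
  derivedDesc_app _ _

instance [Φ.CommShift ℤ] [Ψ.CommShift ℤ] (τ : Φ ⟶ Ψ) [NatTrans.CommShift τ ℤ] :
    NatTrans.CommShift (derivedLiftMap τ) ℤ := by
  have : NatTrans.CommShift (derivedLiftFac Ψ).inv ℤ :=
    inferInstanceAs (NatTrans.CommShift (derivedLiftFac Ψ).symm.hom ℤ)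
  unfold derivedLiftMap
  infer_instance

lemma isIso_derivedLiftMap_app_iff (τ : Φ ⟶ Ψ) (K : CochainComplex C ℤ) :
    IsIso ((derivedLiftMap τ).app (DerivedCategory.Q.obj K)) ↔ QuasiIso (τ.app K) := by
  rw [derivedLiftMap_app, isIso_comp_left_iff, isIso_comp_right_iff,
    DerivedCategory.isIso_Q_map_iff_quasiIso]

end DerivedLift

/-! ## Derived tensor products with complexes of bimodules -/

section DerivedTensorFunctor

open scoped ModuleCat
open Pretriangulated

variable {k : Type u} [Field k] {Λ : Type u} [Ring Λ] [Algebra k Λ]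

/-- The functor `X ⊗_Λ -` on complexes of modules, for a complex of bimodules `X`. -/
noncomputable abbrev tensorCochain (X : CochainComplex (BimoduleCat k Λ) ℤ) :
    CochainComplex (ModuleCat.{u} Λ) ℤ ⥤ CochainComplex (ModuleCat.{u} Λ) ℤ :=
  (tensorModBifunctor k Λ).map₂CochainComplex.obj X

/-- The natural transformation `X ⊗_Λ - ⟶ Y ⊗_Λ -` induced by a morphism of complexes. -/
noncomputable abbrev tensorCochainMap {X Y : CochainComplex (BimoduleCat k Λ) ℤ} (f : X ⟶ Y) :
    tensorCochain X ⟶ tensorCochain Y :=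
  (tensorModBifunctor k Λ).map₂CochainComplex.map f

/-- The functor `X ⊗_Λ -` preserves homotopies. -/
noncomputable def tensorCochainHomotopy (X : CochainComplex (BimoduleCat k Λ) ℤ)
    {M N : CochainComplex (ModuleCat.{u} Λ) ℤ} {f g : M ⟶ N} (h : Homotopy f g) :
    Homotopy ((tensorCochain X).map f) ((tensorCochain X).map g) :=
  HomologicalComplex.mapBifunctorMapHomotopy₂ (𝟙 X) h (tensorModBifunctor k Λ) (.up ℤ)

/-- The functor `X ⊗_Λ -` preserves homotopy equivalences. -/
noncomputable def tensorCochainHomotopyEquiv (X : CochainComplex (BimoduleCat k Λ) ℤ)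
    {M N : CochainComplex (ModuleCat.{u} Λ) ℤ} (e : HomotopyEquiv M N) :
    HomotopyEquiv ((tensorCochain X).obj M) ((tensorCochain X).obj N) where
  hom := (tensorCochain X).map e.hom
  inv := (tensorCochain X).map e.inv
  homotopyHomInvId := (Homotopy.ofEq ((tensorCochain X).map_comp e.hom e.inv).symm).trans
    ((tensorCochainHomotopy X e.homotopyHomInvId).trans
      (Homotopy.ofEq ((tensorCochain X).map_id M)))
  homotopyInvHomId := (Homotopy.ofEq ((tensorCochain X).map_comp e.inv e.hom).symm).trans
    ((tensorCochainHomotopy X e.homotopyInvHomId).trans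
      (Homotopy.ofEq ((tensorCochain X).map_id N)))

instance (i : ℤ) : Projective ((diagonalResolution k Λ).X i) :=
  inferInstanceAs (Projective ((projectiveResolution (regularBimod k Λ)).cochainComplex.X i))

instance : (diagonalResolution k Λ).IsStrictlyLE 0 :=
  inferInstanceAs ((projectiveResolution (regularBimod k Λ)).cochainComplex.IsStrictlyLE 0)

/-- The resolution of the regular bimodule. -/
noncomputable def augmentation : diagonalResolution k Λ ⟶ regularComplex k Λ :=
  (projectiveResolution (regularBimod k Λ)).π'

instance : QuasiIso (augmentation (k := k) (Λ := Λ)) :=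
  inferInstanceAs (QuasiIso (projectiveResolution (regularBimod k Λ)).π')

lemma nonempty_homotopy_diagonalResolution (M : CochainComplex (ModuleCat.{u} Λ) ℤ)
    (hM : M.Acyclic) :
    Nonempty (Homotopy (𝟙 ((tensorCochain (diagonalResolution k Λ)).obj M)) 0) :=
  nonempty_homotopy_mapBifunctor (diagonalResolution k Λ) M (tensorModBifunctor k Λ) 0
    (fun i hi => CochainComplex.isZero_of_isStrictlyLE _ 0 i hi)
    (fun i => (nonempty_homotopy_tensorMod ((diagonalResolution k Λ).X i) M hM).some)

/-- The functor `X ⊗_Λ (B ⊗_Λ -)` on complexes of modules, where `B` is the resolution of `Λ` by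
projective bimodules. -/
noncomputable abbrev derivedTensorCochain (X : CochainComplex (BimoduleCat k Λ) ℤ) :
    CochainComplex (ModuleCat.{u} Λ) ℤ ⥤ CochainComplex (ModuleCat.{u} Λ) ℤ :=
  tensorCochain (diagonalResolution k Λ) ⋙ tensorCochain X

lemma isDegreewiseSplit_tensorCochain (X : CochainComplex (BimoduleCat k Λ) ℤ)
    (S : ShortComplex (CochainComplex (ModuleCat.{u} Λ) ℤ)) (hS : IsDegreewiseSplit S) :
    IsDegreewiseSplit (S.map (tensorCochain X)) :=
  isDegreewiseSplit_mapBifunctor _ X S hS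

lemma isDegreewiseSplit_derivedTensorCochain (X : CochainComplex (BimoduleCat k Λ) ℤ)
    (S : ShortComplex (CochainComplex (ModuleCat.{u} Λ) ℤ)) (hS : IsDegreewiseSplit S) :
    IsDegreewiseSplit (S.map (derivedTensorCochain X)) :=
  IsDegreewiseSplit.map_comp _ _ (isDegreewiseSplit_tensorCochain _)
    (isDegreewiseSplit_tensorCochain X) S hS

/-- If `K` is acyclic, then `B ⊗_Λ K` is already contractible, and any functor `X ⊗_Λ -` preserves
contractions. No flatness or boundedness of `X` is required. -/
instance (X : CochainComplex (BimoduleCat k Λ) ℤ) : PreservesQuasiIso (derivedTensorCochain X) where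
  quasiIso_map f _ := quasiIso_map_of_acyclic (derivedTensorCochain X)
    (fun S hS => (isDegreewiseSplit_derivedTensorCochain X S hS).shortExact)
    (fun K hK => acyclic_of_homotopy ((Homotopy.ofEq ((tensorCochain X).map_id _).symm).trans
        ((tensorCochainHomotopy X (nonempty_homotopy_diagonalResolution (k := k) K hK).some).trans
          (Homotopy.ofEq (Functor.map_zero _ _ _))))) f

/-- The functor `X ⊗^L_Λ -` on the derived category of modules, for a complex of bimodules `X`. -/
noncomputable def derivedTensorFunctor (X : CochainComplex (BimoduleCat k Λ) ℤ) :
    DerivedCategory (ModuleCat.{u} Λ) ⥤ DerivedCategory (ModuleCat.{u} Λ) :=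
  derivedLift (derivedTensorCochain X)

noncomputable instance (X : CochainComplex (BimoduleCat k Λ) ℤ) :
    (derivedTensorFunctor X).CommShift ℤ :=
  inferInstanceAs ((derivedLift (derivedTensorCochain X)).CommShift ℤ)

instance (X : CochainComplex (BimoduleCat k Λ) ℤ) : (derivedTensorFunctor X).Additive :=
  inferInstanceAs (derivedLift (derivedTensorCochain X)).Additive

instance (X : CochainComplex (BimoduleCat k Λ) ℤ) : (derivedTensorFunctor X).Linear k :=
  inferInstanceAs ((derivedLift (derivedTensorCochain X)).Linear k)

instance (X : CochainComplex (BimoduleCat k Λ) ℤ) : PreservesCones (derivedTensorFunctor X) :=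
  preservesCones_derivedLift (derivedTensorCochain X)
    (fun S hS => (isDegreewiseSplit_derivedTensorCochain X S hS).shortExact)

/-- `X ⊗^L_Λ -` is computed by `X ⊗_Λ (B ⊗_Λ -)`. -/
noncomputable def derivedTensorFunctorFac (X : CochainComplex (BimoduleCat k Λ) ℤ) :
    DerivedCategory.Q ⋙ derivedTensorFunctor X ≅
      derivedTensorCochain X ⋙ DerivedCategory.Q :=
  derivedLiftFac (derivedTensorCochain X)

instance (X : CochainComplex (BimoduleCat k Λ) ℤ) :
    NatTrans.CommShift (derivedTensorFunctorFac X).hom ℤ :=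
  inferInstanceAs (NatTrans.CommShift (derivedLiftFac (derivedTensorCochain X)).hom ℤ)

/-- The natural transformation `X ⊗^L_Λ - ⟶ Y ⊗^L_Λ -` induced by a morphism of complexes. -/
noncomputable def derivedTensorMap {X Y : CochainComplex (BimoduleCat k Λ) ℤ} (f : X ⟶ Y) :
    derivedTensorFunctor X ⟶ derivedTensorFunctor Y :=
  derivedLiftMap (Functor.whiskerLeft _ (tensorCochainMap f))

instance {X Y : CochainComplex (BimoduleCat k Λ) ℤ} (f : X ⟶ Y) :
    NatTrans.CommShift (derivedTensorMap f) ℤ := by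
  unfold derivedTensorMap
  exact inferInstanceAs (NatTrans.CommShift (derivedLiftMap (Φ := derivedTensorCochain X)
    (Ψ := derivedTensorCochain Y) (Functor.whiskerLeft _ (tensorCochainMap f))) ℤ)

end DerivedTensorFunctor

/-! ## Associativity of the tensor product of complexes -/

section Associator

open CochainComplex

variable {C₁ C₂ C₃ C₁₂ C₂₃ C₄ : Type*} [Category* C₁] [Category* C₂] [Category* C₃]
  [Category* C₁₂] [Category* C₂₃] [Category* C₄]
  [Preadditive C₁] [Preadditive C₂] [Preadditive C₃] [Preadditive C₁₂] [Preadditive C₂₃]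
  [Preadditive C₄]
  {F₁₂ : C₁ ⥤ C₂ ⥤ C₁₂} {G : C₁₂ ⥤ C₃ ⥤ C₄} {F : C₁ ⥤ C₂₃ ⥤ C₄} {G₂₃ : C₂ ⥤ C₃ ⥤ C₂₃}
  [F₁₂.Additive] [∀ X, (F₁₂.obj X).Additive] [G.Additive] [∀ X, (G.obj X).Additive]
  [F.Additive] [∀ X, (F.obj X).Additive] [G₂₃.Additive] [∀ X, (G₂₃.obj X).Additive]
  [∀ K L, HasMapBifunctor K L F₁₂] [∀ K L, HasMapBifunctor K L G] [∀ K L, HasMapBifunctor K L F]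
  [∀ K L, HasMapBifunctor K L G₂₃]
  (α : bifunctorComp₁₂ F₁₂ G ≅ bifunctorComp₂₃ F G₂₃)
  (K₁ : CochainComplex C₁ ℤ) (K₂ : CochainComplex C₂ ℤ) (K₃ L₃ : CochainComplex C₃ ℤ)
  (h₁₂ : ∀ K₁ K₂ K₃, HomologicalComplex.HasGoodTrifunctor₁₂Obj F₁₂ G (c₁ := .up ℤ) (c₂ := .up ℤ)
    (c₃ := .up ℤ) K₁ K₂ K₃ (.up ℤ) (.up ℤ))
  (h₂₃ : ∀ K₁ K₂ K₃, HomologicalComplex.HasGoodTrifunctor₂₃Obj F G₂₃ (c₁ := .up ℤ) (c₂ := .up ℤ)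
    (c₃ := .up ℤ) K₁ K₂ K₃ (.up ℤ) (.up ℤ) (.up ℤ))

omit [∀ K L, HasMapBifunctor K L G₂₃] in
include h₁₂ in
lemma mapBifunctor₁₂_hom_ext {n : ℤ} {A : C₄}
    {f g : (mapBifunctor (mapBifunctor K₁ K₂ F₁₂) K₃ G).X n ⟶ A}
    (h : ∀ (p q r : ℤ) (hn : p + q + r = n),
      (G.map (ιMapBifunctor K₁ K₂ F₁₂ p q (p + q) rfl)).app (K₃.X r) ≫
        ιMapBifunctor (mapBifunctor K₁ K₂ F₁₂) K₃ G (p + q) r n hn ≫ f =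
      (G.map (ιMapBifunctor K₁ K₂ F₁₂ p q (p + q) rfl)).app (K₃.X r) ≫
        ιMapBifunctor (mapBifunctor K₁ K₂ F₁₂) K₃ G (p + q) r n hn ≫ g) : f = g := by
  have := h₁₂ K₁ K₂ K₃
  refine HomologicalComplex.mapBifunctor₁₂.hom_ext fun p q r hn => ?_
  rw [HomologicalComplex.mapBifunctor₁₂.ι_eq F₁₂ G K₁ K₂ K₃ (.up ℤ) (.up ℤ) p q r (p + q) n rfl hn,
    Category.assoc, Category.assoc]
  exact h p q r hn

/-- The associativity isomorphism for tensor products of cochain complexes. -/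
noncomputable def mapBifunctorAssoc :
    mapBifunctor (mapBifunctor K₁ K₂ F₁₂) K₃ G ≅ mapBifunctor K₁ (mapBifunctor K₂ K₃ G₂₃) F :=
  haveI := h₁₂ K₁ K₂ K₃
  haveI := h₂₃ K₁ K₂ K₃
  HomologicalComplex.mapBifunctorAssociator α K₁ K₂ K₃ (.up ℤ) (.up ℤ) (.up ℤ)

lemma ι_mapBifunctorAssoc (p q r n s : ℤ) (hn : p + q + r = n) (hs : q + r = s) :
    (G.map (ιMapBifunctor K₁ K₂ F₁₂ p q (p + q) rfl)).app (K₃.X r) ≫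
      ιMapBifunctor (mapBifunctor K₁ K₂ F₁₂) K₃ G (p + q) r n hn ≫
        (mapBifunctorAssoc α K₁ K₂ K₃ h₁₂ h₂₃).hom.f n =
    ((α.hom.app (K₁.X p)).app (K₂.X q)).app (K₃.X r) ≫
      (F.obj (K₁.X p)).map (ιMapBifunctor K₂ K₃ G₂₃ q r s hs) ≫
        ιMapBifunctor K₁ (mapBifunctor K₂ K₃ G₂₃) F p s n (by lia) := by
  have := h₁₂ K₁ K₂ K₃
  have := h₂₃ K₁ K₂ K₃
  have h := HomologicalComplex.ι_mapBifunctorAssociatorX_hom α K₁ K₂ K₃ (.up ℤ) (.up ℤ) (.up ℤ)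
    p q r n hn
  rw [HomologicalComplex.mapBifunctor₁₂.ι_eq F₁₂ G K₁ K₂ K₃ (.up ℤ) (.up ℤ) p q r (p + q) n rfl hn,
    HomologicalComplex.mapBifunctor₂₃.ι_eq F G₂₃ K₁ K₂ K₃ (.up ℤ) (.up ℤ) (.up ℤ) p q r s n hs
      (show p + s = n by lia), Category.assoc] at h
  exact h

/-- The diagram chase behind `mapBifunctorAssoc_naturality`, stated for arbitrary objects and
morphisms. -/
lemma comp_eq_comp_of_naturality {V : Type*} [Category* V]
    {X₁ X₂ X₃ X₄ X₅ X₆ X₇ X₈ X₉ X₁₀ X₁₁ X₁₂ : V} {a : X₁ ⟶ X₂} {b : X₂ ⟶ X₃} {S : X₃ ⟶ X₄}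
    {A : X₄ ⟶ X₅} {g : X₂ ⟶ X₆} {b' : X₆ ⟶ X₄} {g' : X₁ ⟶ X₇} {a' : X₇ ⟶ X₆} {al' : X₇ ⟶ X₈}
    {j : X₈ ⟶ X₉} {w : X₉ ⟶ X₅} {al : X₁ ⟶ X₁₀} {g'' : X₁₀ ⟶ X₈} {A' : X₃ ⟶ X₁₁} {f : X₁₀ ⟶ X₁₂}
    {i : X₁₂ ⟶ X₁₁} {M : X₁₁ ⟶ X₅} {f' : X₁₂ ⟶ X₉} (h₁ : b ≫ S = g ≫ b') (h₂ : a ≫ g = g' ≫ a')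
    (h₃ : a' ≫ b' ≫ A = al' ≫ j ≫ w) (h₄ : g' ≫ al' = al ≫ g'') (h₅ : a ≫ b ≫ A' = al ≫ f ≫ i)
    (h₆ : i ≫ M = f' ≫ w) (h₇ : f ≫ f' = g'' ≫ j) :
    a ≫ b ≫ (S ≫ A) = a ≫ b ≫ (A' ≫ M) := by
  calc _ = (a ≫ g) ≫ b' ≫ A := by rw [← Category.assoc b, h₁, Category.assoc, Category.assoc]
    _ = (g' ≫ al') ≫ j ≫ w := by rw [h₂, Category.assoc, h₃, Category.assoc]
    _ = al ≫ (f ≫ f') ≫ w := by rw [h₄, h₇, Category.assoc, Category.assoc]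
    _ = (a ≫ b ≫ A') ≫ M := by rw [h₅, Category.assoc, Category.assoc, Category.assoc, h₆]
    _ = _ := by rw [Category.assoc, Category.assoc]

variable {K₃ L₃} in
lemma mapBifunctorAssoc_naturality (f : K₃ ⟶ L₃) :
    HomologicalComplex.mapBifunctorMap (𝟙 (mapBifunctor K₁ K₂ F₁₂)) f G (.up ℤ) ≫
      (mapBifunctorAssoc α K₁ K₂ L₃ h₁₂ h₂₃).hom =
    (mapBifunctorAssoc α K₁ K₂ K₃ h₁₂ h₂₃).hom ≫ HomologicalComplex.mapBifunctorMap (𝟙 K₁)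
      (HomologicalComplex.mapBifunctorMap (𝟙 K₂) f G₂₃ (.up ℤ)) F (.up ℤ) := by
  ext n : 1
  refine mapBifunctor₁₂_hom_ext K₁ K₂ K₃ h₁₂ fun p q r hn => ?_
  rw [HomologicalComplex.comp_f, HomologicalComplex.comp_f]
  have e₁ := ι_mapBifunctorAssoc α K₁ K₂ K₃ h₁₂ h₂₃ p q r n (q + r) hn rfl
  have e₂ := ι_mapBifunctorAssoc α K₁ K₂ L₃ h₁₂ h₂₃ p q r n (q + r) hn rfl
  have e₃ := HomologicalComplex.ι_mapBifunctorMap (𝟙 (mapBifunctor K₁ K₂ F₁₂)) f G (.up ℤ)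
    (p + q) r n hn
  have e₄ := HomologicalComplex.ι_mapBifunctorMap (𝟙 K₂) f G₂₃ (.up ℤ) q r (q + r) rfl
  have e₅ := HomologicalComplex.ι_mapBifunctorMap (𝟙 K₁)
    (HomologicalComplex.mapBifunctorMap (𝟙 K₂) f G₂₃ (.up ℤ)) F (.up ℤ)
    p (q + r) n (show p + (q + r) = n by lia)
  rw [HomologicalComplex.id_f, CategoryTheory.Functor.map_id, NatTrans.id_app] at e₃ e₄ e₅
  have e₇ := ((α.hom.app (K₁.X p)).app (K₂.X q)).naturality (f.f r)
  rw [Category.id_comp] at e₃ e₄ e₅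
  have e₈ := ((F.obj (K₁.X p)).map_comp _ _).symm.trans ((congrArg (F.obj (K₁.X p)).map e₄).trans
    ((F.obj (K₁.X p)).map_comp _ _))
  exact comp_eq_comp_of_naturality e₃
    ((G.map (ιMapBifunctor K₁ K₂ F₁₂ p q (p + q) rfl)).naturality (f.f r)).symm e₂ e₇ e₁ e₅ e₈

/-- The associativity isomorphism, as an isomorphism of functors in the last variable. -/
noncomputable def map₂CochainComplexAssoc :
    G.map₂CochainComplex.obj (mapBifunctor K₁ K₂ F₁₂) ≅
      G₂₃.map₂CochainComplex.obj K₂ ⋙ F.map₂CochainComplex.obj K₁ :=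
  NatIso.ofComponents (fun K₃ => mapBifunctorAssoc α K₁ K₂ K₃ h₁₂ h₂₃)
    (fun f => mapBifunctorAssoc_naturality α K₁ K₂ h₁₂ h₂₃ f)

lemma ι_mapBifunctorShift₂Iso (L : CochainComplex C₁₂ ℤ) (y p q n : ℤ) (h : p + q = n) :
    ιMapBifunctor L (K₃⟦y⟧) G p q n h ≫ (mapBifunctorShift₂Iso L K₃ G y).hom.f n =
      (p * y).negOnePow • (ιMapBifunctor L K₃ G p (q + y) (n + y) (by lia) :
        (G.obj (L.X p)).obj ((K₃⟦y⟧).X q) ⟶ ((mapBifunctor L K₃ G)⟦y⟧).X n) := by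
  refine (ι_mapBifunctorShift₂Iso_hom_f L K₃ G y p q n h (q + y) (n + y) rfl rfl).trans ?_
  refine congrArg ((p * y).negOnePow • ·) ?_
  refine (congrArg (· ≫ _) ((G.obj (L.X p)).map_id _)).trans ((Category.id_comp _).trans ?_)
  exact Category.comp_id _

/-- The diagram chase behind `mapBifunctorAssoc_shift`, in which the signs multiply as `ε = ε₁ *
ε₂`. -/
lemma comp_eq_comp_of_units_smul {V : Type*} [Category* V] [Preadditive V]
    {X₁ X₂ X₃ X₄ X₅ X₆ X₇ X₈ X₉ X₁₀ : V} {a : X₁ ⟶ X₂} {b : X₂ ⟶ X₃} {S : X₃ ⟶ X₄} {A : X₄ ⟶ X₅}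
    {A' : X₃ ⟶ X₆} {M : X₆ ⟶ X₇} {S' : X₇ ⟶ X₅} {b' : X₂ ⟶ X₄} {al : X₁ ⟶ X₈} {j : X₈ ⟶ X₁₀}
    {w : X₁₀ ⟶ X₅} {f : X₈ ⟶ X₉} {i : X₉ ⟶ X₆} {f' : X₉ ⟶ X₁₀} {i' : X₁₀ ⟶ X₇} {ε ε₁ ε₂ : ℤˣ}
    (hε : ε = ε₁ * ε₂) (h₁ : b ≫ S = ε • b') (h₂ : a ≫ b' ≫ A = al ≫ j ≫ w)
    (h₃ : a ≫ b ≫ A' = al ≫ f ≫ i) (h₄ : i ≫ M = f' ≫ i') (h₅ : i' ≫ S' = ε₁ • w)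
    (h₆ : f ≫ f' = ε₂ • j) : a ≫ b ≫ (S ≫ A) = a ≫ b ≫ (A' ≫ M ≫ S') := by
  calc _ = ε • (a ≫ b' ≫ A) := by
        rw [← Category.assoc b, h₁, Linear.units_smul_comp, Linear.comp_units_smul]
    _ = al ≫ (f ≫ f') ≫ (i' ≫ S') := by
        rw [h₂, h₅, h₆, hε, Linear.units_smul_comp, Linear.comp_units_smul,
          Linear.comp_units_smul, Linear.comp_units_smul, smul_smul, mul_comm]
    _ = al ≫ f ≫ (i ≫ M) ≫ S' := by rw [h₄, Category.assoc, Category.assoc]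
    _ = (a ≫ b ≫ A') ≫ M ≫ S' := by rw [h₃, Category.assoc, Category.assoc, Category.assoc]
    _ = _ := by rw [Category.assoc, Category.assoc]

/-- On the summand with indices `p`, `q`, `r` a shift by `y` of the last factor costs the sign `(-1)
^ ((p + q) y)` when it is pulled out at once, and `(-1) ^ (q y)` followed by `(-1) ^ (p y)` when it
is pulled out in two steps. These agree, so the associativity isomorphism is compatible with the
commutation isomorphisms of tensor functors. -/
lemma mapBifunctorAssoc_shift (y : ℤ) :
    (mapBifunctorShift₂Iso (mapBifunctor K₁ K₂ F₁₂) K₃ G y).hom ≫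
      (mapBifunctorAssoc α K₁ K₂ K₃ h₁₂ h₂₃).hom⟦y⟧' =
    (mapBifunctorAssoc α K₁ K₂ (K₃⟦y⟧) h₁₂ h₂₃).hom ≫ HomologicalComplex.mapBifunctorMap (𝟙 K₁)
      (mapBifunctorShift₂Iso K₂ K₃ G₂₃ y).hom F (.up ℤ) ≫
        (mapBifunctorShift₂Iso K₁ (mapBifunctor K₂ K₃ G₂₃) F y).hom := by
  ext n : 1
  refine mapBifunctor₁₂_hom_ext K₁ K₂ _ h₁₂ fun p q r hn => ?_
  rw [HomologicalComplex.comp_f, HomologicalComplex.comp_f, HomologicalComplex.comp_f]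
  have e₁ := ι_mapBifunctorAssoc α K₁ K₂ (K₃⟦y⟧) h₁₂ h₂₃ p q r n (q + r) hn rfl
  have e₂ := ι_mapBifunctorAssoc α K₁ K₂ K₃ h₁₂ h₂₃ p q (r + y) (n + y) (q + r + y)
    (by lia) (by lia)
  have e₃ := ι_mapBifunctorShift₂Iso (G := G) K₃ (mapBifunctor K₁ K₂ F₁₂) y (p + q) r n hn
  have e₄ := ι_mapBifunctorShift₂Iso (G := G₂₃) K₃ K₂ y q r (q + r) rfl
  have e₅ := ι_mapBifunctorShift₂Iso (G := F) (mapBifunctor K₂ K₃ G₂₃) K₁ y p (q + r) n (by lia)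
  have e₆ := HomologicalComplex.ι_mapBifunctorMap (𝟙 K₁)
    (mapBifunctorShift₂Iso K₂ K₃ G₂₃ y).hom F (.up ℤ)
    p (q + r) n (show p + (q + r) = n by lia)
  rw [HomologicalComplex.id_f, CategoryTheory.Functor.map_id, NatTrans.id_app,
    Category.id_comp] at e₆
  have e₇ := ((F.obj (K₁.X p)).map_comp _ _).symm.trans ((congrArg (F.obj (K₁.X p)).map e₄).trans
    (Functor.map_units_smul (F.obj (K₁.X p)) _ _))
  exact comp_eq_comp_of_units_smul (ε := ((p + q) * y).negOnePow) (ε₁ := (p * y).negOnePow)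
    (ε₂ := (q * y).negOnePow) (by rw [add_mul, Int.negOnePow_add]) e₃ e₂ e₁ e₆ e₅ e₇

instance : NatTrans.CommShift (map₂CochainComplexAssoc α K₁ K₂ h₁₂ h₂₃).hom ℤ where
  shift_comm y := by
    ext K₃ : 2
    refine (mapBifunctorAssoc_shift α K₁ K₂ K₃ h₁₂ h₂₃ y).trans ?_
    rw [NatTrans.comp_app, Functor.commShiftIso_comp_hom_app]
    rfl

end Associator

section TensorCochainAssoc

open scoped ModuleCat

variable {k : Type u} [Field k] {Λ : Type u} [Ring Λ] [Algebra k Λ]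

/-- The isomorphism `(X ⊗_Λ Y) ⊗_Λ M ≅ X ⊗_Λ (Y ⊗_Λ M)` for complexes. -/
noncomputable def tensorCochainAssoc (X Y : CochainComplex (BimoduleCat k Λ) ℤ) :
    tensorCochain (tensorComplex X Y) ≅ tensorCochain Y ⋙ tensorCochain X :=
  map₂CochainComplexAssoc (tensorModAssociator k Λ) X Y
    (fun _ _ _ _ _ => inferInstance) (fun _ _ _ _ _ => inferInstance)

instance (X Y : CochainComplex (BimoduleCat k Λ) ℤ) :
    NatTrans.CommShift (tensorCochainAssoc X Y).hom ℤ :=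
  inferInstanceAs (NatTrans.CommShift (map₂CochainComplexAssoc _ _ _ _ _).hom ℤ)

end TensorCochainAssoc

/-! ## Composition of derived tensor products -/

section DerivedTensorComp

open scoped ModuleCat

variable {k : Type u} [Field k] {Λ : Type u} [Ring Λ] [Algebra k Λ]

/-- The isomorphism `(X ⊗_Λ (B ⊗_Λ Y)) ⊗_Λ M ≅ X ⊗_Λ (B ⊗_Λ (Y ⊗_Λ M))`. -/
noncomputable def tensorCochainDerivedAssoc (X Y : CochainComplex (BimoduleCat k Λ) ℤ) :
    tensorCochain (derivedTensor X Y) ≅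
      (tensorCochain Y ⋙ tensorCochain (diagonalResolution k Λ)) ⋙ tensorCochain X :=
  tensorCochainAssoc X (tensorComplex (diagonalResolution k Λ) Y) ≪≫
    Functor.isoWhiskerRight (tensorCochainAssoc (diagonalResolution k Λ) Y) (tensorCochain X)

instance (X Y : CochainComplex (BimoduleCat k Λ) ℤ) :
    NatTrans.CommShift (tensorCochainDerivedAssoc X Y).hom ℤ :=
  inferInstanceAs (NatTrans.CommShift
    ((tensorCochainAssoc X (tensorComplex (diagonalResolution k Λ) Y)).hom ≫
    Functor.whiskerRight (tensorCochainAssoc (diagonalResolution k Λ) Y).hom (tensorCochain X)) ℤ)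

/-- Associativity of the tensor product of complexes, with the resolutions of the regular
bimodule which represent the derived tensor product. -/
noncomputable def derivedTensorCochainComp (X Y : CochainComplex (BimoduleCat k Λ) ℤ) :
    derivedTensorCochain (derivedTensor X Y) ≅ derivedTensorCochain Y ⋙ derivedTensorCochain X :=
  Functor.isoWhiskerLeft (tensorCochain (diagonalResolution k Λ)) (tensorCochainDerivedAssoc X Y) ≪≫
    (Functor.associator (tensorCochain (diagonalResolution k Λ))
      (tensorCochain Y ⋙ tensorCochain (diagonalResolution k Λ)) (tensorCochain X)).symm ≪≫
    Functor.isoWhiskerRight (Functor.associator (tensorCochain (diagonalResolution k Λ))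
      (tensorCochain Y) (tensorCochain (diagonalResolution k Λ))).symm (tensorCochain X) ≪≫
    Functor.associator (derivedTensorCochain Y) (tensorCochain (diagonalResolution k Λ))
      (tensorCochain X)

instance (X Y : CochainComplex (BimoduleCat k Λ) ℤ) :
    NatTrans.CommShift (derivedTensorCochainComp X Y).hom ℤ :=
  inferInstanceAs (NatTrans.CommShift
    (Functor.whiskerLeft (tensorCochain (diagonalResolution k Λ))
      (tensorCochainDerivedAssoc X Y).hom ≫
    (Functor.associator (tensorCochain (diagonalResolution k Λ))
      (tensorCochain Y ⋙ tensorCochain (diagonalResolution k Λ)) (tensorCochain X)).inv ≫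
    Functor.whiskerRight (Functor.associator (tensorCochain (diagonalResolution k Λ))
      (tensorCochain Y) (tensorCochain (diagonalResolution k Λ))).inv (tensorCochain X) ≫
    (Functor.associator (derivedTensorCochain Y) (tensorCochain (diagonalResolution k Λ))
      (tensorCochain X)).hom) ℤ)

/-- Associativity of the derived tensor product. -/
noncomputable def derivedTensorFunctorComp (X Y : CochainComplex (BimoduleCat k Λ) ℤ) :
    derivedTensorFunctor (derivedTensor X Y) ≅ derivedTensorFunctor Y ⋙ derivedTensorFunctor X :=
  derivedDescIso (derivedTensorFunctorFac (derivedTensor X Y) ≪≫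
    Functor.isoWhiskerRight (derivedTensorCochainComp X Y) DerivedCategory.Q ≪≫
    Functor.associator _ _ _ ≪≫
    Functor.isoWhiskerLeft (derivedTensorCochain Y) (derivedTensorFunctorFac X).symm ≪≫
    (Functor.associator _ _ _).symm ≪≫
    Functor.isoWhiskerRight (derivedTensorFunctorFac Y).symm (derivedTensorFunctor X) ≪≫
    Functor.associator _ _ _)

instance (X Y : CochainComplex (BimoduleCat k Λ) ℤ) :
    NatTrans.CommShift (derivedTensorFunctorComp X Y).hom ℤ := by
  have (Z : CochainComplex (BimoduleCat k Λ) ℤ) :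
      NatTrans.CommShift (derivedTensorFunctorFac Z).inv ℤ :=
    inferInstanceAs (NatTrans.CommShift (derivedTensorFunctorFac Z).symm.hom ℤ)
  unfold derivedTensorFunctorComp derivedDescIso
  dsimp only [Iso.trans_hom, Functor.isoWhiskerLeft_hom, Functor.isoWhiskerRight_hom, Iso.symm_hom]
  infer_instance

end DerivedTensorComp

/-! ## Tensor products with a complex in degree zero -/

section SingleTensor

open CochainComplex

variable {C₁ C₂ D : Type*} [Category* C₁] [Category* C₂] [Category* D] [HasZeroObject C₁]
  [Preadditive C₁] [Preadditive C₂] [Preadditive D] (F : C₁ ⥤ C₂ ⥤ D) [F.Additive]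
  [∀ X, (F.obj X).Additive] [∀ K L, HasMapBifunctor K L F] (N : C₁) (K L : CochainComplex C₂ ℤ)

/-- The summand of the tensor product with a complex concentrated in degree `0`. -/
noncomputable def singleMapBifunctorι (n : ℤ) : (F.obj N).obj (K.X n) ⟶
    (mapBifunctor ((HomologicalComplex.single C₁ (.up ℤ) 0).obj N) K F).X n :=
  (F.map (HomologicalComplex.singleObjXSelf (.up ℤ) 0 N).inv).app (K.X n) ≫
    ιMapBifunctor _ K F 0 n n (zero_add n)

/-- The projection to the summand of the tensor product with a complex concentrated in
degree `0`. -/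
noncomputable def singleMapBifunctorπ (n : ℤ) :
    (mapBifunctor ((HomologicalComplex.single C₁ (.up ℤ) 0).obj N) K F).X n ⟶
      (F.obj N).obj (K.X n) :=
  HomologicalComplex.mapBifunctorDesc (fun p q h =>
    if hp : p = 0 then
      (F.map (HomologicalComplex.singleObjXIsoOfEq (.up ℤ) 0 N p hp).hom).app (K.X q) ≫
        (F.obj N).map (K.XIsoOfEq (show q = n by change p + q = n at h; lia)).hom
    else 0)

lemma singleMapBifunctorι_π (n : ℤ) :
    singleMapBifunctorι F N K n ≫ singleMapBifunctorπ F N K n = 𝟙 _ := by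
  refine (Category.assoc _ _ _).trans ?_
  refine (congrArg (_ ≫ ·) (HomologicalComplex.ι_mapBifunctorDesc _ _ _ _)).trans ?_
  rw [dif_pos rfl, ← Category.assoc, ← NatTrans.comp_app, ← Functor.map_comp]
  erw [Iso.inv_hom_id]
  simp

lemma singleMapBifunctorπ_ι (n : ℤ) :
    singleMapBifunctorπ F N K n ≫ singleMapBifunctorι F N K n = 𝟙 _ :=
  HomologicalComplex.mapBifunctor.hom_ext fun p q h => by
    by_cases hp : p = 0
    · subst hp
      obtain rfl : q = n := by change 0 + q = n at h; lia
      rw [← Category.assoc]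
      refine (congrArg (· ≫ _) (HomologicalComplex.ι_mapBifunctorDesc _ _ _ _)).trans ?_
      rw [dif_pos rfl]
      have h₁ : (K.XIsoOfEq (rfl : q = q)).hom = 𝟙 _ := rfl
      have h₂ : (F.map (HomologicalComplex.singleObjXSelf (.up ℤ) 0 N).hom).app (K.X q) ≫
          (F.map (HomologicalComplex.singleObjXSelf (.up ℤ) 0 N).inv).app (K.X q) = 𝟙 _ := by
        rw [← NatTrans.comp_app, ← Functor.map_comp, Iso.hom_inv_id, CategoryTheory.Functor.map_id,
          NatTrans.id_app]
      rw [h₁, CategoryTheory.Functor.map_id, Category.comp_id, Category.comp_id]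
      refine (Category.assoc _ _ _).symm.trans ?_
      exact (congrArg (· ≫ ιMapBifunctor _ K F 0 q q (zero_add q)) h₂).trans (Category.id_comp _)
    · refine IsZero.eq_of_src ?_ _ _
      exact (((Functor.flip F).obj (K.X q)).map_isZero
        (HomologicalComplex.isZero_single_obj_X (.up ℤ) 0 N p hp))

lemma singleMapBifunctorι_d (n n' : ℤ) (h : n + 1 = n') :
    singleMapBifunctorι F N K n ≫ (mapBifunctor _ K F).d n n' =
      (F.obj N).map (K.d n n') ≫ singleMapBifunctorι F N K n' := by
  refine (Category.assoc _ _ _).trans ?_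
  refine (congrArg (_ ≫ ·) (ιMapBifunctor_d _ K F 0 n n (zero_add n) 1 n' n' rfl h h)).trans ?_
  rw [HomologicalComplex.single_obj_d, Functor.map_zero, zero_app, zero_comp, zero_add,
    Int.negOnePow_zero, one_smul, ← NatTrans.naturality_assoc]
  rfl

/-- The tensor product with a complex concentrated in degree `0` is computed degreewise. -/
noncomputable def singleMapBifunctorIso :
    ((F.obj N).mapHomologicalComplex (.up ℤ)).obj K ≅
      mapBifunctor ((HomologicalComplex.single C₁ (.up ℤ) 0).obj N) K F :=
  HomologicalComplex.Hom.isoOfComponents (fun n =>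
    { hom := singleMapBifunctorι F N K n
      inv := singleMapBifunctorπ F N K n
      hom_inv_id := singleMapBifunctorι_π F N K n
      inv_hom_id := singleMapBifunctorπ_ι F N K n })
        (fun i j h => singleMapBifunctorι_d F N K i j h)

variable {K L} in
lemma singleMapBifunctorι_naturality (f : K ⟶ L) (n : ℤ) :
    (F.obj N).map (f.f n) ≫ singleMapBifunctorι F N L n = singleMapBifunctorι F N K n ≫
      (HomologicalComplex.mapBifunctorMap (𝟙 _) f F (.up ℤ)).f n := by
  symm
  refine (Category.assoc _ _ _).trans ?_
  refine (congrArg (_ ≫ ·) (HomologicalComplex.ι_mapBifunctorMap (𝟙 _) f F (.up ℤ) 0 n n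
    (zero_add n))).trans ?_
  rw [HomologicalComplex.id_f, CategoryTheory.Functor.map_id, NatTrans.id_app, Category.id_comp,
    ← NatTrans.naturality_assoc]
  rfl

/-- The isomorphism `singleMapBifunctorIso` as an isomorphism of functors. -/
noncomputable def singleMap₂CochainComplexIso : (F.obj N).mapHomologicalComplex (.up ℤ) ≅
    F.map₂CochainComplex.obj ((HomologicalComplex.single C₁ (.up ℤ) 0).obj N) :=
  NatIso.ofComponents (singleMapBifunctorIso F N) (fun f => by
    ext n : 1
    exact singleMapBifunctorι_naturality F N f n)

/-- The Koszul sign `(-1) ^ (p y)` is trivial because only `p = 0` occurs. -/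
instance : NatTrans.CommShift (singleMap₂CochainComplexIso F N).hom ℤ where
  shift_comm y := by
    ext K n : 3
    have h := ι_mapBifunctorShift₂Iso (G := F) K ((HomologicalComplex.single C₁ (.up ℤ) 0).obj N)
      y 0 n n (zero_add n)
    rw [zero_mul, Int.negOnePow_zero, one_smul] at h
    refine (Category.id_comp _).trans ?_
    refine Eq.trans ?_ (Category.assoc _ _ _).symm
    exact (congrArg ((F.map (HomologicalComplex.singleObjXSelf (.up ℤ) 0 N).inv).app _ ≫ ·)
      h).symm

end SingleTensor

/-! ## Tensor products with a complex in degree zero, second variable -/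

section SingleTensorRight

open CochainComplex

variable {C₁ C₂ D : Type*} [Category* C₁] [Category* C₂] [Category* D] [HasZeroObject C₂]
  [Preadditive C₁] [Preadditive C₂] [Preadditive D] (F : C₁ ⥤ C₂ ⥤ D) [F.Additive]
  [∀ X, (F.obj X).Additive] [∀ K L, HasMapBifunctor K L F]
  (K L : CochainComplex C₁ ℤ) (N : C₂)

/-- The summand of the tensor product with a complex concentrated in degree `0`. -/
noncomputable def mapBifunctorSingleι (n : ℤ) : (F.flip.obj N).obj (K.X n) ⟶
    (mapBifunctor K ((HomologicalComplex.single C₂ (.up ℤ) 0).obj N) F).X n :=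
  (F.obj (K.X n)).map (HomologicalComplex.singleObjXSelf (.up ℤ) 0 N).inv ≫
    ιMapBifunctor K _ F n 0 n (add_zero n)

/-- The projection to the summand of the tensor product with a complex concentrated in
degree `0`. -/
noncomputable def mapBifunctorSingleπ (n : ℤ) :
    (mapBifunctor K ((HomologicalComplex.single C₂ (.up ℤ) 0).obj N) F).X n ⟶
      (F.flip.obj N).obj (K.X n) :=
  HomologicalComplex.mapBifunctorDesc (fun p q h =>
    if hq : q = 0 then
      (F.obj (K.X p)).map (HomologicalComplex.singleObjXIsoOfEq (.up ℤ) 0 N q hq).hom ≫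
        (F.flip.obj N).map (K.XIsoOfEq (show p = n by change p + q = n at h; lia)).hom
    else 0)

lemma mapBifunctorSingleι_π (n : ℤ) :
    mapBifunctorSingleι F K N n ≫ mapBifunctorSingleπ F K N n = 𝟙 _ := by
  refine (Category.assoc _ _ _).trans ?_
  refine (congrArg (_ ≫ ·) (HomologicalComplex.ι_mapBifunctorDesc _ _ _ _)).trans ?_
  rw [dif_pos rfl, ← Category.assoc, ← Functor.map_comp]
  erw [Iso.inv_hom_id]
  simp

lemma mapBifunctorSingleπ_ι (n : ℤ) :
    mapBifunctorSingleπ F K N n ≫ mapBifunctorSingleι F K N n = 𝟙 _ :=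
  HomologicalComplex.mapBifunctor.hom_ext fun p q h => by
    by_cases hq : q = 0
    · subst hq
      obtain rfl : p = n := by change p + 0 = n at h; lia
      rw [← Category.assoc]
      refine (congrArg (· ≫ _) (HomologicalComplex.ι_mapBifunctorDesc _ _ _ _)).trans ?_
      rw [dif_pos rfl]
      have h₁ : (K.XIsoOfEq (rfl : p = p)).hom = 𝟙 _ := rfl
      have h₂ : (F.obj (K.X p)).map (HomologicalComplex.singleObjXSelf (.up ℤ) 0 N).hom ≫
          (F.obj (K.X p)).map (HomologicalComplex.singleObjXSelf (.up ℤ) 0 N).inv = 𝟙 _ := by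
        rw [← Functor.map_comp, Iso.hom_inv_id, CategoryTheory.Functor.map_id]
      rw [h₁, CategoryTheory.Functor.map_id, Category.comp_id]
      refine (congrArg (· ≫ mapBifunctorSingleι F K N p) (Category.comp_id _)).trans ?_
      refine (Category.assoc _ _ _).symm.trans ?_
      exact (congrArg (· ≫ ιMapBifunctor K _ F p 0 p (add_zero p)) h₂).trans (Category.id_comp _)
    · refine IsZero.eq_of_src ?_ _ _
      exact ((F.obj (K.X p)).map_isZero
        (HomologicalComplex.isZero_single_obj_X (.up ℤ) 0 N q hq))

lemma mapBifunctorSingleι_d (n n' : ℤ) (h : n + 1 = n') :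
    mapBifunctorSingleι F K N n ≫ (mapBifunctor K _ F).d n n' =
      (F.flip.obj N).map (K.d n n') ≫ mapBifunctorSingleι F K N n' := by
  refine (Category.assoc _ _ _).trans ?_
  refine (congrArg (_ ≫ ·) (ιMapBifunctor_d K _ F n 0 n (add_zero n) n' 1 n' h rfl h)).trans ?_
  rw [HomologicalComplex.single_obj_d, Functor.map_zero, zero_comp, smul_zero, add_zero,
    NatTrans.naturality_assoc]
  rfl

/-- The tensor product with a complex concentrated in degree `0` is computed degreewise. -/
noncomputable def mapBifunctorSingleIso :
    ((F.flip.obj N).mapHomologicalComplex (.up ℤ)).obj K ≅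
      mapBifunctor K ((HomologicalComplex.single C₂ (.up ℤ) 0).obj N) F :=
  HomologicalComplex.Hom.isoOfComponents (fun n =>
    { hom := mapBifunctorSingleι F K N n
      inv := mapBifunctorSingleπ F K N n
      hom_inv_id := mapBifunctorSingleι_π F K N n
      inv_hom_id := mapBifunctorSingleπ_ι F K N n })
        (fun i j h => mapBifunctorSingleι_d F K N i j h)

variable {K L N} {N' : C₂}

lemma mapBifunctorSingleIso_hom_naturality_left (f : K ⟶ L) :
    ((F.flip.obj N).mapHomologicalComplex (.up ℤ)).map f ≫ (mapBifunctorSingleIso F L N).hom =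
      (mapBifunctorSingleIso F K N).hom ≫ (F.map₂CochainComplex.map f).app _ := by
  ext n : 1
  symm
  refine (Category.assoc _ _ _).trans ?_
  refine (congrArg (_ ≫ ·) (HomologicalComplex.ι_mapBifunctorMap f (𝟙 _) F (.up ℤ) n 0 n
    (add_zero n))).trans ?_
  rw [HomologicalComplex.id_f, CategoryTheory.Functor.map_id, Category.id_comp]
  refine (Category.assoc _ _ _).symm.trans ?_
  refine (congrArg (· ≫ ιMapBifunctor L _ F n 0 n (add_zero n))
    ((F.map (f.f n)).naturality _)).trans ?_
  exact Category.assoc _ _ _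

lemma mapBifunctorSingleIso_hom_naturality_right (g : N ⟶ N') :
    (NatTrans.mapHomologicalComplex (F.flip.map g) (.up ℤ)).app K ≫
        (mapBifunctorSingleIso F K N').hom =
      (mapBifunctorSingleIso F K N).hom ≫
        (F.map₂CochainComplex.obj K).map ((HomologicalComplex.single C₂ (.up ℤ) 0).map g) := by
  ext n : 1
  symm
  refine (Category.assoc _ _ _).trans ?_
  refine (congrArg (_ ≫ ·) (HomologicalComplex.ι_mapBifunctorMap (𝟙 _) _ F (.up ℤ) n 0 n
    (add_zero n))).trans ?_
  rw [HomologicalComplex.id_f, CategoryTheory.Functor.map_id, NatTrans.id_app, Category.id_comp]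
  have h : (HomologicalComplex.singleObjXSelf (.up ℤ) 0 N).inv ≫
      ((HomologicalComplex.single C₂ (.up ℤ) 0).map g).f 0 =
        g ≫ (HomologicalComplex.singleObjXSelf (.up ℤ) 0 N').inv := by
    rw [HomologicalComplex.single_map_f_self, Iso.inv_hom_id_assoc]
  have h' := congrArg (F.obj (K.X n)).map h
  rw [Functor.map_comp, Functor.map_comp] at h'
  refine (Category.assoc _ _ _).symm.trans ?_
  refine (congrArg (· ≫ ιMapBifunctor K _ F n 0 n (add_zero n)) h').trans ?_
  exact Category.assoc _ _ _

end SingleTensorRight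

lemma eq_units_smul_of_eq_units_smul {G : Type*} [AddCommGroup G] (e : ℤˣ) {a b : G}
    (h : b = e • a) : a = e • b := by
  rw [h, smul_smul, Int.units_mul_self, one_smul]

/-! ### Tensor products with a shifted complex and the sign of two shifts -/

section ShiftTensor

open CochainComplex

variable {C₁ C₂ D : Type*} [Category* C₁] [Category* C₂] [Category* D]
  [Preadditive C₁] [Preadditive C₂] [Preadditive D] (F : C₁ ⥤ C₂ ⥤ D) [F.Additive]
  [∀ X, (F.obj X).Additive] [∀ K L, HasMapBifunctor K L F]
  (K : CochainComplex C₁ ℤ)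

/-- The tensor product with a shifted complex. -/
noncomputable def map₂CochainComplexShiftIso (x : ℤ) :
    F.map₂CochainComplex.obj (K⟦x⟧) ≅
      F.map₂CochainComplex.obj K ⋙ shiftFunctor (CochainComplex D ℤ) x :=
  NatIso.ofComponents (fun M => mapBifunctorShift₁Iso K M F x) (fun {M M'} g => by
    have h := NatTrans.shift_app_comm (F.map₂CochainComplex.flip.map g) x K
    exact h.symm)

/-- Pulling out shifts of the two factors in the two possible orders gives results that differ by
`(-1) ^ (x y)`. For `y = 1` this is the origin of the sign `(-1) ^ N` with which `Λ[N]` acts. -/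
lemma map₂CochainComplexShiftIso_hom_app_shift (x y : ℤ) (M : CochainComplex C₂ ℤ) :
    ((F.map₂CochainComplex.obj (K⟦x⟧)).commShiftIso y).hom.app M ≫
        ((map₂CochainComplexShiftIso F K x).hom.app M)⟦y⟧' =
      (x * y).negOnePow • ((map₂CochainComplexShiftIso F K x).hom.app (M⟦y⟧) ≫
        (((F.map₂CochainComplex.obj K).commShiftIso y).hom.app M)⟦x⟧' ≫
          (shiftFunctorComm (CochainComplex D ℤ) x y).inv.app _) := by
  have h := congrArg Iso.hom (mapBifunctorShift₁Iso_trans_mapBifunctorShift₂Iso K M F x y)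
  have h' := congrArg (· ≫ (shiftFunctorComm (CochainComplex D ℤ) x y).inv.app _) h
  have h₁ : ((x * y).negOnePow • (mapBifunctorShift₂Iso (K⟦x⟧) M F y ≪≫
        (CategoryTheory.shiftFunctor _ y).mapIso (mapBifunctorShift₁Iso K M F x) ≪≫
          (shiftFunctorComm (CochainComplex D ℤ) x y).app _)).hom ≫
          (shiftFunctorComm (CochainComplex D ℤ) x y).inv.app _ = (x * y).negOnePow •
      (((F.map₂CochainComplex.obj (K⟦x⟧)).commShiftIso y).hom.app M ≫
        ((map₂CochainComplexShiftIso F K x).hom.app M)⟦y⟧') := by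
    refine (Linear.units_smul_comp _ _ _).trans (congrArg ((x * y).negOnePow • ·) ?_)
    refine (Category.assoc _ _ _).trans (congrArg (_ ≫ ·) ?_)
    refine (Category.assoc _ _ _).trans ?_
    exact (congrArg (_ ≫ ·) ((shiftFunctorComm (CochainComplex D ℤ) x y).hom_inv_id_app _)).trans
      (Category.comp_id _)
  exact (eq_units_smul_of_eq_units_smul _ (h'.trans h₁)).trans
    (congrArg ((x * y).negOnePow • ·) (Category.assoc _ _ _))

end ShiftTensor

/-! ### The regular bimodule as a unit for tensor products of complexes -/

section Unit

open scoped ModuleCat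

variable {k : Type u} [Field k] {Λ : Type u} [Ring Λ] [Algebra k Λ]

instance {C D : Type*} [Category* C] [Category* D] [Preadditive C] [Preadditive D] {F G : C ⥤ D}
    [F.Additive] [G.Additive] (α : F ⟶ G) :
    NatTrans.CommShift (NatTrans.mapHomologicalComplex α (.up ℤ)) ℤ where
  shift_comm n := by
    ext K i
    exact (Category.id_comp _).trans (Category.comp_id _).symm

instance {C : Type*} [Category* C] [Preadditive C] :
    NatTrans.CommShift (Functor.mapHomologicalComplexIdIso C (.up ℤ)).hom ℤ where
  shift_comm n := by
    ext K i
    simp [Functor.mapHomologicalComplexIdIso]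
    exact Category.id_comp _

/-- The regular bimodule is a unit for the tensor product of complexes. -/
noncomputable def tensorCochainUnitor : tensorCochain (regularComplex k Λ) ≅ 𝟭 _ :=
  (singleMap₂CochainComplexIso (tensorModBifunctor k Λ) (regularBimod k Λ)).symm ≪≫
    NatIso.mapHomologicalComplex (tensorModLeftUnitor k Λ) (.up ℤ) ≪≫
    Functor.mapHomologicalComplexIdIso (ModuleCat.{u} Λ) (.up ℤ)

instance : NatTrans.CommShift (tensorCochainUnitor (k := k) (Λ := Λ)).hom ℤ := by
  have : NatTrans.CommShift
      (singleMap₂CochainComplexIso (tensorModBifunctor k Λ) (regularBimod k Λ)).inv ℤ :=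
    inferInstanceAs (NatTrans.CommShift
      (singleMap₂CochainComplexIso (tensorModBifunctor k Λ) (regularBimod k Λ)).symm.hom ℤ)
  exact inferInstanceAs (NatTrans.CommShift
    ((singleMap₂CochainComplexIso (tensorModBifunctor k Λ) (regularBimod k Λ)).inv ≫
    NatTrans.mapHomologicalComplex (tensorModLeftUnitor k Λ).hom (.up ℤ) ≫
    (Functor.mapHomologicalComplexIdIso (ModuleCat.{u} Λ) (.up ℤ)).hom) ℤ)

/-- The augmentation `B ⊗_Λ K ⟶ K`. -/
noncomputable def tensorCochainAugmentation : tensorCochain (diagonalResolution k Λ) ⟶ 𝟭 _ :=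
  tensorCochainMap augmentation ≫ tensorCochainUnitor.hom

instance : NatTrans.CommShift (tensorCochainAugmentation (k := k) (Λ := Λ)) ℤ :=
  inferInstanceAs (NatTrans.CommShift
    (tensorCochainMap (augmentation (k := k) (Λ := Λ)) ≫ tensorCochainUnitor.hom) ℤ)

/-- The natural transformation `X ⊗_Λ (B ⊗_Λ K) ⟶ X ⊗_Λ K`. -/
noncomputable def derivedTensorCochainCounit (X : CochainComplex (BimoduleCat k Λ) ℤ) :
    derivedTensorCochain X ⟶ tensorCochain X :=
  Functor.whiskerRight tensorCochainAugmentation (tensorCochain X) ≫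
    (tensorCochain X).leftUnitor.hom

instance (X : CochainComplex (BimoduleCat k Λ) ℤ) :
    NatTrans.CommShift (derivedTensorCochainCounit X) ℤ :=
  inferInstanceAs (NatTrans.CommShift
    (Functor.whiskerRight tensorCochainAugmentation (tensorCochain X) ≫
      (tensorCochain X).leftUnitor.hom) ℤ)

end Unit

/-! ## Dévissage in triangulated categories -/

section TriangulatedClass

open Pretriangulated

variable {T : Type*} [Category* T] [Preadditive T] [HasZeroObject T] [HasShift T ℤ]
  [∀ n : ℤ, (shiftFunctor T n).Additive] [Pretriangulated T]

/-- A class of objects which is closed under isomorphisms, shifts and cones. -/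
structure IsTriangulatedClass (P : ObjectProperty T) : Prop where
  of_iso {X Y : T} (e : X ≅ Y) : P X → P Y
  shift {X : T} (n : ℤ) : P X → P (X⟦n⟧)
  cone {A : Triangle T} (hA : A ∈ distTriang T) : P A.obj₁ → P A.obj₂ → P A.obj₃

namespace IsTriangulatedClass

variable {P : ObjectProperty T} (hP : IsTriangulatedClass P)
include hP

lemma of_shift {X : T} (n : ℤ) (h : P (X⟦n⟧)) : P X :=
  hP.of_iso ((shiftEquiv T n).unitIso.symm.app X) (hP.shift (-n) h)

lemma middle {A : Triangle T} (hA : A ∈ distTriang T) (h₁ : P A.obj₁) (h₃ : P A.obj₃) :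
    P A.obj₂ :=
  hP.cone (inv_rot_of_distTriang _ hA) (hP.shift (-1) h₃) h₁

lemma first {A : Triangle T} (hA : A ∈ distTriang T) (h₂ : P A.obj₂) (h₃ : P A.obj₃) :
    P A.obj₁ :=
  hP.of_shift 1 (hP.cone (rot_of_distTriang _ hA) h₂ h₃)

end IsTriangulatedClass

/-- A condition which satisfies the five lemma for each distinguished triangle defines a
triangulated class when it is imposed on all shifts of an object. -/
lemma isTriangulatedClass_forall_shift {b : ObjectProperty T}
    (hiso : ∀ {X Y : T}, (X ≅ Y) → b X → b Y)
    (h : ∀ {A : Triangle T}, A ∈ distTriang T → b A.obj₁ → b A.obj₂ → b (A.obj₁⟦(1 : ℤ)⟧) →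
      b (A.obj₂⟦(1 : ℤ)⟧) → b A.obj₃) :
    IsTriangulatedClass (fun X : T => ∀ n : ℤ, b (X⟦n⟧)) where
  of_iso e hX n := hiso ((shiftFunctor T n).mapIso e) (hX n)
  shift {X} m hX n := hiso ((shiftFunctorAdd T m n).app X) (hX (m + n))
  cone {A} hA h₁ h₂ n := h (Triangle.shift_distinguished A hA n) (h₁ n) (h₂ n)
    (hiso ((shiftFunctorAdd T n 1).app A.obj₁) (h₁ (n + 1)))
    (hiso ((shiftFunctorAdd T n 1).app A.obj₂) (h₂ (n + 1)))

/-- The five lemma for a natural transformation between covariant half-exact functors. -/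
lemma bijective_of_distinguished_covariant {V W : T → Type*} [∀ X, AddCommGroup (V X)]
    [∀ X, AddCommGroup (W X)] (f : ∀ {X Y : T}, (X ⟶ Y) → (V X →+ V Y))
    (g : ∀ {X Y : T}, (X ⟶ Y) → (W X →+ W Y)) (t : ∀ X, V X →+ W X)
    (ht : ∀ {X Y : T} (a : X ⟶ Y) (x : V X), t Y (f a x) = g a (t X x))
    (hf : ∀ {A : Triangle T}, A ∈ distTriang T → Function.Exact (f A.mor₁) (f A.mor₂))
    (hg : ∀ {A : Triangle T}, A ∈ distTriang T → Function.Exact (g A.mor₁) (g A.mor₂))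
    {A : Triangle T} (hA : A ∈ distTriang T) (h₁ : Function.Bijective (t A.obj₁))
    (h₂ : Function.Bijective (t A.obj₂)) (h₃ : Function.Bijective (t (A.obj₁⟦(1 : ℤ)⟧)))
    (h₄ : Function.Bijective (t (A.obj₂⟦(1 : ℤ)⟧))) : Function.Bijective (t A.obj₃) := by
  have hA' := rot_of_distTriang _ hA
  have hA'' := rot_of_distTriang _ hA'
  exact AddMonoidHom.bijective_of_surjective_of_bijective_of_bijective_of_injective
    (f A.mor₁) (f A.mor₂) (f A.mor₃) (f (-A.mor₁⟦(1 : ℤ)⟧'))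
    (g A.mor₁) (g A.mor₂) (g A.mor₃) (g (-A.mor₁⟦(1 : ℤ)⟧')) _ _ _ _ _
    (AddMonoidHom.ext fun x => (ht _ x).symm) (AddMonoidHom.ext fun x => (ht _ x).symm)
    (AddMonoidHom.ext fun x => (ht _ x).symm) (AddMonoidHom.ext fun x => (ht _ x).symm)
    (hf hA) (hf hA') (hf hA'') (hg hA) (hg hA') (hg hA'') h₁.2 h₂ h₃ h₄.1

/-- The five lemma for a natural transformation between contravariant half-exact functors, which
is defined on a class of objects. -/
lemma bijective_of_distinguished_contravariant {p : ObjectProperty T} {V W : T → Type*}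
    [∀ X, AddCommGroup (V X)]
    [∀ X, AddCommGroup (W X)] (f : ∀ {X Y : T}, (X ⟶ Y) → (V Y →+ V X))
    (g : ∀ {X Y : T}, (X ⟶ Y) → (W Y →+ W X)) (t : ∀ X, p X → (V X →+ W X))
    (ht : ∀ {X Y : T} (hX : p X) (hY : p Y) (a : X ⟶ Y) (y : V Y),
      t X hX (f a y) = g a (t Y hY y))
    (hf : ∀ {A : Triangle T}, A ∈ distTriang T → Function.Exact (f A.mor₂) (f A.mor₁))
    (hg : ∀ {A : Triangle T}, A ∈ distTriang T → Function.Exact (g A.mor₂) (g A.mor₁))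
    {A : Triangle T} (hA : A ∈ distTriang T) (p₁ : p A.obj₁) (p₂ : p A.obj₂) (p₃ : p A.obj₃)
    (p₄ : p (A.obj₁⟦(1 : ℤ)⟧)) (p₅ : p (A.obj₂⟦(1 : ℤ)⟧))
    (h₁ : Function.Bijective (t A.obj₁ p₁))
    (h₂ : Function.Bijective (t A.obj₂ p₂)) (h₃ : Function.Bijective (t (A.obj₁⟦(1 : ℤ)⟧) p₄))
    (h₄ : Function.Bijective (t (A.obj₂⟦(1 : ℤ)⟧) p₅)) : Function.Bijective (t A.obj₃ p₃) := by
  have hA' := rot_of_distTriang _ hA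
  have hA'' := rot_of_distTriang _ hA'
  exact AddMonoidHom.bijective_of_surjective_of_bijective_of_bijective_of_injective
    (f (-A.mor₁⟦(1 : ℤ)⟧')) (f A.mor₃) (f A.mor₂) (f A.mor₁)
    (g (-A.mor₁⟦(1 : ℤ)⟧')) (g A.mor₃) (g A.mor₂) (g A.mor₁) _ _ _ _ _
    (AddMonoidHom.ext fun x => (ht _ _ _ x).symm) (AddMonoidHom.ext fun x => (ht _ _ _ x).symm)
    (AddMonoidHom.ext fun x => (ht _ _ _ x).symm) (AddMonoidHom.ext fun x => (ht _ _ _ x).symm)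
    (hf hA'') (hf hA') (hf hA) (hg hA'') (hg hA') (hg hA) h₄.2 h₃ h₂ h₁.1

end TriangulatedClass

/-! ### Generating the bounded derived category by modules of special kinds -/

section Devissage

open Pretriangulated DerivedCategory

variable {R : Type u} [Ring R]

/-- The image of a module in the derived category, in degree `0`. -/
noncomputable abbrev derivedSingle (M : ModuleCat.{u} R) : DerivedCategory (ModuleCat.{u} R) :=
  (DerivedCategory.singleFunctor (ModuleCat.{u} R) 0).obj M

/-- The homology of a module in degree `0`. -/
noncomputable def derivedSingleHomologyIso (M : ModuleCat.{u} R) (n : ℤ) :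
    (DerivedCategory.homologyFunctor (ModuleCat.{u} R) n).obj
      ((DerivedCategory.singleFunctor (ModuleCat.{u} R) n).obj M) ≅ M :=
  (singleFunctorCompHomologyFunctorIso (ModuleCat.{u} R) n).app M

lemma IsTriangulatedClass.single {P : ObjectProperty (DerivedCategory (ModuleCat.{u} R))}
    (hP : IsTriangulatedClass P) {M : ModuleCat.{u} R} (h : P (derivedSingle M)) (n : ℤ) :
    P ((DerivedCategory.singleFunctor (ModuleCat.{u} R) n).obj M) :=
  hP.of_shift n (hP.of_iso (((DerivedCategory.singleFunctors (ModuleCat.{u} R)).shiftIso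
    n 0 n (add_zero n)).symm.app M) h)

lemma finite_of_mono [IsNoetherianRing R] {M N : ModuleCat.{u} R} (f : M ⟶ N) [Mono f]
    [Module.Finite R N] :
    Module.Finite R M :=
  Module.Finite.of_injective f.hom ((ModuleCat.mono_iff_injective f).1 inferInstance)

lemma finite_of_epi {M N : ModuleCat.{u} R} (f : M ⟶ N) [Epi f] [Module.Finite R M] :
    Module.Finite R N :=
  Module.Finite.of_surjective f.hom ((ModuleCat.epi_iff_surjective f).1 inferInstance)

lemma finite_of_isZero {M : ModuleCat.{u} R} (h : IsZero M) : Module.Finite R M := by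
  have := ModuleCat.subsingleton_of_isZero h
  infer_instance

lemma isZero_of_isGE_of_isLE_sub (X : DerivedCategory (ModuleCat.{u} R)) (a b : ℤ) (h : b < a)
    [X.IsGE a] [X.IsLE b] : IsZero X :=
  TStructure.t.isZero X b a h

/-- Induction on the number `n` of degrees in which cohomology may live: a truncation triangle
splits off the top cohomology as a shifted module. For `n = 0` the range of degrees is empty and the
object is zero. -/
lemma IsTriangulatedClass.of_amplitude [IsNoetherianRing R]
    {P : ObjectProperty (DerivedCategory (ModuleCat.{u} R))}
    (hP : IsTriangulatedClass P)
    (h : ∀ M : ModuleCat.{u} R, Module.Finite R M → P (derivedSingle M)) (a : ℤ) (n : ℕ) :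
    ∀ (X : DerivedCategory (ModuleCat.{u} R)) (_ : X.IsGE a) (_ : X.IsLE (a + n - 1))
      (_ : ∀ i : ℤ, Module.Finite R ((DerivedCategory.homologyFunctor (ModuleCat.{u} R) i).obj X)),
        P X := by
  induction n with
  | zero =>
    intro X _ hX _
    have : X.IsLE (a - 1) := by simpa using hX
    have h₁ : IsZero X := isZero_of_isGE_of_isLE_sub X a (a - 1) (by lia)
    have h₂ : IsZero (derivedSingle (ModuleCat.of R PUnit.{u + 1})) :=
      (DerivedCategory.singleFunctor (ModuleCat.{u} R) 0).map_isZero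
        (ModuleCat.isZero_of_subsingleton _)
    exact hP.of_iso (h₂.iso h₁) (h _ inferInstance)
  | succ n ih =>
    intro X _ hX hfin
    have : X.IsLE (a + n) := by
      have : a + (n + 1 : ℕ) - 1 = a + n := by push_cast; ring
      rwa [this] at hX
    -- The long exact sequence shows that `Y` has the smaller amplitude and that `Z` lives in the
    -- single degree `a + n`. Cohomology of `Y` embeds into that of `X`, so finite generation uses
    -- that `R` is noetherian; cohomology of `Z` is a quotient of that of `X`.
    obtain ⟨Y, Z, hY, hZ, f, g, δ, hT⟩ :=
      TStructure.t.exists_triangle X (a + n - 1) (a + n) (by lia)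
    have : Y.IsLE (a + n - 1) := ⟨hY⟩
    have : Z.IsGE (a + n) := ⟨hZ⟩
    have hZ' : Z.IsLE (a + n) := by
      rw [isLE_iff]
      intro i hi
      have := HomologySequence.exact₃ _ hT i (i + 1)
      exact this.isZero_of_both_zeros ((X.isZero_of_isLE (a + n) i hi).eq_of_src _ _)
        ((Y.isZero_of_isLE (a + n - 1) (i + 1) (by lia)).eq_of_tgt _ _)
    have hY' : Y.IsGE a := by
      rw [isGE_iff]
      intro i hi
      have := HomologySequence.exact₁ _ hT (i - 1) i (by lia)
      exact this.isZero_of_both_zeros ((Z.isZero_of_isGE (a + n) (i - 1) (by lia)).eq_of_src _ _)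
        ((X.isZero_of_isGE a i hi).eq_of_tgt _ _)
    have fY (i : ℤ) : Module.Finite R ((DerivedCategory.homologyFunctor (ModuleCat.{u} R) i).obj Y)
        := by
      by_cases hi : i ≤ a + n - 1
      · have : Mono ((DerivedCategory.homologyFunctor (ModuleCat.{u} R) i).map f) :=
          (HomologySequence.mono_homologyMap_mor₁_iff _ hT (i - 1) i (by lia)).2
            ((Z.isZero_of_isGE (a + n) (i - 1) (by lia)).eq_of_src _ _)
        have := hfin i
        exact finite_of_mono ((DerivedCategory.homologyFunctor (ModuleCat.{u} R) i).map f)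
      · exact finite_of_isZero (Y.isZero_of_isLE (a + n - 1) i (by lia))
    have fZ : Module.Finite R ((DerivedCategory.homologyFunctor (ModuleCat.{u} R) (a + n)).obj Z)
        := by
      have : Epi ((DerivedCategory.homologyFunctor (ModuleCat.{u} R) (a + n)).map g) :=
        (HomologySequence.epi_homologyMap_mor₂_iff _ hT (a + n) (a + n + 1)).2
          ((Y.isZero_of_isLE (a + n - 1) (a + n + 1) (by lia)).eq_of_tgt _ _)
      have := hfin (a + n)
      exact finite_of_epi ((DerivedCategory.homologyFunctor (ModuleCat.{u} R) (a + n)).map g)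
    obtain ⟨M, ⟨e⟩⟩ := Z.exists_iso_singleFunctor_obj_of_isGE_of_isLE (a + n)
    have fM : Module.Finite R M := Module.Finite.equiv
      ((DerivedCategory.homologyFunctor (ModuleCat.{u} R) (a + n)).mapIso e ≪≫
        derivedSingleHomologyIso M (a + n)).toLinearEquiv
    exact hP.middle hT (ih Y hY' inferInstance fY) (hP.of_iso e.symm (hP.single (h M fM) _))

/-- A triangulated class which contains all finitely generated modules contains all objects with
bounded and finitely generated cohomology. -/
theorem IsTriangulatedClass.of_finite [IsNoetherianRing R]
    {P : ObjectProperty (DerivedCategory (ModuleCat.{u} R))}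
    (hP : IsTriangulatedClass P)
    (h : ∀ M : ModuleCat.{u} R, Module.Finite R M → P (derivedSingle M)) : finiteBounded R ≤ P := by
  rintro X ⟨⟨⟨a, ha⟩, ⟨b, hb⟩⟩, hfin⟩
  refine hP.of_amplitude h a (b - a + 1).toNat X ha ?_ hfin
  exact TStructure.t.isLE_of_le X b _ (by lia)

lemma moduleCat_shortExact {M N L : Type u} [AddCommGroup M] [AddCommGroup N] [AddCommGroup L]
    [Module R M] [Module R N] [Module R L] (f : M →ₗ[R] N) (g : N →ₗ[R] L)
    (hf : Function.Injective f) (hg : Function.Surjective g) (h : Function.Exact f g) :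
    (ShortComplex.mk (ModuleCat.ofHom f) (ModuleCat.ofHom g) (by
      ext x; exact h.apply_apply_eq_zero x)).ShortExact where
  exact := by
    rw [ShortComplex.moduleCat_exact_iff]
    exact fun x hx => (h x).1 hx
  mono_f := (ModuleCat.mono_iff_injective _).2 hf
  epi_g := (ModuleCat.epi_iff_surjective _).2 hg

lemma finiteBounded_derivedSingle (M : ModuleCat.{u} R) [Module.Finite R M] :
    finiteBounded R (derivedSingle M) := by
  refine ⟨⟨⟨0, inferInstance⟩, ⟨0, inferInstance⟩⟩, fun n => ?_⟩
  by_cases hn : n = 0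
  · subst hn
    exact Module.Finite.equiv (derivedSingleHomologyIso M 0).toLinearEquiv.symm
  · rcases lt_or_gt_of_ne hn with hn | hn
    · exact finite_of_isZero ((derivedSingle M).isZero_of_isGE 0 n hn)
    · exact finite_of_isZero ((derivedSingle M).isZero_of_isLE 0 n hn)

/-- Dimension shifting: the kernel of a cover by a finite free module is finitely generated and has
smaller projective dimension, and the module is the cone of the inclusion of this kernel. -/
lemma IsTriangulatedClass.of_hasProjectiveDimensionLE [IsNoetherianRing R]
    {P : ObjectProperty (DerivedCategory (ModuleCat.{u} R))} (hP : IsTriangulatedClass P)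
    (h : ∀ M : ModuleCat.{u} R, Module.Finite R M → Projective M → P (derivedSingle M)) (d : ℕ) :
    ∀ M : ModuleCat.{u} R, Module.Finite R M → HasProjectiveDimensionLT M (d + 1) →
      P (derivedSingle M) := by
  induction d with
  | zero => exact fun M hM hd => h M hM (projective_iff_hasProjectiveDimensionLT_one.2 hd)
  | succ d ih =>
    intro M hM hd
    obtain ⟨n, p, hp⟩ := Module.Finite.exists_fin' R M
    have hS := moduleCat_shortExact (LinearMap.ker p).subtype p Subtype.val_injective hp
      (fun x => by simp)
    have hproj : Projective (ModuleCat.of R (Fin n → R)) :=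
      ModuleCat.projective_of_free (Pi.basisFun R (Fin n))
    have hK := (hS.hasProjectiveDimensionLT_X₃_iff d hproj).1 hd
    refine hP.cone hS.singleTriangle_distinguished (ih _ ?_ hK) (h _ ?_ hproj)
    · exact inferInstanceAs (Module.Finite R (LinearMap.ker p))
    · exact inferInstanceAs (Module.Finite R (Fin n → R))

/-- Over a noetherian ring of finite global dimension, a triangulated class which contains all
finitely generated projective modules contains all objects with bounded and finitely generated
cohomology. -/
theorem IsTriangulatedClass.of_projective [IsNoetherianRing R] (hR : HasFiniteGlobalDimension R)
    {P : ObjectProperty (DerivedCategory (ModuleCat.{u} R))} (hP : IsTriangulatedClass P)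
    (h : ∀ M : ModuleCat.{u} R, Module.Finite R M → Projective M → P (derivedSingle M)) :
    finiteBounded R ≤ P := by
  obtain ⟨d, hd⟩ := hR
  exact hP.of_finite fun M hM => hP.of_hasProjectiveDimensionLE h d M hM (hd M)

lemma IsTriangulatedClass.of_free {P : ObjectProperty (DerivedCategory (ModuleCat.{u} R))}
    (hP : IsTriangulatedClass P) (h : P (derivedSingle (ModuleCat.of R R))) (n : ℕ) :
    P (derivedSingle (ModuleCat.of R (Fin n → R))) := by
  induction n with
  | zero =>
    have h₁ : IsZero (derivedSingle (ModuleCat.of R (Fin 0 → R))) :=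
      (DerivedCategory.singleFunctor (ModuleCat.{u} R) 0).map_isZero
        (ModuleCat.isZero_of_subsingleton _)
    -- The class contains zero, as the cone of an identity morphism.
    have h₂ := hP.cone (contractible_distinguished (derivedSingle (ModuleCat.of R R))) h h
    exact hP.of_iso ((isZero_zero _).iso h₁) h₂
  | succ n ih =>
    have hS := moduleCat_shortExact (LinearMap.single R (fun _ : Fin (n + 1) => R) 0)
      (LinearMap.funLeft R R (Fin.succ : Fin n → Fin (n + 1)))
      (Pi.single_injective (M := fun _ : Fin (n + 1) => R) 0)
        (LinearMap.funLeft_surjective_of_injective _ _ _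
        (Fin.succ_injective n)) (fun x => ⟨fun hx => ⟨x 0, ?_⟩, ?_⟩)
    · exact hP.middle hS.singleTriangle_distinguished h ih
    · ext i
      refine Fin.cases ?_ (fun j => ?_) i
      · simp
      · have := congrFun hx j
        simp only [LinearMap.funLeft_apply, Pi.zero_apply] at this
        simp [this]
    · rintro ⟨y, rfl⟩
      ext j
      simp [LinearMap.funLeft_apply]

/-- Over a noetherian ring of finite global dimension, a triangulated class which is closed under
retracts and contains the regular module contains all objects with bounded and finitely generated
cohomology. -/
theorem IsTriangulatedClass.of_regular [IsNoetherianRing R] (hR : HasFiniteGlobalDimension R)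
    {P : ObjectProperty (DerivedCategory (ModuleCat.{u} R))} (hP : IsTriangulatedClass P)
    (hret : ∀ {X Y : DerivedCategory (ModuleCat.{u} R)}, Retract X Y → P Y → P X)
    (h : P (derivedSingle (ModuleCat.of R R))) : finiteBounded R ≤ P := by
  refine hP.of_projective hR fun M hM hM' => ?_
  obtain ⟨n, p, hp⟩ := Module.Finite.exists_fin' R M
  have : Epi (ModuleCat.ofHom p) := (ModuleCat.epi_iff_surjective _).2 hp
  let r : Retract M (ModuleCat.of R (Fin n → R)) :=
    { i := Projective.factorThru (𝟙 M) (ModuleCat.ofHom p)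
      r := ModuleCat.ofHom p
      retract := Projective.factorThru_comp _ _ }
  exact hret (r.map (DerivedCategory.singleFunctor (ModuleCat.{u} R) 0)) (hP.of_free h n)

/-- The dual statement for injective modules. -/
lemma IsTriangulatedClass.of_hasInjectiveDimensionLE
    {P : ObjectProperty (DerivedCategory (ModuleCat.{u} R))} (hP : IsTriangulatedClass P)
    (h : ∀ M : ModuleCat.{u} R, Module.Finite R M → Injective M → P (derivedSingle M))
    (hinj : ∀ M : ModuleCat.{u} R, Module.Finite R M →
      ∃ (I : ModuleCat.{u} R) (_ : Module.Finite R I) (_ : Injective I) (i : M ⟶ I), Mono i)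
    (d : ℕ) :
    ∀ M : ModuleCat.{u} R, Module.Finite R M → HasInjectiveDimensionLT M (d + 1) →
      P (derivedSingle M) := by
  induction d with
  | zero => exact fun M hM hd => h M hM (injective_iff_hasInjectiveDimensionLT_one.2 hd)
  | succ d ih =>
    intro M hM hd
    obtain ⟨I, hI, hI', i, hi⟩ := hinj M hM
    have hS := moduleCat_shortExact i.hom (LinearMap.range i.hom).mkQ
      ((ModuleCat.mono_iff_injective i).1 hi) (Submodule.mkQ_surjective _)
      (fun x => by simp)
    have hK := (hS.hasInjectiveDimensionLT_X₃_iff d hI').2 hd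
    refine hP.first hS.singleTriangle_distinguished (h I hI hI') (ih _ ?_ hK)
    exact inferInstanceAs (Module.Finite R (I ⧸ LinearMap.range i.hom))

/-- A uniform bound on projective dimensions and one on injective dimensions both say that `Ext`
vanishes in high degrees for all pairs of modules. -/
lemma hasInjectiveDimensionLT_of_projective (n : ℕ)
    (h : ∀ M : ModuleCat.{u} R, HasProjectiveDimensionLT M n) (M : ModuleCat.{u} R) :
    HasInjectiveDimensionLT M n := by
  let := HasExt.standard (ModuleCat.{u} R)
  rw [hasInjectiveDimensionLT_iff]
  exact fun i hi Y e => e.eq_zero_of_hasProjectiveDimensionLT n hi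

/-- The dual statement for injective modules. -/
theorem IsTriangulatedClass.of_injective [IsNoetherianRing R] (hR : HasFiniteGlobalDimension R)
    {P : ObjectProperty (DerivedCategory (ModuleCat.{u} R))} (hP : IsTriangulatedClass P)
    (h : ∀ M : ModuleCat.{u} R, Module.Finite R M → Injective M → P (derivedSingle M))
    (hinj : ∀ M : ModuleCat.{u} R, Module.Finite R M →
      ∃ (I : ModuleCat.{u} R) (_ : Module.Finite R I) (_ : Injective I) (i : M ⟶ I), Mono i) :
    finiteBounded R ≤ P := by
  obtain ⟨d, hd⟩ := hR
  exact hP.of_finite fun M hM => hP.of_hasInjectiveDimensionLE h hinj d M hM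
    (hasInjectiveDimensionLT_of_projective (d + 1) hd M)

/-- The objects with bounded and finitely generated cohomology form a triangulated class. -/
lemma isTriangulatedClass_finiteBounded [IsNoetherianRing R] : IsTriangulatedClass
    (finiteBounded R) where
  of_iso e hX := ⟨TStructure.t.bounded.prop_of_iso e hX.1, fun n => by
    have := hX.2 n
    exact Module.Finite.equiv
      ((DerivedCategory.homologyFunctor (ModuleCat.{u} R) n).mapIso e).toLinearEquiv⟩
  shift n hX := ObjectProperty.le_shift _ n _ hX
  cone {A} hA h₁ h₂ := by
    obtain ⟨⟨⟨a₁, i₁⟩, ⟨b₁, j₁⟩⟩, f₁⟩ := h₁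
    obtain ⟨⟨⟨a₂, i₂⟩, ⟨b₂, j₂⟩⟩, f₂⟩ := h₂
    have : A.obj₁.IsGE a₁ := i₁
    have : A.obj₁.IsLE b₁ := j₁
    have : A.obj₂.IsGE a₂ := i₂
    have : A.obj₂.IsLE b₂ := j₂
    refine ⟨⟨⟨min (a₁ - 1) a₂, ?_⟩, ⟨max b₁ b₂, ?_⟩⟩, fun i => ?_⟩
    · refine (isGE_iff _ _).2 fun i hi => ?_
      exact (HomologySequence.exact₃ _ hA i (i + 1)).isZero_of_both_zeros
        ((A.obj₂.isZero_of_isGE a₂ i (by lia)).eq_of_src _ _)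
        ((A.obj₁.isZero_of_isGE a₁ (i + 1) (by lia)).eq_of_tgt _ _)
    · refine (isLE_iff _ _).2 fun i hi => ?_
      exact (HomologySequence.exact₃ _ hA i (i + 1)).isZero_of_both_zeros
        ((A.obj₂.isZero_of_isLE b₂ i (by lia)).eq_of_src _ _)
        ((A.obj₁.isZero_of_isLE b₁ (i + 1) (by lia)).eq_of_tgt _ _)
    · have hex := (ShortComplex.moduleCat_exact_iff_ker_sub_range _).1
        (HomologySequence.exact₃ _ hA i (i + 1))
      have := f₂ i
      have := f₁ (i + 1)
      have : IsNoetherian R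
          ((DerivedCategory.homologyFunctor (ModuleCat.{u} R) (i + 1)).obj A.obj₁) :=
        isNoetherian_of_isNoetherianRing_of_finite _ _
      have : IsNoetherian R ((DerivedCategory.homologyFunctor (ModuleCat.{u} R) i).obj A.obj₂) :=
        isNoetherian_of_isNoetherianRing_of_finite _ _
      have : IsNoetherian R ((DerivedCategory.homologyFunctor (ModuleCat.{u} R) i).obj A.obj₃) :=
        -- In the long exact sequence the cohomology of the cone lies between those of the other two
        -- objects, and an extension of noetherian modules is noetherian.
        isNoetherian_of_range_eq_ker
          ((DerivedCategory.homologyFunctor (ModuleCat.{u} R) i).map A.mor₂).hom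
          (HomologySequence.δ A i (i + 1)).hom
          (((ShortComplex.moduleCat_exact_iff_range_eq_ker _).1
            (HomologySequence.exact₃ _ hA i (i + 1))))
      exact Module.IsNoetherian.finite R _

/-- The objects with bounded and finitely generated cohomology are closed under retracts. -/
lemma finiteBounded_of_retract [IsNoetherianRing R] {X Y : DerivedCategory (ModuleCat.{u} R)}
    (r : Retract X Y)
    (hY : finiteBounded R Y) : finiteBounded R X := by
  obtain ⟨⟨⟨a, i₁⟩, ⟨b, j₁⟩⟩, hf⟩ := hY
  have : Y.IsGE a := i₁
  have : Y.IsLE b := j₁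
  have hz (n : ℤ) (h : IsZero ((DerivedCategory.homologyFunctor (ModuleCat.{u} R) n).obj Y)) :
      IsZero ((DerivedCategory.homologyFunctor (ModuleCat.{u} R) n).obj X) := by
    have r' := r.map (DerivedCategory.homologyFunctor (ModuleCat.{u} R) n)
    rw [IsZero.iff_id_eq_zero, ← r'.retract, h.eq_of_src r'.r 0, comp_zero]
  refine ⟨⟨⟨a, (isGE_iff _ _).2 fun i hi => hz i (Y.isZero_of_isGE a i hi)⟩,
    ⟨b, (isLE_iff _ _).2 fun i hi => hz i (Y.isZero_of_isLE b i hi)⟩⟩, fun n => ?_⟩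
  have := hf n
  exact finite_of_mono (r.map (DerivedCategory.homologyFunctor (ModuleCat.{u} R) n)).i

end Devissage

/-! ## Natural transformations between functors which preserve cones -/

section IsoApp

variable {T T' : Type*} [Category* T] [Category* T'] {F G : T ⥤ T'} (τ : F ⟶ G)

lemma isIso_app_of_iso {X Y : T} (e : X ≅ Y) (h : IsIso (τ.app X)) : IsIso (τ.app Y) := by
  have : τ.app Y = F.map e.inv ≫ τ.app X ≫ G.map e.hom := by
    rw [← τ.naturality, ← Functor.map_comp_assoc, e.inv_hom_id, CategoryTheory.Functor.map_id,
      Category.id_comp]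
  rw [this]
  infer_instance

lemma isIso_app_shift [HasShift T ℤ] [HasShift T' ℤ] [F.CommShift ℤ] [G.CommShift ℤ]
    [NatTrans.CommShift τ ℤ] {X : T} (n : ℤ) (h : IsIso (τ.app X)) : IsIso (τ.app (X⟦n⟧)) := by
  rw [NatTrans.app_shift τ n X]
  infer_instance

lemma isIso_app_of_retract {X Y : T} (r : Retract X Y) (h : IsIso (τ.app Y)) :
    IsIso (τ.app X) := by
  refine ⟨G.map r.i ≫ inv (τ.app Y) ≫ F.map r.r, ?_, ?_⟩
  · rw [← NatTrans.naturality_assoc, IsIso.hom_inv_id_assoc, ← Functor.map_comp, r.retract,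
      CategoryTheory.Functor.map_id]
  · rw [Category.assoc, Category.assoc, τ.naturality, IsIso.inv_hom_id_assoc, ← Functor.map_comp,
      r.retract, CategoryTheory.Functor.map_id]

lemma inv_comp_eq_of_comp_hom {A B A' B' : T} (e : A ≅ B) (e' : A' ≅ B') {f : A ⟶ A'}
    {g : B ⟶ B'} (h : f ≫ e'.hom = e.hom ≫ g) : g ≫ e'.inv = e.inv ≫ f := by
  rw [Iso.comp_inv_eq, Category.assoc, h, Iso.inv_hom_id_assoc]

end IsoApp

section IsoLocus

open Pretriangulated

variable {T T' : Type*} [Category* T] [Category* T'] [Preadditive T] [Preadditive T']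
  [HasZeroObject T] [HasZeroObject T'] [HasShift T ℤ] [HasShift T' ℤ]
  [∀ n : ℤ, (shiftFunctor T n).Additive] [∀ n : ℤ, (shiftFunctor T' n).Additive]
  [Pretriangulated T] [Pretriangulated T'] {F G : T ⥤ T'}

lemma PreservesCones.exact_hom (F : T ⥤ T') [PreservesCones F] (Z : T') {A : Triangle T}
    (hA : A ∈ distTriang T) :
    Function.Exact (fun x : Z ⟶ F.obj A.obj₁ => x ≫ F.map A.mor₁)
      (fun x : Z ⟶ F.obj A.obj₂ => x ≫ F.map A.mor₂) := by
  obtain ⟨h, hh⟩ := PreservesCones.exists_distinguished (F := F) hA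
  intro x
  constructor
  · intro hx
    obtain ⟨y, hy⟩ := Triangle.coyoneda_exact₂ _ hh x hx
    exact ⟨y, hy.symm⟩
  · rintro ⟨y, rfl⟩
    have := comp_distTriang_mor_zero₁₂ _ hh
    exact (Category.assoc _ _ _).trans ((congrArg (y ≫ ·) this).trans comp_zero)

lemma isIso_of_bijective_comp {C : Type*} [Category* C] {X Y : C} (f : X ⟶ Y)
    (h : ∀ Z : C, Function.Bijective (fun x : Z ⟶ X => x ≫ f)) : IsIso f := by
  obtain ⟨g, hg⟩ := (h Y).2 (𝟙 Y)
  refine ⟨g, (h X).1 ?_, hg⟩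
  change (f ≫ g) ≫ f = 𝟙 X ≫ f
  have : g ≫ f = 𝟙 Y := hg
  rw [Category.assoc, this, Category.comp_id, Category.id_comp]

lemma bijective_comp_of_isIso {C : Type*} [Category* C] {X Y : C} (f : X ⟶ Y) [IsIso f] (Z : C) :
    Function.Bijective (fun x : Z ⟶ X => x ≫ f) :=
  ⟨fun _ _ h => (cancel_mono f).1 h, fun y => ⟨y ≫ inv f, by simp⟩⟩

/-- Composition with a morphism, as a homomorphism of groups. -/
def postcompHom {C : Type*} [Category* C] [Preadditive C] (Z : C) {X Y : C} (f : X ⟶ Y) :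
    (Z ⟶ X) →+ (Z ⟶ Y) where
  toFun x := x ≫ f
  map_zero' := zero_comp
  map_add' _ _ := Preadditive.add_comp _ _ _ _ _ _

variable [PreservesCones F] [PreservesCones G] (τ : F ⟶ G)

/-- Apply `Hom(Z, -)` to the images of the triangle and of its rotations. The terms of the resulting
exact sequences are `F.obj (A.obj₁⟦1⟧)` and not `(F.obj A.obj₁)⟦1⟧`, so the five lemma needs only
naturality of `τ`, and no compatibility with the connecting morphisms supplied by `PreservesCones`.
-/
lemma isIso_app_of_distinguished {A : Triangle T} (hA : A ∈ distTriang T)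
    (h₁ : IsIso (τ.app A.obj₁)) (h₂ : IsIso (τ.app A.obj₂))
    (h₃ : IsIso (τ.app (A.obj₁⟦(1 : ℤ)⟧))) (h₄ : IsIso (τ.app (A.obj₂⟦(1 : ℤ)⟧))) :
    IsIso (τ.app A.obj₃) := by
  refine isIso_of_bijective_comp _ fun Z => ?_
  exact bijective_of_distinguished_covariant (V := fun X => Z ⟶ F.obj X)
    (W := fun X => Z ⟶ G.obj X) (fun a => postcompHom Z (F.map a))
    (fun a => postcompHom Z (G.map a)) (fun X => postcompHom Z (τ.app X))
    (fun a x => (Category.assoc _ _ _).trans ((congrArg (x ≫ ·) (τ.naturality a)).trans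
      (Category.assoc _ _ _).symm))
    (fun hA => PreservesCones.exact_hom F Z hA) (fun hA => PreservesCones.exact_hom G Z hA) hA
    (bijective_comp_of_isIso _ Z) (bijective_comp_of_isIso _ Z) (bijective_comp_of_isIso _ Z)
    (bijective_comp_of_isIso _ Z)

variable [F.CommShift ℤ] [G.CommShift ℤ] [NatTrans.CommShift τ ℤ]

lemma isTriangulatedClass_isIso_app : IsTriangulatedClass (fun X : T => IsIso (τ.app X)) where
  of_iso e h := isIso_app_of_iso τ e h
  shift n h := isIso_app_shift τ n h
  cone hA h₁ h₂ := isIso_app_of_distinguished τ hA h₁ h₂ (isIso_app_shift τ 1 h₁)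
    (isIso_app_shift τ 1 h₂)

end IsoLocus

/-! ### Derived tensor products at the regular module -/

section RegularModule

open scoped ModuleCat
open Pretriangulated

variable {k : Type u} [Field k] {Λ : Type u} [Ring Λ] [Algebra k Λ]

/-- A natural transformation between functors which preserve cones is an isomorphism on all
objects with bounded and finitely generated cohomology if it is one on the regular module. -/
lemma isIso_app_of_finiteBounded [IsNoetherianRing Λ] (hΛ : HasFiniteGlobalDimension Λ)
    {F G : DerivedCategory (ModuleCat.{u} Λ) ⥤ DerivedCategory (ModuleCat.{u} Λ)}
    [PreservesCones F] [PreservesCones G] [F.CommShift ℤ] [G.CommShift ℤ]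
    (τ : F ⟶ G) [NatTrans.CommShift τ ℤ] (h : IsIso (τ.app (derivedSingle (ModuleCat.of Λ Λ))))
    {X : DerivedCategory (ModuleCat.{u} Λ)} (hX : finiteBounded Λ X) : IsIso (τ.app X) :=
  (isTriangulatedClass_isIso_app τ).of_regular hΛ (fun r h => isIso_app_of_retract τ r h) h X hX

/-- A functor which preserves cones preserves bounded and finitely generated cohomology if this
holds for the regular module. -/
lemma finiteBounded_obj [IsNoetherianRing Λ] (hΛ : HasFiniteGlobalDimension Λ)
    (F : DerivedCategory (ModuleCat.{u} Λ) ⥤ DerivedCategory (ModuleCat.{u} Λ))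
    [PreservesCones F] [F.CommShift ℤ]
    (h : finiteBounded Λ (F.obj (derivedSingle (ModuleCat.of Λ Λ))))
    {X : DerivedCategory (ModuleCat.{u} Λ)} (hX : finiteBounded Λ X) :
    finiteBounded Λ (F.obj X) := by
  have hP : IsTriangulatedClass (fun X => finiteBounded Λ (F.obj X)) :=
    { of_iso := fun e h => isTriangulatedClass_finiteBounded.of_iso (F.mapIso e) h
      shift := fun n h => isTriangulatedClass_finiteBounded.of_iso
        ((F.commShiftIso n).symm.app _) (isTriangulatedClass_finiteBounded.shift n h)
      cone := fun hA h₁ h₂ => by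
        obtain ⟨_, hh⟩ := PreservesCones.exists_distinguished (F := F) hA
        exact isTriangulatedClass_finiteBounded.cone hh h₁ h₂ }
  exact hP.of_regular hΛ (fun r h => finiteBounded_of_retract (r.map F) h) h X hX

/-- The regular module as a complex in degree `0`. -/
noncomputable abbrev regularModuleComplex (Λ : Type u) [Ring Λ] :
    CochainComplex (ModuleCat.{u} Λ) ℤ :=
  (HomologicalComplex.single (ModuleCat.{u} Λ) (.up ℤ) 0).obj (ModuleCat.of Λ Λ)

/-- The complex of left modules underlying a complex of bimodules. -/
noncomputable abbrev leftComplex (k : Type u) [Field k] (Λ : Type u) [Ring Λ] [Algebra k Λ] :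
    CochainComplex (BimoduleCat k Λ) ℤ ⥤ CochainComplex (ModuleCat.{u} Λ) ℤ :=
  (leftModule k Λ).mapHomologicalComplex (.up ℤ)

/-- The isomorphism `X ⊗_Λ Λ ≅ X` for a complex of bimodules `X`. -/
noncomputable def tensorCochainRegularIso (X : CochainComplex (BimoduleCat k Λ) ℤ) :
    (tensorCochain X).obj (regularModuleComplex Λ) ≅ (leftComplex k Λ).obj X :=
  (mapBifunctorSingleIso (tensorModBifunctor k Λ) X (ModuleCat.of Λ Λ)).symm ≪≫
    (NatIso.mapHomologicalComplex (tensorModRightUnitor k Λ) (.up ℤ)).app X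

lemma tensorCochainRegularIso_naturality {X Y : CochainComplex (BimoduleCat k Λ) ℤ} (f : X ⟶ Y) :
    (tensorCochainMap f).app (regularModuleComplex Λ) ≫ (tensorCochainRegularIso Y).hom =
      (tensorCochainRegularIso X).hom ≫ (leftComplex k Λ).map f := by
  have h := mapBifunctorSingleIso_hom_naturality_left (tensorModBifunctor k Λ)
    (N := ModuleCat.of Λ Λ) f
  have h' := (NatIso.mapHomologicalComplex (tensorModRightUnitor k Λ) (.up ℤ)).hom.naturality f
  have h'' : (tensorCochainMap f).app (regularModuleComplex Λ) ≫
      (mapBifunctorSingleIso (tensorModBifunctor k Λ) Y (ModuleCat.of Λ Λ)).inv =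
      (mapBifunctorSingleIso (tensorModBifunctor k Λ) X (ModuleCat.of Λ Λ)).inv ≫
      (((tensorModBifunctor k Λ).flip.obj (ModuleCat.of Λ Λ)).mapHomologicalComplex
        (.up ℤ)).map f :=
    inv_comp_eq_of_comp_hom _ _ h
  refine (Category.assoc _ _ _).symm.trans ?_
  refine (congrArg (· ≫ (NatIso.mapHomologicalComplex (tensorModRightUnitor k Λ)
    (.up ℤ)).hom.app Y) h'').trans ?_
  refine (Category.assoc _ _ _).trans ?_
  exact (congrArg (_ ≫ ·) h').trans (Category.assoc _ _ _).symm

lemma tensorCochainRegularIso_rightMul (X : CochainComplex (BimoduleCat k Λ) ℤ) (a : Λ) :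
    (tensorCochain X).map ((HomologicalComplex.single (ModuleCat.{u} Λ) (.up ℤ) 0).map
        (regularRightMul Λ a)) ≫ (tensorCochainRegularIso X).hom =
      (tensorCochainRegularIso X).hom ≫
        (NatTrans.mapHomologicalComplex (rightMulNat k Λ a) (.up ℤ)).app X := by
  have h := mapBifunctorSingleIso_hom_naturality_right (tensorModBifunctor k Λ) (K := X)
    (regularRightMul Λ a)
  have h' : (NatTrans.mapHomologicalComplex ((tensorModBifunctor k Λ).flip.map
      (regularRightMul Λ a)) (.up ℤ)).app X ≫
      (NatIso.mapHomologicalComplex (tensorModRightUnitor k Λ) (.up ℤ)).hom.app X =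
      (NatIso.mapHomologicalComplex (tensorModRightUnitor k Λ) (.up ℤ)).hom.app X ≫
        (NatTrans.mapHomologicalComplex (rightMulNat k Λ a) (.up ℤ)).app X := by
    ext n : 1
    exact tensorModRightUnit_naturality (X.X n) a
  have h'' : (tensorCochain X).map ((HomologicalComplex.single (ModuleCat.{u} Λ) (.up ℤ) 0).map
        (regularRightMul Λ a)) ≫
      (mapBifunctorSingleIso (tensorModBifunctor k Λ) X (ModuleCat.of Λ Λ)).inv =
      (mapBifunctorSingleIso (tensorModBifunctor k Λ) X (ModuleCat.of Λ Λ)).inv ≫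
      (NatTrans.mapHomologicalComplex ((tensorModBifunctor k Λ).flip.map
      (regularRightMul Λ a)) (.up ℤ)).app X :=
    inv_comp_eq_of_comp_hom _ _ h
  refine (Category.assoc _ _ _).symm.trans ?_
  refine (congrArg (· ≫ (NatIso.mapHomologicalComplex (tensorModRightUnitor k Λ)
    (.up ℤ)).hom.app X) h'').trans ?_
  refine (Category.assoc _ _ _).trans ?_
  exact (congrArg (_ ≫ ·) h').trans (Category.assoc _ _ _).symm

instance {X Y : CochainComplex (BimoduleCat k Λ) ℤ} (f : X ⟶ Y) [QuasiIso f] :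
    QuasiIso ((leftComplex k Λ).map f) :=
  HomologicalComplex.quasiIso_map_of_preservesHomology _ _

lemma quasiIso_tensorCochainMap_app_regular {X Y : CochainComplex (BimoduleCat k Λ) ℤ} (f : X ⟶ Y)
    [QuasiIso f] : QuasiIso ((tensorCochainMap f).app (regularModuleComplex Λ)) := by
  have : (tensorCochainMap f).app (regularModuleComplex Λ) = (tensorCochainRegularIso X).hom ≫
      (leftComplex k Λ).map f ≫ (tensorCochainRegularIso Y).inv := by
    rw [← Category.assoc, ← tensorCochainRegularIso_naturality, Category.assoc, Iso.hom_inv_id,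
      Category.comp_id]
  rw [this]
  infer_instance

instance : QuasiIso ((tensorCochainAugmentation (k := k) (Λ := Λ)).app (regularModuleComplex Λ)) :=
    by
  have := quasiIso_tensorCochainMap_app_regular (augmentation (k := k) (Λ := Λ))
  exact inferInstanceAs (QuasiIso ((tensorCochainMap (augmentation (k := k) (Λ := Λ))).app
    (regularModuleComplex Λ) ≫ tensorCochainUnitor.hom.app (regularModuleComplex Λ)))

/-! ### Tensor products with complexes of projective modules -/

lemma projective_mapBifunctor_X {C₁ C₂ D : Type*} [Category* C₁] [Category* C₂] [Category* D]
    [Preadditive C₁] [Preadditive C₂] [Preadditive D] (F : C₁ ⥤ C₂ ⥤ D) [F.Additive]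
    [∀ X, (F.obj X).Additive] (K : CochainComplex C₁ ℤ) (L : CochainComplex C₂ ℤ)
    [CochainComplex.HasMapBifunctor K L F]
    (h : ∀ p q, Projective ((F.obj (K.X p)).obj (L.X q))) (n : ℤ) :
    Projective ((CochainComplex.mapBifunctor K L F).X n) where
  factors {E X} f e _ := by
    refine ⟨HomologicalComplex.mapBifunctorDesc (fun p q hpq =>
      (h p q).factors (HomologicalComplex.ιMapBifunctor K L F (.up ℤ) p q n hpq ≫ f) e |>.choose),
        ?_⟩
    refine HomologicalComplex.mapBifunctor.hom_ext fun p q hpq => ?_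
    rw [HomologicalComplex.ι_mapBifunctorDesc_assoc]
    exact (h p q).factors (HomologicalComplex.ιMapBifunctor K L F (.up ℤ) p q n hpq ≫ f)
      e |>.choose_spec

lemma isStrictlyLE_mapBifunctor {C₁ C₂ D : Type*} [Category* C₁] [Category* C₂] [Category* D]
    [Preadditive C₁] [Preadditive C₂] [Preadditive D] (F : C₁ ⥤ C₂ ⥤ D) [F.Additive]
    [∀ X, (F.obj X).Additive] (K : CochainComplex C₁ ℤ) (L : CochainComplex C₂ ℤ)
    [CochainComplex.HasMapBifunctor K L F] [HasZeroObject D] (a b : ℤ) [K.IsStrictlyLE a]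
    [L.IsStrictlyLE b] : (CochainComplex.mapBifunctor K L F).IsStrictlyLE (a + b) := by
  rw [CochainComplex.isStrictlyLE_iff]
  intro n hn
  rw [IsZero.iff_id_eq_zero]
  refine HomologicalComplex.mapBifunctor.hom_ext fun p q hpq => IsZero.eq_of_src ?_ _ _
  have hpq' : p + q = n := hpq
  by_cases hp : a < p
  · exact (F.flip.obj (L.X q)).map_isZero (CochainComplex.isZero_of_isStrictlyLE K a p hp)
  · exact (F.obj (K.X p)).map_isZero (CochainComplex.isZero_of_isStrictlyLE L b q (by lia))

/-- The terms of `B` are projective bimodules, so `B ⊗_Λ P` consists of projective modules whatever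
the terms of `P` are; boundedness above then gives K-projectivity. -/
lemma isKProjective_tensorCochain_diagonalResolution (P : CochainComplex (ModuleCat.{u} Λ) ℤ)
    (b : ℤ) [P.IsStrictlyLE b] :
    ((tensorCochain (diagonalResolution k Λ)).obj P).IsKProjective := by
  have (n : ℤ) : Projective (((tensorCochain (diagonalResolution k Λ)).obj P).X n) :=
    projective_mapBifunctor_X (tensorModBifunctor k Λ) _ _ (fun p q => inferInstance) n
  have : ((tensorCochain (diagonalResolution k Λ)).obj P).IsStrictlyLE (0 + b) :=
    isStrictlyLE_mapBifunctor (tensorModBifunctor k Λ) (diagonalResolution k Λ) P 0 b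
  exact CochainComplex.isKProjective_of_projective _ (0 + b)

/-- Between K-projective complexes a quasi-isomorphism is a homotopy equivalence, and these are
preserved by every tensor functor. -/
lemma quasiIso_tensorCochain_map_of_isKProjective (X : CochainComplex (BimoduleCat k Λ) ℤ)
    {K L : CochainComplex (ModuleCat.{u} Λ) ℤ} [K.IsKProjective] [L.IsKProjective] (f : K ⟶ L)
    [QuasiIso f] : QuasiIso ((tensorCochain X).map f) := by
  obtain ⟨e, he⟩ := (CochainComplex.IsKProjective.quasiIso_iff f).1 inferInstance
  subst he
  exact inferInstanceAs (QuasiIso (tensorCochainHomotopyEquiv X e).hom)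

/-- For a bounded above complex of projective modules `P` the derived tensor product with `P` is
computed by the tensor product, as soon as `B ⊗_Λ P ⟶ P` is a quasi-isomorphism. -/
lemma quasiIso_derivedTensorCochainCounit (X : CochainComplex (BimoduleCat k Λ) ℤ)
    (P : CochainComplex (ModuleCat.{u} Λ) ℤ) (b : ℤ) [P.IsStrictlyLE b] [∀ n, Projective (P.X n)]
    (h : QuasiIso ((tensorCochainAugmentation (k := k) (Λ := Λ)).app P)) :
    QuasiIso ((derivedTensorCochainCounit X).app P) := by
  have := isKProjective_tensorCochain_diagonalResolution (k := k) P b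
  have := CochainComplex.isKProjective_of_projective P b
  have h' := quasiIso_tensorCochain_map_of_isKProjective X (L := P)
    ((tensorCochainAugmentation (k := k) (Λ := Λ)).app P)
  have e : (derivedTensorCochainCounit X).app P =
      (tensorCochain X).map ((tensorCochainAugmentation (k := k) (Λ := Λ)).app P) :=
    Category.comp_id _
  rw [e]
  exact h'

instance : Projective (ModuleCat.of Λ Λ) := ModuleCat.projective_of_free
    (Module.Basis.singleton Unit Λ)

instance (n : ℤ) : Projective ((regularModuleComplex Λ).X n) := by
  by_cases h : n = 0
  · exact Projective.of_iso (HomologicalComplex.singleObjXIsoOfEq (.up ℤ) 0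
      (ModuleCat.of Λ Λ) n h).symm inferInstance
  · exact (HomologicalComplex.isZero_single_obj_X (.up ℤ) 0 (ModuleCat.of Λ Λ) n h).projective

instance (X : CochainComplex (BimoduleCat k Λ) ℤ) :
    QuasiIso ((derivedTensorCochainCounit X).app (regularModuleComplex Λ)) :=
  quasiIso_derivedTensorCochainCounit X (regularModuleComplex Λ) 0 inferInstance

/-- The value of `X ⊗^L_Λ -` at `Λ` is `X`. -/
noncomputable def derivedTensorFunctorRegularIso (X : CochainComplex (BimoduleCat k Λ) ℤ) :
    (derivedTensorFunctor X).obj (derivedSingle (ModuleCat.of Λ Λ)) ≅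
      DerivedCategory.Q.obj ((leftComplex k Λ).obj X) :=
  (derivedTensorFunctorFac X).app (regularModuleComplex Λ) ≪≫
    asIso (DerivedCategory.Q.map ((derivedTensorCochainCounit X).app (regularModuleComplex Λ))) ≪≫
    DerivedCategory.Q.mapIso (tensorCochainRegularIso X)

lemma derivedTensorFunctorRegularIso_rightMul (X : CochainComplex (BimoduleCat k Λ) ℤ) (a : Λ) :
    (derivedTensorFunctor X).map ((DerivedCategory.singleFunctor (ModuleCat.{u} Λ) 0).map
        (regularRightMul Λ a)) ≫ (derivedTensorFunctorRegularIso X).hom =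
      (derivedTensorFunctorRegularIso X).hom ≫ DerivedCategory.Q.map
        ((NatTrans.mapHomologicalComplex (rightMulNat k Λ a) (.up ℤ)).app X) := by
  let s := (HomologicalComplex.single (ModuleCat.{u} Λ) (.up ℤ) 0).map (regularRightMul Λ a)
  have h₁ := (derivedTensorFunctorFac X).hom.naturality s
  have h₂ := congrArg DerivedCategory.Q.map ((derivedTensorCochainCounit X).naturality s)
  have h₃ := congrArg DerivedCategory.Q.map (tensorCochainRegularIso_rightMul X a)
  rw [Functor.map_comp, Functor.map_comp] at h₂ h₃
  have h₄ : (derivedTensorFunctor X).map ((DerivedCategory.singleFunctor (ModuleCat.{u} Λ) 0).map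
      (regularRightMul Λ a)) = (derivedTensorFunctor X).map (DerivedCategory.Q.map s) := rfl
  rw [h₄]
  refine (Category.assoc _ _ _).symm.trans ?_
  refine (congrArg (· ≫ _) h₁).trans ?_
  refine (Category.assoc _ _ _).trans ?_
  refine Eq.trans (congrArg ((derivedTensorFunctorFac X).hom.app (regularModuleComplex Λ) ≫ ·) ?_)
    (Category.assoc _ _ _).symm
  refine (Category.assoc _ _ _).symm.trans ?_
  refine (congrArg (· ≫ _) h₂).trans ?_
  refine (Category.assoc _ _ _).trans ?_
  refine Eq.trans (congrArg (_ ≫ ·) h₃) (Category.assoc _ _ _).symm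

/-- At `Λ` the resolution `B ⊗_Λ Λ` may be replaced by `Λ` itself, because both are K-projective;
there the map induced by `f` is `f` on underlying complexes of left modules. -/
lemma isIso_derivedTensorMap_app_regular {X Y : CochainComplex (BimoduleCat k Λ) ℤ} (f : X ⟶ Y)
    [QuasiIso f] :
    IsIso ((derivedTensorMap f).app (derivedSingle (ModuleCat.of Λ Λ))) := by
  refine (isIso_derivedLiftMap_app_iff _ (regularModuleComplex Λ)).2 ?_
  have h := quasiIso_tensorCochainMap_app_regular f
  let a : (tensorCochain (diagonalResolution k Λ)).obj (regularModuleComplex Λ) ⟶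
      regularModuleComplex Λ := tensorCochainAugmentation.app (regularModuleComplex Λ)
  have ha : QuasiIso a := inferInstanceAs (QuasiIso
    ((tensorCochainAugmentation (k := k) (Λ := Λ)).app (regularModuleComplex Λ)))
  have hX : QuasiIso ((tensorCochain X).map a) := by
    have := isKProjective_tensorCochain_diagonalResolution (k := k) (regularModuleComplex Λ) 0
    have := CochainComplex.isKProjective_of_projective (regularModuleComplex Λ) 0
    exact quasiIso_tensorCochain_map_of_isKProjective X a
  have hY : QuasiIso ((tensorCochain Y).map a) := by
    have := isKProjective_tensorCochain_diagonalResolution (k := k) (regularModuleComplex Λ) 0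
    have := CochainComplex.isKProjective_of_projective (regularModuleComplex Λ) 0
    exact quasiIso_tensorCochain_map_of_isKProjective Y a
  -- In the naturality square for the augmentation the two sides given by `a` and the side given by
  -- `f` at `Λ` are quasi-isomorphisms, hence so is the fourth side.
  have e := (tensorCochainMap f).naturality a
  have h' : QuasiIso ((tensorCochain X).map a ≫
      (tensorCochainMap f).app (regularModuleComplex Λ)) := inferInstance
  rw [e] at h'
  exact (quasiIso_iff_comp_right _ _).1 h'

/-! ### The unit -/

/-- The natural transformation `Λ ⊗^L_Λ - ⟶ 𝟭`. -/
noncomputable def derivedTensorUnit : derivedTensorFunctor (regularComplex k Λ) ⟶ 𝟭 _ :=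
  derivedDesc ((derivedTensorFunctorFac (regularComplex k Λ)).hom ≫
    Functor.whiskerRight (derivedTensorCochainCounit (regularComplex k Λ) ≫ tensorCochainUnitor.hom)
      DerivedCategory.Q ≫ DerivedCategory.Q.leftUnitor.hom ≫ DerivedCategory.Q.rightUnitor.inv)

instance : NatTrans.CommShift (derivedTensorUnit (k := k) (Λ := Λ)) ℤ := by
  unfold derivedTensorUnit
  infer_instance

lemma isIso_derivedTensorUnit_app_regular :
    IsIso ((derivedTensorUnit (k := k) (Λ := Λ)).app (derivedSingle (ModuleCat.of Λ Λ))) := by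
  let g : (derivedTensorCochain (regularComplex k Λ)).obj (regularModuleComplex Λ) ⟶
      regularModuleComplex Λ :=
    (derivedTensorCochainCounit (regularComplex k Λ)).app (regularModuleComplex Λ) ≫
    tensorCochainUnitor.hom.app (regularModuleComplex Λ)
  have hg : QuasiIso g := inferInstanceAs (QuasiIso
    ((derivedTensorCochainCounit (regularComplex k Λ)).app (regularModuleComplex Λ) ≫
      (tensorCochainUnitor.app (regularModuleComplex Λ)).hom))
  have h : (derivedTensorUnit (k := k) (Λ := Λ)).app (derivedSingle (ModuleCat.of Λ Λ)) =
      (derivedTensorFunctorFac (regularComplex k Λ)).hom.app (regularModuleComplex Λ) ≫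
      DerivedCategory.Q.map g :=
    (derivedDesc_app _ (regularModuleComplex Λ)).trans (congrArg (_ ≫ ·)
      ((congrArg (DerivedCategory.Q.map g ≫ ·) (Category.comp_id _)).trans (Category.comp_id _)))
  have h2 : IsIso (DerivedCategory.Q.map g) :=
    (DerivedCategory.isIso_Q_map_iff_quasiIso (C := ModuleCat.{u} Λ) g).2 hg
  rw [h]
  exact IsIso.comp_isIso' (inferInstanceAs (IsIso ((derivedTensorFunctorFac
    (regularComplex k Λ)).app (regularModuleComplex Λ)).hom)) h2

end RegularModule

/-! ## Equivariant endofunctors up to isomorphism -/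

section IsPow

variable {α M : Type*} [Monoid M] {mul : α → α → α} {one : α} {iso : α → α → Prop} (π : α → M)


/-- Turns powers up to isomorphism into powers in a monoid of isomorphism classes, where inverses
are unique. -/
lemma map_iteratedPow (hmul : ∀ a b, π (mul a b) = π a * π b) (hone : π one = 1) (x : α) (n : ℕ) :
    π (iteratedPow mul one x n) = π x ^ n := by
  induction n with
  | zero => exact hone.trans (pow_zero _).symm
  | succ n ih => exact (hmul _ _).trans ((congrArg (π x * ·) ih).trans (pow_succ' _ _).symm)

lemma isPow_ofNat_iff (hmul : ∀ a b, π (mul a b) = π a * π b) (hone : π one = 1)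
    (hiso : ∀ a b, iso a b ↔ π a = π b) (x z : α) (n : ℕ) :
    IsPow mul one iso x (n : ℤ) z ↔ π x ^ n = π z :=
  (hiso _ _).trans (by rw [map_iteratedPow π hmul hone])

lemma isPow_negSucc_iff (hmul : ∀ a b, π (mul a b) = π a * π b) (hone : π one = 1)
    (hiso : ∀ a b, iso a b ↔ π a = π b) (x z : α) (n : ℕ) :
    IsPow mul one iso x (Int.negSucc n) z ↔
      ∃ y, π x * π y = 1 ∧ π y * π x = 1 ∧ π y ^ (n + 1) = π z := by
  refine exists_congr fun y => ?_
  rw [hiso, hiso, hiso, hmul, hmul, hone, map_iteratedPow π hmul hone]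

end IsPow

/-! ### The monoid of isomorphism classes of equivariant endofunctors -/

section Equivariant

open EquivariantEndofunctor

namespace EquivariantEndofunctor

variable {k : Type u} [Field k] {C : Type*} [Category* C] [Preadditive C] [Linear k C]
  {F : C ⥤ C}

lemma Isomorphic.refl (E : EquivariantEndofunctor k F) : Isomorphic E E :=
  ⟨Iso.refl _, fun X => by simp⟩

lemma Isomorphic.symm {E E' : EquivariantEndofunctor k F} (h : Isomorphic E E') :
    Isomorphic E' E := by
  obtain ⟨α, hα⟩ := h
  refine ⟨α.symm, fun X => ?_⟩
  rw [← cancel_epi (α.hom.app (F.obj X)), ← Category.assoc, ← hα X, Category.assoc,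
    ← Functor.map_comp]
  simp

lemma Isomorphic.trans {E E' E'' : EquivariantEndofunctor k F} (h : Isomorphic E E')
    (h' : Isomorphic E' E'') : Isomorphic E E'' := by
  obtain ⟨α, hα⟩ := h
  obtain ⟨β, hβ⟩ := h'
  refine ⟨α ≪≫ β, fun X => ?_⟩
  simp only [Iso.trans_hom, NatTrans.comp_app, Functor.map_comp, Category.assoc]
  rw [← hβ X, ← Category.assoc, hα X, Category.assoc]

lemma Isomorphic.mul {E₁ E₁' E₂ E₂' : EquivariantEndofunctor k F} (h₂ : Isomorphic E₂ E₂')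
    (h₁ : Isomorphic E₁ E₁') : Isomorphic (E₂.mul E₁) (E₂'.mul E₁') := by
  obtain ⟨β, hβ⟩ := h₂
  obtain ⟨α, hα⟩ := h₁
  refine ⟨Functor.isoWhiskerLeft E₁.functor β ≪≫ Functor.isoWhiskerRight α E₂'.functor, fun X => ?_⟩
  have h := hβ (E₁.functor.obj X)
  have n := β.hom.naturality (E₁.comm.hom.app X)
  have n' := E₂'.comm.hom.naturality (α.hom.app X)
  dsimp [EquivariantEndofunctor.mul] at h n n' ⊢
  simp only [Functor.map_comp, Category.assoc]
  rw [reassoc_of% h, ← n', reassoc_of% n, ← Functor.map_comp_assoc, hα X]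
  simp only [Functor.map_comp, Category.assoc]

lemma mul_assoc_isomorphic (E₃ E₂ E₁ : EquivariantEndofunctor k F) :
    Isomorphic ((E₃.mul E₂).mul E₁) (E₃.mul (E₂.mul E₁)) :=
  ⟨Iso.refl _, fun X => by simp [EquivariantEndofunctor.mul]⟩

lemma mul_comm_hom_app (E₂ E₁ : EquivariantEndofunctor k F) (X : C) :
    (E₂.mul E₁).comm.hom.app X =
      E₂.functor.map (E₁.comm.hom.app X) ≫ E₂.comm.hom.app (E₁.functor.obj X) := rfl

lemma one_comm_hom_app (X : C) : (one k F).comm.hom.app X = 𝟙 (F.obj X) := Category.comp_id _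

lemma one_mul_isomorphic (E : EquivariantEndofunctor k F) : Isomorphic ((one k F).mul E) E := by
  refine ⟨E.functor.rightUnitor, fun X => ?_⟩
  rw [mul_comm_hom_app, one_comm_hom_app]
  have : (E.comm.hom.app X ≫ 𝟙 _) ≫ F.map (𝟙 (E.functor.obj X)) = 𝟙 _ ≫ E.comm.hom.app X := by
    simp
  exact this

lemma mul_one_isomorphic (E : EquivariantEndofunctor k F) : Isomorphic (E.mul (one k F)) E :=
  ⟨E.functor.leftUnitor, fun X => by simp [EquivariantEndofunctor.mul, one]⟩

variable (k F) in
/-- Equivariant endofunctors up to isomorphism. -/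
def isomorphicSetoid : Setoid (EquivariantEndofunctor k F) where
  r := Isomorphic
  iseqv := ⟨Isomorphic.refl, Isomorphic.symm, Isomorphic.trans⟩

variable (k F) in
/-- The isomorphism classes of equivariant endofunctors. -/
def Class := Quotient (isomorphicSetoid k F)

/-- The isomorphism class of an equivariant endofunctor. -/
def toClass (E : EquivariantEndofunctor k F) : Class k F := Quotient.mk (isomorphicSetoid k F) E

lemma isomorphic_iff (E E' : EquivariantEndofunctor k F) :
    Isomorphic E E' ↔ toClass E = toClass E' :=
  (Quotient.eq (r := isomorphicSetoid k F)).symm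

instance : Monoid (Class k F) where
  mul := Quotient.map₂ EquivariantEndofunctor.mul fun _ _ h _ _ h' => h.mul h'
  one := toClass (one k F)
  mul_assoc := by
    rintro ⟨a⟩ ⟨b⟩ ⟨c⟩
    exact Quotient.sound (s := isomorphicSetoid k F) (mul_assoc_isomorphic a b c)
  one_mul := by
    rintro ⟨a⟩
    exact Quotient.sound (s := isomorphicSetoid k F) (one_mul_isomorphic a)
  mul_one := by
    rintro ⟨a⟩
    exact Quotient.sound (s := isomorphicSetoid k F) (mul_one_isomorphic a)

lemma toClass_mul (E E' : EquivariantEndofunctor k F) :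
    toClass (E.mul E') = toClass E * toClass E' := rfl

lemma toClass_one : toClass (one k F) = 1 := rfl

lemma isPower_ofNat_iff (E G : EquivariantEndofunctor k F) (n : ℕ) :
    IsPower E (n : ℤ) G ↔ toClass E ^ n = toClass G :=
  isPow_ofNat_iff _ toClass_mul toClass_one isomorphic_iff E G n

lemma isPower_negSucc_iff (E G : EquivariantEndofunctor k F) (n : ℕ) :
    IsPower E (Int.negSucc n) G ↔ ∃ y, toClass E * toClass y = 1 ∧ toClass y * toClass E = 1 ∧
      toClass y ^ (n + 1) = toClass G :=
  isPow_negSucc_iff _ toClass_mul toClass_one isomorphic_iff E G n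

/-! ### Integral powers of the suspension with their signs -/

section Shift

variable [HasShift C ℤ] [∀ n : ℤ, (shiftFunctor C n).Additive]
  [∀ n : ℤ, (shiftFunctor C n).Linear k]

variable (k C) in
/-- The functor `Σ ^ N` with `(-1) ^ N` times the obvious commutation isomorphism with `Σ`. -/
def shift (N : ℤ) : EquivariantEndofunctor k (shiftFunctor C (1 : ℤ)) where
  functor := shiftFunctor C N
  additive := inferInstance
  linear := inferInstance
  comm := NatIso.ofComponents (fun X => N.negOnePow • (shiftFunctorComm C 1 N).app X)
    (fun f => (Linear.comp_units_smul _ _ _).trans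
      ((congrArg (N.negOnePow • ·) ((shiftFunctorComm C 1 N).hom.naturality f)).trans
        (Linear.units_smul_comp _ _ _).symm))

lemma shift_comm_hom_app (N : ℤ) (X : C) :
    (shift k C N).comm.hom.app X = N.negOnePow • (shiftFunctorComm C 1 N).hom.app X := rfl

lemma toClass_shift_zero : toClass (shift k C 0) = 1 := by
  refine (isomorphic_iff _ _).1 ⟨shiftFunctorZero C ℤ, fun X => ?_⟩
  rw [shift_comm_hom_app, Int.negOnePow_zero, one_smul, shiftFunctorComm_zero_hom_app,
    one_comm_hom_app]
  refine (Category.assoc _ _ _).trans (congrArg (_ ≫ ·) ?_)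
  exact ((shiftFunctor C (1 : ℤ)).map_comp _ _).symm.trans ((congrArg _
    ((shiftFunctorZero C ℤ).inv_hom_id_app X)).trans (CategoryTheory.Functor.map_id _ _))

/-- The commutation isomorphism of `Σ` with itself is the identity, so the factor `(-1) ^ 1`
produces `-id`. -/
lemma toClass_shift_one : toClass (shift k C 1) = toClass (negSelf k (shiftFunctor C (1 : ℤ))) := by
  refine (isomorphic_iff _ _).1 ⟨Iso.refl _, fun X => ?_⟩
  rw [shift_comm_hom_app, Int.negOnePow_one, shiftFunctorComm_eq_refl]
  have : (-𝟙 (X⟦(1 : ℤ)⟧⟦(1 : ℤ)⟧)) ≫ (𝟙 (X⟦(1 : ℤ)⟧))⟦(1 : ℤ)⟧' = 𝟙 _ ≫ (-𝟙 _) := by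
    simp
  refine Eq.trans ?_ this
  exact congrArg (· ≫ _) (Units.neg_smul _ _ |>.trans (congrArg Neg.neg (one_smul _ _)))

lemma toClass_shift_add (m n : ℤ) :
    toClass (shift k C (n + m)) = toClass (shift k C m) * toClass (shift k C n) := by
  refine ((isomorphic_iff _ _).1 ⟨shiftFunctorAdd C n m, fun X => ?_⟩).trans (toClass_mul _ _)
  have h : ((n + m).negOnePow • (shiftFunctorComm C 1 (n + m)).hom.app X) ≫
      ((shiftFunctorAdd C n m).hom.app X)⟦(1 : ℤ)⟧' = (shiftFunctorAdd C n m).hom.app (X⟦(1 : ℤ)⟧) ≫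
      (n.negOnePow • (shiftFunctorComm C 1 n).hom.app X)⟦m⟧' ≫
      (m.negOnePow • (shiftFunctorComm C 1 m).hom.app (X⟦n⟧)) := by
    rw [Linear.units_smul_comp, shiftFunctorComm_hom_app_comp_shift_shiftFunctorAdd_hom_app,
      Functor.map_units_smul, Linear.units_smul_comp, Linear.comp_units_smul,
        Linear.comp_units_smul,
      Linear.comp_units_smul, smul_smul, ← Int.negOnePow_add]
  exact h

lemma toClass_shift_pow (N : ℤ) (n : ℕ) :
    toClass (shift k C N) ^ n = toClass (shift k C (n * N)) := by
  induction n with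
  | zero => simp [toClass_shift_zero]
  | succ n ih => rw [pow_succ, ih, ← toClass_shift_add]; congr 2; push_cast; ring

/-- The classes of `shift k C N` form a group of powers by `toClass_shift_add`. For negative `N` the
quasi-inverse in the definition of a power is unspecified, but inverses in a monoid are unique, so
it must be the class of `shift k C (-1)`. -/
lemma isPower_negSelf_iff (N : ℤ) (G : EquivariantEndofunctor k (shiftFunctor C (1 : ℤ))) :
    IsPower (negSelf k (shiftFunctor C (1 : ℤ))) N G ↔ toClass (shift k C N) = toClass G := by
  have inv : ∀ a : ℤ, toClass (shift k C a) * toClass (shift k C (-a)) = 1 := fun a => by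
    rw [← toClass_shift_add, neg_add_cancel, toClass_shift_zero]
  rcases N with n | n
  · refine (isPower_ofNat_iff _ _ n).trans ?_
    rw [← toClass_shift_one, toClass_shift_pow, mul_one]
    rfl
  · rw [isPower_negSucc_iff, ← toClass_shift_one]
    have e : toClass (shift k C (-1)) ^ (n + 1) = toClass (shift k C (Int.negSucc n)) := by
      rw [toClass_shift_pow]
      congr 2
      rw [Int.negSucc_eq]
      push_cast
      ring
    constructor
    · rintro ⟨y, h₁, h₂, h₃⟩
      have : toClass y = toClass (shift k C (-1)) := left_inv_eq_right_inv h₂ (inv 1)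
      rw [← h₃, this, e]
    · intro h
      exact ⟨_, inv 1, by simpa using inv (-1), e.trans h⟩

end Shift

/-! ### Restriction of equivariant endofunctors to a full subcategory -/

section Restriction

variable {T : Type*} [Category* T] [Preadditive T] [Linear k T] [HasShift C ℤ] [HasShift T ℤ]
  (ι : C ⥤ T) [ι.CommShift ℤ]

/-- The equivariant endofunctor `G` is a restriction of `E` along `ι`. -/
def Restricts (G : EquivariantEndofunctor k (shiftFunctor C (1 : ℤ)))
    (E : EquivariantEndofunctor k (shiftFunctor T (1 : ℤ))) : Prop :=
  ∃ β : G.functor ⋙ ι ≅ ι ⋙ E.functor, ∀ X : C,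
    ι.map (G.comm.hom.app X) ≫ (ι.commShiftIso (1 : ℤ)).hom.app (G.functor.obj X) ≫
      (β.hom.app X)⟦(1 : ℤ)⟧' =
    β.hom.app (X⟦(1 : ℤ)⟧) ≫ E.functor.map ((ι.commShiftIso (1 : ℤ)).hom.app X) ≫
      E.comm.hom.app (ι.obj X)

variable {ι} {G G' : EquivariantEndofunctor k (shiftFunctor C (1 : ℤ))}
    {E E' : EquivariantEndofunctor k (shiftFunctor T (1 : ℤ))}

/-- Along a fully faithful functor restrictions are unique: the comparison isomorphism and its
compatibility with `Σ` can both be tested after applying `ι`. -/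
lemma Restricts.toClass_eq [ι.Full] [ι.Faithful] (h : Restricts ι G E) (h' : Restricts ι G' E) :
    toClass G = toClass G' := by
  obtain ⟨β, hβ⟩ := h
  obtain ⟨γ, hγ⟩ := h'
  have hι := Functor.FullyFaithful.ofFullyFaithful ι
  let α : G.functor ≅ G'.functor := NatIso.ofComponents
    (fun X => hι.preimageIso ((β ≪≫ γ.symm).app X)) (fun f => hι.map_injective (by
      have h₁ := β.hom.naturality f
      have h₂ := γ.inv.naturality f
      dsimp at h₁ h₂
      simp [reassoc_of% h₁, h₂]))
  have hα : ∀ X, ι.map (α.hom.app X) = β.hom.app X ≫ γ.inv.app X := fun X => hι.map_preimage _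
  refine (isomorphic_iff _ _).1 ⟨α, fun X => hι.map_injective ?_⟩
  have hs := (ι.commShiftIso (1 : ℤ)).hom.naturality (α.hom.app X)
  have hb := hβ X
  have hg := hγ X
  dsimp at hs hb hg
  rw [← cancel_mono ((ι.commShiftIso (1 : ℤ)).hom.app (G'.functor.obj X)),
    ← cancel_mono ((γ.hom.app X)⟦(1 : ℤ)⟧')]
  simp only [Functor.map_comp, Category.assoc, hα, hs, hg]
  rw [Iso.inv_hom_id_app_assoc, ← hb, ← Functor.map_comp, Iso.inv_hom_id_app]
  simp

/-- Invertibility of `τ` is asked only on the image of `ι`. Comparison maps between derived tensor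
functors are controlled only on objects generated by the regular module. -/
lemma Restricts.of_natTrans (h : Restricts ι G E) (τ : E.functor ⟶ E'.functor)
    (hτ : ∀ X, IsIso (τ.app (ι.obj X)))
    (hc : ∀ X, E.comm.hom.app X ≫ (τ.app X)⟦(1 : ℤ)⟧' =
      τ.app (X⟦(1 : ℤ)⟧) ≫ E'.comm.hom.app X) : Restricts ι G E' := by
  obtain ⟨β, hβ⟩ := h
  have : IsIso (Functor.whiskerLeft ι τ) := by
    have : ∀ X, IsIso ((Functor.whiskerLeft ι τ).app X) := hτ
    exact NatIso.isIso_of_isIso_app _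
  refine ⟨β ≪≫ asIso (Functor.whiskerLeft ι τ), fun X => ?_⟩
  have n := τ.naturality ((ι.commShiftIso (1 : ℤ)).hom.app X)
  have hb := hβ X
  have hcX := hc (ι.obj X)
  dsimp at n hb hcX ⊢
  simp only [Functor.map_comp, Category.assoc]
  rw [reassoc_of% hb, hcX, ← reassoc_of% n]

lemma Restricts.of_natTrans' (h : Restricts ι G E) (τ : E'.functor ⟶ E.functor)
    (hτ : ∀ X, IsIso (τ.app (ι.obj X)))
    (hc : ∀ X, E'.comm.hom.app X ≫ (τ.app X)⟦(1 : ℤ)⟧' =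
      τ.app (X⟦(1 : ℤ)⟧) ≫ E.comm.hom.app X) : Restricts ι G E' := by
  obtain ⟨β, hβ⟩ := h
  have : IsIso (Functor.whiskerLeft ι τ) := by
    have : ∀ X, IsIso ((Functor.whiskerLeft ι τ).app X) := hτ
    exact NatIso.isIso_of_isIso_app _
  refine ⟨β ≪≫ (asIso (Functor.whiskerLeft ι τ)).symm, fun X => ?_⟩
  have n := τ.naturality ((ι.commShiftIso (1 : ℤ)).hom.app X)
  have hb := hβ X
  have hcX := hc (ι.obj X)
  have h₁ : ∀ X, (asIso (Functor.whiskerLeft ι τ)).inv.app X ≫ τ.app (ι.obj X) = 𝟙 _ := fun X =>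
    (asIso (Functor.whiskerLeft ι τ)).inv_hom_id_app X
  have h₂ : IsIso (τ.app ((ι.obj X)⟦(1 : ℤ)⟧)) :=
    isIso_app_of_iso τ ((ι.commShiftIso (1 : ℤ)).app X) (hτ _)
  have h₃ := hτ X
  rw [← cancel_mono ((τ.app (ι.obj X))⟦(1 : ℤ)⟧')]
  simp only [Iso.trans_hom, Iso.symm_hom, NatTrans.comp_app, Functor.map_comp, Category.assoc]
  rw [← Functor.map_comp, h₁, hcX, reassoc_of% n, reassoc_of% (h₁ (X⟦(1 : ℤ)⟧)), ← hb]
  simp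

lemma Restricts.mul (h : Restricts ι G E) (h' : Restricts ι G' E') :
    Restricts ι (G.mul G') (E.mul E') := by
  obtain ⟨β, hβ⟩ := h
  obtain ⟨γ, hγ⟩ := h'
  refine ⟨Functor.isoWhiskerLeft G'.functor β ≪≫ Functor.isoWhiskerRight γ E.functor,
    fun X => ?_⟩
  have hb := hβ (G'.functor.obj X)
  have n := β.hom.naturality (G'.comm.hom.app X)
  have n' := E.comm.hom.naturality (γ.hom.app X)
  have hg := congrArg E.functor.map (hγ X)
  dsimp [EquivariantEndofunctor.mul] at hb n n' hg ⊢
  simp only [Functor.map_comp, Category.assoc] at hg ⊢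
  rw [reassoc_of% hb, ← n', reassoc_of% n, reassoc_of% hg]

lemma Restricts.one : Restricts ι (one k (shiftFunctor C (1 : ℤ))) (EquivariantEndofunctor.one k _)
    :=
  ⟨Functor.leftUnitor _ ≪≫ (Functor.rightUnitor _).symm, fun X => by
    simp [EquivariantEndofunctor.one]⟩

lemma Restricts.shift [∀ n : ℤ, (shiftFunctor C n).Additive] [ι.Additive]
    [∀ n : ℤ, (shiftFunctor C n).Linear k] [∀ n : ℤ, (shiftFunctor T n).Additive]
    [∀ n : ℤ, (shiftFunctor T n).Linear k] (N : ℤ) :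
    Restricts ι (shift k C N) (EquivariantEndofunctor.shift k T N) := by
  refine ⟨ι.commShiftIso N, fun X => ?_⟩
  have h : ι.map (N.negOnePow • (shiftFunctorComm C 1 N).hom.app X) ≫
      (ι.commShiftIso (1 : ℤ)).hom.app (X⟦N⟧) ≫ ((ι.commShiftIso N).hom.app X)⟦(1 : ℤ)⟧' =
      (ι.commShiftIso N).hom.app (X⟦(1 : ℤ)⟧) ≫ ((ι.commShiftIso (1 : ℤ)).hom.app X)⟦N⟧' ≫
      (N.negOnePow • (shiftFunctorComm T 1 N).hom.app (ι.obj X)) := by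
    rw [Functor.map_units_smul, ι.map_shiftFunctorComm]
    simp only [Linear.units_smul_comp, Linear.comp_units_smul, Category.assoc]
    congr 1
    have h₁ := (ι.commShiftIso (1 : ℤ)).inv_hom_id_app (X⟦N⟧)
    have h₂ := congrArg (fun f => f⟦(1 : ℤ)⟧') ((ι.commShiftIso N).inv_hom_id_app X)
    simp only [Functor.map_comp] at h₂
    dsimp at h₁ h₂
    rw [reassoc_of% h₁, h₂]
    simp
  exact h

lemma Restricts.congr_left (h : Restricts ι G E) (e : toClass G = toClass G') :
    Restricts ι G' E := by
  obtain ⟨α, hα⟩ := (isomorphic_iff _ _).2 e.symm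
  obtain ⟨β, hβ⟩ := h
  refine ⟨Functor.isoWhiskerRight α ι ≪≫ β, fun X => ?_⟩
  have hb := hβ X
  have ha := congrArg ι.map (hα X)
  have n := (ι.commShiftIso (1 : ℤ)).hom.naturality (α.hom.app X)
  dsimp at hb ha n ⊢
  simp only [Functor.map_comp, Category.assoc] at ha ⊢
  rw [← reassoc_of% n, reassoc_of% ha, hb]

lemma Restricts.congr_right (h : Restricts ι G E) (e : toClass E = toClass E') :
    Restricts ι G E' := by
  obtain ⟨α, hα⟩ := (isomorphic_iff _ _).2 e
  exact h.of_natTrans α.hom (fun _ => inferInstance) hα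

/-- A functor with values in the essential image of `ι` lifts along `ι`, and its commutation
isomorphism is transported to the lift by full faithfulness. -/
lemma exists_restricts [ι.Full] [ι.Faithful] [ι.Additive] [ι.Linear k]
    (h : ∀ X, ι.essImage (E.functor.obj (ι.obj X))) : ∃ G, Restricts ι G E := by
  let S : C ⥤ C := Functor.essImage.liftFunctor (ι ⋙ E.functor) ι h
  let β : S ⋙ ι ≅ ι ⋙ E.functor := Functor.essImage.liftFunctorCompIso (ι ⋙ E.functor) ι h
  have hι := Functor.FullyFaithful.ofFullyFaithful ι
  have hS : S.Linear k := by
    have := E.additive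
    have := E.linear
    have : (S ⋙ ι).Linear k := Functor.linear_of_iso k β.symm
    exact ⟨fun {X Y} f r => ι.map_injective
      ((Functor.map_smul (S ⋙ ι) r f).trans (Functor.map_smul ι r (S.map f)).symm)⟩
  have hS' : S.Additive := by
    have := E.additive
    have : (S ⋙ ι).Additive := Functor.additive_of_iso β.symm
    exact ⟨fun {X Y f g} => ι.map_injective
      ((Functor.map_add (S ⋙ ι)).trans (Functor.map_add ι).symm)⟩
  let c : ((shiftFunctor C (1 : ℤ)) ⋙ S) ⋙ ι ≅ (S ⋙ shiftFunctor C (1 : ℤ)) ⋙ ι :=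
    NatIso.ofComponents (fun X => β.app (X⟦(1 : ℤ)⟧) ≪≫
      E.functor.mapIso ((ι.commShiftIso (1 : ℤ)).app X) ≪≫ E.comm.app (ι.obj X) ≪≫
      (shiftFunctor T (1 : ℤ)).mapIso (β.symm.app X) ≪≫ (ι.commShiftIso (1 : ℤ)).symm.app (S.obj X))
      (fun {X Y} f => by
        have h₁ := β.hom.naturality (f⟦(1 : ℤ)⟧')
        have h₂ := congrArg E.functor.map ((ι.commShiftIso (1 : ℤ)).hom.naturality f)
        have h₃ := E.comm.hom.naturality (ι.map f)
        have h₄ := congrArg (fun f => f⟦(1 : ℤ)⟧') (β.inv.naturality f)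
        have h₅ := (ι.commShiftIso (1 : ℤ)).inv.naturality (S.map f)
        simp only [Functor.map_comp, Functor.comp_map] at h₁ h₂ h₃ h₄ h₅
        dsimp
        simp only [Category.assoc]
        rw [reassoc_of% h₁, reassoc_of% h₂, reassoc_of% h₃, reassoc_of% h₄, h₅])
  let d : shiftFunctor C (1 : ℤ) ⋙ S ≅ S ⋙ shiftFunctor C (1 : ℤ) :=
    NatIso.ofComponents (fun X => hι.preimageIso (c.app X)) (fun {X Y} f => hι.map_injective (by
      have := c.hom.naturality f
      dsimp only [Functor.comp_map] at this
      simp only [Functor.map_comp, Functor.FullyFaithful.preimageIso_hom, Iso.app_hom,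
        Functor.FullyFaithful.map_preimage, Functor.comp_map]
      exact this))
  refine ⟨⟨S, hS', hS, d⟩, β, fun X => ?_⟩
  have hd : ι.map (d.hom.app X) = β.hom.app (X⟦(1 : ℤ)⟧) ≫
      E.functor.map ((ι.commShiftIso (1 : ℤ)).hom.app X) ≫ E.comm.hom.app (ι.obj X) ≫
      (β.inv.app X)⟦(1 : ℤ)⟧' ≫ (ι.commShiftIso (1 : ℤ)).inv.app (S.obj X) := hι.map_preimage _
  refine (congrArg (· ≫ _) hd).trans ?_
  simp only [Category.assoc]
  rw [Iso.inv_hom_id_app_assoc, ← Functor.map_comp, Iso.inv_hom_id_app]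
  simp

end Restriction

end EquivariantEndofunctor

end Equivariant

/-! ## Derived tensor products as equivariant functors -/

section SignedShift

variable {C D E : Type*} [Category* C] [Category* D] [Category* E] [HasShift C ℤ] [HasShift D ℤ]
  [HasShift E ℤ] [Preadditive D] [Preadditive E]

/-- The natural transformation `τ : F ⟶ Σ ^ N G` is compatible with the suspensions up to the sign
`(-1) ^ N`. -/
def IsSignedCommShift {F G : C ⥤ D} [F.CommShift ℤ] [G.CommShift ℤ] {N : ℤ}
    (τ : F ⟶ G ⋙ shiftFunctor D N) : Prop :=
  ∀ X, (F.commShiftIso (1 : ℤ)).hom.app X ≫ (τ.app X)⟦(1 : ℤ)⟧' =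
    N.negOnePow • (τ.app (X⟦(1 : ℤ)⟧) ≫ ((G.commShiftIso (1 : ℤ)).hom.app X)⟦N⟧' ≫
      (shiftFunctorComm D 1 N).hom.app (G.obj X))

namespace IsSignedCommShift

variable {F G : C ⥤ D} [F.CommShift ℤ] [G.CommShift ℤ] {N : ℤ} {τ : F ⟶ G ⋙ shiftFunctor D N}

lemma whiskerLeft (h : IsSignedCommShift τ) {B : Type*} [Category* B] [HasShift B ℤ]
    (H : B ⥤ C) [H.CommShift ℤ] :
    IsSignedCommShift (F := H ⋙ F) (G := H ⋙ G) (Functor.whiskerLeft H τ) := fun X => by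
  have h₁ := h (H.obj X)
  have h₂ := τ.naturality ((H.commShiftIso (1 : ℤ)).hom.app X)
  rw [Functor.commShiftIso_comp_hom_app, Functor.commShiftIso_comp_hom_app]
  simp only [Functor.comp_map] at h₂
  dsimp at h₁ h₂ ⊢
  simp only [Functor.map_comp, Category.assoc]
  rw [h₁, Linear.comp_units_smul, reassoc_of% h₂]

lemma comp (h : IsSignedCommShift τ) {F' G' : C ⥤ D} [F'.CommShift ℤ] [G'.CommShift ℤ]
    (f : F' ⟶ F) [NatTrans.CommShift f ℤ] (g : G ⟶ G') [NatTrans.CommShift g ℤ] :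
    IsSignedCommShift (f ≫ τ ≫ Functor.whiskerRight g (shiftFunctor D N)) := fun X => by
  have h₁ := h X
  have h₂ := NatTrans.shift_app_comm f (1 : ℤ) X
  have h₃ := congrArg (fun f => f⟦N⟧') (NatTrans.shift_app_comm g (1 : ℤ) X)
  have h₄ := (shiftFunctorComm D 1 N).hom.naturality (g.app X)
  simp only [Functor.comp_map, Functor.map_comp] at h₃ h₄
  simp only [NatTrans.comp_app, Functor.whiskerRight_app, Functor.map_comp, Category.assoc]
  rw [reassoc_of% h₂, reassoc_of% h₁, Linear.units_smul_comp, Linear.comp_units_smul]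
  simp only [Category.assoc]
  rw [← h₄, reassoc_of% h₃]

lemma whiskerRight (h : IsSignedCommShift τ) (H : D ⥤ E) [H.CommShift ℤ] [H.Additive]
    [(shiftFunctor E (1 : ℤ)).Additive] :
    IsSignedCommShift (F := F ⋙ H) (G := G ⋙ H)
      (Functor.whiskerRight τ H ≫ Functor.whiskerLeft G (H.commShiftIso N).hom) := fun X => by
  have h₁ := congrArg H.map (h X)
  have h₂ := (H.commShiftIso (1 : ℤ)).hom.naturality (τ.app X)
  have h₃ := (H.commShiftIso N).hom.naturality ((G.commShiftIso (1 : ℤ)).hom.app X)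
  rw [Functor.map_units_smul] at h₁
  simp only [Functor.map_comp, H.map_shiftFunctorComm] at h₁
  rw [Functor.commShiftIso_comp_hom_app, Functor.commShiftIso_comp_hom_app]
  dsimp at h₁ h₂ h₃ ⊢
  simp only [Functor.map_comp, Category.assoc]
  rw [← reassoc_of% h₂, reassoc_of% h₁, Linear.units_smul_comp]
  simp only [Category.assoc]
  rw [reassoc_of% h₃]
  congr 4
  have h₄ := (H.commShiftIso (1 : ℤ)).inv_hom_id_app ((G.obj X)⟦N⟧)
  have h₅ := congrArg (fun f => f⟦(1 : ℤ)⟧') ((H.commShiftIso N).inv_hom_id_app (G.obj X))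
  simp only [Functor.map_comp] at h₅
  dsimp at h₄ h₅
  rw [reassoc_of% h₄, h₅]
  simp

end IsSignedCommShift

/-- Both sides are natural transformations of functors on the derived category, so they may be
compared on objects `Q.obj K`; there the claim is the hypothesis on `σ`, up to the commutation
isomorphism of `Q`. -/
lemma isSignedCommShift_derivedDesc {C : Type*} [Category* C] [Abelian C] [HasDerivedCategory C]
    {G H : DerivedCategory C ⥤ D} [G.CommShift ℤ] [H.CommShift ℤ] {N : ℤ}
    [(shiftFunctor D N).Additive]
    (σ : DerivedCategory.Q ⋙ G ⟶ (DerivedCategory.Q ⋙ H) ⋙ shiftFunctor D N)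
    (h : IsSignedCommShift σ) :
    IsSignedCommShift (F := G) (G := H) (derivedDesc (H := H ⋙ shiftFunctor D N) σ) := by
  let τ : G ⟶ H ⋙ shiftFunctor D N := derivedDesc (H := H ⋙ shiftFunctor D N) σ
  let l : shiftFunctor (DerivedCategory C) (1 : ℤ) ⋙ G ⟶
      (H ⋙ shiftFunctor D N) ⋙ shiftFunctor D (1 : ℤ) :=
    (G.commShiftIso (1 : ℤ)).hom ≫ Functor.whiskerRight τ (shiftFunctor D (1 : ℤ))
  let r : shiftFunctor (DerivedCategory C) (1 : ℤ) ⋙ G ⟶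
      (H ⋙ shiftFunctor D N) ⋙ shiftFunctor D (1 : ℤ) :=
    Functor.whiskerLeft (shiftFunctor (DerivedCategory C) (1 : ℤ)) τ ≫
      Functor.whiskerRight (H.commShiftIso (1 : ℤ)).hom (shiftFunctor D N) ≫
        Functor.whiskerLeft H (shiftFunctorComm D 1 N).hom
  suffices e : l = N.negOnePow • r from fun X => (NatTrans.congr_app e X).trans
    (NatTrans.app_units_zsmul _ _ _)
  refine derived_natTrans_ext fun K => ?_
  refine Eq.trans ?_ (NatTrans.app_units_zsmul _ _ _).symm
  have h' := h K
  rw [Functor.commShiftIso_comp_hom_app, Functor.commShiftIso_comp_hom_app] at h'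
  have hτ : ∀ K, τ.app (DerivedCategory.Q.obj K) = σ.app K := derivedDesc_app _
  have n := τ.naturality ((DerivedCategory.Q.commShiftIso (1 : ℤ)).hom.app K)
  have hτ' : τ.app ((DerivedCategory.Q ⋙ shiftFunctor _ (1 : ℤ)).obj K) =
      G.map ((DerivedCategory.Q.commShiftIso (1 : ℤ)).inv.app K) ≫ σ.app (K⟦(1 : ℤ)⟧) ≫
        (H.map ((DerivedCategory.Q.commShiftIso (1 : ℤ)).hom.app K))⟦N⟧' := by
    have n' : G.map ((DerivedCategory.Q.commShiftIso (1 : ℤ)).hom.app K) ≫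
        τ.app ((DerivedCategory.Q ⋙ shiftFunctor _ (1 : ℤ)).obj K) = σ.app (K⟦(1 : ℤ)⟧) ≫
        (H.map ((DerivedCategory.Q.commShiftIso (1 : ℤ)).hom.app K))⟦N⟧' :=
      n.trans (congrArg (· ≫ (H.map ((DerivedCategory.Q.commShiftIso (1 : ℤ)).hom.app K))⟦N⟧')
        (hτ _))
    rw [← n', ← Functor.map_comp_assoc, Iso.inv_hom_id_app, CategoryTheory.Functor.map_id]
    exact (Category.id_comp _).symm
  have hl : l.app (DerivedCategory.Q.obj K) =
      (G.commShiftIso (1 : ℤ)).hom.app (DerivedCategory.Q.obj K) ≫ (σ.app K)⟦(1 : ℤ)⟧' :=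
    congrArg (fun f => (G.commShiftIso (1 : ℤ)).hom.app (DerivedCategory.Q.obj K) ≫ f⟦(1 : ℤ)⟧')
      (hτ K)
  have hr : r.app (DerivedCategory.Q.obj K) =
      (G.map ((DerivedCategory.Q.commShiftIso (1 : ℤ)).inv.app K) ≫ σ.app (K⟦(1 : ℤ)⟧) ≫
        (H.map ((DerivedCategory.Q.commShiftIso (1 : ℤ)).hom.app K))⟦N⟧') ≫
      ((H.commShiftIso (1 : ℤ)).hom.app (DerivedCategory.Q.obj K))⟦N⟧' ≫
        (shiftFunctorComm D 1 N).hom.app (H.obj (DerivedCategory.Q.obj K)) :=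
    congrArg (· ≫ _) hτ'
  have hG : IsIso (G.map ((DerivedCategory.Q.commShiftIso (1 : ℤ)).hom.app K)) := inferInstance
  rw [hl, hr, ← cancel_epi (G.map ((DerivedCategory.Q.commShiftIso (1 : ℤ)).hom.app K)),
    Linear.comp_units_smul]
  refine ((Category.assoc _ _ _).symm.trans h').trans (congrArg (N.negOnePow • ·) ?_)
  have hi : G.map ((DerivedCategory.Q.commShiftIso (1 : ℤ)).hom.app K) ≫
      G.map ((DerivedCategory.Q.commShiftIso (1 : ℤ)).inv.app K) = 𝟙 _ := by
    rw [← Functor.map_comp, Iso.hom_inv_id_app, CategoryTheory.Functor.map_id]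
  simp only [Functor.map_comp, Category.assoc]
  rw [reassoc_of% hi]
  rfl

end SignedShift

/-! ### The action of complexes of bimodules by equivariant endofunctors -/

section DerivedTensorEquivariant

open scoped ModuleCat

variable {k : Type u} [Field k] {Λ : Type u} [Ring Λ] [Algebra k Λ]


variable (k Λ) in
/-- The equivariant endofunctor `X ⊗^L_Λ -` of the derived category of modules. -/
noncomputable def derivedTensorEquivariant (X : CochainComplex (BimoduleCat k Λ) ℤ) :
    EquivariantEndofunctor k (shiftFunctor (DerivedCategory (ModuleCat.{u} Λ)) (1 : ℤ)) where
  functor := derivedTensorFunctor X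
  additive := inferInstance
  linear := inferInstance
  comm := (derivedTensorFunctor X).commShiftIso (1 : ℤ)

namespace EquivariantEndofunctor

/-- The associativity isomorphism commutes with shifts of the last factor without a sign, hence the
action is multiplicative as a map to equivariant endofunctors. -/
lemma toClass_derivedTensor (X Y : CochainComplex (BimoduleCat k Λ) ℤ) :
    toClass (derivedTensorEquivariant k Λ (derivedTensor X Y)) =
      toClass (derivedTensorEquivariant k Λ X) * toClass (derivedTensorEquivariant k Λ Y) := by
  refine ((isomorphic_iff _ _).1 ⟨derivedTensorFunctorComp X Y, fun M => ?_⟩).trans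
    (toClass_mul _ _)
  have h := NatTrans.shift_app_comm (derivedTensorFunctorComp X Y).hom (1 : ℤ) M
  rw [Functor.commShiftIso_comp_hom_app] at h
  exact h

/-- `X[N] ⊗_Λ -` is the shift of `X ⊗_Λ -`. -/
noncomputable def derivedTensorCochainShiftIso (X : CochainComplex (BimoduleCat k Λ) ℤ) (N : ℤ) :
    derivedTensorCochain (X⟦N⟧) ≅
      derivedTensorCochain X ⋙ shiftFunctor (CochainComplex (ModuleCat.{u} Λ) ℤ) N :=
  Functor.isoWhiskerLeft (tensorCochain (diagonalResolution k Λ))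
    (map₂CochainComplexShiftIso (tensorModBifunctor k Λ) X N)

lemma isSignedCommShift_derivedTensorCochainShiftIso (X : CochainComplex (BimoduleCat k Λ) ℤ)
    (N : ℤ) : IsSignedCommShift (F := derivedTensorCochain (X⟦N⟧)) (G := derivedTensorCochain X)
      (derivedTensorCochainShiftIso X N).hom := by
  have h : IsSignedCommShift (F := tensorCochain (X⟦N⟧)) (G := tensorCochain X)
      (map₂CochainComplexShiftIso (tensorModBifunctor k Λ) X N).hom := fun M => by
    have h := map₂CochainComplexShiftIso_hom_app_shift (tensorModBifunctor k Λ) X N 1 M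
    rw [mul_one] at h
    exact h
  exact h.whiskerLeft (tensorCochain (diagonalResolution k Λ))

/-- The functor `X[N] ⊗^L_Λ -` is the shift of `X ⊗^L_Λ -`. -/
noncomputable def derivedTensorFunctorShiftIso (X : CochainComplex (BimoduleCat k Λ) ℤ) (N : ℤ) :
    derivedTensorFunctor (X⟦N⟧) ≅
      derivedTensorFunctor X ⋙ shiftFunctor (DerivedCategory (ModuleCat.{u} Λ)) N :=
  derivedDescIso (derivedTensorFunctorFac (X⟦N⟧) ≪≫
    (Functor.isoWhiskerRight (derivedTensorCochainShiftIso X N) DerivedCategory.Q ≪≫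
      Functor.isoWhiskerLeft (derivedTensorCochain X) (DerivedCategory.Q.commShiftIso N)) ≪≫
      Functor.isoWhiskerRight (derivedTensorFunctorFac X).symm (shiftFunctor _ N))

/-- The sign `(-1) ^ N` produced by exchanging a shift of the bimodule complex with `Σ` is the one
built into `shift k _ N`. -/
lemma toClass_derivedTensorEquivariant_shift (X : CochainComplex (BimoduleCat k Λ) ℤ) (N : ℤ) :
    toClass (derivedTensorEquivariant k Λ (X⟦N⟧)) =
      toClass (shift k (DerivedCategory (ModuleCat.{u} Λ)) N) *
        toClass (derivedTensorEquivariant k Λ X) := by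
  refine ((isomorphic_iff _ _).1 ⟨derivedTensorFunctorShiftIso X N, fun M => ?_⟩).trans
    (toClass_mul _ _)
  have h₁ : IsSignedCommShift (F := derivedTensorCochain (X⟦N⟧) ⋙ DerivedCategory.Q)
      (G := derivedTensorCochain X ⋙ DerivedCategory.Q)
      (Functor.whiskerRight (derivedTensorCochainShiftIso X N).hom DerivedCategory.Q ≫
      Functor.whiskerLeft (derivedTensorCochain X) (DerivedCategory.Q.commShiftIso N).hom) :=
    (isSignedCommShift_derivedTensorCochainShiftIso X N).whiskerRight DerivedCategory.Q
  have hi : NatTrans.CommShift (derivedTensorFunctorFac X).inv ℤ := inferInstance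
  have h₂ := h₁.comp (derivedTensorFunctorFac (X⟦N⟧)).hom
    (F' := DerivedCategory.Q ⋙ derivedTensorFunctor (X⟦N⟧))
    (G' := DerivedCategory.Q ⋙ derivedTensorFunctor X) (derivedTensorFunctorFac X).inv
  have h₃ : IsSignedCommShift (F := derivedTensorFunctor (X⟦N⟧)) (G := derivedTensorFunctor X)
      (derivedTensorFunctorShiftIso X N).hom := isSignedCommShift_derivedDesc _ h₂
  have h₄ := h₃ M
  refine h₄.trans ?_
  refine (congrArg (N.negOnePow • ·) (Category.assoc _ _ _).symm).trans ?_
  refine (Linear.comp_units_smul (R := ℤ) _ N.negOnePow _).symm.trans ?_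
  exact Category.assoc _ _ _

variable {G : EquivariantEndofunctor k (shiftFunctor (BoundedDerivedCategory Λ) (1 : ℤ))}
  {X Y : CochainComplex (BimoduleCat k Λ) ℤ}

lemma Restricts.of_quasiIso [IsNoetherianRing Λ] (hΛ : HasFiniteGlobalDimension Λ)
    (h : Restricts (finiteBounded Λ).ι G (derivedTensorEquivariant k Λ X)) (f : X ⟶ Y)
    [QuasiIso f] : Restricts (finiteBounded Λ).ι G (derivedTensorEquivariant k Λ Y) :=
  h.of_natTrans (derivedTensorMap f)
    (fun M => isIso_app_of_finiteBounded hΛ _ (isIso_derivedTensorMap_app_regular f) M.property)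
    (fun M => NatTrans.shift_app_comm (derivedTensorMap f) (1 : ℤ) M)

lemma Restricts.of_quasiIso' [IsNoetherianRing Λ] (hΛ : HasFiniteGlobalDimension Λ)
    (h : Restricts (finiteBounded Λ).ι G (derivedTensorEquivariant k Λ Y)) (f : X ⟶ Y)
    [QuasiIso f] : Restricts (finiteBounded Λ).ι G (derivedTensorEquivariant k Λ X) :=
  h.of_natTrans' (derivedTensorMap f)
    (fun M => isIso_app_of_finiteBounded hΛ _ (isIso_derivedTensorMap_app_regular f) M.property)
    (fun M => NatTrans.shift_app_comm (derivedTensorMap f) (1 : ℤ) M)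

/-- An isomorphism in the derived category of bimodules is a roof of two quasi-isomorphisms, and
each of them induces an isomorphism on the bounded derived category. -/
lemma Restricts.of_derivedIsomorphic [IsNoetherianRing Λ] (hΛ : HasFiniteGlobalDimension Λ)
    (h : Restricts (finiteBounded Λ).ι G (derivedTensorEquivariant k Λ X))
    (e : DerivedIsomorphic X Y) :
    Restricts (finiteBounded Λ).ι G (derivedTensorEquivariant k Λ Y) := by
  obtain ⟨e⟩ := e
  obtain ⟨Z, f, s, hs, hf⟩ := DerivedCategory.left_fac e.hom
  have hsq : QuasiIso s := (DerivedCategory.isIso_Q_map_iff_quasiIso (C := BimoduleCat k Λ) s).1 hs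
  have : IsIso (DerivedCategory.Q.map f) := by
    have h' : DerivedCategory.Q.map f = e.hom ≫ DerivedCategory.Q.map s := by
      rw [hf]
      simp
    rw [h']
    infer_instance
  have hfq : QuasiIso f := (DerivedCategory.isIso_Q_map_iff_quasiIso (C := BimoduleCat k Λ) f).1
      this
  exact (h.of_quasiIso hΛ f).of_quasiIso' hΛ s

lemma Restricts.derivedTensor
    {G' : EquivariantEndofunctor k (shiftFunctor (BoundedDerivedCategory Λ) (1 : ℤ))}
    (h : Restricts (finiteBounded Λ).ι G (derivedTensorEquivariant k Λ X))
    (h' : Restricts (finiteBounded Λ).ι G' (derivedTensorEquivariant k Λ Y)) :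
    Restricts (finiteBounded Λ).ι (G.mul G') (derivedTensorEquivariant k Λ (derivedTensor X Y)) :=
  (h.mul h').congr_right (toClass_derivedTensor X Y).symm

instance {T : Type*} [Category* T] [Preadditive T] [HasZeroObject T] [HasShift T ℤ]
    [∀ n : ℤ, (shiftFunctor T n).Additive] [Pretriangulated T] : PreservesCones (𝟭 T) where
  exists_distinguished {A} hA := ⟨A.mor₃, hA⟩

lemma restricts_regularComplex [IsNoetherianRing Λ] (hΛ : HasFiniteGlobalDimension Λ) :
    Restricts (finiteBounded Λ).ι (one k (shiftFunctor (BoundedDerivedCategory Λ) (1 : ℤ)))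
      (derivedTensorEquivariant k Λ (regularComplex k Λ)) :=
  Restricts.one.of_natTrans' derivedTensorUnit
    (fun M => isIso_app_of_finiteBounded hΛ _ isIso_derivedTensorUnit_app_regular M.property)
    (fun M => NatTrans.shift_app_comm (derivedTensorUnit (k := k) (Λ := Λ)) (1 : ℤ) M)

lemma restricts_regularComplex_shift [IsNoetherianRing Λ] (hΛ : HasFiniteGlobalDimension Λ)
    (N : ℤ) :
    Restricts (finiteBounded Λ).ι (shift k (BoundedDerivedCategory Λ) N)
      (derivedTensorEquivariant k Λ ((regularComplex k Λ)⟦N⟧)) :=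
  (((Restricts.shift N).mul (restricts_regularComplex hΛ)).congr_right
    (toClass_derivedTensorEquivariant_shift _ N).symm).congr_left
      ((toClass_mul _ _).trans (mul_one _))

end EquivariantEndofunctor

end DerivedTensorEquivariant

/-! ## Traces for finitely generated projective modules -/

section ModuleTrace

open scoped ModuleCat

variable {k : Type u} [Field k] {Λ : Type u} [Ring Λ] [Algebra k Λ]

variable (k Λ) in
/-- The functor `Λ* ⊗_Λ -` on modules. -/
noncomputable abbrev nakayama : ModuleCat.{u} Λ ⥤ ModuleCat.{u} Λ :=
  (tensorModBifunctor k Λ).obj (dualBimod k Λ)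

variable (k Λ) in
/-- The isomorphism `Λ* ⊗_Λ Λ ≅ Λ*`. -/
noncomputable def nakayamaRegularIso :
    (nakayama k Λ).obj (ModuleCat.of Λ Λ) ≅ (leftModule k Λ).obj (dualBimod k Λ) :=
  tensorModRightUnit (dualBimod k Λ)

lemma nakayamaRegularIso_naturality (a : Λ) :
    (nakayama k Λ).map (regularRightMul Λ a) ≫ (nakayamaRegularIso k Λ).hom =
      (nakayamaRegularIso k Λ).hom ≫ (rightMulNat k Λ a).app (dualBimod k Λ) :=
  tensorModRightUnit_naturality (dualBimod k Λ) a

/-- The evaluation of an element of the bimodule `Λ*` at `1`. -/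
def dualEvalOne (ξ : (leftModule k Λ).obj (dualBimod k Λ)) : k :=
  (show Module.Dual k Λ from ξ) 1

lemma dualEvalOne_add (ξ ξ' : (leftModule k Λ).obj (dualBimod k Λ)) :
    dualEvalOne (ξ + ξ') = dualEvalOne ξ + dualEvalOne ξ' := rfl

lemma dualBimod_left_smul (a : Λ) (ξ : dualBimod k Λ) (x : Λ) :
    (show Module.Dual k Λ from (a ⊗ₜ[k] (1 : Λᵐᵒᵖ)) • ξ) x =
      (show Module.Dual k Λ from ξ) (x * a) :=
  (dualAction_apply k Λ a 1 ξ x).trans (by rw [one_mul])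

lemma dualBimod_right_smul (a : Λ) (ξ : dualBimod k Λ) (x : Λ) :
    (show Module.Dual k Λ from ((1 : Λ) ⊗ₜ[k] op a) • ξ) x =
      (show Module.Dual k Λ from ξ) (a * x) :=
  (dualAction_apply k Λ 1 a ξ x).trans (by rw [mul_one])

/-- Both sides are the value of `ξ` at `a`. Evaluation at `1` thus does not distinguish the left
from the right action on `Λ*`, which is what makes traces cyclic. -/
lemma dualEvalOne_smul (a : Λ) (ξ : (leftModule k Λ).obj (dualBimod k Λ)) :
    dualEvalOne (a • ξ) = dualEvalOne (((rightMulNat k Λ a).app (dualBimod k Λ)).hom ξ) :=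
  (dualBimod_left_smul a ξ 1).trans
    (Eq.trans (by rw [one_mul, mul_one]) (dualBimod_right_smul a ξ 1).symm)

lemma dualEvalOne_smul_base (r : k) (ξ : (leftModule k Λ).obj (dualBimod k Λ)) :
    dualEvalOne (algebraMap k Λ r • ξ) = r * dualEvalOne ξ := by
  refine (dualBimod_left_smul (algebraMap k Λ r) ξ 1).trans ?_
  rw [one_mul, Algebra.algebraMap_eq_smul_one]
  exact map_smul (show Module.Dual k Λ from ξ) r 1

variable {Q R : ModuleCat.{u} Λ}

/-- The functional `ξ ⊗ q ↦ ξ (φ q)` on `Λ* ⊗_Λ Q`. -/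
noncomputable def nakayamaEval (φ : Q ⟶ ModuleCat.of Λ Λ) (t : (nakayama k Λ).obj Q) : k :=
  dualEvalOne ((((nakayama k Λ).map φ) ≫ (nakayamaRegularIso k Λ).hom).hom t)

lemma nakayamaEval_add_left (φ ψ : Q ⟶ ModuleCat.of Λ Λ) (t : (nakayama k Λ).obj Q) :
    nakayamaEval (φ + ψ) t = nakayamaEval φ t + nakayamaEval ψ t := by
  unfold nakayamaEval
  rw [Functor.map_add, Preadditive.add_comp]
  rfl

lemma nakayamaEval_add_right (φ : Q ⟶ ModuleCat.of Λ Λ) (t t' : (nakayama k Λ).obj Q) :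
    nakayamaEval φ (t + t') = nakayamaEval φ t + nakayamaEval φ t' :=
  (congrArg dualEvalOne (map_add _ t t')).trans (dualEvalOne_add _ _)

lemma nakayamaEval_smul (φ : Q ⟶ ModuleCat.of Λ Λ) (a : Λ) (t : (nakayama k Λ).obj Q) :
    nakayamaEval φ (a • t) = nakayamaEval (φ ≫ regularRightMul Λ a) t := by
  unfold nakayamaEval
  have h' : (nakayama k Λ).map (φ ≫ regularRightMul Λ a) ≫
      (nakayamaRegularIso k Λ).hom = ((nakayama k Λ).map φ ≫
        (nakayamaRegularIso k Λ).hom) ≫ (rightMulNat k Λ a).app (dualBimod k Λ) := by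
    rw [Functor.map_comp, Category.assoc, Category.assoc, nakayamaRegularIso_naturality]
  rw [h', map_smul, dualEvalOne_smul]
  rfl

lemma nakayamaEval_smul_base (φ : Q ⟶ ModuleCat.of Λ Λ) (r : k) (t : (nakayama k Λ).obj Q) :
    nakayamaEval φ (algebraMap k Λ r • t) = r * nakayamaEval φ t :=
  (congrArg dualEvalOne (map_smul _ _ t)).trans (dualEvalOne_smul_base _ _)

lemma nakayamaEval_comp (f : Q ⟶ R) (ψ : R ⟶ ModuleCat.of Λ Λ) (t : (nakayama k Λ).obj Q) :
    nakayamaEval (f ≫ ψ) t = nakayamaEval ψ (((nakayama k Λ).map f).hom t) := by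
  unfold nakayamaEval
  rw [Functor.map_comp, Category.assoc]
  rfl

lemma nakayamaEval_sum_left {ι : Type*} (s : Finset ι) (φ : ι → (Q ⟶ ModuleCat.of Λ Λ))
    (t : (nakayama k Λ).obj Q) :
    nakayamaEval (∑ i ∈ s, φ i) t = ∑ i ∈ s, nakayamaEval (φ i) t :=
  map_sum (AddMonoidHom.mk' (fun φ : Q ⟶ ModuleCat.of Λ Λ => nakayamaEval (k := k) φ t)
    (fun φ ψ => nakayamaEval_add_left φ ψ t)) _ _

lemma nakayamaEval_sum_right {ι : Type*} (s : Finset ι) (φ : Q ⟶ ModuleCat.of Λ Λ)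
    (t : ι → (nakayama k Λ).obj Q) :
    nakayamaEval φ (∑ i ∈ s, t i) = ∑ i ∈ s, nakayamaEval φ (t i) :=
  map_sum (AddMonoidHom.mk' (fun t => nakayamaEval (k := k) φ t) (nakayamaEval_add_right φ)) _ _

/-- A finite dual basis of a module. -/
structure FiniteDualBasis (Q : ModuleCat.{u} Λ) where
  /-- the number of elements -/
  n : ℕ
  /-- the generators -/
  elem : Fin n → Q
  /-- the coordinates -/
  coord : Fin n → (Q ⟶ ModuleCat.of Λ Λ)
  sum_smul (x : Q) : ∑ i, ((coord i).hom x : Λ) • elem i = x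

lemma nonempty_finiteDualBasis (Q : ModuleCat.{u} Λ) [Module.Finite Λ Q] [Projective Q] :
    Nonempty (FiniteDualBasis Q) := by
  have : Module.Projective Λ Q := (IsProjective.iff_projective Q).2 inferInstance
  obtain ⟨n, f, g, -, -, h⟩ := Module.Finite.exists_comp_eq_id_of_projective Λ Q
  refine ⟨⟨n, fun i => f (Pi.single i 1), fun i => ModuleCat.ofHom (LinearMap.proj i ∘ₗ g),
    fun x => ?_⟩⟩
  have := LinearMap.congr_fun h x
  refine Eq.trans ?_ this
  change ∑ i, (g x i) • f (Pi.single i 1) = f (g x)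
  conv_rhs => rw [← (Pi.basisFun Λ (Fin n)).sum_repr (g x), map_sum]
  simp

/-- The trace of `u : Q ⟶ Λ* ⊗_Λ Q`, computed with a dual basis. -/
noncomputable def FiniteDualBasis.trace (b : FiniteDualBasis Q) (u : Q ⟶ (nakayama k Λ).obj Q) :
    k :=
  ∑ i, nakayamaEval (b.coord i) (u.hom (b.elem i))

/-- Expand the images `f e_i` in the dual basis `c`, move the coefficients from `Λ* ⊗_Λ Q` to the
functionals by `nakayamaEval_smul`, and carry out the sum over `i`, which reassembles the functional
`f ≫ c.coord j`. Allowing two different dual bases gives independence of the choice at the same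
time. -/
lemma FiniteDualBasis.trace_comp (b : FiniteDualBasis Q) (c : FiniteDualBasis R) (f : Q ⟶ R)
    (v : R ⟶ (nakayama k Λ).obj Q) :
    b.trace (f ≫ v) = c.trace (v ≫ (nakayama k Λ).map f) := by
  have h₁ (i) : v.hom (f.hom (b.elem i)) =
      ∑ j, ((c.coord j).hom (f.hom (b.elem i)) : Λ) • v.hom (c.elem j) := by
    conv_lhs => rw [← c.sum_smul (f.hom (b.elem i)), map_sum]
    exact Finset.sum_congr rfl fun j _ => map_smul _ _ _
  have h₂ (j) : ∑ i, b.coord i ≫ regularRightMul Λ ((c.coord j).hom (f.hom (b.elem i)) : Λ) =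
      f ≫ c.coord j := by
    refine ModuleCat.hom_ext (LinearMap.ext fun x => ?_)
    rw [ModuleCat.hom_sum, LinearMap.sum_apply]
    have h := congrArg (fun y => (c.coord j).hom (f.hom y)) (b.sum_smul x)
    rw [map_sum, map_sum] at h
    refine Eq.trans (Finset.sum_congr rfl fun i _ => ?_) h
    rw [map_smul, map_smul]
    rfl
  have h₃ (i) : nakayamaEval (b.coord i) ((f ≫ v).hom (b.elem i)) =
      ∑ j, nakayamaEval (b.coord i ≫ regularRightMul Λ
        ((c.coord j).hom (f.hom (b.elem i)) : Λ)) (v.hom (c.elem j)) := by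
    refine (congrArg (nakayamaEval (b.coord i)) (h₁ i)).trans ?_
    rw [nakayamaEval_sum_right]
    exact Finset.sum_congr rfl fun j _ => nakayamaEval_smul _ _ _
  unfold FiniteDualBasis.trace
  rw [Finset.sum_congr rfl fun i _ => h₃ i, Finset.sum_comm]
  refine Finset.sum_congr rfl fun j _ => ?_
  rw [← nakayamaEval_sum_left, h₂, nakayamaEval_comp]
  rfl

/-- The trace of `u : Q ⟶ Λ* ⊗_Λ Q` for a finitely generated projective module `Q`. -/
noncomputable def moduleTrace [Module.Finite Λ Q] [Projective Q] (u : Q ⟶ (nakayama k Λ).obj Q) :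
    k :=
  (nonempty_finiteDualBasis Q).some.trace u

lemma moduleTrace_comp [Module.Finite Λ Q] [Projective Q] [Module.Finite Λ R] [Projective R]
    (f : Q ⟶ R) (v : R ⟶ (nakayama k Λ).obj Q) :
    moduleTrace (f ≫ v) = moduleTrace (v ≫ (nakayama k Λ).map f) :=
  FiniteDualBasis.trace_comp _ _ f v

/-- Cyclicity for the identity morphism, with a different dual basis on each side. -/
lemma moduleTrace_eq [Module.Finite Λ Q] [Projective Q] (b : FiniteDualBasis Q)
    (u : Q ⟶ (nakayama k Λ).obj Q) : moduleTrace u = b.trace u := by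
  have := FiniteDualBasis.trace_comp (nonempty_finiteDualBasis Q).some b (𝟙 Q) u
  rw [Category.id_comp, CategoryTheory.Functor.map_id, Category.comp_id] at this
  exact this

lemma moduleTrace_add [Module.Finite Λ Q] [Projective Q] (u u' : Q ⟶ (nakayama k Λ).obj Q) :
    moduleTrace (u + u') = moduleTrace u + moduleTrace u' := by
  unfold moduleTrace FiniteDualBasis.trace
  rw [← Finset.sum_add_distrib]
  exact Finset.sum_congr rfl fun i _ => nakayamaEval_add_right _ _ _

lemma moduleTrace_smul [Module.Finite Λ Q] [Projective Q] (r : k)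
    (u : Q ⟶ (nakayama k Λ).obj Q) : moduleTrace (r • u) = r * moduleTrace u := by
  unfold moduleTrace FiniteDualBasis.trace
  rw [Finset.mul_sum]
  exact Finset.sum_congr rfl fun i _ => nakayamaEval_smul_base _ r _

/-- The dual basis of the regular module. -/
noncomputable def regularDualBasis : FiniteDualBasis (ModuleCat.of Λ Λ) where
  n := 1
  elem _ := (1 : Λ)
  coord _ := 𝟙 _
  sum_smul x := by
    rw [Fin.sum_univ_one]
    exact mul_one (x : Λ)

lemma moduleTrace_regular (u : ModuleCat.of Λ Λ ⟶ (nakayama k Λ).obj (ModuleCat.of Λ Λ)) :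
    moduleTrace u = dualEvalOne ((nakayamaRegularIso k Λ).hom.hom (u.hom (1 : Λ))) := by
  rw [moduleTrace_eq regularDualBasis]
  refine (Fin.sum_univ_one _).trans ?_
  exact congrArg (fun f : (nakayama k Λ).obj (ModuleCat.of Λ Λ) ⟶
    (nakayama k Λ).obj (ModuleCat.of Λ Λ) => dualEvalOne
    ((f ≫ (nakayamaRegularIso k Λ).hom).hom (u.hom (1 : Λ)))) (CategoryTheory.Functor.map_id _ _)

end ModuleTrace

/-! ## Bounded complexes of finitely generated projective modules -/

section StrictlyPerfect

variable {R : Type u} [Ring R]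

/-- A bounded complex of finitely generated projective modules. -/
class StrictlyPerfect (P : CochainComplex (ModuleCat.{u} R) ℤ) : Prop where
  finite (n : ℤ) : Module.Finite R (P.X n)
  projective (n : ℤ) : Projective (P.X n)
  bounded : ∃ a b : ℤ, P.IsStrictlyGE a ∧ P.IsStrictlyLE b

attribute [instance] StrictlyPerfect.finite StrictlyPerfect.projective

namespace StrictlyPerfect

instance isKProjective (P : CochainComplex (ModuleCat.{u} R) ℤ) [hP : StrictlyPerfect P] :
    P.IsKProjective := by
  obtain ⟨a, b, _, _⟩ := hP.bounded
  exact CochainComplex.isKProjective_of_projective P b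

instance shift (P : CochainComplex (ModuleCat.{u} R) ℤ) [hP : StrictlyPerfect P] (n : ℤ) :
    StrictlyPerfect (P⟦n⟧) where
  finite i := hP.finite (i + n)
  projective i := hP.projective (i + n)
  bounded := by
    obtain ⟨a, b, _, _⟩ := hP.bounded
    exact ⟨a - n, b - n, P.isStrictlyGE_shift a n (a - n) (by lia),
      P.isStrictlyLE_shift b n (b - n) (by lia)⟩

instance mappingCone {P Q : CochainComplex (ModuleCat.{u} R) ℤ} [hP : StrictlyPerfect P]
    [hQ : StrictlyPerfect Q] (f : P ⟶ Q) : StrictlyPerfect (CochainComplex.mappingCone f) := by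
  have e (n : ℤ) : Nonempty ((CochainComplex.mappingCone f).X n ≅ P.X (n + 1) ⊞ Q.X n) :=
    ⟨HomologicalComplex.homotopyCofiber.XIsoBiprod f n (n + 1) rfl⟩
  refine ⟨fun n => ?_, fun n => ?_, ?_⟩
  · obtain ⟨e⟩ := e n
    exact Module.Finite.equiv (e ≪≫ ModuleCat.biprodIsoProd _ _).toLinearEquiv.symm
  · obtain ⟨e⟩ := e n
    exact Projective.of_iso e.symm inferInstance
  · obtain ⟨a, b, _, _⟩ := hP.bounded
    obtain ⟨c, d, _, _⟩ := hQ.bounded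
    refine ⟨min (a - 1) c, max b d, ?_, ?_⟩
    · rw [CochainComplex.isStrictlyGE_iff]
      intro n hn
      obtain ⟨e⟩ := e n
      refine IsZero.of_iso ?_ e
      rw [biprod_isZero_iff]
      exact ⟨P.isZero_of_isStrictlyGE a _ (by lia), Q.isZero_of_isStrictlyGE c _ (by lia)⟩
    · rw [CochainComplex.isStrictlyLE_iff]
      intro n hn
      obtain ⟨e⟩ := e n
      refine IsZero.of_iso ?_ e
      rw [biprod_isZero_iff]
      exact ⟨P.isZero_of_isStrictlyLE b _ (by lia), Q.isZero_of_isStrictlyLE d _ (by lia)⟩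

instance single (M : ModuleCat.{u} R) [Module.Finite R M] [Projective M] :
    StrictlyPerfect ((CochainComplex.singleFunctor (ModuleCat.{u} R) 0).obj M) where
  finite n := by
    by_cases h : n = 0
    · exact Module.Finite.equiv
        (HomologicalComplex.singleObjXIsoOfEq (.up ℤ) 0 M n h).symm.toLinearEquiv
    · exact finite_of_isZero (HomologicalComplex.isZero_single_obj_X (.up ℤ) 0 M n h)
  projective n := by
    by_cases h : n = 0
    · exact Projective.of_iso
        (HomologicalComplex.singleObjXIsoOfEq (.up ℤ) 0 M n h).symm inferInstance
    · exact (HomologicalComplex.isZero_single_obj_X (.up ℤ) 0 M n h).projective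
  bounded := ⟨0, 0, inferInstance, inferInstance⟩

/-- The source is K-projective, so morphisms out of it in the derived category are homotopy classes
of chain maps. -/
lemma exists_Q_map_eq {P K : CochainComplex (ModuleCat.{u} R) ℤ} [StrictlyPerfect P]
    (f : DerivedCategory.Q.obj P ⟶ DerivedCategory.Q.obj K) :
    ∃ g : P ⟶ K, DerivedCategory.Q.map g = f := by
  let e := DerivedCategory.quotientCompQhIso (ModuleCat.{u} R)
  obtain ⟨g, hg⟩ := (CochainComplex.IsKProjective.Qh_map_bijective P
    ((HomotopyCategory.quotient _ _).obj K)).surjective (e.hom.app P ≫ f ≫ e.inv.app K)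
  obtain ⟨g, rfl⟩ := (HomotopyCategory.quotient _ _).map_surjective g
  refine ⟨g, ?_⟩
  have h : (HomotopyCategory.quotient _ _ ⋙ DerivedCategory.Qh).map g ≫ e.hom.app K =
      e.hom.app P ≫ DerivedCategory.Q.map g := e.hom.naturality g
  rw [← cancel_epi (e.hom.app P), ← h]
  refine (congrArg (· ≫ e.hom.app K) hg).trans ?_
  simp

lemma nonempty_homotopy {P K : CochainComplex (ModuleCat.{u} R) ℤ} [StrictlyPerfect P]
    {f g : P ⟶ K} (h : DerivedCategory.Q.map f = DerivedCategory.Q.map g) :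
    Nonempty (Homotopy f g) := by
  let e := DerivedCategory.quotientCompQhIso (ModuleCat.{u} R)
  refine ⟨HomotopyCategory.homotopyOfEq _ _ ((CochainComplex.IsKProjective.Qh_map_bijective P
    ((HomotopyCategory.quotient _ _).obj K)).injective ?_)⟩
  have hn (f : P ⟶ K) : (HomotopyCategory.quotient _ _ ⋙ DerivedCategory.Qh).map f ≫ e.hom.app K =
      e.hom.app P ≫ DerivedCategory.Q.map f := e.hom.naturality f
  have h' := (hn f).trans ((congrArg (e.hom.app P ≫ ·) h).trans (hn g).symm)
  exact (cancel_mono (e.hom.app K)).1 h'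

end StrictlyPerfect

/-- For cones, the first morphism of the triangle lifts to a chain map between strictly perfect
complexes, and the mapping cone of the lift is strictly perfect. -/
lemma isTriangulatedClass_strictlyPerfect : IsTriangulatedClass
    (fun X : DerivedCategory (ModuleCat.{u} R) => ∃ P : CochainComplex (ModuleCat.{u} R) ℤ,
      StrictlyPerfect P ∧ Nonempty (X ≅ DerivedCategory.Q.obj P)) where
  of_iso e := fun ⟨P, hP, ⟨i⟩⟩ => ⟨P, hP, ⟨e.symm ≪≫ i⟩⟩
  shift n := fun ⟨P, hP, ⟨i⟩⟩ => ⟨P⟦n⟧, inferInstance,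
    ⟨(shiftFunctor _ n).mapIso i ≪≫ ((DerivedCategory.Q.commShiftIso n).app P).symm⟩⟩
  cone {A} hA := fun ⟨P, hP, ⟨i⟩⟩ ⟨Q, hQ, ⟨j⟩⟩ => by
    obtain ⟨f, hf⟩ := StrictlyPerfect.exists_Q_map_eq (i.inv ≫ A.mor₁ ≫ j.hom)
    refine ⟨CochainComplex.mappingCone f, inferInstance, ⟨Pretriangulated.Triangle.π₃.mapIso
      (Pretriangulated.isoTriangleOfIso₁₂ A (DerivedCategory.Q.mapTriangle.obj
        (CochainComplex.mappingCone.triangle f)) hA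
          (DerivedCategory.mappingCone_triangle_distinguished f) i j ?_)⟩⟩
    exact (Iso.hom_inv_id_assoc i _).symm.trans (congrArg (i.hom ≫ ·) hf.symm)

lemma exists_strictlyPerfect [IsNoetherianRing R] (hR : HasFiniteGlobalDimension R)
    (X : DerivedCategory (ModuleCat.{u} R)) (hX : finiteBounded R X) :
    ∃ P : CochainComplex (ModuleCat.{u} R) ℤ,
      StrictlyPerfect P ∧ Nonempty (X ≅ DerivedCategory.Q.obj P) :=
  isTriangulatedClass_strictlyPerfect.of_projective hR
    (fun M _ _ => ⟨_, StrictlyPerfect.single M, ⟨Iso.refl _⟩⟩) X hX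

end StrictlyPerfect

/-! ### Supertraces on bounded complexes of projective modules -/

section Supertrace

open scoped ModuleCat

variable {k : Type u} [Field k] {Λ : Type u} [Ring Λ] [Algebra k Λ]

variable (k Λ) in
/-- The functor `Λ* ⊗_Λ -` on complexes of modules. -/
noncomputable abbrev nakayamaCochain :
    CochainComplex (ModuleCat.{u} Λ) ℤ ⥤ CochainComplex (ModuleCat.{u} Λ) ℤ :=
  (nakayama k Λ).mapHomologicalComplex (.up ℤ)

variable {P Q : CochainComplex (ModuleCat.{u} Λ) ℤ} [hP : StrictlyPerfect P] [StrictlyPerfect Q]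

/-- The component of a chain map `P ⟶ Λ* ⊗_Λ P`. -/
noncomputable def nakayamaComponent (u : P ⟶ (nakayamaCochain k Λ).obj P) (n : ℤ) :
    P.X n ⟶ (nakayama k Λ).obj (P.X n) :=
  u.f n

/-- The alternating sum of the traces of the components of a chain map. -/
noncomputable def supertrace (u : P ⟶ (nakayamaCochain k Λ).obj P) : k :=
  ∑ᶠ n : ℤ, n.negOnePow • moduleTrace (nakayamaComponent u n)

lemma moduleTrace_zero {M : ModuleCat.{u} Λ} [Module.Finite Λ M] [Projective M] :
    moduleTrace (0 : M ⟶ (nakayama k Λ).obj M) = 0 := by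
  have := moduleTrace_smul (0 : k) (0 : M ⟶ (nakayama k Λ).obj M)
  rwa [zero_smul, zero_mul] at this

variable (P) in
lemma finite_support_moduleTrace (g : ∀ n : ℤ, P.X n ⟶ (nakayama k Λ).obj (P.X n)) (e : ℤ → ℤˣ) :
    (Function.support fun n : ℤ => e n • moduleTrace (g n)).Finite := by
  obtain ⟨a, b, _, _⟩ := hP.bounded
  refine (Set.finite_Icc a b).subset fun n hn => ?_
  by_contra h
  have hz : IsZero (P.X n) := by
    rw [Set.mem_Icc, not_and_or, not_le, not_le] at h
    rcases h with h | h
    · exact P.isZero_of_isStrictlyGE a n h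
    · exact P.isZero_of_isStrictlyLE b n h
  refine hn ?_
  change e n • moduleTrace (g n) = 0
  rw [hz.eq_of_src (g n) 0, moduleTrace_zero, smul_zero]

lemma supertrace_add (u u' : P ⟶ (nakayamaCochain k Λ).obj P) :
    supertrace (u + u') = supertrace u + supertrace u' := by
  unfold supertrace
  rw [← finsum_add_distrib (finite_support_moduleTrace P _ _) (finite_support_moduleTrace P _ _)]
  refine finsum_congr fun n => ?_
  rw [← smul_add, ← moduleTrace_add]
  rfl

lemma supertrace_smul (r : k) (u : P ⟶ (nakayamaCochain k Λ).obj P) :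
    supertrace (r • u) = r * supertrace u := by
  unfold supertrace
  rw [← smul_eq_mul, smul_finsum]
  refine finsum_congr fun n => ?_
  rw [smul_comm, smul_eq_mul, ← moduleTrace_smul]
  rfl

lemma supertrace_comp (f : P ⟶ Q) (v : Q ⟶ (nakayamaCochain k Λ).obj P) :
    supertrace (f ≫ v) = supertrace (v ≫ (nakayamaCochain k Λ).map f) :=
  finsum_congr fun n => congrArg (n.negOnePow • ·) (moduleTrace_comp (f.f n)
    (show Q.X n ⟶ (nakayama k Λ).obj (P.X n) from v.f n))

/-- A null-homotopic map is `ds + sd`. By cyclicity the trace of `ds` in degree `n` is the trace of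
`sd` in degree `n + 1`, and the alternating sum telescopes; it is finite since `P` is bounded. -/
lemma supertrace_eq_zero {u : P ⟶ (nakayamaCochain k Λ).obj P} (h : Homotopy u 0) :
    supertrace u = 0 := by
  let s (n : ℤ) : P.X n ⟶ (nakayama k Λ).obj (P.X (n - 1)) := h.hom n (n - 1)
  let s' (n : ℤ) : P.X (n + 1) ⟶ (nakayama k Λ).obj (P.X n) := h.hom (n + 1) n
  let t (n : ℤ) : k := moduleTrace (s n ≫ (nakayama k Λ).map (P.d (n - 1) n))
  have ht (n : ℤ) : moduleTrace (P.d n (n + 1) ≫ s' n) = t (n + 1) := by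
    -- In `t (n + 1)` the homotopy ends in degree `n + 1 - 1`, which has to be identified with `n`.
    have aux : ∀ m, n = m → moduleTrace (P.d n (n + 1) ≫ s' n) = moduleTrace
        ((show P.X (n + 1) ⟶ (nakayama k Λ).obj (P.X m) from h.hom (n + 1) m) ≫
          (nakayama k Λ).map (P.d m (n + 1))) := by
      rintro _ rfl
      exact moduleTrace_comp _ _
    exact aux (n + 1 - 1) (by lia)
  have h₁ (n : ℤ) : nakayamaComponent u n = P.d n (n + 1) ≫ s' n +
      s n ≫ (nakayama k Λ).map (P.d (n - 1) n) := by
    have h' := h.comm n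
    rw [dNext_eq h.hom (show (ComplexShape.up ℤ).Rel n (n + 1) from rfl),
      prevD_eq h.hom (show (ComplexShape.up ℤ).Rel (n - 1) n from sub_add_cancel n 1),
      HomologicalComplex.zero_f, add_zero] at h'
    exact h'
  have h₂ (n : ℤ) : n.negOnePow • moduleTrace (nakayamaComponent u n) =
      n.negOnePow • t n - (n + 1).negOnePow • t (n + 1) := by
    rw [h₁, moduleTrace_add, ht, Int.negOnePow_succ, Units.neg_smul, sub_neg_eq_add, smul_add,
      add_comm]
  have hf : (Function.support fun n : ℤ => n.negOnePow • t n).Finite :=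
    finite_support_moduleTrace P _ _
  have hf' : (Function.support fun n : ℤ => (n + 1).negOnePow • t (n + 1)).Finite :=
    hf.preimage (f := fun n : ℤ => n + 1) (fun a _ b _ e => by simpa using e)
  unfold supertrace
  rw [finsum_congr h₂, finsum_sub_distrib hf hf', sub_eq_zero]
  exact (finsum_comp_equiv (Equiv.addRight (1 : ℤ)) (f := fun n : ℤ => n.negOnePow • t n)).symm

lemma supertrace_eq_of_homotopy {u u' : P ⟶ (nakayamaCochain k Λ).obj P} (h : Homotopy u u') :
    supertrace u = supertrace u' := by
  have h₁ : supertrace (u - u') = 0 := supertrace_eq_zero (Homotopy.equivSubZero h)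
  have h₂ := supertrace_add (u - u') u'
  rwa [sub_add_cancel, h₁, zero_add] at h₂

/-- Shifting reindexes the degrees by one and so reverses the alternating sign. This minus sign is
the reason why the equivariant Serre functor carries `s = -ζ`. -/
lemma supertrace_shift (u : P ⟶ (nakayamaCochain k Λ).obj P) :
    supertrace (P := P⟦(1 : ℤ)⟧)
      (u⟦(1 : ℤ)⟧' ≫ ((nakayamaCochain k Λ).commShiftIso (1 : ℤ)).inv.app P) = -supertrace u := by
  unfold supertrace
  rw [← finsum_comp_equiv (Equiv.addRight (1 : ℤ)) (f := fun n : ℤ => n.negOnePow •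
    moduleTrace (nakayamaComponent u n)), ← finsum_neg_distrib]
  refine finsum_congr fun n => ?_
  have : nakayamaComponent (P := P⟦(1 : ℤ)⟧)
      (u⟦(1 : ℤ)⟧' ≫ ((nakayamaCochain k Λ).commShiftIso (1 : ℤ)).inv.app P) n =
      nakayamaComponent u (n + 1) := Category.comp_id _
  rw [this]
  change _ = -((n + 1).negOnePow • moduleTrace (nakayamaComponent u (n + 1)))
  rw [Int.negOnePow_succ, Units.neg_smul, neg_neg]
  rfl

end Supertrace

/-! ## Traces in the derived category -/

/-- The formal part of `PerfectResolution.trace_shift`: shifting a morphism and then transporting it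
along a resolution agrees with transporting it and then shifting. -/
lemma transport_shift_aux {C D : Type*} [Category* C] [Category* D] [HasShift C ℤ] [HasShift D ℤ]
    (F : D ⥤ D) [F.CommShift ℤ] (Q : C ⥤ D) [Q.CommShift ℤ] (ν : C ⥤ C) [ν.CommShift ℤ] {X : D}
    {P : C} (e : X ≅ Q.obj P) (v : X ⟶ F.obj X) (θ : F.obj (Q.obj P) ⟶ Q.obj (ν.obj P))
    (θ' : F.obj (Q.obj (P⟦(1 : ℤ)⟧)) ⟶ Q.obj (ν.obj (P⟦(1 : ℤ)⟧)))
    (hc : (F.map ((Q.commShiftIso (1 : ℤ)).hom.app P) ≫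
      (F.commShiftIso (1 : ℤ)).hom.app (Q.obj P)) ≫ θ⟦(1 : ℤ)⟧' =
        θ' ≫ Q.map ((ν.commShiftIso (1 : ℤ)).hom.app P) ≫
          (Q.commShiftIso (1 : ℤ)).hom.app (ν.obj P))
    (u : P⟦(1 : ℤ)⟧ ⟶ (ν.obj P)⟦(1 : ℤ)⟧)
    (hu : Q.map u = (Q.commShiftIso (1 : ℤ)).hom.app P ≫
      (e.inv ≫ v ≫ F.map e.hom ≫ θ)⟦(1 : ℤ)⟧' ≫ (Q.commShiftIso (1 : ℤ)).inv.app (ν.obj P)) :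
    Q.map (u ≫ (ν.commShiftIso (1 : ℤ)).inv.app P) =
      ((Q.commShiftIso (1 : ℤ)).hom.app P ≫ e.inv⟦(1 : ℤ)⟧') ≫
      (v⟦(1 : ℤ)⟧' ≫ (F.commShiftIso (1 : ℤ)).inv.app X) ≫
        F.map (e.hom⟦(1 : ℤ)⟧' ≫ (Q.commShiftIso (1 : ℤ)).inv.app P) ≫ θ' := by
  have n := (F.commShiftIso (1 : ℤ)).inv.naturality e.hom
  have h₁ := (Q.commShiftIso (1 : ℤ)).hom_inv_id_app (ν.obj P)
  have h₂ : Q.map ((ν.commShiftIso (1 : ℤ)).hom.app P) ≫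
      Q.map ((ν.commShiftIso (1 : ℤ)).inv.app P) = 𝟙 _ := by
    rw [← Functor.map_comp, Iso.hom_inv_id_app, CategoryTheory.Functor.map_id]
  have h₃ : θ⟦(1 : ℤ)⟧' ≫ (Q.commShiftIso (1 : ℤ)).inv.app (ν.obj P) ≫
      Q.map ((ν.commShiftIso (1 : ℤ)).inv.app P) = (F.commShiftIso (1 : ℤ)).inv.app (Q.obj P) ≫
        F.map ((Q.commShiftIso (1 : ℤ)).inv.app P) ≫ θ' := by
    rw [← cancel_epi ((F.commShiftIso (1 : ℤ)).hom.app (Q.obj P)),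
      ← cancel_epi (F.map ((Q.commShiftIso (1 : ℤ)).hom.app P))]
    have e₁ := congrArg (· ≫ (Q.commShiftIso (1 : ℤ)).inv.app (ν.obj P) ≫
      Q.map ((ν.commShiftIso (1 : ℤ)).inv.app P)) hc
    simp only [Category.assoc] at e₁
    dsimp at h₁
    rw [reassoc_of% h₁, h₂] at e₁
    refine e₁.trans ((Category.comp_id _).trans ?_)
    rw [Iso.hom_inv_id_app_assoc, ← Functor.map_comp_assoc, Iso.hom_inv_id_app,
      CategoryTheory.Functor.map_id]
    exact (Category.id_comp _).symm
  dsimp at n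
  simp only [Functor.map_comp, hu, Category.assoc]
  rw [h₃, reassoc_of% n]

section DerivedTrace

open scoped ModuleCat

variable {k : Type u} [Field k] {Λ : Type u} [Ring Λ] [Algebra k Λ]

variable (k Λ) in
/-- The derived tensor product with `Λ*`. -/
noncomputable abbrev derivedNakayama :
    DerivedCategory (ModuleCat.{u} Λ) ⥤ DerivedCategory (ModuleCat.{u} Λ) :=
  derivedTensorFunctor (dualComplex k Λ)

variable (k Λ) in
/-- The tensor product of complexes with `Λ*`, computed degreewise. -/
noncomputable def nakayamaTensorIso : tensorCochain (dualComplex k Λ) ≅ nakayamaCochain k Λ :=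
  (singleMap₂CochainComplexIso (tensorModBifunctor k Λ) (dualBimod k Λ)).symm

instance : NatTrans.CommShift (nakayamaTensorIso k Λ).hom ℤ :=
  inferInstanceAs (NatTrans.CommShift
    (singleMap₂CochainComplexIso (tensorModBifunctor k Λ) (dualBimod k Λ)).symm.hom ℤ)

/-- The comparison of the derived tensor product with the tensor product with `Λ*`. -/
noncomputable def nakayamaComparison :
    DerivedCategory.Q ⋙ derivedNakayama k Λ ⟶ nakayamaCochain k Λ ⋙ DerivedCategory.Q :=
  (derivedTensorFunctorFac (dualComplex k Λ)).hom ≫ Functor.whiskerRight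
    (derivedTensorCochainCounit (dualComplex k Λ) ≫ (nakayamaTensorIso k Λ).hom) DerivedCategory.Q

instance : NatTrans.CommShift (nakayamaComparison (k := k) (Λ := Λ)) ℤ := by
  unfold nakayamaComparison
  infer_instance

/-- The definition of traces uses only the comparison map. Its invertibility at `Λ` is needed to
compute the pairing there. -/
instance : IsIso ((nakayamaComparison (k := k) (Λ := Λ)).app (regularModuleComplex Λ)) := by
  have h : QuasiIso ((derivedTensorCochainCounit (dualComplex k Λ)).app (regularModuleComplex Λ) ≫
      ((nakayamaTensorIso k Λ).app (regularModuleComplex Λ)).hom) := inferInstance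
  have h2 := (DerivedCategory.isIso_Q_map_iff_quasiIso (C := ModuleCat.{u} Λ) _).2 h
  exact IsIso.comp_isIso' (inferInstanceAs (IsIso ((derivedTensorFunctorFac
    (dualComplex k Λ)).app (regularModuleComplex Λ)).hom)) h2

/-- A resolution by a bounded complex of finitely generated projective modules. -/
structure PerfectResolution (X : DerivedCategory (ModuleCat.{u} Λ)) where
  /-- the complex -/
  complex : CochainComplex (ModuleCat.{u} Λ) ℤ
  perfect : StrictlyPerfect complex
  /-- the isomorphism in the derived category -/
  iso : X ≅ DerivedCategory.Q.obj complex

namespace PerfectResolution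

attribute [instance] PerfectResolution.perfect

variable {X Y : DerivedCategory (ModuleCat.{u} Λ)} (p : PerfectResolution X)
  (q : PerfectResolution Y)

/-- The morphism `P ⟶ Λ* ⊗_Λ R` in the derived category which corresponds to
`X ⟶ Λ* ⊗^L_Λ Y`. -/
noncomputable def transport (v : X ⟶ (derivedNakayama k Λ).obj Y) :
    DerivedCategory.Q.obj p.complex ⟶
      DerivedCategory.Q.obj ((nakayamaCochain k Λ).obj q.complex) :=
  p.iso.inv ≫ v ≫ (derivedNakayama k Λ).map q.iso.hom ≫ nakayamaComparison.app q.complex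

/-- The trace of a morphism `X ⟶ Λ* ⊗^L_Λ X`. -/
noncomputable def trace (v : X ⟶ (derivedNakayama k Λ).obj X) : k :=
  supertrace (StrictlyPerfect.exists_Q_map_eq (p.transport p v)).choose

lemma trace_eq (v : X ⟶ (derivedNakayama k Λ).obj X)
    (u : p.complex ⟶ (nakayamaCochain k Λ).obj p.complex)
    (h : DerivedCategory.Q.map u = p.transport p v) : p.trace v = supertrace u :=
  supertrace_eq_of_homotopy (StrictlyPerfect.nonempty_homotopy
    ((StrictlyPerfect.exists_Q_map_eq (p.transport p v)).choose_spec.trans h.symm)).some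

lemma trace_add (v v' : X ⟶ (derivedNakayama k Λ).obj X) :
    p.trace (v + v') = p.trace v + p.trace v' := by
  obtain ⟨u, hu⟩ := StrictlyPerfect.exists_Q_map_eq (p.transport p v)
  obtain ⟨u', hu'⟩ := StrictlyPerfect.exists_Q_map_eq (p.transport p v')
  rw [p.trace_eq v u hu, p.trace_eq v' u' hu', ← supertrace_add]
  refine p.trace_eq _ _ ?_
  rw [Functor.map_add, hu, hu']
  simp [transport]

lemma trace_smul (r : k) (v : X ⟶ (derivedNakayama k Λ).obj X) :
    p.trace (r • v) = r * p.trace v := by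
  obtain ⟨u, hu⟩ := StrictlyPerfect.exists_Q_map_eq (p.transport p v)
  rw [p.trace_eq v u hu, ← supertrace_smul]
  refine p.trace_eq _ _ ?_
  rw [Functor.map_smul, hu]
  simp [transport]

/-- Represent both morphisms by chain maps between the chosen resolutions; naturality of the
comparison map then reduces the claim to cyclicity of the supertrace. -/
lemma trace_comp (f : X ⟶ Y) (v : Y ⟶ (derivedNakayama k Λ).obj X) :
    p.trace (f ≫ v) = q.trace (v ≫ (derivedNakayama k Λ).map f) := by
  obtain ⟨g, hg⟩ := StrictlyPerfect.exists_Q_map_eq (p.iso.inv ≫ f ≫ q.iso.hom)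
  obtain ⟨w, hw⟩ := StrictlyPerfect.exists_Q_map_eq (q.transport p v)
  rw [p.trace_eq (f ≫ v) (g ≫ w), q.trace_eq (v ≫ (derivedNakayama k Λ).map f)
    (w ≫ (nakayamaCochain k Λ).map g), supertrace_comp]
  · have n : (derivedNakayama k Λ).map (DerivedCategory.Q.map g) ≫
        nakayamaComparison.app q.complex = nakayamaComparison.app p.complex ≫
          DerivedCategory.Q.map ((nakayamaCochain k Λ).map g) := nakayamaComparison.naturality g
    rw [Functor.map_comp, hw]
    unfold transport
    simp only [Category.assoc]
    refine congrArg (fun x => q.iso.inv ≫ v ≫ (derivedNakayama k Λ).map p.iso.hom ≫ x) n.symm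
      |>.trans ?_
    rw [hg]
    simp
  · rw [Functor.map_comp, hg, hw]
    simp [transport]

/-- Cyclicity with `f = 𝟙 X` compares two resolutions of the same object. -/
lemma trace_unique (p' : PerfectResolution X) (v : X ⟶ (derivedNakayama k Λ).obj X) :
    p.trace v = p'.trace v := by
  have := p.trace_comp p' (𝟙 X) v
  rwa [Category.id_comp, CategoryTheory.Functor.map_id, Category.comp_id] at this

/-- The shift of a resolution. -/
noncomputable def shift : PerfectResolution (X⟦(1 : ℤ)⟧) where
  complex := p.complex⟦(1 : ℤ)⟧
  perfect := inferInstance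
  iso := (shiftFunctor _ (1 : ℤ)).mapIso p.iso ≪≫
    (DerivedCategory.Q.commShiftIso (1 : ℤ)).symm.app p.complex

lemma trace_shift (v : X ⟶ (derivedNakayama k Λ).obj X) :
    p.shift.trace (v⟦(1 : ℤ)⟧' ≫ ((derivedNakayama k Λ).commShiftIso (1 : ℤ)).inv.app X) =
      -p.trace v := by
  obtain ⟨u, hu⟩ := StrictlyPerfect.exists_Q_map_eq (p.transport p v)
  rw [p.trace_eq v u hu, ← supertrace_shift]
  refine p.shift.trace_eq _ _ ?_
  have hc := NatTrans.shift_app_comm (nakayamaComparison (k := k) (Λ := Λ)) (1 : ℤ) p.complex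
  rw [Functor.commShiftIso_comp_hom_app, Functor.commShiftIso_comp_hom_app] at hc
  have hu' : DerivedCategory.Q.map (u⟦(1 : ℤ)⟧') =
      (DerivedCategory.Q.commShiftIso (1 : ℤ)).hom.app p.complex ≫
        (p.transport p v)⟦(1 : ℤ)⟧' ≫
          (DerivedCategory.Q.commShiftIso (1 : ℤ)).inv.app ((nakayamaCochain k Λ).obj p.complex) :=
            by
    have n := (DerivedCategory.Q.commShiftIso (1 : ℤ)).hom.naturality u
    rw [← hu, ← Category.assoc]
    exact (Iso.eq_comp_inv ((DerivedCategory.Q.commShiftIso (1 : ℤ)).app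
      ((nakayamaCochain k Λ).obj p.complex))).2 n
  exact transport_shift_aux (derivedNakayama k Λ) DerivedCategory.Q (nakayamaCochain k Λ)
    p.iso v (nakayamaComparison.app p.complex) (nakayamaComparison.app (p.complex⟦(1 : ℤ)⟧)) hc _
      hu'

end PerfectResolution

end DerivedTrace

/-! ## The trace pairing -/

lemma exact_dualMap {K V₁ V₂ V₃ : Type*} [Field K] [AddCommGroup V₁] [AddCommGroup V₂]
    [AddCommGroup V₃] [Module K V₁] [Module K V₂] [Module K V₃] {f : V₁ →ₗ[K] V₂}
    {g : V₂ →ₗ[K] V₃} (h : Function.Exact f g) : Function.Exact g.dualMap f.dualMap := by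
  rw [LinearMap.exact_iff, LinearMap.range_dualMap_eq_dualAnnihilator_ker,
    LinearMap.ker_dualMap_eq_dualAnnihilator_range, LinearMap.exact_iff.1 h]

/-- A retract of a bijective natural map is bijective. -/
lemma bijective_of_retract {V V' W W' : Type*} {t : V → W} {t' : V' → W'} (i : V' → V) (r : V → V')
    (hir : ∀ x, r (i x) = x) (j : W' → W) (s : W → W') (hjs : ∀ y, s (j y) = y)
    (h₁ : ∀ x, t (i x) = j (t' x)) (h₂ : ∀ x, t' (r x) = s (t x)) (h : Function.Bijective t) :
    Function.Bijective t' := by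
  constructor
  · intro x y hxy
    rw [← hir x, ← hir y, h.1 ((h₁ x).trans ((congrArg j hxy).trans (h₁ y).symm))]
  · intro y
    obtain ⟨x, hx⟩ := h.2 (j y)
    exact ⟨r x, by rw [h₂, hx, hjs]⟩

section Pairing

open scoped ModuleCat
open Pretriangulated

variable {k : Type u} [Field k] {Λ : Type u} [Ring Λ] [Algebra k Λ]

namespace PerfectResolution

variable {X Y : DerivedCategory (ModuleCat.{u} Λ)} (p : PerfectResolution X)

variable (k) in
/-- The pairing of `Hom(X, Y)` with `Hom(Y, Λ* ⊗^L_Λ X)` given by the trace. -/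
noncomputable def pairing (Y : DerivedCategory (ModuleCat.{u} Λ)) :
    (X ⟶ Y) →ₗ[k] Module.Dual k (Y ⟶ (derivedNakayama k Λ).obj X) :=
  LinearMap.mk₂ k (fun f v => p.trace (f ≫ v))
    (fun f f' v => by rw [Preadditive.add_comp, trace_add])
    (fun r f v => by rw [Linear.smul_comp, trace_smul, smul_eq_mul])
    (fun f v v' => by rw [Preadditive.comp_add, trace_add])
    (fun r f v => by rw [Linear.comp_smul, trace_smul, smul_eq_mul])

lemma pairing_unique (p' : PerfectResolution X) : p.pairing k Y = p'.pairing k Y := by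
  ext f v
  exact p.trace_unique p' _

lemma pairing_comp_right {Y' : DerivedCategory (ModuleCat.{u} Λ)} (f : X ⟶ Y) (a : Y ⟶ Y') :
    p.pairing k Y' (f ≫ a) = (Linear.leftComp k _ a).dualMap (p.pairing k Y f) := by
  ext v
  exact congrArg p.trace (Category.assoc _ _ _)

lemma pairing_comp_left {X' : DerivedCategory (ModuleCat.{u} Λ)} (p' : PerfectResolution X')
    (a : X' ⟶ X) (f : X ⟶ Y) : p'.pairing k Y (a ≫ f) =
      (Linear.rightComp k _ ((derivedNakayama k Λ).map a)).dualMap (p.pairing k Y f) := by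
  ext v
  refine (congrArg p'.trace (Category.assoc _ _ _)).trans ((p'.trace_comp p a (f ≫ v)).trans ?_)
  exact congrArg p.trace (Category.assoc _ _ _)

lemma bijective_pairing_retract_right {Y' : DerivedCategory (ModuleCat.{u} Λ)} (r : Retract Y' Y)
    (h : Function.Bijective (p.pairing k Y)) : Function.Bijective (p.pairing k Y') := by
  have e : ∀ φ, (Linear.leftComp k ((derivedNakayama k Λ).obj X) r.r).dualMap
      ((Linear.leftComp k ((derivedNakayama k Λ).obj X) r.i).dualMap φ) = φ :=
    fun φ => LinearMap.ext fun v => congrArg φ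
      ((Category.assoc _ _ _).symm.trans ((congrArg (· ≫ v) r.retract).trans (Category.id_comp _)))
  exact bijective_of_retract (· ≫ r.i) (· ≫ r.r) (fun x => by simp)
    (Linear.leftComp k ((derivedNakayama k Λ).obj X) r.i).dualMap
      (Linear.leftComp k ((derivedNakayama k Λ).obj X) r.r).dualMap e
    (fun x => p.pairing_comp_right x r.i) (fun x => p.pairing_comp_right x r.r) h

lemma bijective_pairing_retract_left {X' : DerivedCategory (ModuleCat.{u} Λ)}
    (p' : PerfectResolution X') (r : Retract X' X)
    (h : Function.Bijective (p.pairing k Y)) : Function.Bijective (p'.pairing k Y) := by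
  have e : ∀ φ, (Linear.rightComp k Y ((derivedNakayama k Λ).map r.i)).dualMap
      ((Linear.rightComp k Y ((derivedNakayama k Λ).map r.r)).dualMap φ) = φ :=
    fun φ => LinearMap.ext fun v => congrArg φ
      ((Category.assoc _ _ _).trans ((congrArg (v ≫ ·) (r.map (derivedNakayama k Λ)).retract).trans
        (Category.comp_id _)))
  exact bijective_of_retract (r.r ≫ ·) (r.i ≫ ·) (fun x => by
      rw [← Category.assoc, r.retract, Category.id_comp])
    (Linear.rightComp k _ ((derivedNakayama k Λ).map r.r)).dualMap
    (Linear.rightComp k _ ((derivedNakayama k Λ).map r.i)).dualMap e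
    (fun x => p'.pairing_comp_left p r.r x) (fun x => p.pairing_comp_left p' r.i x) h

lemma pairing_shift (f : X ⟶ Y) (v : Y ⟶ (derivedNakayama k Λ).obj X) :
    p.shift.pairing k (Y⟦(1 : ℤ)⟧) (f⟦(1 : ℤ)⟧')
      (v⟦(1 : ℤ)⟧' ≫ ((derivedNakayama k Λ).commShiftIso (1 : ℤ)).inv.app X) =
        -p.pairing k Y f v := by
  refine Eq.trans (congrArg p.shift.trace ?_) (p.trace_shift (f ≫ v))
  rw [Functor.map_comp, Category.assoc]

/-- The two pairings correspond to each other up to the sign `-1` and the bijections induced by the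
shift. -/
lemma bijective_pairing_shift_iff : Function.Bijective (p.shift.pairing k (Y⟦(1 : ℤ)⟧)) ↔
    Function.Bijective (p.pairing k Y) := by
  let e : (Y ⟶ (derivedNakayama k Λ).obj X) →ₗ[k]
      (Y⟦(1 : ℤ)⟧ ⟶ (derivedNakayama k Λ).obj (X⟦(1 : ℤ)⟧)) :=
    (Linear.rightComp k _ (((derivedNakayama k Λ).commShiftIso (1 : ℤ)).inv.app X)) ∘ₗ
      (shiftFunctor (DerivedCategory (ModuleCat.{u} Λ)) (1 : ℤ)).mapLinearMap k
  have hs (A B : DerivedCategory (ModuleCat.{u} Λ)) : Function.Bijective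
      ((shiftFunctor (DerivedCategory (ModuleCat.{u} Λ)) (1 : ℤ)).map : (A ⟶ B) → _) :=
    ⟨Functor.map_injective _, Functor.map_surjective _⟩
  have he : Function.Bijective e :=
    (bijective_comp_of_isIso (((derivedNakayama k Λ).commShiftIso (1 : ℤ)).inv.app X) _).comp
      (hs _ _)
  let e' := LinearEquiv.ofBijective e he
  have h : ⇑(p.pairing k Y) = (fun φ => -φ) ∘ e'.dualMap ∘ p.shift.pairing k (Y⟦(1 : ℤ)⟧) ∘
      (shiftFunctor (DerivedCategory (ModuleCat.{u} Λ)) (1 : ℤ)).map := by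
    funext f
    refine LinearMap.ext fun v => ?_
    exact (neg_eq_iff_eq_neg.2 (p.pairing_shift f v)).symm
  rw [h, (neg_involutive.bijective).of_comp_iff', e'.dualMap.bijective.of_comp_iff',
    (hs X Y).of_comp_iff]

/-- The five lemma in the second argument: both `Hom(X, -)` and the dual of `Hom(-, Λ* ⊗^L_Λ X)` are
covariant and half-exact, and exactness survives dualization over a field. -/
lemma bijective_pairing_of_distinguished {A : Triangle (DerivedCategory (ModuleCat.{u} Λ))}
    (hA : A ∈ distTriang _) (h₁ : Function.Bijective (p.pairing k A.obj₁))
    (h₂ : Function.Bijective (p.pairing k A.obj₂))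
    (h₃ : Function.Bijective (p.pairing k (A.obj₁⟦(1 : ℤ)⟧)))
    (h₄ : Function.Bijective (p.pairing k (A.obj₂⟦(1 : ℤ)⟧))) :
    Function.Bijective (p.pairing k A.obj₃) := by
  refine bijective_of_distinguished_covariant (V := fun Y => X ⟶ Y)
    (W := fun Y => Module.Dual k (Y ⟶ (derivedNakayama k Λ).obj X))
    (fun a => (Linear.rightComp k X a).toAddMonoidHom)
    (fun a => (Linear.leftComp k _ a).dualMap.toAddMonoidHom)
    (fun Y => (p.pairing k Y).toAddMonoidHom) (fun a f => p.pairing_comp_right f a)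
    (fun {A} hA => PreservesCones.exact_hom (𝟭 _) X hA) (fun {A} hA => ?_) hA h₁ h₂ h₃ h₄
  refine exact_dualMap (f := Linear.leftComp k ((derivedNakayama k Λ).obj X) A.mor₂)
    (g := Linear.leftComp k ((derivedNakayama k Λ).obj X) A.mor₁) fun f => ⟨fun hf => ?_, ?_⟩
  · obtain ⟨g, hg⟩ := Triangle.yoneda_exact₂ _ hA f hf
    exact ⟨g, hg.symm⟩
  · rintro ⟨g, rfl⟩
    change A.mor₁ ≫ A.mor₂ ≫ g = 0
    rw [← Category.assoc, comp_distTriang_mor_zero₁₂ _ hA, zero_comp]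

lemma bijective_pairing_of_distinguished_left
    {A : Triangle (DerivedCategory (ModuleCat.{u} Λ))} (hA : A ∈ distTriang _)
    (p₁ : PerfectResolution A.obj₁) (p₂ : PerfectResolution A.obj₂) (p₃ : PerfectResolution A.obj₃)
    (h₁ : Function.Bijective (p₁.pairing k Y)) (h₂ : Function.Bijective (p₂.pairing k Y))
    (h₃ : Function.Bijective (p₁.shift.pairing k Y))
    (h₄ : Function.Bijective (p₂.shift.pairing k Y)) :
    Function.Bijective (p₃.pairing k Y) := by
  have key {X} (p p' : PerfectResolution X) (h : Function.Bijective (p.pairing k Y)) :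
      Function.Bijective (p'.pairing k Y) := by rwa [p'.pairing_unique p]
  -- The pairing depends on a resolution of its first argument, so the transformation in the five
  -- lemma is defined only on objects which have one, by an arbitrary choice. Independence of the
  -- resolution makes the choice harmless.
  let t : ∀ X : DerivedCategory (ModuleCat.{u} Λ), Nonempty (PerfectResolution X) → ((X ⟶ Y) →+
      Module.Dual k (Y ⟶ (derivedNakayama k Λ).obj X)) :=
    fun X hX => (hX.some.pairing k Y).toAddMonoidHom
  refine key (Nonempty.some ⟨p₃⟩) p₃ ?_
  refine bijective_of_distinguished_contravariant (V := fun X => X ⟶ Y)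
    (W := fun X => Module.Dual k (Y ⟶ (derivedNakayama k Λ).obj X))
    (p := fun X => Nonempty (PerfectResolution X))
    (fun a => (Linear.leftComp k Y a).toAddMonoidHom)
    (fun a => (Linear.rightComp k Y ((derivedNakayama k Λ).map a)).dualMap.toAddMonoidHom)
    t (fun hX hX' a f => pairing_comp_left _ _ a f)
    (fun {A} hA => fun f => ⟨fun hf => ?_, ?_⟩) (fun {A} hA => ?_) hA ⟨p₁⟩ ⟨p₂⟩ ⟨p₃⟩ ⟨p₁.shift⟩
    ⟨p₂.shift⟩ (key _ _ h₁) (key _ _ h₂) (key _ _ h₃) (key _ _ h₄)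
  · obtain ⟨g, hg⟩ := Triangle.yoneda_exact₂ _ hA f hf
    exact ⟨g, hg.symm⟩
  · rintro ⟨g, rfl⟩
    change A.mor₁ ≫ A.mor₂ ≫ g = 0
    rw [← Category.assoc, comp_distTriang_mor_zero₁₂ _ hA, zero_comp]
  · exact exact_dualMap (f := Linear.rightComp k Y ((derivedNakayama k Λ).map A.mor₁))
      (g := Linear.rightComp k Y ((derivedNakayama k Λ).map A.mor₂))
      (PreservesCones.exact_hom (derivedNakayama k Λ) Y hA)

end PerfectResolution

end Pairing

/-! ### Reduction of perfectness to the regular module -/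

section Perfectness

open scoped ModuleCat
open Pretriangulated

variable {k : Type u} [Field k] {Λ : Type u} [Ring Λ] [Algebra k Λ]

variable (k) in
/-- The trace pairing of `Hom(X, Y)` with `Hom(Y, Λ* ⊗^L_Λ X)` identifies the first space with the
dual of the second one. -/
def IsPerfectPair (X Y : DerivedCategory (ModuleCat.{u} Λ)) : Prop :=
  ∀ p : PerfectResolution X, Function.Bijective (p.pairing k Y)

namespace IsPerfectPair

variable {X X' Y Y' : DerivedCategory (ModuleCat.{u} Λ)}

lemma retract_right (h : IsPerfectPair k X Y) (r : Retract Y' Y) : IsPerfectPair k X Y' :=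
  fun p => p.bijective_pairing_retract_right r (h p)

lemma of_iso_right (h : IsPerfectPair k X Y) (e : Y ≅ Y') : IsPerfectPair k X Y' :=
  h.retract_right ⟨e.inv, e.hom, e.inv_hom_id⟩

lemma of_iso_left (h : IsPerfectPair k X Y) (e : X ≅ X') : IsPerfectPair k X' Y := fun p =>
  PerfectResolution.bijective_pairing_retract_left ⟨p.complex, p.perfect, e ≪≫ p.iso⟩ p
    ⟨e.inv, e.hom, e.inv_hom_id⟩ (h _)

lemma shift (h : IsPerfectPair k X Y) (p : PerfectResolution X) :
    IsPerfectPair k (X⟦(1 : ℤ)⟧) (Y⟦(1 : ℤ)⟧) := fun q => by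
  rw [q.pairing_unique p.shift]
  exact p.bijective_pairing_shift_iff.2 (h p)

lemma of_shift (h : IsPerfectPair k (X⟦(1 : ℤ)⟧) (Y⟦(1 : ℤ)⟧)) : IsPerfectPair k X Y := fun p =>
  p.bijective_pairing_shift_iff.1 (h p.shift)

end IsPerfectPair

variable (k) in
/-- If the regular module forms perfect pairs with its shifts, then all pairs are perfect. -/
theorem isPerfectPair_of_regular [IsNoetherianRing Λ] (hΛ : HasFiniteGlobalDimension Λ)
    (h : ∀ n : ℤ, IsPerfectPair k (derivedSingle (ModuleCat.of Λ Λ))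
      ((derivedSingle (ModuleCat.of Λ Λ))⟦n⟧))
    {X Y : DerivedCategory (ModuleCat.{u} Λ)} (hX : finiteBounded Λ X) (hY : finiteBounded Λ Y) :
    IsPerfectPair k X Y := by
  have hres : ∀ {X : DerivedCategory (ModuleCat.{u} Λ)}, finiteBounded Λ X →
      Nonempty (PerfectResolution X) := fun hX => by
    obtain ⟨P, hP, ⟨e⟩⟩ := exists_strictlyPerfect hΛ _ hX
    exact ⟨⟨P, hP, e⟩⟩
  let A : DerivedCategory (ModuleCat.{u} Λ) := derivedSingle (ModuleCat.of Λ Λ)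
  have hA : finiteBounded Λ A := finiteBounded_derivedSingle _
  have h₁ {Y} (hY : finiteBounded Λ Y) : IsPerfectPair k A Y := by
    -- First vary the second argument. The five lemma involves suspensions of the first two
    -- vertices, hence the condition is imposed on all shifts.
    have hc : IsTriangulatedClass (fun Y : DerivedCategory (ModuleCat.{u} Λ) =>
        ∀ n : ℤ, IsPerfectPair k A (Y⟦n⟧)) :=
      isTriangulatedClass_forall_shift (fun e h => h.of_iso_right e)
        (fun hT a b c d p => p.bijective_pairing_of_distinguished hT (a p) (b p) (c p) (d p))
    exact (hc.of_regular hΛ (fun r h n => (h n).retract_right (r.map (shiftFunctor _ n))) h Y hY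
      0).of_iso_right ((shiftFunctorZero _ ℤ).app Y)
  -- Then vary the first argument. Requiring perfectness against all `Y` at once makes the condition
  -- stable under shifts of `X`, since these can be absorbed in a shift of `Y`.
  let b : ObjectProperty (DerivedCategory (ModuleCat.{u} Λ)) := fun X =>
    finiteBounded Λ X ∧ ∀ Y, finiteBounded Λ Y → IsPerfectPair k X Y
  have hb {X X'} (e : X ≅ X') (h : b X) : b X' :=
    ⟨isTriangulatedClass_finiteBounded.of_iso e h.1, fun Y hY => (h.2 Y hY).of_iso_left e⟩
  have hb₁ {X} (h : b X) : b (X⟦(1 : ℤ)⟧) :=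
    ⟨isTriangulatedClass_finiteBounded.shift 1 h.1, fun Y hY =>
      ((h.2 (Y⟦(-1 : ℤ)⟧) (isTriangulatedClass_finiteBounded.shift (-1) hY)).shift
        (hres h.1).some).of_iso_right ((shiftFunctorCompIsoId _ (-1 : ℤ) 1 (by lia)).app Y)⟩
  have hb₂ {X} (h : b X) : b (X⟦(-1 : ℤ)⟧) :=
    ⟨isTriangulatedClass_finiteBounded.shift (-1) h.1, fun Y hY =>
      ((h.2 (Y⟦(1 : ℤ)⟧) (isTriangulatedClass_finiteBounded.shift 1 hY)).of_iso_left
        ((shiftFunctorCompIsoId _ (-1 : ℤ) 1 (by lia)).symm.app X)).of_shift⟩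
  have hbn {X} (h : b X) (n : ℤ) : b (X⟦n⟧) := by
    induction n using Int.induction_on with
    | zero => exact hb ((shiftFunctorZero _ ℤ).symm.app X) h
    | succ n ih => exact hb ((shiftFunctorAdd _ (n : ℤ) 1).symm.app X) (hb₁ ih)
    | pred n ih => exact hb ((shiftFunctorAdd _ (-n : ℤ) (-1)).symm.app X) (hb₂ ih)
  have hc : IsTriangulatedClass b :=
    { of_iso := hb
      shift := fun n h => hbn h n
      cone := fun hT h₁ h₂ => ⟨isTriangulatedClass_finiteBounded.cone hT h₁.1 h₂.1, fun Y hY p =>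
        PerfectResolution.bijective_pairing_of_distinguished_left hT (hres h₁.1).some
          (hres h₂.1).some p (h₁.2 Y hY _) (h₂.2 Y hY _) ((hb₁ h₁).2 Y hY _) ((hb₁ h₂).2 Y hY _)⟩ }
  exact (hc.of_regular hΛ (fun r h => ⟨finiteBounded_of_retract r h.1, fun Y hY p =>
    PerfectResolution.bijective_pairing_retract_left (hres h.1).some p r (h.2 Y hY _)⟩)
    ⟨hA, fun Y hY => h₁ hY⟩ X hX).2 Y hY

end Perfectness

/-! ## Perfectness of the trace pairing -/

section RegularPair

open scoped ModuleCat

variable {k : Type u} [Field k] {Λ : Type u} [Ring Λ] [Algebra k Λ]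

lemma hom_eq_zero_of_isZero {R : Type u} [Ring R] {K L : CochainComplex (ModuleCat.{u} R) ℤ}
    [StrictlyPerfect K] (h : ∀ i, IsZero (K.X i) ∨ IsZero (L.X i))
    (f : DerivedCategory.Q.obj K ⟶ DerivedCategory.Q.obj L) : f = 0 := by
  obtain ⟨g, rfl⟩ := StrictlyPerfect.exists_Q_map_eq f
  have : g = 0 := by
    ext1 i
    rcases h i with h | h
    · exact h.eq_of_src _ _
    · exact h.eq_of_tgt _ _
  rw [this, Functor.map_zero]

variable (Λ) in
/-- The regular module is its own resolution. -/
noncomputable def regularResolution : PerfectResolution (derivedSingle (ModuleCat.of Λ Λ)) where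
  complex := regularModuleComplex Λ
  perfect := StrictlyPerfect.single (ModuleCat.of Λ Λ)
  iso := Iso.refl _

variable (k Λ) in
/-- The value of the derived tensor product with `Λ*` at the regular module. -/
noncomputable def derivedNakayamaRegularIso :
    (derivedNakayama k Λ).obj (derivedSingle (ModuleCat.of Λ Λ)) ≅
      DerivedCategory.Q.obj ((nakayamaCochain k Λ).obj (regularModuleComplex Λ)) :=
  let e : (DerivedCategory.Q ⋙ derivedNakayama k Λ).obj (regularModuleComplex Λ) ≅
      (nakayamaCochain k Λ ⋙ DerivedCategory.Q).obj (regularModuleComplex Λ) :=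
    asIso ((nakayamaComparison (k := k) (Λ := Λ)).app (regularModuleComplex Λ))
  e

/-- Both spaces in the pairing vanish: the complexes involved are concentrated in different single
degrees, and morphisms out of strictly perfect complexes are represented by chain maps. -/
lemma isPerfectPair_regular_shift {n : ℤ} (hn : n ≠ 0) :
    IsPerfectPair k (derivedSingle (ModuleCat.of Λ Λ))
      ((derivedSingle (ModuleCat.of Λ Λ))⟦n⟧) := by
  let K := regularModuleComplex Λ
  have hK (i : ℤ) (hi : i ≠ 0) : IsZero (K.X i) :=
    HomologicalComplex.isZero_single_obj_X (.up ℤ) 0 (ModuleCat.of Λ Λ) i hi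
  have hK' (i : ℤ) (hi : i + n ≠ 0) : IsZero ((K⟦n⟧).X i) := hK (i + n) hi
  have : StrictlyPerfect K := StrictlyPerfect.single (ModuleCat.of Λ Λ)
  let e : (derivedSingle (ModuleCat.of Λ Λ))⟦n⟧ ≅ DerivedCategory.Q.obj (K⟦n⟧) :=
    (DerivedCategory.Q.commShiftIso n).symm.app K
  have h₁ (f : derivedSingle (ModuleCat.of Λ Λ) ⟶ (derivedSingle (ModuleCat.of Λ Λ))⟦n⟧) :
      f = 0 := by
    rw [← cancel_mono e.hom, zero_comp]
    refine hom_eq_zero_of_isZero (K := K) (fun i => ?_) (f ≫ e.hom)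
    by_cases hi : i = 0
    · exact Or.inr (hK' i (by lia))
    · exact Or.inl (hK i hi)
  have h₂ (f : (derivedSingle (ModuleCat.of Λ Λ))⟦n⟧ ⟶
      (derivedNakayama k Λ).obj (derivedSingle (ModuleCat.of Λ Λ))) : f = 0 := by
    rw [← cancel_mono (derivedNakayamaRegularIso k Λ).hom, ← cancel_epi e.inv, zero_comp, comp_zero]
    refine hom_eq_zero_of_isZero (fun i => ?_) _
    by_cases hi : i = 0
    · exact Or.inl (hK' i (by lia))
    · exact Or.inr ((nakayama k Λ).map_isZero (hK i hi))
  refine fun p => ⟨fun f g _ => (h₁ f).trans (h₁ g).symm, fun φ => ⟨0, LinearMap.ext fun v => ?_⟩⟩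
  rw [h₂ v, map_zero, map_zero]

/-- The chain map `Λ ⟶ Λ* ⊗_Λ Λ` given by a module homomorphism. -/
noncomputable def regularChainMap
    (w : ModuleCat.of Λ Λ ⟶ (nakayama k Λ).obj (ModuleCat.of Λ Λ)) :
    regularModuleComplex Λ ⟶ (nakayamaCochain k Λ).obj (regularModuleComplex Λ) :=
  (HomologicalComplex.single (ModuleCat.{u} Λ) (.up ℤ) 0).map w ≫
    (HomologicalComplex.singleMapHomologicalComplex (nakayama k Λ) (.up ℤ) (0 : ℤ)).inv.app
      (ModuleCat.of Λ Λ)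

lemma regularChainMap_add (w w' : ModuleCat.of Λ Λ ⟶ (nakayama k Λ).obj (ModuleCat.of Λ Λ)) :
    regularChainMap (w + w') = regularChainMap w + regularChainMap w' := by
  unfold regularChainMap
  rw [Functor.map_add]
  exact Preadditive.add_comp _ _ _ _ _ _

lemma regularChainMap_smul (r : k)
    (w : ModuleCat.of Λ Λ ⟶ (nakayama k Λ).obj (ModuleCat.of Λ Λ)) :
    regularChainMap (r • w) = r • regularChainMap w := by
  unfold regularChainMap
  have h : (HomologicalComplex.single (ModuleCat.{u} Λ) (.up ℤ) (0 : ℤ)).map (r • w) =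
      r • (HomologicalComplex.single (ModuleCat.{u} Λ) (.up ℤ) (0 : ℤ)).map w := by
    refine HomologicalComplex.from_single_hom_ext ?_
    rw [HomologicalComplex.smul_f_apply, HomologicalComplex.single_map_f_self,
      HomologicalComplex.single_map_f_self, Linear.smul_comp, Linear.comp_smul]
  rw [h]
  exact Linear.smul_comp _ _ _ _ _ _

lemma regularChainMap_comp (f : ModuleCat.of Λ Λ ⟶ ModuleCat.of Λ Λ)
    (w : ModuleCat.of Λ Λ ⟶ (nakayama k Λ).obj (ModuleCat.of Λ Λ)) :
    regularChainMap (f ≫ w) =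
      (HomologicalComplex.single (ModuleCat.{u} Λ) (.up ℤ) 0).map f ≫ regularChainMap w := by
  unfold regularChainMap
  rw [Functor.map_comp]
  exact Category.assoc _ _ _

lemma regularChainMap_surjective (u : regularModuleComplex Λ ⟶
    (nakayamaCochain k Λ).obj (regularModuleComplex Λ)) : ∃ w, regularChainMap w = u := by
  obtain ⟨w, hw⟩ := (HomologicalComplex.single (ModuleCat.{u} Λ) (.up ℤ) (0 : ℤ)).map_surjective
    (u ≫ (HomologicalComplex.singleMapHomologicalComplex (nakayama k Λ) (.up ℤ) (0 : ℤ)).hom.app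
      (ModuleCat.of Λ Λ))
  refine ⟨w, ?_⟩
  refine (congrArg (· ≫ _) hw).trans ?_
  refine (Category.assoc _ _ _).trans ?_
  exact (congrArg (u ≫ ·) (Iso.hom_inv_id_app (HomologicalComplex.singleMapHomologicalComplex
    (nakayama k Λ) (.up ℤ) (0 : ℤ)) (ModuleCat.of Λ Λ))).trans (Category.comp_id _)

instance : StrictlyPerfect (regularModuleComplex Λ) := StrictlyPerfect.single (ModuleCat.of Λ Λ)

lemma comp_inv_comp_hom_comp {C : Type*} [Category* C] {A B B' D E : C} (a : A ⟶ B) (w : B ⟶ B')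
    (j : D ≅ B') (c : B' ⟶ E) : (a ≫ w ≫ j.inv) ≫ j.hom ≫ c = a ≫ w ≫ c := by simp

lemma supertrace_regularChainMap
    (w : ModuleCat.of Λ Λ ⟶ (nakayama k Λ).obj (ModuleCat.of Λ Λ)) :
    supertrace (regularChainMap w) = moduleTrace w := by
  unfold supertrace
  rw [finsum_eq_single _ 0]
  · rw [Int.negOnePow_zero, one_smul]
    let i : (regularModuleComplex Λ).X 0 ≅ ModuleCat.of Λ Λ :=
      HomologicalComplex.singleObjXSelf (.up ℤ) 0 (ModuleCat.of Λ Λ)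
    have h : nakayamaComponent (regularChainMap w) 0 = i.hom ≫ w ≫ (nakayama k Λ).map i.inv := by
      refine (HomologicalComplex.comp_f _ _ _).trans ?_
      rw [HomologicalComplex.single_map_f_self,
        HomologicalComplex.singleMapHomologicalComplex_inv_app_self]
      exact comp_inv_comp_hom_comp i.hom w
        (HomologicalComplex.singleObjXSelf (.up ℤ) 0 ((nakayama k Λ).obj (ModuleCat.of Λ Λ)))
        ((nakayama k Λ).map i.inv)
    rw [h, moduleTrace_comp, Category.assoc, ← Functor.map_comp, Iso.inv_hom_id,
      CategoryTheory.Functor.map_id, Category.comp_id]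
  · intro n hn
    have hz : IsZero ((regularModuleComplex Λ).X n) :=
      HomologicalComplex.isZero_single_obj_X (.up ℤ) 0 (ModuleCat.of Λ Λ) n hn
    rw [hz.eq_of_src (nakayamaComponent (regularChainMap w) n) 0, moduleTrace_zero, smul_zero]

/-- The homomorphism `Λ ⟶ Λ* ⊗_Λ Λ` which maps `1` to `ξ`. -/
noncomputable def dualToHom (ξ : Module.Dual k Λ) :
    ModuleCat.of Λ Λ ⟶ (nakayama k Λ).obj (ModuleCat.of Λ Λ) :=
  ModuleCat.ofHom (LinearMap.toSpanSingleton Λ ((leftModule k Λ).obj (dualBimod k Λ)) ξ) ≫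
    (nakayamaRegularIso k Λ).inv

lemma dualToHom_surjective (w : ModuleCat.of Λ Λ ⟶ (nakayama k Λ).obj (ModuleCat.of Λ Λ)) :
    ∃ ξ, dualToHom ξ = w := by
  refine ⟨(w ≫ (nakayamaRegularIso k Λ).hom).hom (1 : Λ), ?_⟩
  refine (Iso.comp_inv_eq _).2 ?_
  refine ModuleCat.hom_ext (LinearMap.ext fun x : Λ => ?_)
  refine (map_smul (w ≫ (nakayamaRegularIso k Λ).hom).hom x (1 : Λ)).symm.trans ?_
  exact congrArg _ (mul_one x)

/-- Under `Hom(Λ, Λ) = Λ` and `Hom(Λ, Λ* ⊗_Λ Λ) = Λ*` the trace of the composite is evaluation. -/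
lemma moduleTrace_regularRightMul_comp (a : Λ) (ξ : Module.Dual k Λ) :
    moduleTrace (regularRightMul Λ a ≫ dualToHom ξ) = ξ a := by
  rw [moduleTrace_regular]
  let ξ' : (leftModule k Λ).obj (dualBimod k Λ) := ξ
  let t : ModuleCat.of Λ Λ ⟶ (leftModule k Λ).obj (dualBimod k Λ) :=
    ModuleCat.ofHom (LinearMap.toSpanSingleton Λ ((leftModule k Λ).obj (dualBimod k Λ)) ξ')
  have h : (t ≫ (nakayamaRegularIso k Λ).inv) ≫ (nakayamaRegularIso k Λ).hom = t := by simp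
  refine (congrArg (fun f : ModuleCat.of Λ Λ ⟶ (leftModule k Λ).obj (dualBimod k Λ) =>
    dualEvalOne (f.hom (1 * a : Λ))) h).trans ?_
  change dualEvalOne ((1 * a : Λ) • ξ') = ξ a
  rw [one_mul]
  exact (dualBimod_left_smul a ξ 1).trans (congrArg ξ (one_mul a))

lemma dualToHom_add (ξ ξ' : Module.Dual k Λ) : dualToHom (ξ + ξ') = dualToHom ξ + dualToHom ξ' := by
  refine Eq.trans ?_ (Preadditive.add_comp _ _ _ _ _ _)
  refine congrArg (· ≫ (nakayamaRegularIso k Λ).inv) (ModuleCat.hom_ext (LinearMap.ext fun x => ?_))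
  let η : (leftModule k Λ).obj (dualBimod k Λ) := ξ
  let η' : (leftModule k Λ).obj (dualBimod k Λ) := ξ'
  let y : Λ := x
  exact smul_add y η η'

lemma dualToHom_smul (r : k) (ξ : Module.Dual k Λ) : dualToHom (r • ξ) = r • dualToHom ξ := by
  refine Eq.trans ?_ (Linear.smul_comp _ _ _ r (ModuleCat.ofHom (LinearMap.toSpanSingleton Λ
    ((leftModule k Λ).obj (dualBimod k Λ)) ξ)) (nakayamaRegularIso k Λ).inv)
  refine congrArg (· ≫ (nakayamaRegularIso k Λ).inv)
    (ModuleCat.hom_ext (LinearMap.ext fun x : Λ => ?_))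
  refine LinearMap.ext fun y : Λ => ?_
  refine (dualBimod_left_smul x (r • ξ) y).trans ?_
  refine Eq.trans ?_ (dualBimod_left_smul (algebraMap k Λ r)
    ((x ⊗ₜ[k] (1 : Λᵐᵒᵖ)) • (show dualBimod k Λ from ξ)) y).symm
  refine Eq.trans ?_ (dualBimod_left_smul x ξ (y * algebraMap k Λ r)).symm
  change r • ξ (y * x) = ξ (y * algebraMap k Λ r * x)
  rw [mul_assoc, Algebra.left_comm, ← Algebra.smul_def, map_smul]

variable (k Λ) in
/-- The elements of `Λ*` as morphisms in the derived category. -/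
noncomputable def dualToDerivedHom : Module.Dual k Λ →ₗ[k] (derivedSingle (ModuleCat.of Λ Λ) ⟶
    (derivedNakayama k Λ).obj (derivedSingle (ModuleCat.of Λ Λ))) where
  toFun ξ := DerivedCategory.Q.map (regularChainMap (dualToHom ξ)) ≫
    (derivedNakayamaRegularIso k Λ).inv
  map_add' ξ ξ' := by
    rw [dualToHom_add, regularChainMap_add, Functor.map_add]
    exact Preadditive.add_comp _ _ _ _ _ _
  map_smul' r ξ := by
    rw [dualToHom_smul, regularChainMap_smul, Functor.map_smul]
    exact Linear.smul_comp _ _ _ _ _ _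

lemma dualToDerivedHom_surjective : Function.Surjective (dualToDerivedHom k Λ) := fun v => by
  obtain ⟨u, hu⟩ := StrictlyPerfect.exists_Q_map_eq (P := regularModuleComplex Λ)
    (v ≫ (derivedNakayamaRegularIso k Λ).hom)
  obtain ⟨w, rfl⟩ := regularChainMap_surjective u
  obtain ⟨ξ, rfl⟩ := dualToHom_surjective w
  refine ⟨ξ, ?_⟩
  exact (congrArg (· ≫ (derivedNakayamaRegularIso k Λ).inv) hu).trans
    ((Category.assoc _ _ _).trans
      ((congrArg (v ≫ ·) (Iso.hom_inv_id _)).trans (Category.comp_id _)))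

lemma transport_refl_aux {D : Type*} [Category* D] (F : D ⥤ D) {A B : D} (s : A ⟶ A)
    (u : A ⟶ B) (e : F.obj A ≅ B) :
    s ≫ u = 𝟙 A ≫ (s ≫ u ≫ e.inv) ≫ F.map (𝟙 A) ≫ e.hom := by
  simp

lemma pairing_regular (a : Λ) (ξ : Module.Dual k Λ) :
    (regularResolution Λ).pairing k (derivedSingle (ModuleCat.of Λ Λ))
      ((DerivedCategory.singleFunctor (ModuleCat.{u} Λ) 0).map (regularRightMul Λ a))
        (dualToDerivedHom k Λ ξ) = ξ a := by
  refine ((regularResolution Λ).trace_eq _ (regularChainMap (regularRightMul Λ a ≫ dualToHom ξ))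
    ?_).trans ((supertrace_regularChainMap _).trans (moduleTrace_regularRightMul_comp a ξ))
  let s : derivedSingle (ModuleCat.of Λ Λ) ⟶ derivedSingle (ModuleCat.of Λ Λ) :=
    (DerivedCategory.singleFunctor (ModuleCat.{u} Λ) 0).map (regularRightMul Λ a)
  have h : DerivedCategory.Q.map (regularChainMap (regularRightMul Λ a ≫ dualToHom ξ)) =
      s ≫ DerivedCategory.Q.map (regularChainMap (dualToHom ξ)) :=
    (congrArg DerivedCategory.Q.map (regularChainMap_comp _ _)).trans
      (DerivedCategory.Q.map_comp _ _)
  refine h.trans ?_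
  change _ = 𝟙 (derivedSingle (ModuleCat.of Λ Λ)) ≫ (s ≫ dualToDerivedHom k Λ ξ) ≫
    (derivedNakayama k Λ).map (𝟙 (derivedSingle (ModuleCat.of Λ Λ))) ≫
      (derivedNakayamaRegularIso k Λ).hom
  exact transport_refl_aux (derivedNakayama k Λ) s
    (DerivedCategory.Q.map (regularChainMap (dualToHom ξ))) (derivedNakayamaRegularIso k Λ)

/-- The pairing is evaluation of `Λ*` on `Λ`: injectivity holds because linear forms separate the
elements of a vector space, and surjectivity is reflexivity of a finite-dimensional one. -/
lemma isPerfectPair_regular [Module.Finite k Λ] :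
    IsPerfectPair k (derivedSingle (ModuleCat.of Λ Λ)) (derivedSingle (ModuleCat.of Λ Λ)) := by
  have hf (f : derivedSingle (ModuleCat.of Λ Λ) ⟶ derivedSingle (ModuleCat.of Λ Λ)) : ∃ a : Λ,
      f = (DerivedCategory.singleFunctor (ModuleCat.{u} Λ) 0).map (regularRightMul Λ a) := by
    obtain ⟨g, rfl⟩ := (DerivedCategory.singleFunctor (ModuleCat.{u} Λ) 0).map_surjective f
    refine ⟨g.hom (1 : Λ), congrArg _ (ModuleCat.hom_ext (LinearMap.ext fun x : Λ => ?_))⟩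
    exact (congrArg g.hom (mul_one x).symm).trans (map_smul g.hom x (1 : Λ))
  intro p
  rw [p.pairing_unique (regularResolution Λ)]
  constructor
  · rw [injective_iff_map_eq_zero]
    intro f h
    obtain ⟨a, rfl⟩ := hf f
    have ha : a = 0 := by
      refine (Module.forall_dual_apply_eq_zero_iff k a).1 fun ξ => ?_
      rw [← pairing_regular, h]
      rfl
    rw [ha]
    have : regularRightMul Λ 0 = 0 := ModuleCat.hom_ext (LinearMap.ext fun x : Λ => mul_zero x)
    rw [this, Functor.map_zero]
  · intro φ
    obtain ⟨a, ha⟩ := (Module.evalEquiv k Λ).surjective (φ ∘ₗ dualToDerivedHom k Λ)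
    refine ⟨(DerivedCategory.singleFunctor (ModuleCat.{u} Λ) 0).map (regularRightMul Λ a),
      LinearMap.ext fun v => ?_⟩
    obtain ⟨ξ, rfl⟩ := dualToDerivedHom_surjective v
    exact (pairing_regular a ξ).trans (LinearMap.congr_fun ha ξ)

variable (k) in
/-- The trace pairings on the derived category are perfect. -/
theorem isPerfectPair [Module.Finite k Λ] [IsNoetherianRing Λ] (hΛ : HasFiniteGlobalDimension Λ)
    {X Y : DerivedCategory (ModuleCat.{u} Λ)} (hX : finiteBounded Λ X) (hY : finiteBounded Λ Y) :
    IsPerfectPair k X Y := by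
  refine isPerfectPair_of_regular k hΛ (fun n => ?_) hX hY
  by_cases hn : n = 0
  · subst hn
    exact isPerfectPair_regular.of_iso_right ((shiftFunctorZero _ ℤ).symm.app _)
  · exact isPerfectPair_regular_shift hn

end RegularPair

/-! ## Essential surjectivity of the derived Nakayama functor -/

/-- A map compatible with two perfect pairings is bijective. For surjectivity, pairing with `w` is a
functional on `U`, hence equal to `κ f` for some `f`; then `F f` and `w` agree under every
functional on `W`, since all of them come from `κ'`. -/
lemma bijective_of_dual_pairings {K U V W : Type*} [Field K] [AddCommGroup U] [AddCommGroup W]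
    [Module K U] [Module K W] {κ : V → Module.Dual K U} {κ' : U →ₗ[K] Module.Dual K W} {F : V → W}
    (h : ∀ f v, κ f v = κ' v (F f)) (hκ : Function.Bijective κ) (hκ' : Function.Bijective κ') :
    Function.Bijective F := by
  constructor
  · intro f g hfg
    exact hκ.1 (LinearMap.ext fun v => by rw [h, h, hfg])
  · intro w
    obtain ⟨f, hf⟩ := hκ.2 (κ'.flip w)
    refine ⟨f, sub_eq_zero.1 ((Module.forall_dual_apply_eq_zero_iff K _).1 fun ψ => ?_)⟩
    obtain ⟨v, rfl⟩ := hκ'.2 ψ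
    rw [map_sub, ← h, hf, sub_eq_zero]
    rfl

/-- Two splittings of an idempotent are isomorphic. -/
lemma nonempty_iso_of_retracts {C : Type*} [Category* C] {X Y Z Z' : C} (r : Retract X Z)
    (s : Retract Y Z') (e : Z ≅ Z') (h : e.hom ≫ s.r ≫ s.i = (r.r ≫ r.i) ≫ e.hom) :
    Nonempty (X ≅ Y) := by
  have h' : (s.r ≫ s.i) ≫ e.inv = e.inv ≫ r.r ≫ r.i := by
    rw [Iso.comp_inv_eq, Category.assoc, Iso.eq_inv_comp, h]
  have hr := r.retract
  have hs := s.retract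
  refine ⟨⟨r.i ≫ e.hom ≫ s.r, s.i ≫ e.inv ≫ r.r, ?_, ?_⟩⟩
  · have h₁ : e.hom ≫ s.r ≫ s.i ≫ e.inv = r.r ≫ r.i := by
      have := congrArg (· ≫ e.inv) h
      simpa using this
    simp only [Category.assoc]
    rw [reassoc_of% h₁, reassoc_of% hr, hr]
  · have h₁ : e.inv ≫ r.r ≫ r.i ≫ e.hom = s.r ≫ s.i := by
      have := congrArg (· ≫ e.hom) h'
      simpa using this.symm
    simp only [Category.assoc]
    rw [reassoc_of% h₁, reassoc_of% hs, hs]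

section EssentialImage

open Pretriangulated

variable {T : Type*} [Category* T] [Preadditive T] [HasZeroObject T] [HasShift T ℤ]
  [∀ n : ℤ, (shiftFunctor T n).Additive] [Pretriangulated T]

/-- The image of a triangulated class under a functor which preserves cones and is full on the
class is triangulated. -/
lemma IsTriangulatedClass.essImage {P : ObjectProperty T} (hP : IsTriangulatedClass P) (F : T ⥤ T)
    [F.CommShift ℤ] [PreservesCones F]
    (hF : ∀ {X Y : T}, P X → P Y → Function.Surjective (F.map : (X ⟶ Y) → _)) :
    IsTriangulatedClass (fun Z => ∃ X, P X ∧ Nonempty (F.obj X ≅ Z)) where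
  of_iso e := fun ⟨X, hX, ⟨i⟩⟩ => ⟨X, hX, ⟨i ≪≫ e⟩⟩
  shift n := fun ⟨X, hX, ⟨i⟩⟩ => ⟨X⟦n⟧, hP.shift n hX,
    ⟨(F.commShiftIso n).app X ≪≫ (shiftFunctor T n).mapIso i⟩⟩
  cone {A} hA := fun ⟨X, hX, ⟨i⟩⟩ ⟨Y, hY, ⟨j⟩⟩ => by
    -- By fullness the first morphism of the triangle comes from the class, and the image of its
    -- cone is a cone of the given morphism.
    obtain ⟨f, hf⟩ := hF hX hY (i.hom ≫ A.mor₁ ≫ j.inv)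
    obtain ⟨Z, g, h, hT⟩ := distinguished_cocone_triangle f
    obtain ⟨h', hT'⟩ := PreservesCones.exists_distinguished (F := F) hT
    refine ⟨Z, hP.cone hT hX hY, ⟨Triangle.π₃.mapIso (isoTriangleOfIso₁₂ _ A hT' hA i j ?_)⟩⟩
    change F.map f ≫ j.hom = i.hom ≫ A.mor₁
    rw [hf]
    simp

end EssentialImage

/-! ### The injective module `Λ*` -/

section Injective

variable {k : Type u} [Field k] {Λ : Type u} [Ring Λ] [Algebra k Λ]

open scoped ModuleCat

variable (k Λ) in
/-- The left module `Λ*`. -/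
noncomputable abbrev dualModule : ModuleCat.{u} Λ := (leftModule k Λ).obj (dualBimod k Λ)

/-- The homomorphism `M ⟶ Λ*` which corresponds to a linear form on `M`. -/
noncomputable def coinducedHom {M : ModuleCat.{u} Λ} (φ : Module.Dual k M) :
    M ⟶ dualModule k Λ :=
  ModuleCat.ofHom
    { toFun := fun m => show Module.Dual k Λ from
        φ ∘ₗ (LinearMap.toSpanSingleton Λ M m).restrictScalars k
      map_add' := fun m m' => LinearMap.ext fun x : Λ =>
        (congrArg φ (smul_add x m m')).trans (map_add φ _ _)
      map_smul' := fun a m => LinearMap.ext fun x : Λ =>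
        (congrArg φ (smul_smul x a m)).trans (dualBimod_left_smul a
          (φ ∘ₗ (LinearMap.toSpanSingleton Λ M m).restrictScalars k) x).symm }

/-- The linear form which corresponds to a homomorphism `M ⟶ Λ*`. -/
noncomputable def evalOneForm {M : ModuleCat.{u} Λ} (g : M ⟶ dualModule k Λ) : Module.Dual k M where
  toFun m := dualEvalOne (g.hom m)
  map_add' m m' := (congrArg dualEvalOne (map_add g.hom m m')).trans (dualEvalOne_add _ _)
  map_smul' r m := (congrArg dualEvalOne (map_smul g.hom (algebraMap k Λ r) m)).trans
    (dualEvalOne_smul_base r _)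

lemma coinducedHom_evalOneForm {M : ModuleCat.{u} Λ} (g : M ⟶ dualModule k Λ) :
    coinducedHom (evalOneForm g) = g := by
  refine ModuleCat.hom_ext (LinearMap.ext fun m => LinearMap.ext fun x : Λ => ?_)
  refine (congrArg dualEvalOne (map_smul g.hom x m)).trans ?_
  refine (dualBimod_left_smul x (g.hom m) 1).trans ?_
  rw [one_mul]

/-- Homomorphisms to `Λ*` are linear forms over `k`, and a linear form extends along any injection
of vector spaces. -/
instance : Injective (dualModule k Λ) where
  factors {X Y} g f _ := by
    obtain ⟨l, hl⟩ := (f.hom.restrictScalars k).exists_leftInverse_of_injective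
      (LinearMap.ker_eq_bot.2 ((ModuleCat.mono_iff_injective f).1 inferInstance))
    refine ⟨coinducedHom (evalOneForm g ∘ₗ l), ?_⟩
    rw [← coinducedHom_evalOneForm g]
    refine ModuleCat.hom_ext (LinearMap.ext fun m => LinearMap.ext fun x : Λ => ?_)
    change evalOneForm (coinducedHom (evalOneForm g)) (l (x • f.hom m)) =
      evalOneForm g (x • m)
    rw [coinducedHom_evalOneForm]
    refine congrArg (evalOneForm g) ?_
    exact (congrArg l (map_smul f.hom x m).symm).trans (LinearMap.congr_fun hl (x • m))

instance [Module.Finite k Λ] : Module.Finite Λ (dualModule k Λ) := by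
  have : IsScalarTower k Λ (dualModule k Λ) := inferInstance
  have h : Module.Finite k (dualModule k Λ) := by
    let e : Module.Dual k Λ →ₗ[k] dualModule k Λ :=
      { toFun := fun ξ => ξ
        map_add' := fun _ _ => rfl
        map_smul' := fun r ξ => LinearMap.ext fun x : Λ => by
          refine Eq.trans ?_ (dualBimod_left_smul (algebraMap k Λ r) ξ x).symm
          change r • ξ x = ξ (x * algebraMap k Λ r)
          rw [← Algebra.commutes, ← Algebra.smul_def, map_smul] }
    exact Module.Finite.of_surjective e fun ξ => ⟨ξ, rfl⟩
  exact Module.Finite.of_restrictScalars_finite k Λ _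

variable (k) in
/-- Each finitely generated module can be embedded into a finite direct sum of copies of `Λ*`. -/
lemma exists_mono_dualModule_biproduct [Module.Finite k Λ] (M : ModuleCat.{u} Λ)
    [Module.Finite Λ M] :
    ∃ (n : ℕ) (i : M ⟶ ⨁ fun _ : Fin n => dualModule k Λ), Mono i := by
  have : Module.Finite k M := Module.Finite.trans Λ M
  let b := Module.finBasis k M
  let i : M ⟶ ⨁ fun _ : Fin (Module.finrank k M) => dualModule k Λ :=
    -- One copy of `Λ*` for each coordinate form of a `k`-basis. Evaluating the components at `1`
    -- returns the coordinates, which gives injectivity.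
    biproduct.lift fun j => coinducedHom (b.coord j)
  refine ⟨_, i, (ModuleCat.mono_iff_injective _).2 ((injective_iff_map_eq_zero _).2
    fun m hm => ?_)⟩
  refine b.forall_coord_eq_zero_iff.1 fun j => ?_
  have h : (coinducedHom (b.coord j)).hom m = 0 := by
    have h₁ : i ≫ biproduct.π _ j = coinducedHom (b.coord j) := biproduct.lift_π _ _
    rw [← h₁]
    exact (congrArg (biproduct.π (fun _ : Fin (Module.finrank k M) => dualModule k Λ) j).hom
      hm).trans (map_zero _)
  have h₂ := congrArg dualEvalOne h
  exact (congrArg (b.coord j) (one_smul Λ m).symm).trans h₂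

lemma finite_biproduct (n : ℕ) (M : ModuleCat.{u} Λ) [Module.Finite Λ M] :
    Module.Finite Λ (⨁ fun _ : Fin n => M : ModuleCat.{u} Λ) :=
  Module.Finite.equiv (ModuleCat.biproductIsoPi (fun _ : Fin n => M)).toLinearEquiv.symm

end Injective

/-! ### Full faithfulness and essential surjectivity of the derived Nakayama functor -/

section SerreFunctor

variable {k : Type u} [Field k] {Λ : Type u} [Ring Λ] [Algebra k Λ]

open scoped ModuleCat

/-- The value of the derived tensor product with `Λ*` at the regular module is `Λ*`. -/
noncomputable def derivedNakayamaDualIso :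
    (derivedNakayama k Λ).obj (derivedSingle (ModuleCat.of Λ Λ)) ≅ derivedSingle (dualModule k Λ) :=
  derivedTensorFunctorRegularIso (dualComplex k Λ) ≪≫ DerivedCategory.Q.mapIso
    ((HomologicalComplex.singleMapHomologicalComplex (leftModule k Λ) (.up ℤ) (0 : ℤ)).app
      (dualBimod k Λ))

/-- The value of the derived tensor product with `Λ*` at a free module. -/
noncomputable def derivedNakayamaFreeIso (n : ℕ) :
    (derivedNakayama k Λ).obj (derivedSingle (⨁ fun _ : Fin n => ModuleCat.of Λ Λ)) ≅
      derivedSingle (⨁ fun _ : Fin n => dualModule k Λ) :=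
  (DerivedCategory.singleFunctor (ModuleCat.{u} Λ) 0 ⋙ derivedNakayama k Λ).mapBiproduct
      (fun _ : Fin n => ModuleCat.of Λ Λ) ≪≫
    biproduct.mapIso (fun _ => derivedNakayamaDualIso) ≪≫
    ((DerivedCategory.singleFunctor (ModuleCat.{u} Λ) 0).mapBiproduct
      (fun _ : Fin n => dualModule k Λ)).symm

variable [Module.Finite k Λ] [IsNoetherianRing Λ]

lemma finiteBounded_derivedNakayama (hΛ : HasFiniteGlobalDimension Λ)
    {X : DerivedCategory (ModuleCat.{u} Λ)} (hX : finiteBounded Λ X) :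
    finiteBounded Λ ((derivedNakayama k Λ).obj X) :=
  finiteBounded_obj hΛ _ (isTriangulatedClass_finiteBounded.of_iso derivedNakayamaDualIso.symm
    (finiteBounded_derivedSingle (dualModule k Λ))) hX

lemma nonempty_perfectResolution (hΛ : HasFiniteGlobalDimension Λ)
    {X : DerivedCategory (ModuleCat.{u} Λ)} (hX : finiteBounded Λ X) :
    Nonempty (PerfectResolution X) := by
  obtain ⟨P, hP, ⟨e⟩⟩ := exists_strictlyPerfect hΛ _ hX
  exact ⟨⟨P, hP, e⟩⟩

/-- By cyclicity of the trace, the pairing of `f` with `v` equals the pairing of `v` with the image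
of `f` under the functor. Both pairings are perfect, so the functor is bijective on morphisms. -/
lemma bijective_derivedNakayama_map (hΛ : HasFiniteGlobalDimension Λ)
    {X Y : DerivedCategory (ModuleCat.{u} Λ)} (hX : finiteBounded Λ X) (hY : finiteBounded Λ Y) :
    Function.Bijective ((derivedNakayama k Λ).map : (X ⟶ Y) → _) := by
  obtain ⟨p⟩ := nonempty_perfectResolution hΛ hX
  obtain ⟨q⟩ := nonempty_perfectResolution hΛ hY
  exact bijective_of_dual_pairings (κ := p.pairing k Y)
    (κ' := q.pairing k ((derivedNakayama k Λ).obj X)) (fun f v => p.trace_comp q f v)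
    (isPerfectPair k hΛ hX hY p)
    (isPerfectPair k hΛ hY (finiteBounded_derivedNakayama hΛ hX) q)

/-- The injective module is a direct summand of a power of `Λ*`, which is the value of the functor
at a free module. The corresponding idempotent lifts to the free module by full faithfulness, and
the image of the lift is sent to `I`. -/
lemma exists_derivedNakayama_iso_of_injective (hΛ : HasFiniteGlobalDimension Λ)
    (I : ModuleCat.{u} Λ) [Module.Finite Λ I] [Injective I] :
    ∃ X, finiteBounded Λ X ∧ Nonempty ((derivedNakayama k Λ).obj X ≅ derivedSingle I) := by
  obtain ⟨n, i, hi⟩ := exists_mono_dualModule_biproduct k I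
  let S := DerivedCategory.singleFunctor (ModuleCat.{u} Λ) 0
  let s : Retract I (⨁ fun _ : Fin n => dualModule k Λ) :=
    { i := i
      r := Injective.factorThru (𝟙 I) i
      retract := Injective.comp_factorThru _ _ }
  have : Module.Finite Λ (⨁ fun _ : Fin n => ModuleCat.of Λ Λ : ModuleCat.{u} Λ) :=
    finite_biproduct n (ModuleCat.of Λ Λ)
  have hfree := finiteBounded_derivedSingle (⨁ fun _ : Fin n => ModuleCat.of Λ Λ : ModuleCat.{u} Λ)
  have hbij := bijective_derivedNakayama_map (k := k) hΛ hfree hfree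
  let e := derivedNakayamaFreeIso (k := k) (Λ := Λ) n
  obtain ⟨f, hf⟩ := hbij.2 (e.hom ≫ ((s.map S).r ≫ (s.map S).i) ≫ e.inv)
  -- The lift is an endomorphism of a module in degree zero, so it comes from the module category,
  -- where idempotents split.
  obtain ⟨g, rfl⟩ := S.map_surjective f
  have hg : g ≫ g = g := by
    refine S.map_injective (hbij.1 ?_)
    change (derivedNakayama k Λ).map (S.map (g ≫ g)) = (derivedNakayama k Λ).map (S.map g)
    have := (s.map S).retract
    rw [S.map_comp, Functor.map_comp, hf]
    simp only [Category.assoc, Iso.inv_hom_id_assoc]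
    rw [reassoc_of% this]
  obtain ⟨Y, j, q, hjq, hqj⟩ := IsIdempotentComplete.idempotents_split _ g hg
  let r : Retract Y (⨁ fun _ : Fin n => ModuleCat.of Λ Λ) := ⟨j, q, hjq⟩
  have hq : Epi q := r.splitEpi.epi
  have : Module.Finite Λ Y := finite_of_epi q
  refine ⟨derivedSingle Y, finiteBounded_derivedSingle Y,
    nonempty_iso_of_retracts ((r.map S).map (derivedNakayama k Λ)) (s.map S) e ?_⟩
  have h : (derivedNakayama k Λ).map (S.map g) = ((r.map S).map (derivedNakayama k Λ)).r ≫
      ((r.map S).map (derivedNakayama k Λ)).i := by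
    rw [← hqj, S.map_comp, Functor.map_comp]
    rfl
  rw [← h, hf]
  simp

/-- The derived tensor product with `Λ*` is essentially surjective on the bounded derived
category. -/
lemma exists_derivedNakayama_iso (hΛ : HasFiniteGlobalDimension Λ)
    {Z : DerivedCategory (ModuleCat.{u} Λ)} (hZ : finiteBounded Λ Z) :
    ∃ X, finiteBounded Λ X ∧ Nonempty ((derivedNakayama k Λ).obj X ≅ Z) :=
  (isTriangulatedClass_finiteBounded.essImage (derivedNakayama k Λ) fun hX hY =>
    (bijective_derivedNakayama_map hΛ hX hY).2).of_injective hΛ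
    (fun I _ _ => exists_derivedNakayama_iso_of_injective hΛ I) (fun M _ => by
      obtain ⟨n, i, hi⟩ := exists_mono_dualModule_biproduct k M
      exact ⟨_, finite_biproduct n _, inferInstance, i, hi⟩) Z hZ

end SerreFunctor

/-! ## The Serre structure -/

/-- Rewrites a shifted composite through the commutation isomorphism of the restriction `S` as the
shifted composite in the ambient category, conjugated by the commutation isomorphism of `ι`. -/
lemma restricts_comm_inv_aux {C T : Type*} [Category* C] [Category* T] [HasShift C ℤ]
    [HasShift T ℤ] (ι : C ⥤ T) [ι.CommShift ℤ] (F : T ⥤ T) [F.CommShift ℤ] {S : C ⥤ C}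
    (c : shiftFunctor C (1 : ℤ) ⋙ S ≅ S ⋙ shiftFunctor C (1 : ℤ)) (β : S ⋙ ι ≅ ι ⋙ F) {X Y : C}
    (hβ : ι.map (c.hom.app Y) ≫ (ι.commShiftIso (1 : ℤ)).hom.app (S.obj Y) ≫
      (β.hom.app Y)⟦(1 : ℤ)⟧' = β.hom.app (Y⟦(1 : ℤ)⟧) ≫
        F.map ((ι.commShiftIso (1 : ℤ)).hom.app Y) ≫ (F.commShiftIso (1 : ℤ)).hom.app (ι.obj Y))
    (f : Y ⟶ X) (g : X ⟶ S.obj Y) :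
    ι.map (f⟦(1 : ℤ)⟧') ≫ ι.map (g⟦(1 : ℤ)⟧' ≫ c.inv.app Y) ≫ β.hom.app (Y⟦(1 : ℤ)⟧) =
      (ι.commShiftIso (1 : ℤ)).hom.app Y ≫ ((ι.map f ≫ ι.map g ≫ β.hom.app Y)⟦(1 : ℤ)⟧' ≫
        (F.commShiftIso (1 : ℤ)).inv.app (ι.obj Y)) ≫
          F.map ((ι.commShiftIso (1 : ℤ)).inv.app Y) := by
  have key : ι.map (c.inv.app Y) ≫ β.hom.app (Y⟦(1 : ℤ)⟧) =
      (ι.commShiftIso (1 : ℤ)).hom.app (S.obj Y) ≫ (β.hom.app Y)⟦(1 : ℤ)⟧' ≫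
        (F.commShiftIso (1 : ℤ)).inv.app (ι.obj Y) ≫
          F.map ((ι.commShiftIso (1 : ℤ)).inv.app Y) := by
    rw [← cancel_epi (ι.map (c.hom.app Y)), ← Functor.map_comp_assoc, Iso.hom_inv_id_app,
      CategoryTheory.Functor.map_id, Category.id_comp, reassoc_of% hβ, Iso.hom_inv_id_app_assoc,
      ← Functor.map_comp, Iso.hom_inv_id_app]
    exact (Category.comp_id _).symm.trans
      (congrArg (_ ≫ ·) (CategoryTheory.Functor.map_id F _).symm)
  have n₁ := (ι.commShiftIso (1 : ℤ)).hom.naturality f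
  have n₂ := (ι.commShiftIso (1 : ℤ)).hom.naturality g
  dsimp at n₁ n₂ key ⊢
  simp only [Functor.map_comp, Category.assoc]
  rw [key, reassoc_of% n₂, reassoc_of% n₁]

section SerreStructure

variable {k : Type u} [Field k] {Λ : Type u} [Ring Λ] [Algebra k Λ]
  [Module.Finite k Λ] [IsNoetherianRing Λ]

open scoped ModuleCat

/-- A chosen resolution of an object of the bounded derived category. -/
noncomputable def boundedResolution (hΛ : HasFiniteGlobalDimension Λ)
    (X : BoundedDerivedCategory Λ) : PerfectResolution ((finiteBounded Λ).ι.obj X) :=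
  (nonempty_perfectResolution hΛ X.property).some

omit [Module.Finite k Λ] [IsNoetherianRing Λ] in
variable (k) in
lemma bijective_boundedDerivedCategory_ι_map (X Y : BoundedDerivedCategory Λ) :
    Function.Bijective ((finiteBounded Λ).ι.mapLinearMap k : (X ⟶ Y) →ₗ[k] _) :=
  ⟨fun _ _ h => (finiteBounded Λ).ι.map_injective h, fun f => (finiteBounded Λ).ι.map_surjective f⟩

variable {S : BoundedDerivedCategory Λ ⥤ BoundedDerivedCategory Λ}
  (β : S ⋙ (finiteBounded Λ).ι ≅ (finiteBounded Λ).ι ⋙ derivedNakayama k Λ)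

/-- The morphisms `Y ⟶ S X`, where `S` is the restriction of the derived tensor product
with `Λ*`. -/
noncomputable def restrictedHomEquiv [S.Additive] [S.Linear k] (Y X : BoundedDerivedCategory Λ) :
    (Y ⟶ S.obj X) ≃ₗ[k] ((finiteBounded Λ).ι.obj Y ⟶
      (derivedNakayama k Λ).obj ((finiteBounded Λ).ι.obj X)) :=
  LinearEquiv.ofBijective
    (Linear.rightComp k _ (β.hom.app X) ∘ₗ (finiteBounded Λ).ι.mapLinearMap k)
    ((bijective_comp_of_isIso (β.hom.app X) _).comp
      (bijective_boundedDerivedCategory_ι_map k _ _))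

/-- The Serre duality isomorphism defined by the trace. -/
noncomputable def traceDuality (hΛ : HasFiniteGlobalDimension Λ) [S.Additive] [S.Linear k]
    (X Y : BoundedDerivedCategory Λ) : (X ⟶ Y) ≃ₗ[k] Module.Dual k (Y ⟶ S.obj X) :=
  (LinearEquiv.ofBijective ((finiteBounded Λ).ι.mapLinearMap k : (X ⟶ Y) →ₗ[k] _)
    (bijective_boundedDerivedCategory_ι_map k X Y) ≪≫ₗ
    LinearEquiv.ofBijective ((boundedResolution hΛ X).pairing k
      ((finiteBounded Λ).ι.obj Y)) (isPerfectPair k hΛ X.property Y.property _)) ≪≫ₗ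
    (restrictedHomEquiv β Y X).dualMap

lemma traceDuality_apply (hΛ : HasFiniteGlobalDimension Λ) [S.Additive] [S.Linear k]
    {X Y : BoundedDerivedCategory Λ} (f : X ⟶ Y) (u : Y ⟶ S.obj X) :
    traceDuality β hΛ X Y f u = (boundedResolution hΛ X).trace
      ((finiteBounded Λ).ι.map f ≫ (finiteBounded Λ).ι.map u ≫ β.hom.app X) := rfl

/-- The trace of a shift is minus the trace. The canonical commutation isomorphism must preserve the
pairing, and hence it is `-c` when `c` is the isomorphism inherited from the tensor functor. -/
lemma traceDuality_shift (hΛ : HasFiniteGlobalDimension Λ) [S.Additive] [S.Linear k]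
    (c : shiftFunctor (BoundedDerivedCategory Λ) (1 : ℤ) ⋙ S ≅
      S ⋙ shiftFunctor (BoundedDerivedCategory Λ) (1 : ℤ)) {X Y : BoundedDerivedCategory Λ}
    (hβ : (finiteBounded Λ).ι.map (c.hom.app Y) ≫
      ((finiteBounded Λ).ι.commShiftIso (1 : ℤ)).hom.app (S.obj Y) ≫ (β.hom.app Y)⟦(1 : ℤ)⟧' =
      β.hom.app (Y⟦(1 : ℤ)⟧) ≫ (derivedNakayama k Λ).map
        (((finiteBounded Λ).ι.commShiftIso (1 : ℤ)).hom.app Y) ≫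
          ((derivedNakayama k Λ).commShiftIso (1 : ℤ)).hom.app ((finiteBounded Λ).ι.obj Y))
    (f : Y ⟶ X) (g : X ⟶ S.obj Y) :
    traceDuality β hΛ (Y⟦(1 : ℤ)⟧) (X⟦(1 : ℤ)⟧) (f⟦(1 : ℤ)⟧') (g⟦(1 : ℤ)⟧' ≫ (-c.inv.app Y)) =
      traceDuality β hΛ Y X f g := by
  let t := (finiteBounded Λ).ι.map f ≫ (finiteBounded Λ).ι.map g ≫ β.hom.app Y
  let p := boundedResolution hΛ Y
  let q := boundedResolution hΛ (Y⟦(1 : ℤ)⟧)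
  let i : (finiteBounded Λ).ι.obj (Y⟦(1 : ℤ)⟧) ≅ ((finiteBounded Λ).ι.obj Y)⟦(1 : ℤ)⟧ :=
    ((finiteBounded Λ).ι.commShiftIso (1 : ℤ)).app Y
  have h₃ : q.trace (i.hom ≫ (t⟦(1 : ℤ)⟧' ≫
      ((derivedNakayama k Λ).commShiftIso (1 : ℤ)).inv.app ((finiteBounded Λ).ι.obj Y)) ≫
        (derivedNakayama k Λ).map i.inv) = -p.trace t := by
    -- The resolution chosen for `Y⟦1⟧` is unrelated to the shift of the one chosen for `Y`;
    -- cyclicity along `i` replaces the first by the second.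
    refine (q.trace_comp p.shift i.hom _).trans ?_
    rw [← p.trace_shift t]
    refine congrArg p.shift.trace ?_
    refine (Category.assoc _ _ _).trans ((congrArg (_ ≫ ·) ?_).trans (Category.comp_id _))
    rw [← Functor.map_comp, Iso.inv_hom_id, CategoryTheory.Functor.map_id]
    rfl
  have h₄ := restricts_comm_inv_aux (finiteBounded Λ).ι (derivedNakayama k Λ) c β hβ f g
  have h₅ : g⟦(1 : ℤ)⟧' ≫ (-c.inv.app Y) = -(g⟦(1 : ℤ)⟧' ≫ c.inv.app Y) :=
    Preadditive.comp_neg _ _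
  refine (congrArg _ h₅).trans ((map_neg (traceDuality β hΛ (Y⟦(1 : ℤ)⟧) (X⟦(1 : ℤ)⟧)
    (f⟦(1 : ℤ)⟧')) _).trans ?_)
  exact neg_eq_iff_eq_neg.2 ((congrArg q.trace h₄).trans h₃)

/-- Full faithfulness and essential surjectivity are inherited from the derived Nakayama functor, as
`ι` is fully faithful. -/
lemma isEquivalence_of_restricts (hΛ : HasFiniteGlobalDimension Λ) 
    (β : S ⋙ (finiteBounded Λ).ι ≅ (finiteBounded Λ).ι ⋙ derivedNakayama k Λ) :
    S.IsEquivalence := by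
  have hbij (X Y) : Function.Bijective
      (((finiteBounded Λ).ι ⋙ derivedNakayama k Λ).map : (X ⟶ Y) → _) :=
    (bijective_derivedNakayama_map hΛ X.property Y.property).comp
      (bijective_boundedDerivedCategory_ι_map k X Y)
  have h₁ : ((finiteBounded Λ).ι ⋙ derivedNakayama k Λ).Full := ⟨fun {X Y} => (hbij X Y).2⟩
  have h₂ : ((finiteBounded Λ).ι ⋙ derivedNakayama k Λ).Faithful :=
    ⟨fun {X Y} _ _ h => (hbij X Y).1 h⟩
  have h₃ : (S ⋙ (finiteBounded Λ).ι).Full := Functor.Full.of_iso β.symm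
  have h₄ : (S ⋙ (finiteBounded Λ).ι).Faithful := Functor.Faithful.of_iso β.symm
  have : S.Full := Functor.Full.of_comp_faithful S (finiteBounded Λ).ι
  have : S.Faithful := Functor.Faithful.of_comp S (finiteBounded Λ).ι
  have : S.EssSurj := ⟨fun Z => by
    obtain ⟨X, hX, ⟨e⟩⟩ := exists_derivedNakayama_iso (k := k) hΛ Z.property
    exact ⟨⟨X, hX⟩, ⟨(finiteBounded Λ).fullyFaithfulι.preimageIso (β.app ⟨X, hX⟩ ≪≫ e)⟩⟩⟩
  exact {}

/-- The Serre structure on the bounded derived category defined by the trace. -/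
noncomputable def traceSerreStructure (hΛ : HasFiniteGlobalDimension Λ) (hS : S.Additive)
    (hS' : S.Linear k)
    (β : S ⋙ (finiteBounded Λ).ι ≅ (finiteBounded Λ).ι ⋙ derivedNakayama k Λ) :
    SerreStructure k (BoundedDerivedCategory Λ) where
  S := S
  isEquivalence := isEquivalence_of_restricts hΛ β
  additive := hS
  linear := hS'
  κ X Y := traceDuality β hΛ X Y
  κ_comp_left f h u := by
    rw [traceDuality_apply, traceDuality_apply]
    simp only [Functor.map_comp, Category.assoc]
  κ_comp_right {W X Y} f g u := by
    rw [traceDuality_apply, traceDuality_apply, Functor.map_comp, Category.assoc]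
    refine ((boundedResolution hΛ W).trace_comp (boundedResolution hΛ X) _ _).trans ?_
    have n : (finiteBounded Λ).ι.map (S.map f) ≫ β.hom.app X = β.hom.app W ≫
        (derivedNakayama k Λ).map ((finiteBounded Λ).ι.map f) := β.hom.naturality f
    rw [Functor.map_comp, Category.assoc, Category.assoc, Category.assoc, n]

/-- The bounded derived category has a Serre structure whose equivariant Serre functor is the
restriction of the derived tensor product with `Λ*`. -/
theorem exists_serreStructure_restricts (hΛ : HasFiniteGlobalDimension Λ) :
    ∃ σ : SgnEquivariantSerreStructure k (shiftFunctor (BoundedDerivedCategory Λ) (1 : ℤ)),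
      EquivariantEndofunctor.Restricts (finiteBounded Λ).ι σ.toEquivariantEndofunctor
        (derivedTensorEquivariant k Λ (dualComplex k Λ)) := by
  obtain ⟨G, hG⟩ := EquivariantEndofunctor.exists_restricts (k := k) (ι := (finiteBounded Λ).ι)
    (E := derivedTensorEquivariant k Λ (dualComplex k Λ)) (fun X =>
      ⟨⟨_, finiteBounded_derivedNakayama hΛ X.property⟩, ⟨Iso.refl _⟩⟩)
  obtain ⟨β, hβ⟩ := id hG
  -- With `ζ = -G.comm` the isomorphism `s = -ζ` is the commutation isomorphism of the restricted
  -- tensor functor.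
  let ζ : shiftFunctor (BoundedDerivedCategory Λ) (1 : ℤ) ⋙
      (traceSerreStructure hΛ G.additive G.linear β).S ≅
      (traceSerreStructure hΛ G.additive G.linear β).S ⋙
        shiftFunctor (BoundedDerivedCategory Λ) (1 : ℤ) :=
    show shiftFunctor (BoundedDerivedCategory Λ) (1 : ℤ) ⋙ G.functor ≅ _ from -G.comm
  refine ⟨⟨traceSerreStructure hΛ G.additive G.linear β, ζ, fun X Y f g => ?_⟩, β, fun X => ?_⟩
  · have := G.additive
    have := G.linear
    exact traceDuality_shift β hΛ G.comm (hβ Y) f g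
  · have h : -ζ = G.comm := Iso.ext (neg_neg _)
    refine Eq.trans ?_ (hβ X)
    exact congrArg (fun i : shiftFunctor (BoundedDerivedCategory Λ) (1 : ℤ) ⋙ G.functor ≅ _ =>
      (finiteBounded Λ).ι.map (i.hom.app X) ≫ _) h

end SerreStructure

/-! ## Uniqueness of Serre functors and the main theorem -/

section SerreUniqueness

namespace SerreStructure

variable {k : Type u} [Field k] {C : Type*} [Category* C] [Preadditive C] [Linear k C]
  (σ σ' : SerreStructure k C)

/-- The trace `Hom(X, S X) → k`. -/
def tr (X : C) (u : X ⟶ σ.S.obj X) : k := σ.κ X X (𝟙 X) u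

lemma κ_eq_tr {X Y : C} (f : X ⟶ Y) (u : Y ⟶ σ.S.obj X) : σ.κ X Y f u = σ.tr X (f ≫ u) := by
  rw [tr, ← σ.κ_comp_left, Category.id_comp]

lemma tr_comp {X Y : C} (f : X ⟶ Y) (u : Y ⟶ σ.S.obj X) :
    σ.tr X (f ≫ u) = σ.tr Y (u ≫ σ.S.map f) := by
  rw [← κ_eq_tr, tr, ← σ.κ_comp_right, Category.comp_id]

/-- Duality is given for morphisms with source a fixed object, while nondegeneracy is needed here
for morphisms to `S X`. As `S` is an equivalence, `B` is of the form `S B'` and `u` comes from a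
morphism `B' ⟶ X`, to which duality applies after a cyclic permutation. -/
lemma eq_zero_of_tr {B X : C} (u : B ⟶ σ.S.obj X) (h : ∀ f : X ⟶ B, σ.tr X (f ≫ u) = 0) :
    u = 0 := by
  have := σ.isEquivalence
  have := σ.additive
  let e := σ.S.objObjPreimageIso B
  obtain ⟨g, hg⟩ := σ.S.map_surjective (e.hom ≫ u)
  have : g = 0 := by
    refine (σ.κ _ X).injective (LinearMap.ext fun f => ?_)
    rw [κ_eq_tr, tr_comp, hg, ← Category.assoc, h, map_zero]
    rfl
  rw [← cancel_epi e.hom, ← hg, this, Functor.map_zero, comp_zero]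

/-- The same passage to `B ≅ S B'` represents functionals without any finiteness assumption on the
spaces of morphisms. -/
lemma exists_tr_eq {B X : C} (φ : Module.Dual k (X ⟶ B)) :
    ∃ u : B ⟶ σ.S.obj X, ∀ f, σ.tr X (f ≫ u) = φ f := by
  have := σ.isEquivalence
  let e := σ.S.objObjPreimageIso B
  obtain ⟨g, hg⟩ := (σ.κ _ X).surjective (φ ∘ₗ Linear.rightComp k X e.hom)
  refine ⟨e.inv ≫ σ.S.map g, fun f => ?_⟩
  rw [← Category.assoc, ← tr_comp, ← κ_eq_tr, hg]
  change φ ((f ≫ e.inv) ≫ e.hom) = φ f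
  rw [Category.assoc, e.inv_hom_id, Category.comp_id]

lemma hom_ext_of_tr {B X : C} {u v : B ⟶ σ.S.obj X}
    (h : ∀ f : X ⟶ B, σ.tr X (f ≫ u) = σ.tr X (f ≫ v)) : u = v := by
  refine sub_eq_zero.1 (σ.eq_zero_of_tr _ fun f => ?_)
  rw [Preadditive.comp_sub, tr, map_sub, sub_eq_zero]
  exact h f

/-- The comparison of two Serre functors. -/
noncomputable def comparison (X : C) : σ.S.obj X ⟶ σ'.S.obj X :=
  (σ'.exists_tr_eq (σ.κ X X (𝟙 X))).choose

lemma tr_comparison {X : C} (f : X ⟶ σ.S.obj X) : σ'.tr X (f ≫ σ.comparison σ' X) = σ.tr X f :=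
  (σ'.exists_tr_eq (σ.κ X X (𝟙 X))).choose_spec f

lemma comparison_comp (X : C) : σ.comparison σ' X ≫ σ'.comparison σ X = 𝟙 _ :=
  σ.hom_ext_of_tr fun f => by
    rw [← Category.assoc, tr_comparison, tr_comparison, Category.comp_id]

/-- The Serre functor is unique up to isomorphism. -/
noncomputable def serreFunctorIso : σ.S ≅ σ'.S :=
  NatIso.ofComponents (fun X => ⟨σ.comparison σ' X, σ'.comparison σ X, comparison_comp _ _ _,
    -- The comparison is characterized by preserving traces, so naturality may be tested under
    -- traces, where it follows from cyclicity for both Serre structures.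
    comparison_comp _ _ _⟩) (fun {X Y} a => σ'.hom_ext_of_tr fun f => by
      dsimp
      rw [← Category.assoc, tr_comparison, ← tr_comp, ← σ.tr_comparison σ', Category.assoc, tr_comp,
        Category.assoc])

end SerreStructure

end SerreUniqueness

/-! ### Powers of equivariant endofunctors, with commutation isomorphisms forgotten -/

section FunctorIso

namespace EquivariantEndofunctor

variable {k : Type u} [Field k] {C : Type*} [Category* C] [Preadditive C] [Linear k C] {F : C ⥤ C}

lemma Isomorphic.nonempty_iso {E E' : EquivariantEndofunctor k F} (h : Isomorphic E E') :
    Nonempty (E.functor ≅ E'.functor) :=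
  let ⟨α, _⟩ := h
  ⟨α⟩

lemma nonempty_iso_mul {E₁ E₁' E₂ E₂' : EquivariantEndofunctor k F}
    (h₂ : Nonempty (E₂.functor ≅ E₂'.functor)) (h₁ : Nonempty (E₁.functor ≅ E₁'.functor)) :
    Nonempty ((E₂.mul E₁).functor ≅ (E₂'.mul E₁').functor) :=
  let ⟨β⟩ := h₂
  let ⟨α⟩ := h₁
  ⟨Functor.isoWhiskerLeft E₁.functor β ≪≫ Functor.isoWhiskerRight α E₂'.functor⟩

lemma nonempty_iso_iteratedPow {E E' : EquivariantEndofunctor k F}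
    (h : Nonempty (E.functor ≅ E'.functor)) (n : ℕ) :
    Nonempty ((iteratedPow mul (one k F) E n).functor ≅
      (iteratedPow mul (one k F) E' n).functor) := by
  induction n with
  | zero => exact ⟨Iso.refl _⟩
  | succ n ih => exact nonempty_iso_mul h ih

lemma toClass_iteratedPow (E : EquivariantEndofunctor k F) (n : ℕ) :
    toClass (iteratedPow mul (one k F) E n) = toClass E ^ n :=
  map_iteratedPow _ toClass_mul toClass_one E n

end EquivariantEndofunctor

end FunctorIso

/-! ### Recognizing a shifted regular bimodule by its tensor functor -/

section Criterion

variable {k : Type u} [Field k] {Λ : Type u} [Ring Λ] [Algebra k Λ]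

open scoped ModuleCat

instance : (leftModule k Λ).Faithful where
  map_injective h := ModuleCat.hom_ext (LinearMap.ext fun x =>
    LinearMap.congr_fun (congrArg ModuleCat.Hom.hom h) x)

/-- The functor to left modules is exact and faithful, so the degrees of nonzero cohomology of a
complex of bimodules can be read off from the underlying left modules. -/
lemma exactAt_leftComplex_iff (Z : CochainComplex (BimoduleCat k Λ) ℤ) (i : ℤ) :
    ((leftComplex k Λ).obj Z).ExactAt i ↔ Z.ExactAt i :=
  ShortComplex.exact_map_iff_of_faithful (Z.sc i) (leftModule k Λ)

lemma isGE_Q_leftComplex_iff (Z : CochainComplex (BimoduleCat k Λ) ℤ) (n : ℤ) :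
    (DerivedCategory.Q.obj ((leftComplex k Λ).obj Z)).IsGE n ↔
      (DerivedCategory.Q.obj Z).IsGE n := by
  rw [DerivedCategory.isGE_Q_obj_iff, DerivedCategory.isGE_Q_obj_iff, CochainComplex.isGE_iff,
    CochainComplex.isGE_iff]
  simp only [exactAt_leftComplex_iff]

lemma isLE_Q_leftComplex_iff (Z : CochainComplex (BimoduleCat k Λ) ℤ) (n : ℤ) :
    (DerivedCategory.Q.obj ((leftComplex k Λ).obj Z)).IsLE n ↔
      (DerivedCategory.Q.obj Z).IsLE n := by
  rw [DerivedCategory.isLE_Q_obj_iff, DerivedCategory.isLE_Q_obj_iff, CochainComplex.isLE_iff,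
    CochainComplex.isLE_iff]
  simp only [exactAt_leftComplex_iff]

variable (k Λ) in
/-- The regular bimodule as a left module. -/
def regularLinearEquiv : Λ ≃ₗ[Λ] regularBimod k Λ where
  __ := (regularBimodEquiv k Λ).symm
  map_smul' a x := (regularBimodEquiv k Λ).injective (by
    rw [regularBimodEquiv_smul]
    rfl)

/-- A bimodule whose underlying left module is free of rank one, compatibly with the right
multiplications, is the regular bimodule. -/
lemma nonempty_iso_regularBimod {B : BimoduleCat k Λ}
    (e : (leftModule k Λ).obj B ≅ ModuleCat.of Λ Λ)
    (h : ∀ a : Λ, (rightMulNat k Λ a).app B ≫ e.hom = e.hom ≫ regularRightMul Λ a) :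
    Nonempty (B ≅ regularBimod k Λ) := by
  let f : B →ₗ[Λ] Λ := e.hom.hom
  let g : B ⟶ regularBimod k Λ := bimodHomMk ((regularLinearEquiv k Λ).toLinearMap ∘ₗ f)
    fun a x => (regularBimodEquiv k Λ).injective (by
      rw [regularBimodEquiv_rightMul]
      exact LinearMap.congr_fun (congrArg ModuleCat.Hom.hom (h a)) x)
  have hf : Function.Bijective f := ConcreteCategory.bijective_of_isIso e.hom
  have : IsIso g := (ConcreteCategory.isIso_iff_bijective g).2
    ((regularLinearEquiv k Λ).bijective.comp hf)
  exact ⟨asIso g⟩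

variable (k Λ) in
/-- The left module underlying a bimodule in degree `0`. -/
noncomputable def leftComplexSingleIso (B : BimoduleCat k Λ) :
    (leftComplex k Λ).obj ((CochainComplex.singleFunctor (BimoduleCat k Λ) 0).obj B) ≅
      (CochainComplex.singleFunctor (ModuleCat.{u} Λ) 0).obj ((leftModule k Λ).obj B) :=
  (HomologicalComplex.singleMapHomologicalComplex (leftModule k Λ) (.up ℤ) (0 : ℤ)).app B

lemma comp_hom_eq_of_naturality {C : Type*} [Category* C] {A B D : C} (f : A ⟶ A) (g : B ⟶ B)
    (i : A ⟶ B) (j : D ≅ B) (h : i ≫ g = f ≫ i) :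
    f ≫ i ≫ j.inv = (i ≫ j.inv) ≫ j.hom ≫ g ≫ j.inv := by
  simp [reassoc_of% h]

lemma leftComplexSingleIso_rightMul (B : BimoduleCat k Λ) (a : Λ) :
    (NatTrans.mapHomologicalComplex (rightMulNat k Λ a) (.up ℤ)).app
        ((CochainComplex.singleFunctor (BimoduleCat k Λ) 0).obj B) ≫
        (leftComplexSingleIso k Λ B).hom =
      (leftComplexSingleIso k Λ B).hom ≫
        (CochainComplex.singleFunctor (ModuleCat.{u} Λ) 0).map ((rightMulNat k Λ a).app B) := by
  let S := CochainComplex.singleFunctor (ModuleCat.{u} Λ) 0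
  refine HomologicalComplex.to_single_hom_ext ?_
  have h₁ : (S.map ((rightMulNat k Λ a).app B)).f 0 = _ :=
    HomologicalComplex.single_map_f_self _ _ _
  have h₂ : (leftComplexSingleIso k Λ B).hom.f 0 = _ :=
    HomologicalComplex.singleMapHomologicalComplex_hom_app_self _ _ _ _
  have h₃ := (rightMulNat k Λ a).naturality
    (HomologicalComplex.singleObjXSelf (.up ℤ) (0 : ℤ) B).hom
  rw [HomologicalComplex.comp_f, HomologicalComplex.comp_f, h₁, h₂]
  exact comp_hom_eq_of_naturality _ _ _ (HomologicalComplex.singleObjXSelf (.up ℤ) (0 : ℤ)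
    ((leftModule k Λ).obj B)) h₃

/-- As a complex of left modules `Z` has cohomology only in degree `-M`. The same then holds for
bimodules, and a complex of this kind is a shifted bimodule. -/
lemma exists_iso_single_shift_of_iso (Z : CochainComplex (BimoduleCat k Λ) ℤ) (M : ℤ)
    (e : DerivedCategory.Q.obj ((leftComplex k Λ).obj Z) ≅
      (derivedSingle (ModuleCat.of Λ Λ))⟦M⟧) :
    ∃ B : BimoduleCat k Λ, DerivedIsomorphic Z
      (((CochainComplex.singleFunctor (BimoduleCat k Λ) 0).obj B)⟦M⟧) := by
  let i := e ≪≫ ((DerivedCategory.singleFunctors (ModuleCat.{u} Λ)).shiftIso M (-M) 0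
    (by lia)).app (ModuleCat.of Λ Λ)
  have hGE : (DerivedCategory.Q.obj Z).IsGE (-M) := (isGE_Q_leftComplex_iff Z _).1
    (DerivedCategory.TStructure.t.isGE_of_iso i.symm (-M))
  have hLE : (DerivedCategory.Q.obj Z).IsLE (-M) := (isLE_Q_leftComplex_iff Z _).1
    (DerivedCategory.TStructure.t.isLE_of_iso i.symm (-M))
  obtain ⟨B, ⟨j⟩⟩ := DerivedCategory.exists_iso_singleFunctor_obj_of_isGE_of_isLE
    (DerivedCategory.Q.obj Z) (-M)
  refine ⟨B, ⟨j ≪≫ ((DerivedCategory.singleFunctors (BimoduleCat k Λ)).shiftIso M (-M) 0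
    (by lia)).symm.app B ≪≫ (DerivedCategory.Q.commShiftIso M).symm.app
      ((CochainComplex.singleFunctor (BimoduleCat k Λ) 0).obj B)⟩⟩

/-- A bimodule `B` such that `B ⊗^L_Λ Λ ≅ Λ` compatibly with the endomorphisms of `Λ` is the regular
bimodule. -/
lemma nonempty_iso_regularBimod_of_derived {B : BimoduleCat k Λ}
    (δ : (derivedTensorFunctor ((CochainComplex.singleFunctor (BimoduleCat k Λ) 0).obj B)).obj
      (derivedSingle (ModuleCat.of Λ Λ)) ≅ derivedSingle (ModuleCat.of Λ Λ))
    (h : ∀ s : derivedSingle (ModuleCat.of Λ Λ) ⟶ derivedSingle (ModuleCat.of Λ Λ),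
      (derivedTensorFunctor ((CochainComplex.singleFunctor (BimoduleCat k Λ) 0).obj B)).map s ≫
        δ.hom = δ.hom ≫ s) : Nonempty (B ≅ regularBimod k Λ) := by
  let W := (CochainComplex.singleFunctor (BimoduleCat k Λ) 0).obj B
  let S := DerivedCategory.singleFunctor (ModuleCat.{u} Λ) 0
  let ε : (derivedTensorFunctor W).obj (derivedSingle (ModuleCat.of Λ Λ)) ≅
      S.obj ((leftModule k Λ).obj B) :=
    derivedTensorFunctorRegularIso W ≪≫ DerivedCategory.Q.mapIso (leftComplexSingleIso k Λ B)
  have hε (a : Λ) : (derivedTensorFunctor W).map (S.map (regularRightMul Λ a)) ≫ ε.hom =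
      ε.hom ≫ S.map ((rightMulNat k Λ a).app B) := by
    have h₁ := derivedTensorFunctorRegularIso_rightMul W a
    have h₂ := congrArg DerivedCategory.Q.map (leftComplexSingleIso_rightMul B a)
    rw [Functor.map_comp, Functor.map_comp] at h₂
    refine (Category.assoc _ _ _).symm.trans ((congrArg (· ≫ _) h₁).trans ?_)
    refine (Category.assoc _ _ _).trans ((congrArg (_ ≫ ·) h₂).trans ?_)
    exact (Category.assoc _ _ _).symm
  have hS : S.FullyFaithful := .ofFullyFaithful S
  -- Modules embed fully faithfully in degree zero, so the isomorphism at `Λ` is one of left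
  -- modules. Its compatibility with the right multiplications is the hypothesis applied to the
  -- endomorphisms `regularRightMul Λ a`.
  let e : (leftModule k Λ).obj B ≅ ModuleCat.of Λ Λ := hS.preimageIso (ε.symm ≪≫ δ)
  have he : S.map e.hom = ε.inv ≫ δ.hom := hS.map_preimage _
  refine nonempty_iso_regularBimod e fun a => S.map_injective ?_
  rw [S.map_comp, S.map_comp, he, ← cancel_epi ε.hom]
  have h₁ : ε.hom ≫ S.map ((rightMulNat k Λ a).app B) ≫ ε.inv =
      (derivedTensorFunctor W).map (S.map (regularRightMul Λ a)) := by
    rw [← Category.assoc, ← hε, Category.assoc, ε.hom_inv_id, Category.comp_id]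
  have h₂ := h (S.map (regularRightMul Λ a))
  simp only [Category.assoc, Iso.hom_inv_id_assoc]
  rw [reassoc_of% h₁]
  exact h₂

variable [IsNoetherianRing Λ]

/-- If the derived tensor product with `Z` restricts to a functor which is isomorphic to `Σ ^ M` on
the bounded derived category, then `Z ≅ Λ[M]` in the derived category of bimodules. -/
theorem derivedIsomorphic_shift_of_restricts (hΛ : HasFiniteGlobalDimension Λ)
    {G : EquivariantEndofunctor k (shiftFunctor (BoundedDerivedCategory Λ) (1 : ℤ))}
    {Z : CochainComplex (BimoduleCat k Λ) ℤ} {M : ℤ}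
    (hG : EquivariantEndofunctor.Restricts (finiteBounded Λ).ι G (derivedTensorEquivariant k Λ Z))
    (hM : Nonempty (G.functor ≅ shiftFunctor (BoundedDerivedCategory Λ) M)) :
    DerivedIsomorphic Z ((regularComplex k Λ)⟦M⟧) := by
  obtain ⟨e⟩ := hM
  let A : BoundedDerivedCategory Λ :=
    ⟨derivedSingle (ModuleCat.of Λ Λ), finiteBounded_derivedSingle (ModuleCat.of Λ Λ)⟩
  let γ : G.functor ⋙ (finiteBounded Λ).ι ≅
      (finiteBounded Λ).ι ⋙ shiftFunctor (DerivedCategory (ModuleCat.{u} Λ)) M :=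
    Functor.isoWhiskerRight e (finiteBounded Λ).ι ≪≫ (finiteBounded Λ).ι.commShiftIso M
  obtain ⟨B, hB⟩ : ∃ B : BimoduleCat k Λ, DerivedIsomorphic Z
      (((CochainComplex.singleFunctor (BimoduleCat k Λ) 0).obj B)⟦M⟧) := by
    obtain ⟨β, -⟩ := hG
    exact exists_iso_single_shift_of_iso Z M
      ((derivedTensorFunctorRegularIso Z).symm ≪≫ β.symm.app A ≪≫ γ.app A)
  let W := (CochainComplex.singleFunctor (BimoduleCat k Λ) 0).obj B
  obtain ⟨β, -⟩ := hG.of_derivedIsomorphic hΛ hB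
  -- The shift by `M` is carried along on both sides and removed afterwards, being fully faithful.
  -- Naturality of `δ` at endomorphisms of `A` is what fixes the right action on `B`.
  let δ : (finiteBounded Λ).ι ⋙ derivedTensorFunctor W ⋙ shiftFunctor _ M ≅
      (finiteBounded Λ).ι ⋙ shiftFunctor (DerivedCategory (ModuleCat.{u} Λ)) M :=
    Functor.isoWhiskerLeft (finiteBounded Λ).ι
      (EquivariantEndofunctor.derivedTensorFunctorShiftIso W M).symm ≪≫
      β.symm ≪≫ γ
  have hs : (shiftFunctor (DerivedCategory (ModuleCat.{u} Λ)) M).FullyFaithful :=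
    .ofFullyFaithful _
  let δ' : (derivedTensorFunctor W).obj (derivedSingle (ModuleCat.of Λ Λ)) ≅
    derivedSingle (ModuleCat.of Λ Λ) := hs.preimageIso (δ.app A)
  have hδ' : δ'.hom⟦M⟧' = δ.hom.app A := hs.map_preimage _
  obtain ⟨i⟩ := nonempty_iso_regularBimod_of_derived (B := B) δ' fun s => by
    refine (shiftFunctor (DerivedCategory (ModuleCat.{u} Λ)) M).map_injective ?_
    rw [Functor.map_comp, Functor.map_comp, hδ']
    obtain ⟨t, rfl⟩ := (finiteBounded Λ).ι.map_surjective (X := A) (Y := A) s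
    exact δ.hom.naturality t
  obtain ⟨j⟩ := hB
  exact ⟨j ≪≫ DerivedCategory.Q.mapIso ((shiftFunctor _ M).mapIso
    ((CochainComplex.singleFunctor (BimoduleCat k Λ) 0).mapIso i))⟩

end Criterion

/-! ### The two implications -/

section FractionalCalabiYau

open scoped ModuleCat
open EquivariantEndofunctor

variable {k : Type u} [Field k] {Λ : Type u} [Ring Λ] [Algebra k Λ] [IsNoetherianRing Λ]

lemma restricts_iteratedPow (hΛ : HasFiniteGlobalDimension Λ)
    {G : EquivariantEndofunctor k (shiftFunctor (BoundedDerivedCategory Λ) (1 : ℤ))}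
    {X : CochainComplex (BimoduleCat k Λ) ℤ}
    (h : Restricts (finiteBounded Λ).ι G (derivedTensorEquivariant k Λ X)) (n : ℕ) :
    Restricts (finiteBounded Λ).ι (iteratedPow mul (one k _) G n)
      (derivedTensorEquivariant k Λ (iteratedPow derivedTensor (regularComplex k Λ) X n)) := by
  induction n with
  | zero => exact restricts_regularComplex hΛ
  | succ n ih => exact h.derivedTensor ih

lemma derivedIsomorphic_regularComplex_of_restricts (hΛ : HasFiniteGlobalDimension Λ)
    {G : EquivariantEndofunctor k (shiftFunctor (BoundedDerivedCategory Λ) (1 : ℤ))}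
    {Z : CochainComplex (BimoduleCat k Λ) ℤ}
    (hG : Restricts (finiteBounded Λ).ι G (derivedTensorEquivariant k Λ Z))
    (h : Nonempty (G.functor ≅ 𝟭 _)) : DerivedIsomorphic Z (regularComplex k Λ) := by
  obtain ⟨e⟩ := h
  obtain ⟨i⟩ := derivedIsomorphic_shift_of_restricts hΛ (M := 0) hG
    ⟨e ≪≫ (shiftFunctorZero _ ℤ).symm⟩
  exact ⟨i ≪≫ DerivedCategory.Q.mapIso ((shiftFunctorZero _ ℤ).app (regularComplex k Λ))⟩

lemma toClass_eq_one_of_derivedIsomorphic (hΛ : HasFiniteGlobalDimension Λ)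
    {G : EquivariantEndofunctor k (shiftFunctor (BoundedDerivedCategory Λ) (1 : ℤ))}
    {Z : CochainComplex (BimoduleCat k Λ) ℤ}
    (hG : Restricts (finiteBounded Λ).ι G (derivedTensorEquivariant k Λ Z))
    (h : DerivedIsomorphic Z (regularComplex k Λ)) : toClass G = 1 :=
  (hG.of_derivedIsomorphic hΛ h).toClass_eq (restricts_regularComplex hΛ)

/-- The derived tensor product with a quasi-inverse of `Λ*` restricts to the bounded derived
category. -/
lemma exists_restricts_of_inverse [Module.Finite k Λ] (hΛ : HasFiniteGlobalDimension Λ)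
    {Y : CochainComplex (BimoduleCat k Λ) ℤ}
    (h : DerivedIsomorphic (derivedTensor Y (dualComplex k Λ)) (regularComplex k Λ)) :
    ∃ H, Restricts (finiteBounded Λ).ι H (derivedTensorEquivariant k Λ Y) := by
  refine exists_restricts (k := k) (ι := (finiteBounded Λ).ι) fun X => ?_
  -- Every bounded object is `Λ* ⊗^L_Λ X'` with `X'` bounded, and tensoring it with the inverse `Y`
  -- returns `X'`.
  obtain ⟨X', hX', ⟨e⟩⟩ := exists_derivedNakayama_iso (k := k) hΛ X.property
  obtain ⟨i⟩ := h
  obtain ⟨β, -⟩ := (restricts_regularComplex hΛ).of_derivedIsomorphic hΛ ⟨i.symm⟩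
  exact ⟨⟨X', hX'⟩, ⟨β.app ⟨X', hX'⟩ ≪≫
    (derivedTensorFunctorComp Y (dualComplex k Λ)).app X' ≪≫ (derivedTensorFunctor Y).mapIso e⟩⟩

/-- For the trace Serre structure the powers of `(S, s)` are the restrictions of the actions of the
tensor powers of `Λ*`. Isomorphic complexes of bimodules have the same restricted class, commutation
isomorphisms included. -/
lemma isFractionalCalabiYau_of_isDerivedTensorPower [Module.Finite k Λ]
    (hΛ : HasFiniteGlobalDimension Λ) {N m : ℤ}
    (h : IsDerivedTensorPower (dualComplex k Λ) m ((regularComplex k Λ)⟦N⟧)) :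
    IsFractionalCalabiYau k (BoundedDerivedCategory Λ) N m := by
  obtain ⟨σ, hσ⟩ := exists_serreStructure_restricts (k := k) hΛ
  refine ⟨σ, shift k _ N, ?_, (isPower_negSelf_iff N _).2 rfl⟩
  rcases m with n | n
  · exact (isomorphic_iff _ _).2 (((restricts_iteratedPow hΛ hσ n).of_derivedIsomorphic hΛ
      h).toClass_eq (restricts_regularComplex_shift hΛ N))
  · obtain ⟨Y, h₁, h₂, h₃⟩ := h
    obtain ⟨H, hH⟩ := exists_restricts_of_inverse hΛ h₂
    refine ⟨H, ?_, ?_, ?_⟩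
    · exact (isomorphic_iff _ _).2
        (toClass_eq_one_of_derivedIsomorphic hΛ (hσ.derivedTensor hH) h₁)
    · exact (isomorphic_iff _ _).2
        (toClass_eq_one_of_derivedIsomorphic hΛ (hH.derivedTensor hσ) h₂)
    · exact (isomorphic_iff _ _).2 (((restricts_iteratedPow hΛ hH (n + 1)).of_derivedIsomorphic hΛ
        h₃).toClass_eq (restricts_regularComplex_shift hΛ N))

/-- Only the underlying functors are compared. The given Serre functor is isomorphic to the
restriction of `Λ* ⊗^L_Λ -` by uniqueness, and an isomorphism of a power of it with `Σ ^ N` is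
converted into one of bimodules by the detection criterion. -/
lemma isDerivedTensorPower_of_isFractionalCalabiYau [Module.Finite k Λ]
    (hΛ : HasFiniteGlobalDimension Λ) {N m : ℤ}
    (h : IsFractionalCalabiYau k (BoundedDerivedCategory Λ) N m) :
    IsDerivedTensorPower (dualComplex k Λ) m ((regularComplex k Λ)⟦N⟧) := by
  obtain ⟨σ, hσ⟩ := exists_serreStructure_restricts (k := k) hΛ
  obtain ⟨σ', G, hm, hN⟩ := h
  have hN := (isPower_negSelf_iff N G).1 hN
  obtain ⟨eG⟩ := ((isomorphic_iff _ _).2 hN).nonempty_iso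
  have hS : Nonempty (σ.toEquivariantEndofunctor.functor ≅ σ'.toEquivariantEndofunctor.functor) :=
    ⟨σ.toSerreStructure.serreFunctorIso σ'.toSerreStructure⟩
  rcases m with n | n
  · obtain ⟨e⟩ := Isomorphic.nonempty_iso hm
    obtain ⟨e'⟩ := nonempty_iso_iteratedPow hS n
    exact derivedIsomorphic_shift_of_restricts hΛ (restricts_iteratedPow hΛ hσ n)
      ⟨e' ≪≫ e ≪≫ eG.symm⟩
  · obtain ⟨H, h₁, h₂, h₃⟩ := hm
    -- The quasi-inverse `H` need not come from bimodules, but `H ^ (n + 1) ≅ Σ ^ N` gives `H ≅ S ^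
    -- n H ^ (n + 1) ≅ S ^ n Σ ^ N`. The last functor is the action of the `n`-th tensor power of
    -- `Λ*` tensored with `Λ[N]`, which serves as the inverse of `Λ*`.
    let K := (iteratedPow mul (one k _) σ.toEquivariantEndofunctor n).mul (shift k _ N)
    have hK : Restricts (finiteBounded Λ).ι K _ :=
      (restricts_iteratedPow hΛ hσ n).derivedTensor (restricts_regularComplex_shift hΛ N)
    have hKH : Nonempty (K.functor ≅ H.functor) := by
      obtain ⟨e⟩ := nonempty_iso_mul (nonempty_iso_iteratedPow hS n)
        ⟨Iso.refl (shift k (BoundedDerivedCategory Λ) N).functor⟩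
      have h : toClass ((iteratedPow mul (one k _) σ'.toEquivariantEndofunctor n).mul
          (shift k _ N)) = toClass H := by
        rw [isomorphic_iff, toClass_mul, toClass_one] at h₁
        rw [isomorphic_iff, toClass_iteratedPow] at h₃
        rw [toClass_mul, toClass_iteratedPow, hN, ← h₃, pow_succ, ← mul_assoc,
          pow_mul_pow_eq_one n h₁, one_mul]
      obtain ⟨e'⟩ := ((isomorphic_iff _ _).2 h).nonempty_iso
      exact ⟨e ≪≫ e'⟩
    refine ⟨_, derivedIsomorphic_regularComplex_of_restricts hΛ (hσ.derivedTensor hK) ?_,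
      derivedIsomorphic_regularComplex_of_restricts hΛ (hK.derivedTensor hσ) ?_,
      derivedIsomorphic_shift_of_restricts hΛ (restricts_iteratedPow hΛ hK (n + 1)) ?_⟩
    · obtain ⟨e⟩ := nonempty_iso_mul hS hKH
      obtain ⟨e'⟩ := Isomorphic.nonempty_iso h₁
      exact ⟨e ≪≫ e'⟩
    · obtain ⟨e⟩ := nonempty_iso_mul hKH hS
      obtain ⟨e'⟩ := Isomorphic.nonempty_iso h₂
      exact ⟨e ≪≫ e'⟩
    · obtain ⟨e⟩ := nonempty_iso_iteratedPow hKH (n + 1)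
      obtain ⟨e'⟩ := Isomorphic.nonempty_iso h₃
      exact ⟨e ≪≫ e' ≪≫ eG.symm⟩

end FractionalCalabiYau

theorem theorem5p2 (k : Type u) [Field k] (Λ : Type u) [Ring Λ] [Algebra k Λ]
    [Module.Finite k Λ] (hΛ : HasFiniteGlobalDimension Λ) (N m : ℤ) :
    IsFractionalCalabiYau k (BoundedDerivedCategory Λ) N m ↔
      IsDerivedTensorPower (dualComplex k Λ) m ((regularComplex k Λ)⟦N⟧) :=
  have : IsNoetherianRing Λ := IsNoetherianRing.of_finite k Λ
  ⟨isDerivedTensorPower_of_isFractionalCalabiYau hΛ, isFractionalCalabiYau_of_isDerivedTensorPower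
    hΛ⟩
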